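/- **Setting.** Let $\ell\in\{2,3,\dots\}\cup\{\infty\}$; put $I=\{0,1,\dots,\ell\}$ if $\ell<\infty$ and $I=\mathbb Z_{\ge 0}$ if $\ell=\infty$, let $(a_{ij})_{i,j\in I}$ be the Cartan matrix of type $C^{(1)}_\ell$ (if $\ell<\infty$; $a_{10}=a_{\ell-1,\ell}=-2$) or $C_\infty$ (if $\ell=\infty$; $a_{10}=-2$), and let $(\alpha_i,\alpha_j)=d_ia_{ij}$ with $d_0=2$, $d_\ell=2$ if $\ell<\infty$, and $d_i=1$ otherwise. For $i<j$ let $Q_{ij}(u,v)$ be $u+v^2$ if $(i,j)=(0,1)$, $u^2+v$ if $(i,j)=(\ell-1,\ell)$, $u+v$ for all other pairs with $j=i+1$, and $1$ if $j>i+1$; put $Q_{ji}(u,v)=Q_{ij}(v,u)$ and $Q_{ii}=0$. For a commutative ring $k$ and $\beta\in Q^+=\bigoplus_{i\in I}\mathbb Z_{\ge0}\alpha_i$, let $R_k(\beta)$ be the quiver Hecke algebra over $k$ with these polynomials, with generators $e(\nu)$ ($\nu\in I^\beta$), $x_r$, $\psi_r$, graded by $\deg e(\nu)=0$, $\deg x_re(\nu)=(\alpha_{\nu_r},\alpha_{\nu_r})$,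 $\deg\psi_re(\nu)=-(\alpha_{\nu_r},\alpha_{\nu_{r+1}})$. For a dominant weight $\Lambda$, let $R_k^\Lambda(\beta)$ be its quotient by the relations $x_1^{\langle\alpha^\vee_{\nu_1},\Lambda\rangle}e(\nu)=0$. Fix a reduced expression $w=s_{i_1}\cdots s_{i_m}$ of each $w\in\mathfrak S_n$ and put $\psi_w=\psi_{i_1}\cdots\psi_{i_m}$. For $m\in\mathbb Z$ let $\overline m\in I$ be $|m|$ if $\ell=\infty$, and the image of $m$ under the folding $\mathbb Z\to\mathbb Z/2\ell\to\{0,\dots,\ell\}$ which sends $j$ and $2\ell-j$ to $j$ for $0\le j\le\ell$, if $\ell<\infty$. For a multicharge $\kappa\in\mathbb Z^l$, $l\ge1$, the node $A=(r,c,t)$ (row $r$, column $c$, component $t$) of an $l$-multipartition has residue $\operatorname{res}A=\overline{\kappa_t+c-r}$, and $\operatorname{cont}(\lambda)=\sum_{A\in[\lambda]}\alpha_{\operatorname{res}A}$. **Specht modules over a field $K$.** Write $\beta_{(a;m)}=\sum_{j=0}^{m-1}\alpha_{\overline{a+j}}$. Let $L(a;m)=Ku$ be the one-dimensional graded $R_K(\beta_{(a;m)})$-module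 in degree $0$ on which all $x_r,\psi_r$ act as $0$ and $e(\nu)$ acts as $1$ if $\nu=(\overline a,\overline{a+1},\dots,\overline{a+m-1})$ and as $0$ otherwise, and let $\circ$ be the convolution (induction) product of graded modules. For $a,b\ge0$ let $w[a,b]\in\mathfrak S_{a+b}$ be given by $x\mapsto x+b$ for $x\le a$ and $x\mapsto x-a$ for $x>a$. Let $$\iota\colon L(a;l_1+l_2)\to L(a+l_1;l_2)\circ L(a;l_1)$$ be the homogeneous homomorphism for which $\iota(u)$ is the sum of $\psi_{w[l_2,l_1]}(u\otimes u)$ and a linear combination of the $\psi_w(u\otimes u)$ with $w<w[l_2,l_1]$ in the Bruhat order, and let $p\colon L(a;l_1)\circ L(a+l_1;l_2)\to L(a;l_1+l_2)$ be the homomorphism with $p(u\otimes u)=u$. For a partition $\mu$ with charge $\kappa\in\mathbb Z$ let $M^\mu=L(\kappa;\mu_1)\circ L(\kappa-1;\mu_2)\circ\cdots$. A Garnir node of $\mu$ is a node $A=(r,c)$ with $(r+1,c)\in[\mu]$; let $M^\mu_A$ be obtained from $M^\mu$ by replacing the factors $L(\kappa-r+1;\mu_r)\circ L(\kappa-r;\mu_{r+1})$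 by $L(\kappa-r+1;c-1)\circ L(\kappa-r;\mu_r+1)\circ L(\kappa-r+c;\mu_{r+1}-c)$. The Garnir homomorphism $G_A\colon M^\mu_A\to M^\mu$ is induced by $$L(\kappa-r;\mu_r+1)\xrightarrow{\ \iota\ }L(\kappa-r+c;\mu_r-c+1)\circ L(\kappa-r;c)$$ on the middle factor, followed by the projections $p$ of $L(\kappa-r+1;c-1)\circ L(\kappa-r+c;\mu_r-c+1)$ onto $L(\kappa-r+1;\mu_r)$ and of $L(\kappa-r;c)\circ L(\kappa-r+c;\mu_{r+1}-c)$ onto $L(\kappa-r;\mu_{r+1})$. Let $C^\mu=M^\mu/\sum_A\operatorname{im}G_A$. For an $l$-multipartition $\lambda=(\lambda^{(1)},\dots,\lambda^{(l)})$ with multicharge $\kappa\in\mathbb Z^l$, let $$S^\lambda(K)=q^{\deg(\mathsf t^\lambda)}\,C^{\lambda^{(1)}}\circ\cdots\circ C^{\lambda^{(l)}},$$ where $q^d$ shifts degrees up by $d$, $\mathsf t^\lambda$ is the initial tableau (filled along successive rows of successive components), and the degree of a standard tableau $T$ is $\deg T=\sum_{A}d_A$, the sum over the nodes $A$ of $\lambda$;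 here, for a node $A$ of residue $i$, $d_A$ is $d_i$ times the number of addable minus the number of removable $i$-nodes below $A$, for the diagram of the nodes whose entries are at most $T(A)$. Let $\overline m^\lambda\in S^\lambda(K)$ be the image of $u\otimes\cdots\otimes u$. **Specht modules over an integral domain $R$.** If $K$ is the field of fractions of $R$, then $S^\lambda(R)=R_R(\operatorname{cont}(\lambda))\,\overline m^\lambda\subseteq S^\lambda(K)$, with the induced grading. **Theorem.** Let $R$ be an integral domain, $l\ge1$, $\lambda$ an $l$-multipartition of $n$, $\kappa\in\mathbb Z^l$ and $\beta=\operatorname{cont}(\lambda)$. For a tableau $T$ of shape $\lambda$ let $w^T\in\mathfrak S_n$ be given by $w^T\mathsf t^\lambda=T$. 1. $S^\lambda(R)$ is generated as an $R$-module by $\{\psi_{w^T}\overline m^\lambda : T\text{ a standard tableau of shape }\lambda\}$. 2. Let $\Lambda=\Lambda_{\overline{\kappa_1}}+\dots+\Lambda_{\overline{\kappa_l}}$. Then $S^\lambda(R)$ is a graded $R_R^\Lambda(\beta)$-module, i.e. the action of $R_R(\beta)$ on $S^\lambda(R)$ factors through $R_R^\Lambda(\beta)$, $S^\lambda(R)$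 is the direct sum of its homogeneous components, and elements of degree $c$ of $R^\Lambda_R(\beta)$ map the component of degree $d$ to the component of degree $c+d$. -/

import Mathlib

open scoped TensorProduct

namespace TypeC

universe u v

/-! ### Lie-theoretic data of type `C_ℓ^{(1)}` (for `ℓ < ⊤`) and `C_∞` (for `ℓ = ⊤`) -/

/-- The index set `I`: `{0, …, ℓ}` if `ℓ` is finite, all of `ℕ` if `ℓ = ⊤`. -/
def Idx (ℓ : ℕ∞) : Type := {i : ℕ // (i : ℕ∞) ≤ ℓ}

instance (ℓ : ℕ∞) : DecidableEq (Idx ℓ) :=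
  inferInstanceAs (DecidableEq {i : ℕ // (i : ℕ∞) ≤ ℓ})

/-- The Cartan integer `a_{ij}`. -/
def cartan {ℓ : ℕ∞} (i j : Idx ℓ) : ℤ :=
  if i.1 = j.1 then 2
  else if i.1 = 1 ∧ j.1 = 0 then -2
  else if i.1 + 1 = j.1 ∧ (j.1 : ℕ∞) = ℓ then -2
  else if i.1 + 1 = j.1 ∨ j.1 + 1 = i.1 then -1
  else 0

/-- The symmetriser `d = (2,1,…,1,2)` (`ℓ` finite) or `d = (2,1,1,…)` (`ℓ = ⊤`). -/
def symmetriser {ℓ : ℕ∞} (i : Idx ℓ) : ℤ := if i.1 = 0 ∨ (i.1 : ℕ∞) = ℓ then 2 else 1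

/-- The form `(α_i, α_j) = d_i a_{ij}` on simple roots. -/
def form {ℓ : ℕ∞} (i j : Idx ℓ) : ℤ := symmetriser i * cartan i j

/-- The positive cone `Q⁺` of the root lattice; the multiset `{i₁, …, i_n}` stands for
`α_{i₁} + ⋯ + α_{i_n}`, and its cardinality is the height. -/
abbrev RootCone (ℓ : ℕ∞) : Type := Multiset (Idx ℓ)

/-- The bilinear form `(β, γ)` on the positive cone. -/
def rootForm {ℓ : ℕ∞} (β γ : RootCone ℓ) : ℤ :=
  (β.map fun i => (γ.map fun j => form i j).sum).sum

/-- The residue map `ℤ → I`, `k ↦ k̄`: `|k|` if `ℓ = ⊤`, and otherwise the folding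
`ℤ → ℤ/2ℓ → {0, …, ℓ}`, `k ↦ min (k mod 2ℓ) (2ℓ - k mod 2ℓ)`. -/
def residue (ℓ : ℕ∞) (k : ℤ) : Idx ℓ :=
  if h : ℓ = ⊤ then ⟨k.natAbs, by simp [h]⟩
  else ⟨min (k % (2 * ℓ.toNat : ℕ)).toNat (2 * ℓ.toNat - (k % (2 * ℓ.toNat : ℕ)).toNat), by
    have h1 : min (k % (2 * ℓ.toNat : ℕ)).toNat (2 * ℓ.toNat - (k % (2 * ℓ.toNat : ℕ)).toNat)
        ≤ ℓ.toNat := by omega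
    calc _ ≤ ((ℓ.toNat : ℕ) : ℕ∞) := by exact_mod_cast h1
      _ = ℓ := ENat.natCast_toNat h⟩

/-- The exponents `(p, q)` of the monomials `u^p v^q` of `Q_{ij}(u,v)`; all coefficients are `1`.
For `i < j` the polynomial is `u + v²` if `(i,j) = (0,1)`, `u² + v` if `(i,j) = (ℓ-1,ℓ)`,
`u + v` for the other pairs with `j = i + 1`, and `1` if `j > i + 1`;
moreover `Q_{ii} = 0` and `Q_{ij}(u,v) = Q_{ji}(v,u)`. -/
def qExponents {ℓ : ℕ∞} (i j : Idx ℓ) : List (ℕ × ℕ) :=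
  if i.1 = j.1 then []
  else if i.1 + 1 = j.1 then
    if i.1 = 0 then [(1, 0), (0, 2)]
    else if (j.1 : ℕ∞) = ℓ then [(2, 0), (0, 1)]
    else [(1, 0), (0, 1)]
  else if j.1 + 1 = i.1 then
    if j.1 = 0 then [(2, 0), (0, 1)]
    else if (i.1 : ℕ∞) = ℓ then [(1, 0), (0, 2)]
    else [(1, 0), (0, 1)]
  else [(0, 0)]

section Relations

variable {ℓ : ℕ∞} {F : Type*} [Ring F]

/-- `Q_{ij}(u, v)`, to be used for commuting `u`, `v`. -/
def qEval (i j : Idx ℓ) (u v : F) : F :=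
  ((qExponents i j).map fun m => u ^ m.1 * v ^ m.2).sum

/-- The polynomial `(Q_{ij}(u, v) - Q_{ij}(w, v)) / (u - w)`, to be used for commuting `u`, `v`,
`w`; the monomial `u^p v^q` contributes `∑_{s < p} u^s w^{p-1-s} v^q`. -/
def qDivDiff (i j : Idx ℓ) (u v w : F) : F :=
  ((qExponents i j).map fun m =>
    (∑ s ∈ Finset.range m.1, u ^ s * w ^ (m.1 - 1 - s)) * v ^ m.2).sum

/-! ### Quiver Hecke algebras -/

/-- Symbols for the generators. Strands are numbered from `0`: `x r` is `x_{r+1}` and `psi r` is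
`ψ_{r+1}` in the usual numbering. Symbols that are not admissible for the given
`β` (`e ν` with `ν ∉ I^β`, and `x r`, `psi r` with `r` out of range) are set to `0` in `Rel`. -/
inductive Gen (ℓ : ℕ∞) : Type
  | e (ν : List (Idx ℓ))
  | x (r : ℕ)
  | psi (r : ℕ)

open Gen

/-- `I^β`, as a finite set of words. -/
def words (β : RootCone ℓ) : Finset (List (Idx ℓ)) := (Multiset.lists β).toFinset

lemma mem_words (β : RootCone ℓ) (ν : List (Idx ℓ)) : ν ∈ words β ↔ (ν : RootCone ℓ) = β := by
  rw [words, Multiset.mem_toFinset, Multiset.mem_lists_iff]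
  exact eq_comm

/-- The defining relations of the quiver Hecke algebra `R(β)`, for elements `g` of a ring `F`. A word
`ν` whose entries in positions `r, r+1` are `i, j` is written as `μ ++ i :: j :: ρ` with
`r = μ.length`. -/
inductive Rel (β : RootCone ℓ) (g : Gen ℓ → F) : F → F → Prop
  | e_zero (ν : List (Idx ℓ)) (h : (ν : RootCone ℓ) ≠ β) : Rel β g (g (e ν)) 0
  | x_zero (r : ℕ) (h : β.card ≤ r) : Rel β g (g (x r)) 0
  | psi_zero (r : ℕ) (h : β.card ≤ r + 1) : Rel β g (g (psi r)) 0
  | e_mul_self (ν : List (Idx ℓ)) : Rel β g (g (e ν) * g (e ν)) (g (e ν))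
  | e_mul (ν ν' : List (Idx ℓ)) (h : ν ≠ ν') : Rel β g (g (e ν) * g (e ν')) 0
  | e_sum : Rel β g (∑ ν ∈ words β, g (e ν)) 1
  | x_e (r : ℕ) (ν : List (Idx ℓ)) : Rel β g (g (x r) * g (e ν)) (g (e ν) * g (x r))
  | psi_e (μ ρ : List (Idx ℓ)) (i j : Idx ℓ) :
      Rel β g (g (psi μ.length) * g (e (μ ++ i :: j :: ρ)))
        (g (e (μ ++ j :: i :: ρ)) * g (psi μ.length))
  | x_x (r s : ℕ) : Rel β g (g (x r) * g (x s)) (g (x s) * g (x r))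
  | psi_x (r s : ℕ) (h : s ≠ r) (h' : s ≠ r + 1) :
      Rel β g (g (psi r) * g (x s)) (g (x s) * g (psi r))
  | psi_psi (r s : ℕ) (h : r + 1 < s ∨ s + 1 < r) :
      Rel β g (g (psi r) * g (psi s)) (g (psi s) * g (psi r))
  | x_psi (μ ρ : List (Idx ℓ)) (i j : Idx ℓ) :
      Rel β g (g (x μ.length) * g (psi μ.length) * g (e (μ ++ i :: j :: ρ)))
        ((g (psi μ.length) * g (x (μ.length + 1)) - if i = j then 1 else 0)
          * g (e (μ ++ i :: j :: ρ)))
  | x_psi' (μ ρ : List (Idx ℓ)) (i j : Idx ℓ) :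
      Rel β g (g (x (μ.length + 1)) * g (psi μ.length) * g (e (μ ++ i :: j :: ρ)))
        ((g (psi μ.length) * g (x μ.length) + if i = j then 1 else 0)
          * g (e (μ ++ i :: j :: ρ)))
  | psi_sq (μ ρ : List (Idx ℓ)) (i j : Idx ℓ) :
      Rel β g (g (psi μ.length) * g (psi μ.length) * g (e (μ ++ i :: j :: ρ)))
        (qEval i j (g (x μ.length)) (g (x (μ.length + 1))) * g (e (μ ++ i :: j :: ρ)))
  | braid (μ ρ : List (Idx ℓ)) (i j k : Idx ℓ) :
      Rel β g
        ((g (psi (μ.length + 1)) * g (psi μ.length) * g (psi (μ.length + 1))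
            - g (psi μ.length) * g (psi (μ.length + 1)) * g (psi μ.length))
          * g (e (μ ++ i :: j :: k :: ρ)))
        ((if i = k then
            qDivDiff i j (g (x μ.length)) (g (x (μ.length + 1))) (g (x (μ.length + 2)))
          else 0) * g (e (μ ++ i :: j :: k :: ρ)))

lemma map_qEval {F' : Type*} [Ring F'] (φ : F →+* F') (i j : Idx ℓ) (u v : F) :
    φ (qEval i j u v) = qEval i j (φ u) (φ v) := by
  simp [qEval, map_list_sum, Function.comp_def]

lemma map_qDivDiff {F' : Type*} [Ring F'] (φ : F →+* F') (i j : Idx ℓ) (u v w : F) :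
    φ (qDivDiff i j u v w) = qDivDiff i j (φ u) (φ v) (φ w) := by
  simp [qDivDiff, map_list_sum, Function.comp_def]

lemma Rel.map {F' : Type*} [Ring F'] (φ : F →+* F') {β : RootCone ℓ} {g : Gen ℓ → F} {a b : F}
    (h : Rel β g a b) : Rel β (fun s => φ (g s)) (φ a) (φ b) := by
  cases h <;>
    simp only [map_zero, map_one, map_mul, map_sum, map_sub, map_add, map_qEval, map_qDivDiff,
      apply_ite φ]
  case e_zero ν h => exact .e_zero ν h
  case x_zero r h => exact .x_zero r h
  case psi_zero r h => exact .psi_zero r h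
  case e_mul_self ν => exact .e_mul_self ν
  case e_mul ν ν' h => exact .e_mul ν ν' h
  case e_sum => exact .e_sum
  case x_e r ν => exact .x_e r ν
  case psi_e μ ρ i j => exact .psi_e μ ρ i j
  case x_x r s => exact .x_x r s
  case psi_x r s h h' => exact .psi_x r s h h'
  case psi_psi r s h => exact .psi_psi r s h
  case x_psi μ ρ i j => exact .x_psi μ ρ i j
  case x_psi' μ ρ i j => exact .x_psi' μ ρ i j
  case psi_sq μ ρ i j => exact .psi_sq μ ρ i j
  case braid μ ρ i j k => exact .braid μ ρ i j k

end Relations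

/-- The quiver Hecke algebra `R(β)` over `k`, by generators and relations. -/
def QH (k : Type u) [CommRing k] {ℓ : ℕ∞} (β : RootCone ℓ) : Type u :=
  RingQuot (Rel β (FreeAlgebra.ι k : Gen ℓ → FreeAlgebra k (Gen ℓ)))

namespace QH

variable (k : Type u) [CommRing k] {ℓ : ℕ∞} (β : RootCone ℓ)

instance : Ring (QH k β) :=
  inferInstanceAs (Ring (RingQuot (Rel β (FreeAlgebra.ι k : Gen ℓ → FreeAlgebra k (Gen ℓ)))))

instance (R : Type*) [CommRing R] [Algebra R k] : Algebra R (QH k β) :=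
  inferInstanceAs
    (Algebra R (RingQuot (Rel β (FreeAlgebra.ι k : Gen ℓ → FreeAlgebra k (Gen ℓ)))))

instance (R : Type*) [CommRing R] [Algebra R k] : IsScalarTower R k (QH k β) :=
  inferInstanceAs
    (IsScalarTower R k (RingQuot (Rel β (FreeAlgebra.ι k : Gen ℓ → FreeAlgebra k (Gen ℓ)))))

/-- The projection from the free algebra. -/
def proj : FreeAlgebra k (Gen ℓ) →ₐ[k] QH k β :=
  RingQuot.mkAlgHom k (Rel β (FreeAlgebra.ι k : Gen ℓ → FreeAlgebra k (Gen ℓ)))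

/-- The class of a generator. -/
def gen (s : Gen ℓ) : QH k β := proj k β (FreeAlgebra.ι k s)

/-- The idempotent `e(ν)` (it is `0` if `ν ∉ I^β`). -/
def e (ν : List (Idx ℓ)) : QH k β := gen k β (.e ν)

/-- The generator `x_{r+1}`. -/
def x (r : ℕ) : QH k β := gen k β (.x r)

/-- The generator `ψ_{r+1}`. -/
def psi (r : ℕ) : QH k β := gen k β (.psi r)

/-- `ψ_{i₁} ⋯ ψ_{i_r}` for a word `[i₁, …, i_r]`. -/
def psiWord (w : List ℕ) : QH k β := (w.map (psi k β)).prod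

variable {k β} in
/-- The universal property of `R(β)`. -/
def lift {S A : Type*} [CommRing S] [Ring A] [Algebra S A] {β : RootCone ℓ} (g : Gen ℓ → A)
    (h : ∀ a b, Rel β g a b → a = b) : QH S β →ₐ[S] A :=
  RingQuot.liftAlgHom S ⟨FreeAlgebra.lift S g, fun a b hab => h _ _ (by
    have := hab.map (FreeAlgebra.lift S g : FreeAlgebra S (Gen ℓ) →ₐ[S] A).toRingHom
    simpa using this)⟩

lemma rel_gen {a b : QH k β} (h : Rel β (gen k β) a b) : a = b := by
  have key : ∀ a b, Rel β (FreeAlgebra.ι k : Gen ℓ → FreeAlgebra k (Gen ℓ)) a b →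
      proj k β a = proj k β b := fun a b hab => RingQuot.mkAlgHom_rel k hab
  cases h
  case e_zero ν h => simpa [gen] using key _ _ (.e_zero ν h)
  case x_zero r h => simpa [gen] using key _ _ (.x_zero r h)
  case psi_zero r h => simpa [gen] using key _ _ (.psi_zero r h)
  case e_mul_self ν => simpa [gen] using key _ _ (.e_mul_self ν)
  case e_mul ν ν' h => simpa [gen] using key _ _ (.e_mul ν ν' h)
  case e_sum => simpa [gen] using key _ _ .e_sum
  case x_e r ν => simpa [gen] using key _ _ (.x_e r ν)
  case psi_e μ ρ i j => simpa [gen] using key _ _ (.psi_e μ ρ i j)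
  case x_x r s => simpa [gen] using key _ _ (.x_x r s)
  case psi_x r s h h' => simpa [gen] using key _ _ (.psi_x r s h h')
  case psi_psi r s h => simpa [gen] using key _ _ (.psi_psi r s h)
  case x_psi μ ρ i j =>
    have := key _ _ (.x_psi μ ρ i j)
    simpa only [gen, map_mul, map_sub, apply_ite (proj k β), map_one, map_zero] using this
  case x_psi' μ ρ i j =>
    have := key _ _ (.x_psi' μ ρ i j)
    simpa only [gen, map_mul, map_add, apply_ite (proj k β), map_one, map_zero] using this
  case psi_sq μ ρ i j =>
    have := key _ _ (.psi_sq μ ρ i j)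
    rw [map_mul, map_mul, map_mul] at this
    erw [map_qEval (proj k β).toRingHom] at this
    exact this
  case braid μ ρ i j l =>
    have := key _ _ (.braid μ ρ i j l)
    rw [map_mul, map_mul, map_sub, map_mul, map_mul, map_mul, map_mul, apply_ite (proj k β),
      map_zero] at this
    erw [map_qDivDiff (proj k β).toRingHom] at this
    exact this

/-- Extension of scalars `R_R(β) → R_K(β)`, the identity on generators. -/
def baseChange (R : Type u) (K : Type v) [CommRing R] [CommRing K] [Algebra R K] {ℓ : ℕ∞}
    (β : RootCone ℓ) : QH R β →ₐ[R] QH K β :=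
  lift (gen K β) fun _ _ h => rel_gen K β h

/-- Homogeneous monomials in the generators, with their degrees:
`deg e(ν) = 0`, `deg x_r e(ν) = (α_{ν_r}, α_{ν_r})`, `deg ψ_r e(ν) = -(α_{ν_r}, α_{ν_{r+1}})`. -/
inductive HomMonomial : ℤ → QH k β → Prop
  | e (ν : List (Idx ℓ)) : HomMonomial 0 (e k β ν)
  | x (μ ρ : List (Idx ℓ)) (i : Idx ℓ) :
      HomMonomial (form i i) (x k β μ.length * QH.e k β (μ ++ i :: ρ))
  | psi (μ ρ : List (Idx ℓ)) (i j : Idx ℓ) :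
      HomMonomial (-form i j) (psi k β μ.length * QH.e k β (μ ++ i :: j :: ρ))
  | mul {c d : ℤ} {a b : QH k β} : HomMonomial c a → HomMonomial d b →
      HomMonomial (c + d) (a * b)

/-- The homogeneous component of degree `d` of `R(β)`. -/
def grade (d : ℤ) : Submodule k (QH k β) := Submodule.span k {a | HomMonomial k β d a}

end QH

/-! ### Cyclotomic quiver Hecke algebras -/

/-- The cyclotomic relations `x_1^{⟨α_{ν_1}^∨, Λ⟩} e(ν) = 0`; a dominant weight `Λ = ∑ Λ(i) Λ_i` is
given by its coefficients `Λ(i) = ⟨α_i^∨, Λ⟩`. -/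
inductive CycRel (k : Type u) [CommRing k] {ℓ : ℕ∞} (β : RootCone ℓ) (Λ : Idx ℓ →₀ ℕ) :
    QH k β → QH k β → Prop
  | mk (i : Idx ℓ) (ρ : List (Idx ℓ)) :
      CycRel k β Λ (QH.x k β 0 ^ Λ i * QH.e k β (i :: ρ)) 0

/-- The cyclotomic quiver Hecke algebra `R^Λ(β)`. -/
abbrev CycQH (k : Type u) [CommRing k] {ℓ : ℕ∞} (β : RootCone ℓ) (Λ : Idx ℓ →₀ ℕ) : Type u :=
  RingQuot (CycRel k β Λ)

namespace CycQH

variable (k : Type u) [CommRing k] {ℓ : ℕ∞} (β : RootCone ℓ) (Λ : Idx ℓ →₀ ℕ)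

/-- The projection `R(β) → R^Λ(β)`. -/
def mk : QH k β →ₐ[k] CycQH k β Λ := RingQuot.mkAlgHom k (CycRel k β Λ)

/-- The homogeneous component of degree `d` of `R^Λ(β)`. -/
def grade (d : ℤ) : Submodule k (CycQH k β Λ) := (QH.grade k β d).map (mk k β Λ).toLinearMap

end CycQH

/-! ### Convolution products -/

section Conv

variable (K : Type u) [CommRing K] {ℓ : ℕ∞} (γ : RootCone ℓ) {t : ℕ} (β : Fin t → RootCone ℓ)
  (M : Fin t → Type v) [∀ i, AddCommGroup (M i)] [∀ i, Module K (M i)]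
  [∀ i, Module (QH K (β i)) (M i)]

/-- The number of strands to the left of the `i`-th block. -/
def offset (i : Fin t) : ℕ := ∑ j ∈ Finset.Iio i, (β j).card

/-- The elements `a b ⊗ m - a ⊗ b m` for `a = 1` and `b` running through the generators of
`R(β_1) ⊗ ⋯ ⊗ R(β_t)`, which is mapped to `R(β_1 + ⋯ + β_t)` by juxtaposition:
`e(ν_1) ⊗ ⋯ ⊗ e(ν_t) ↦ e(ν_1 * ⋯ * ν_t)`, and the `x`'s and `ψ`'s of the `i`-th factor are shifted
by the number of strands to the left. -/
inductive ConvRel : QH K γ ⊗[K] (⨂[K] i, M i) → Prop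
  | e (ν : Fin t → List (Idx ℓ)) (hν : ∀ i, (ν i : RootCone ℓ) = β i) (m : ∀ i, M i) :
      ConvRel (QH.e K γ (List.ofFn ν).flatten ⊗ₜ[K] PiTensorProduct.tprod K m
        - 1 ⊗ₜ[K] PiTensorProduct.tprod K fun i => QH.e K (β i) (ν i) • m i)
  | x (i : Fin t) (r : ℕ) (hr : r < (β i).card) (m : ∀ i, M i) :
      ConvRel (QH.x K γ (offset β i + r) ⊗ₜ[K] PiTensorProduct.tprod K m
        - 1 ⊗ₜ[K] PiTensorProduct.tprod K (Function.update m i (QH.x K (β i) r • m i)))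
  | psi (i : Fin t) (r : ℕ) (hr : r + 1 < (β i).card) (m : ∀ i, M i) :
      ConvRel (QH.psi K γ (offset β i + r) ⊗ₜ[K] PiTensorProduct.tprod K m
        - 1 ⊗ₜ[K] PiTensorProduct.tprod K (Function.update m i (QH.psi K (β i) r • m i)))

/-- The convolution product
`M_1 ∘ ⋯ ∘ M_t = R(γ) e(β_1, …, β_t) ⊗_{R(β_1) ⊗ ⋯ ⊗ R(β_t)} (M_1 ⊗ ⋯ ⊗ M_t)`, where
`γ = β_1 + ⋯ + β_t`. (It is enough to divide by the relations `ConvRel`; they imply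
`1 ⊗ m = e(β_1, …, β_t) ⊗ m`, so `R(γ)` may be written for `R(γ) e(β_1, …, β_t)`.) -/
def Conv : Type (max u v) :=
  (QH K γ ⊗[K] (⨂[K] i, M i)) ⧸ Submodule.span (QH K γ) {z | ConvRel K γ β M z}

instance : AddCommGroup (Conv K γ β M) :=
  inferInstanceAs (AddCommGroup (_ ⧸ Submodule.span (QH K γ) {z | ConvRel K γ β M z}))

instance : Module (QH K γ) (Conv K γ β M) :=
  inferInstanceAs (Module (QH K γ) (_ ⧸ Submodule.span (QH K γ) {z | ConvRel K γ β M z}))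

instance (R : Type*) [CommRing R] [Algebra R K] : Module R (Conv K γ β M) :=
  inferInstanceAs (Module R (_ ⧸ Submodule.span (QH K γ) {z | ConvRel K γ β M z}))

instance (R : Type*) [CommRing R] [Algebra R K] : IsScalarTower R (QH K γ) (Conv K γ β M) :=
  inferInstanceAs
    (IsScalarTower R (QH K γ) (_ ⧸ Submodule.span (QH K γ) {z | ConvRel K γ β M z}))

instance (R : Type*) [CommRing R] [Algebra R K] : IsScalarTower R K (Conv K γ β M) :=
  inferInstanceAs
    (IsScalarTower R K (_ ⧸ Submodule.span (QH K γ) {z | ConvRel K γ β M z}))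

/-- The class of `a ⊗ (m_1 ⊗ ⋯ ⊗ m_t)`. -/
def Conv.mk (a : QH K γ) (m : ∀ i, M i) : Conv K γ β M :=
  Submodule.Quotient.mk (a ⊗ₜ[K] PiTensorProduct.tprod K m)

/-- The grading of a convolution product of graded modules. -/
def Conv.grade (gr : ∀ i, ℤ → Submodule K (M i)) (d : ℤ) : Submodule K (Conv K γ β M) :=
  Submodule.span K {z | ∃ (c : ℤ) (δ : Fin t → ℤ) (a : QH K γ) (m : ∀ i, M i),
    c + ∑ i, δ i = d ∧ a ∈ QH.grade K γ c ∧ (∀ i, m i ∈ gr i (δ i)) ∧ z = Conv.mk K γ β M a m}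

end Conv

/-! ### Segment modules -/

/-- `ν_{(a;m)} = (ā, …, \overline{a+m-1})`. -/
def segWord (ℓ : ℕ∞) (a : ℤ) (m : ℕ) : List (Idx ℓ) :=
  (List.range m).map fun t : ℕ => residue ℓ (a + (t : ℤ))

/-- `β_{(a;m)} = α_ā + ⋯ + α_{\overline{a+m-1}}`. -/
def segRoot (ℓ : ℕ∞) (a : ℤ) (m : ℕ) : RootCone ℓ := (segWord ℓ a m : Multiset (Idx ℓ))

section Character

variable (ℓ : ℕ∞)

lemma residue_val_of_top (k : ℤ) (h : ℓ = ⊤) : (residue ℓ k).1 = k.natAbs := by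
  simp [residue, h]

lemma residue_val_of_ne_top (k : ℤ) (h : ℓ ≠ ⊤) :
    (residue ℓ k).1 = min (k % (2 * ℓ.toNat : ℕ)).toNat
      (2 * ℓ.toNat - (k % (2 * ℓ.toNat : ℕ)).toNat) := by
  simp [residue, h]

lemma emod_succ_cases (k : ℤ) (N : ℕ) (hN : 2 ≤ N) :
    ((k + 1) % (N : ℤ) = k % N + 1 ∧ k % N + 1 < N) ∨
      ((k + 1) % (N : ℤ) = 0 ∧ k % N + 1 = N) := by
  have h0 : 0 ≤ k % (N : ℤ) := Int.emod_nonneg _ (by omega)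
  have h1 : k % (N : ℤ) < N := Int.emod_lt_of_pos _ (by omega)
  have h2 : (k + 1) % (N : ℤ) = (k % N + 1) % N := by simp
  rcases lt_or_ge (k % (N : ℤ) + 1) N with h | h
  · exact Or.inl ⟨by rw [h2, Int.emod_eq_of_lt (by omega) h], h⟩
  · have h3 : k % (N : ℤ) + 1 = N := by omega
    exact Or.inr ⟨by rw [h2, h3, Int.emod_self], h3⟩

lemma segWord_getElem? (a : ℤ) (m n : ℕ) (i : Idx ℓ) (h : (segWord ℓ a m)[n]? = some i) :
    i = residue ℓ (a + n) := by
  simp only [segWord, List.getElem?_map, Option.map_eq_some_iff] at h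
  obtain ⟨b, hb, rfl⟩ := h
  have := List.getElem?_eq_some_iff.1 hb
  obtain ⟨_, h2⟩ := this
  rw [List.getElem_range] at h2
  rw [h2]

variable [hℓ : Fact (2 ≤ ℓ)]

lemma two_le_toNat (h : ℓ ≠ ⊤) : 2 ≤ ℓ.toNat := by
  have h2 : (2 : ℕ∞) ≤ ℓ := Fact.out
  rw [← ENat.natCast_toNat h] at h2
  exact_mod_cast h2

lemma residue_adjacent (k : ℤ) :
    (residue ℓ k).1 + 1 = (residue ℓ (k + 1)).1 ∨ (residue ℓ (k + 1)).1 + 1 = (residue ℓ k).1 := by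
  by_cases h : ℓ = ⊤
  · rw [residue_val_of_top ℓ _ h, residue_val_of_top ℓ _ h]
    omega
  · have hL := two_le_toNat ℓ h
    rw [residue_val_of_ne_top ℓ _ h, residue_val_of_ne_top ℓ _ h]
    have h0 : 0 ≤ k % ((2 * ℓ.toNat : ℕ) : ℤ) := Int.emod_nonneg _ (by omega)
    have h1 := emod_succ_cases k (2 * ℓ.toNat) (by omega)
    omega

lemma residue_turn (k : ℤ) (hk : residue ℓ k = residue ℓ (k + 2)) :
    (residue ℓ (k + 1)).1 = 0 ∨ ((residue ℓ (k + 1)).1 : ℕ∞) = ℓ := by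
  have hv : (residue ℓ k).1 = (residue ℓ (k + 2)).1 := congrArg Subtype.val hk
  by_cases h : ℓ = ⊤
  · rw [residue_val_of_top ℓ _ h, residue_val_of_top ℓ _ h] at hv
    rw [residue_val_of_top ℓ _ h]
    left
    omega
  · have hL := two_le_toNat ℓ h
    rw [residue_val_of_ne_top ℓ _ h, residue_val_of_ne_top ℓ _ h] at hv
    have h0 : 0 ≤ k % ((2 * ℓ.toNat : ℕ) : ℤ) := Int.emod_nonneg _ (by omega)
    have h1 := emod_succ_cases k (2 * ℓ.toNat) (by omega)
    have h2 := emod_succ_cases (k + 1) (2 * ℓ.toNat) (by omega)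
    rw [show k + 1 + 1 = k + 2 by ring] at h2
    have h3 : (residue ℓ (k + 1)).1 = 0 ∨ (residue ℓ (k + 1)).1 = ℓ.toNat := by
      rw [residue_val_of_ne_top ℓ _ h]
      omega
    refine h3.imp_right fun h4 => ?_
    rw [h4, ENat.natCast_toNat h]

lemma qEval_zero {K : Type*} [Ring K] (k : ℤ) :
    qEval (residue ℓ k) (residue ℓ (k + 1)) (0 : K) 0 = 0 := by
  have h := residue_adjacent ℓ k
  unfold qEval qExponents
  split_ifs <;> first | omega | simp

lemma qDivDiff_zero {K : Type*} [Ring K] (k : ℤ) (hk : residue ℓ k = residue ℓ (k + 2)) :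
    qDivDiff (residue ℓ k) (residue ℓ (k + 1)) (0 : K) 0 0 = 0 := by
  have h := residue_adjacent ℓ k
  have h' := residue_turn ℓ k hk
  have h2 : ((1 : ℕ) : ℕ∞) ≠ ℓ := by
    rintro rfl
    exact absurd (Fact.out : (2 : ℕ∞) ≤ ((1 : ℕ) : ℕ∞)) (by norm_num)
  have h3 : ∀ i : Idx ℓ, (i.1 : ℕ∞) = ℓ → ∀ j : Idx ℓ, i.1 + 1 ≠ j.1 := by
    intro i hi j hj
    have hj2 := j.2
    have h6 : (j.1 : ℕ∞) ≤ (i.1 : ℕ∞) := hj2.trans_eq hi.symm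
    have h7 : j.1 ≤ i.1 := by exact_mod_cast h6
    omega
  have h4 : (residue ℓ k).1 = 0 → (residue ℓ (k + 1)).1 = 1 := by omega
  have h5 := h3 (residue ℓ (k + 1))
  unfold qDivDiff qExponents
  split_ifs with a1 a2 a3 a4 a5 a6 a7
  · simp
  · rw [h4 a3] at h'
    rcases h' with h' | h'
    · omega
    · exact absurd h' h2
  · simp [Finset.sum_range_succ]
  · rcases h' with h' | h'
    · omega
    · exact absurd h' a4
  · simp [Finset.sum_range_succ]
  · rcases h' with h' | h'
    · exact absurd h' a6
    · exact absurd a5 (h5 h' _)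
  · rcases h' with h' | h'
    · exact absurd h' a6
    · exact absurd a5 (h5 h' _)
  · omega

variable (K : Type u) [CommRing K] (a : ℤ) (m : ℕ)

/-- The scalars by which the generators act on the segment module `L(a;m)`: `e(ν)` acts as
`δ_{ν, ν_{(a;m)}}`, and `x_r`, `ψ_r` act as `0`. -/
def segScalar : Gen ℓ → K
  | .e ν => if ν = segWord ℓ a m then 1 else 0
  | .x _ => 0
  | .psi _ => 0

lemma segScalar_rel (b c : K) (h : Rel (segRoot ℓ a m) (segScalar ℓ K a m) b c) : b = c := by
  cases h
  case e_zero ν h =>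
    have : ν ≠ segWord ℓ a m := by rintro rfl; exact h rfl
    simp [segScalar, this]
  case x_zero r h => rfl
  case psi_zero r h => rfl
  case e_mul_self ν => by_cases h1 : ν = segWord ℓ a m <;> simp [segScalar, h1]
  case e_mul ν ν' h =>
    by_cases h1 : ν = segWord ℓ a m
    · have : ν' ≠ segWord ℓ a m := fun h2 => h (h1.trans h2.symm)
      simp [segScalar, this]
    · simp [segScalar, h1]
  case e_sum =>
    have : segWord ℓ a m ∈ words (segRoot ℓ a m) := (mem_words _ _).2 rfl
    simp [segScalar, Finset.sum_ite_eq', this]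
  case x_e r ν => simp [segScalar]
  case psi_e μ ρ i j => simp [segScalar]
  case x_x r s => rfl
  case psi_x r s h h' => rfl
  case psi_psi r s h => rfl
  case x_psi μ ρ i j =>
    by_cases h1 : μ ++ i :: j :: ρ = segWord ℓ a m
    · have hi := segWord_getElem? ℓ a m μ.length i (by rw [← h1]; simp)
      have hj := segWord_getElem? ℓ a m (μ.length + 1) j (by rw [← h1]; simp)
      have hij : i ≠ j := by
        intro hij
        have := residue_adjacent ℓ (a + μ.length)
        rw [← hi, show a + (μ.length : ℤ) + 1 = a + ((μ.length + 1 : ℕ) : ℤ) by push_cast; ring,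
          ← hj, hij] at this
        omega
      simp [segScalar, hij]
    · simp [segScalar, h1]
  case x_psi' μ ρ i j =>
    by_cases h1 : μ ++ i :: j :: ρ = segWord ℓ a m
    · have hi := segWord_getElem? ℓ a m μ.length i (by rw [← h1]; simp)
      have hj := segWord_getElem? ℓ a m (μ.length + 1) j (by rw [← h1]; simp)
      have hij : i ≠ j := by
        intro hij
        have := residue_adjacent ℓ (a + μ.length)
        rw [← hi, show a + (μ.length : ℤ) + 1 = a + ((μ.length + 1 : ℕ) : ℤ) by push_cast; ring,
          ← hj, hij] at this
        omega
      simp [segScalar, hij]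
    · simp [segScalar, h1]
  case psi_sq μ ρ i j =>
    by_cases h1 : μ ++ i :: j :: ρ = segWord ℓ a m
    · have hi := segWord_getElem? ℓ a m μ.length i (by rw [← h1]; simp)
      have hj := segWord_getElem? ℓ a m (μ.length + 1) j (by rw [← h1]; simp)
      have := qEval_zero ℓ (K := K) (a + μ.length)
      rw [← hi, show a + (μ.length : ℤ) + 1 = a + ((μ.length + 1 : ℕ) : ℤ) by push_cast; ring,
          ← hj] at this
      simp [segScalar, this]
    · simp [segScalar, h1]
  case braid μ ρ i j k =>
    by_cases h1 : μ ++ i :: j :: k :: ρ = segWord ℓ a m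
    · have hi := segWord_getElem? ℓ a m μ.length i (by rw [← h1]; simp)
      have hj := segWord_getElem? ℓ a m (μ.length + 1) j (by rw [← h1]; simp)
      have hk := segWord_getElem? ℓ a m (μ.length + 2) k (by rw [← h1]; simp)
      by_cases hik : i = k
      · have := qDivDiff_zero ℓ (K := K) (a + μ.length)
        rw [← hi, show a + (μ.length : ℤ) + 1 = a + ((μ.length + 1 : ℕ) : ℤ) by push_cast; ring,
          ← hj, show a + (μ.length : ℤ) + 2 = a + ((μ.length + 2 : ℕ) : ℤ) by push_cast; ring,
          ← hk] at this
        simpa [segScalar, hik] using fun _ => (hik ▸ this hik).symm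
      · simp [segScalar, hik]
    · simp [segScalar, h1]

/-- The action of `R(β_{(a;m)})` on the one-dimensional module `L(a;m)`. -/
def segCharacter : QH K (segRoot ℓ a m) →ₐ[K] K :=
  QH.lift (segScalar ℓ K a m) (segScalar_rel ℓ K a m)

/-- The segment module `L(a;m) = K u`, where `u` is the element `1` of `K`. -/
def Seg (_ℓ : ℕ∞) (K : Type u) (_a : ℤ) (_m : ℕ) : Type u := K

instance : AddCommGroup (Seg ℓ K a m) := inferInstanceAs (AddCommGroup K)

instance : Module K (Seg ℓ K a m) := inferInstanceAs (Module K K)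

instance : Module (QH K (segRoot ℓ a m)) (Seg ℓ K a m) :=
  Module.compHom K (segCharacter ℓ K a m).toRingHom

/-- The generator `u` of `L(a;m)`. -/
def Seg.u : Seg ℓ K a m := (1 : K)

/-- `L(a;m)` is concentrated in degree `0`. -/
def Seg.grade (d : ℤ) : Submodule K (Seg ℓ K a m) := if d = 0 then ⊤ else ⊥

/-- The convolution product `L(a_1;m_1) ∘ ⋯ ∘ L(a_t;m_t)` of a list of segment modules, as a module
over `R(γ)`, where `γ = ∑ β_{(a_i;m_i)}`. -/
abbrev SegConv (γ : RootCone ℓ) (s : List (ℤ × ℕ)) : Type u :=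
  Conv K γ (fun i : Fin s.length => segRoot ℓ s[i].1 s[i].2)
    (fun i : Fin s.length => Seg ℓ K s[i].1 s[i].2)

/-- The generator `u ⊗ ⋯ ⊗ u`. -/
def SegConv.gen (γ : RootCone ℓ) (s : List (ℤ × ℕ)) : SegConv ℓ K γ s :=
  Conv.mk K γ _ _ 1 fun i => Seg.u ℓ K s[i].1 s[i].2

/-- The grading of `L(a_1;m_1) ∘ ⋯ ∘ L(a_t;m_t)`. -/
def SegConv.grade (γ : RootCone ℓ) (s : List (ℤ × ℕ)) (d : ℤ) :
    Submodule K (SegConv ℓ K γ s) :=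
  Conv.grade K γ _ _ (fun i => Seg.grade ℓ K s[i].1 s[i].2) d

/-! ### Garnir homomorphisms and Specht modules -/

/-- A reduced word (`s_{i+1}` being written as `i`) of the permutation `w[a,b]` that moves the first
`a` letters past the following `b` letters: `(s_b ⋯ s_1)(s_{b+1} ⋯ s_2) ⋯ (s_{a+b-1} ⋯ s_a)`. -/
def blockWord (a b : ℕ) : List ℕ :=
  (List.range a).flatMap fun i => (List.range b).reverse.map fun j => j + i

/-- `h(ψ_{a+1}, ψ_{a+2}, …, ψ_{a+N})` for a noncommutative polynomial `h`. -/
def psiPoly (γ : RootCone ℓ) {N : ℕ} (a : ℕ) (h : FreeAlgebra K (Fin N)) : QH K γ :=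
  FreeAlgebra.lift K (fun j : Fin N => QH.psi K γ (a + j)) h

/-- The module `L(k+l₁;l₂) ∘ L(k;l₁)`. -/
abbrev SwapConv (k : ℤ) (l₁ l₂ : ℕ) : Type u :=
  SegConv ℓ K (segRoot ℓ k (l₁ + l₂)) [(k + l₁, l₂), (k, l₁)]

/-- The generator `u ⊗ u` of `L(k+l₁;l₂) ∘ L(k;l₁)`. -/
abbrev SwapConv.gen (k : ℤ) (l₁ l₂ : ℕ) : SwapConv ℓ K k l₁ l₂ := SegConv.gen ℓ K _ _

/-- The homogeneous homomorphism
`ι : L(k;l₁+l₂) → q^{(β_{(k;l₁)}, β_{(k+l₁;l₂)})} L(k+l₁;l₂) ∘ L(k;l₁)`, normalised by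
`ι(u) = ψ_{w[l₂,l₁]} (u ⊗ u) + (a linear combination of ψ_w (u ⊗ u) with w < w[l₂,l₁] in the Bruhat
order)`. -/
structure IsSegEmbedding (k : ℤ) (l₁ l₂ : ℕ)
    (ι : Seg ℓ K k (l₁ + l₂) →ₗ[QH K (segRoot ℓ k (l₁ + l₂))] SwapConv ℓ K k l₁ l₂) : Prop where
  homogeneous : ι (Seg.u ℓ K k (l₁ + l₂)) ∈
    SegConv.grade ℓ K _ _ (-rootForm (segRoot ℓ k l₁) (segRoot ℓ (k + l₁) l₂))
  leading : ι (Seg.u ℓ K k (l₁ + l₂))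
      - QH.psiWord K (segRoot ℓ k (l₁ + l₂)) (blockWord l₂ l₁) • SwapConv.gen ℓ K k l₁ l₂ ∈
    Submodule.span K {z | ∃ w : List ℕ, w.Sublist (blockWord l₂ l₁) ∧ w ≠ blockWord l₂ l₁ ∧
      z = QH.psiWord K (segRoot ℓ k (l₁ + l₂)) w • SwapConv.gen ℓ K k l₁ l₂}

/-- `cont(μ)` for a partition `μ` with charge `κ`; the node in row `r` and column `c` (both counted
from `0`) has residue `\overline{κ + c - r}`. -/
def contPartition (κ : ℤ) (μ : YoungDiagram) : RootCone ℓ :=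
  μ.cells.val.map fun A => residue ℓ (κ + A.2 - A.1)

/-- The segments `(κ; μ_1), (κ-1; μ_2), …` of the rows of `μ`. -/
def rowSegs (κ : ℤ) (μ : YoungDiagram) : List (ℤ × ℕ) :=
  (List.range (μ.colLen 0)).map fun r : ℕ => (κ - (r : ℤ), μ.rowLen r)

/-- The module `M^μ_κ = L(κ;μ_1) ∘ L(κ-1;μ_2) ∘ ⋯`. -/
abbrev PermMod (κ : ℤ) (μ : YoungDiagram) : Type u :=
  SegConv ℓ K (contPartition ℓ κ μ) (rowSegs κ μ)

/-- The segments of `M^μ_{κ,A}`, where `A` is the node in row `r` and column `c` (counted from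
`0`): the segments of rows `r` and `r+1` are replaced by
`L(κ-r; c) ∘ L(κ-r-1; μ_r+1) ∘ L(κ-r+c; μ_{r+1}-c-1)`. -/
def garnirSegs (κ : ℤ) (μ : YoungDiagram) (r c : ℕ) : List (ℤ × ℕ) :=
  (rowSegs κ μ).take r ++
    [(κ - r, c), (κ - r - 1, μ.rowLen r + 1), (κ - r + c, μ.rowLen (r + 1) - (c + 1))] ++
    (rowSegs κ μ).drop (r + 2)

/-- The module `M^μ_{κ,A}` for the node `A = (r, c)`. -/
abbrev GarnirPerm (κ : ℤ) (μ : YoungDiagram) (r c : ℕ) : Type u :=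
  SegConv ℓ K (contPartition ℓ κ μ) (garnirSegs κ μ r c)

/-- The Garnir homomorphism `M^μ_{κ,A} → M^μ_κ` for `A = (r, c)`. It is the composite
`⋯ ∘ L(κ-r;c) ∘ L(κ-r-1;μ_r+1) ∘ L(κ-r+c;μ_{r+1}-c-1) ∘ ⋯`
`→ ⋯ ∘ L(κ-r;c) ∘ L(κ-r+c;μ_r-c) ∘ L(κ-r-1;c+1) ∘ L(κ-r+c;μ_{r+1}-c-1) ∘ ⋯`
`→ ⋯ ∘ L(κ-r;μ_r) ∘ L(κ-r-1;μ_{r+1}) ∘ ⋯`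
of `id ∘ ι ∘ id` and of the map induced by the projections `p : u ⊗ u ↦ u`. As `M^μ_{κ,A}` is
generated by `u ⊗ ⋯ ⊗ u`, it is determined by the image of this element: if
`ι(u) = h(ψ_1, …, ψ_N) (u ⊗ u)` for a noncommutative polynomial `h` in the generators
`ψ_1, …, ψ_N` (`N = μ_r`) of `R(β_{(κ-r-1;μ_r+1)})`, the image is
`h(ψ_{a+1}, …, ψ_{a+N}) (u ⊗ ⋯ ⊗ u)`, where `a` is the number of strands to the left of the
block in which `ι` is applied. -/
def IsGarnirHom (κ : ℤ) (μ : YoungDiagram) (r c : ℕ)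
    (G : GarnirPerm ℓ K κ μ r c →ₗ[QH K (contPartition ℓ κ μ)] PermMod ℓ K κ μ) : Prop :=
  ∃ (ι : Seg ℓ K (κ - r - 1) (c + 1 + (μ.rowLen r - c)) →ₗ[QH K (segRoot ℓ (κ - r - 1)
        (c + 1 + (μ.rowLen r - c)))] SwapConv ℓ K (κ - r - 1) (c + 1) (μ.rowLen r - c))
    (h : FreeAlgebra K (Fin (c + (μ.rowLen r - c)))),
    IsSegEmbedding ℓ K (κ - r - 1) (c + 1) (μ.rowLen r - c) ι ∧
    ι (Seg.u ℓ K (κ - r - 1) (c + 1 + (μ.rowLen r - c))) =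
      psiPoly ℓ K (segRoot ℓ (κ - r - 1) (c + 1 + (μ.rowLen r - c))) 0 h •
        SwapConv.gen ℓ K (κ - r - 1) (c + 1) (μ.rowLen r - c) ∧
    G (SegConv.gen ℓ K (contPartition ℓ κ μ) (garnirSegs κ μ r c)) =
      psiPoly ℓ K (contPartition ℓ κ μ) ((∑ q ∈ Finset.range r, μ.rowLen q) + c) h •
        SegConv.gen ℓ K (contPartition ℓ κ μ) (rowSegs κ μ)

/-- The sum of the images of the Garnir homomorphisms over all Garnir nodes of `μ`, i.e. the nodes
`(r, c)` of `μ` such that `(r + 1, c)` is a node of `μ`. -/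
def garnirImage (κ : ℤ) (μ : YoungDiagram) :
    Submodule (QH K (contPartition ℓ κ μ)) (PermMod ℓ K κ μ) :=
  ⨆ (r : ℕ) (c : ℕ) (_ : (r + 1, c) ∈ μ)
    (G : GarnirPerm ℓ K κ μ r c →ₗ[QH K (contPartition ℓ κ μ)] PermMod ℓ K κ μ)
    (_ : IsGarnirHom ℓ K κ μ r c G), LinearMap.range G

/-- The cokernel of the Garnir homomorphisms of a partition. -/
abbrev GarnirCoker (κ : ℤ) (μ : YoungDiagram) : Type u := PermMod ℓ K κ μ ⧸ garnirImage ℓ K κ μ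

/-- The grading of the cokernel. -/
def GarnirCoker.grade (κ : ℤ) (μ : YoungDiagram) (d : ℤ) : Submodule K (GarnirCoker ℓ K κ μ) :=
  (SegConv.grade ℓ K (contPartition ℓ κ μ) (rowSegs κ μ) d).map
    ((garnirImage ℓ K κ μ).mkQ.restrictScalars K)

end Character

section Specht

variable (ℓ : ℕ∞) {l : ℕ} (κ : Fin l → ℤ) (lam : Fin l → YoungDiagram)

/-- `|λ|` for an `l`-multipartition `λ`. -/
def size : ℕ := ∑ t, (lam t).card

/-- `cont(λ)`, the sum of the simple roots of the residues of the nodes. -/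
def cont : RootCone ℓ := ∑ t, contPartition ℓ (κ t) (lam t)

/-- The positions `(t, r, c)` (component, row, column), counted from `0`, in their lexicographic
order. -/
abbrev Pos (l : ℕ) : Type := Fin l ×ₗ (ℕ ×ₗ ℕ)

/-- The component of a position. -/
def Pos.comp (A : Pos l) : Fin l := (ofLex A).1

/-- The row of a position. -/
def Pos.row (A : Pos l) : ℕ := (ofLex (ofLex A).2).1

/-- The column of a position. -/
def Pos.col (A : Pos l) : ℕ := (ofLex (ofLex A).2).2

/-- The nodes of the Young diagram `[λ]`. -/
abbrev Node : Type := {A : Pos l // (A.row, A.col) ∈ lam A.comp}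

/-- The nodes, sorted by components. -/
def nodeEquiv : (Σ t, {A : ℕ × ℕ // A ∈ (lam t).cells}) ≃ Node lam where
  toFun A := ⟨toLex (A.1, toLex A.2.1), (YoungDiagram.mem_cells _).1 A.2.2⟩
  invFun A := ⟨A.1.comp, ⟨(A.1.row, A.1.col), (YoungDiagram.mem_cells _).2 A.2⟩⟩
  left_inv _ := rfl
  right_inv _ := rfl

instance : Fintype (Node lam) := Fintype.ofEquiv _ (nodeEquiv lam)

lemma card_node : Fintype.card (Node lam) = size lam := by
  rw [← Fintype.card_congr (nodeEquiv lam)]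
  simp [size, YoungDiagram.card]

/-- The `λ`-tableaux. (Entries are counted from `0`.) -/
abbrev Tableau : Type := Node lam ≃ Fin (size lam)

/-- The initial tableau `t^λ`, filled along successive rows of successive components. -/
def initial : Tableau lam := (Fintype.orderIsoFinOfCardEq (Node lam) (card_node lam)).symm.toEquiv

variable {lam} in
/-- A tableau is standard if its entries increase along rows and down columns. -/
def IsStandard (T : Tableau lam) : Prop :=
  (∀ A B : Node lam, A.1.comp = B.1.comp → A.1.row = B.1.row → A.1.col < B.1.col → T A < T B) ∧
  (∀ A B : Node lam, A.1.comp = B.1.comp → A.1.col = B.1.col → A.1.row < B.1.row → T A < T B)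

variable {lam} in
/-- The permutation `w^T`, given by `w^T t^λ = T`. -/
def permOf (T : Tableau lam) : Equiv.Perm (Fin (size lam)) := (initial lam).symm.trans T

/-- The residue of a position. -/
def res (A : Pos l) : Idx ℓ := residue ℓ (κ A.comp + A.col - A.row)

/-- A set of positions is the Young diagram of a multipartition. -/
def IsDiagram (S : Set (Pos l)) : Prop :=
  S.Finite ∧ ∀ A ∈ S, ∀ B : Pos l, B.comp = A.comp → B.row ≤ A.row → B.col ≤ A.col → B ∈ S

/-- `A` is below `B`. -/
def IsBelow (A B : Pos l) : Prop := B.comp < A.comp ∨ A.comp = B.comp ∧ B.row < A.row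

/-- `d_A` of the diagram `S`: if `A` is an `i`-node, it is
`d_i (#{addable i-nodes of S below A} - #{removable i-nodes of S below A})`. -/
noncomputable def belowDegree (S : Set (Pos l)) (A : Pos l) : ℤ :=
  symmetriser (res ℓ κ A) *
    (({B | B ∉ S ∧ IsDiagram (insert B S) ∧ res ℓ κ B = res ℓ κ A ∧ IsBelow B A}.ncard : ℤ)
      - {B | B ∈ S ∧ IsDiagram (S \ {B}) ∧ res ℓ κ B = res ℓ κ A ∧ IsBelow B A}.ncard)

variable {lam} in
/-- The degree of a standard tableau: the sum, over all nodes `A`, of `d_A` of the diagram of the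
nodes with entries at most that of `A`. -/
noncomputable def degree (T : Tableau lam) : ℤ :=
  ∑ A : Node lam, belowDegree ℓ κ {B | ∃ h : (B.row, B.col) ∈ lam B.comp, T ⟨B, h⟩ ≤ T A} A.1

/-- `Λ = Λ_{κ̄_1} + ⋯ + Λ_{κ̄_l}`. -/
noncomputable def weight : Idx ℓ →₀ ℕ := ∑ t, Finsupp.single (residue ℓ (κ t)) 1

variable (K : Type u) [CommRing K] [Fact (2 ≤ ℓ)]

/-- The Specht module over a field `K`: the convolution product of the cokernels of the Garnir
homomorphisms of the components of `λ`. -/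
abbrev Specht : Type u :=
  Conv K (cont ℓ κ lam) (fun t => contPartition ℓ (κ t) (lam t))
    (fun t => GarnirCoker ℓ K (κ t) (lam t))

/-- The generator `m̄^λ`. -/
def Specht.gen : Specht ℓ κ lam K :=
  Conv.mk K _ _ _ 1 fun t => (garnirImage ℓ K (κ t) (lam t)).mkQ (SegConv.gen ℓ K _ _)

/-- The grading of the Specht module, including the shift by `deg(t^λ)`. -/
noncomputable def Specht.grade (d : ℤ) : Submodule K (Specht ℓ κ lam K) :=
  Conv.grade K _ _ _ (fun t => GarnirCoker.grade ℓ K (κ t) (lam t)) (d - degree ℓ κ (initial lam))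

variable (R : Type v) [CommRing R] [Algebra R K]

/-- The Specht module over an integral domain `R` with field of fractions `K`: the lattice
`R_R(cont(λ)) m̄^λ` in the Specht module over `K`. -/
def SpechtLattice : Submodule R (Specht ℓ κ lam K) where
  carrier := {v | ∃ a : QH R (cont ℓ κ lam), QH.baseChange R K _ a • Specht.gen ℓ κ lam K = v}
  add_mem' := by
    rintro _ _ ⟨a, rfl⟩ ⟨b, rfl⟩
    exact ⟨a + b, by rw [map_add, add_smul]⟩
  zero_mem' := ⟨0, by rw [map_zero, zero_smul]⟩
  smul_mem' := by
    rintro c _ ⟨a, rfl⟩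
    exact ⟨c • a, by rw [map_smul, smul_assoc]⟩

/-- The grading of the lattice, induced from the one of the Specht module over `K`. -/
noncomputable def SpechtLattice.grade (d : ℤ) : Submodule R (SpechtLattice ℓ κ lam K R) :=
  ((Specht.grade ℓ κ lam K d).restrictScalars R).comap (SpechtLattice ℓ κ lam K R).subtype

end Specht

/-- The permutation `s_{i₁} ⋯ s_{i_r}` of `{0, …, n-1}`, where `s_i` transposes `i` and `i + 1`. -/
def wordPerm (n : ℕ) (w : List ℕ) : Equiv.Perm (Fin n) :=
  (w.map fun i => (if h : i + 1 < n then Equiv.swap ⟨i, by omega⟩ ⟨i + 1, h⟩ else 1 :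
    Equiv.Perm (Fin n))).prod

/-- `w` is a reduced expression of the permutation `σ`. -/
def IsReducedExpression {n : ℕ} (σ : Equiv.Perm (Fin n)) (w : List ℕ) : Prop :=
  (∀ i ∈ w, i + 1 < n) ∧ wordPerm n w = σ ∧
    ∀ w' : List ℕ, (∀ i ∈ w', i + 1 < n) → wordPerm n w' = σ → w.length ≤ w'.length

end TypeC

namespace TypeC

universe u v w

/-! ### Words in the simple transpositions -/

/-! The Specht module is cyclic on m̄, a weight vector killed by every x_r. So it is exhausted by
the filtration `filt` by the number of ψ's. The x's preserve this filtration, and ψ_r² as well as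
the defect of a braid relation are polynomials in the x's on weight vectors. Hence, modulo shorter
words, ψ_w m̄ depends only on the permutation of w, and it drops in the filtration if w is not
reduced (`IsEigen.sub_mem_of_wordPerm_eq`, `IsEigen.mem_of_drop`). The combinatorial input is a
normal form for words given by Lehmer codes (`exists_nf`), together with the exchange property.

Spanning (`filt_le_standard`). If the tableau of w decreases somewhere along a row, w can be
rewritten to end in a ψ_r that kills m̄. If rows increase but some column does not, w can be
rewritten to end in the leading word of a Garnir relation (`exchange_blockWord`), which is a
combination of shorter words. Induction on the length gives the standard tableaux. Over R this
requires Garnir relations with integer coefficients, whereas the normalisation of ι only speaks of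
coefficients in K. The main work is therefore an integral form of ι (`exists_swap_vector`,
`exists_segEmbedding`).

Integral ι. The product L(a+l₁;l₂) ∘ L(a;l₁) is deformed: on the second segment the x's get
eigenvalues ±T or −T², chosen so that the polynomials Q still vanish along the segment
(`qEval_zeta`, `qDivDiff_zeta`). Over ℤ[T,T⁻¹] there is then an explicit module with a basis of
shuffles of the strands (`strandData`). The coefficient of the sorted shuffle in the image of the
generating one is a polynomial in T (`coefTop_integral`), and its value at T = 0 is a functional f
on R_ℤ(β) (`exists_functional`). On the right f transforms like u ⊗ u, and on the left like the
joint segment, except for one ψ. Pairing Grassmannian words with their complements in the longest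
one by means of f gives a unitriangular integer matrix. Solving a linear system with it gives a
vector V, and a duality argument shows that V spans a copy of the joint segment
(`swap_vector_of_functional`). The homogeneous component of the right degree is ι(u).

Grading (`spechtLattice_isInternal`). The relations of R(β) are homogeneous, so R(β) also acts on
the finitely supported functions ℤ → M with degrees being shifted (`twistGen_rel`, `twistRep`). The
universal properties of convolution products and quotients then produce a linear map that sorts
elements by degree, which proves that the sum of the components is direct (`Conv.isGraded`,
`IsGraded.quotient`).

Cyclotomic relations (`x_pow_filt`). Every vector is a combination of vectors ψ_w ψ_1⋯ψ_p m̄, where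
w avoids ψ_1 and p + 1 is the first position of a component: for other positions the row relations
or the Garnir relations in the first column shorten the product (`filt_le_front`). Now x_1 commutes
with ψ_w and takes ψ_1⋯ψ_p m̄ to products of fewer than p ψ's, so one component of the given residue
is used up by each factor x_1. -/

/-- A commutation or a braid move on words. -/
inductive Step : List ℕ → List ℕ → Prop
  | comm (u v : List ℕ) (i j : ℕ) (h : i + 1 < j ∨ j + 1 < i) :
      Step (u ++ i :: j :: v) (u ++ j :: i :: v)
  | braid (u v : List ℕ) (i : ℕ) :
      Step (u ++ (i + 1) :: i :: (i + 1) :: v) (u ++ i :: (i + 1) :: i :: v)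

/-- Equality of words up to commutation and braid moves. -/
abbrev WEq : List ℕ → List ℕ → Prop := Relation.EqvGen Step

infix:50 " ≈ᵇ " => WEq

lemma WEq.refl (u : List ℕ) : u ≈ᵇ u := Relation.EqvGen.refl u

lemma WEq.symm {u v : List ℕ} (h : u ≈ᵇ v) : v ≈ᵇ u := Relation.EqvGen.symm _ _ h

lemma WEq.trans {u v w : List ℕ} (h : u ≈ᵇ v) (h' : v ≈ᵇ w) : u ≈ᵇ w :=
  Relation.EqvGen.trans _ _ _ h h'

lemma Step.context {w w' : List ℕ} (h : Step w w') (a b : List ℕ) :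
    Step (a ++ w ++ b) (a ++ w' ++ b) := by
  cases h with
  | comm u v i j h => simpa using Step.comm (a ++ u) (v ++ b) i j h
  | braid u v i => simpa using Step.braid (a ++ u) (v ++ b) i

lemma WEq.context {w w' : List ℕ} (h : w ≈ᵇ w') (a b : List ℕ) : a ++ w ++ b ≈ᵇ a ++ w' ++ b := by
  induction h with
  | rel _ _ h => exact Relation.EqvGen.rel _ _ (h.context a b)
  | refl _ => exact WEq.refl _
  | symm _ _ _ ih => exact ih.symm
  | trans _ _ _ _ _ ih ih' => exact ih.trans ih'

lemma WEq.append_left {w w' : List ℕ} (h : w ≈ᵇ w') (a : List ℕ) : a ++ w ≈ᵇ a ++ w' := by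
  simpa using h.context a []

lemma WEq.append_right {w w' : List ℕ} (h : w ≈ᵇ w') (b : List ℕ) : w ++ b ≈ᵇ w' ++ b := by
  simpa using h.context [] b

lemma WEq.cons {w w' : List ℕ} (h : w ≈ᵇ w') (r : ℕ) : r :: w ≈ᵇ r :: w' :=
  h.append_left [r]

lemma WEq.of_comm (i j : ℕ) (v : List ℕ) (h : i + 1 < j ∨ j + 1 < i) : i :: j :: v ≈ᵇ j :: i :: v :=
  Relation.EqvGen.rel _ _ (Step.comm [] v i j h)

lemma WEq.of_braid (i : ℕ) (v : List ℕ) : (i + 1) :: i :: (i + 1) :: v ≈ᵇ i :: (i + 1) :: i :: v :=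
  Relation.EqvGen.rel _ _ (Step.braid [] v i)

lemma Step.length_eq {w w' : List ℕ} (h : Step w w') : w.length = w'.length := by
  cases h <;> simp

lemma WEq.length_eq {w w' : List ℕ} (h : w ≈ᵇ w') : w.length = w'.length := by
  induction h with
  | rel _ _ h => exact h.length_eq
  | refl _ => rfl
  | symm _ _ _ ih => exact ih.symm
  | trans _ _ _ _ _ ih ih' => exact ih.trans ih'

lemma Step.mem_iff {w w' : List ℕ} (h : Step w w') (i : ℕ) : i ∈ w ↔ i ∈ w' := by
  cases h <;> simp <;> tauto

lemma WEq.mem_iff {w w' : List ℕ} (h : w ≈ᵇ w') (i : ℕ) : i ∈ w ↔ i ∈ w' := by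
  induction h with
  | rel _ _ h => exact h.mem_iff i
  | refl _ => rfl
  | symm _ _ _ ih => exact ih.symm
  | trans _ _ _ _ _ ih ih' => exact ih.trans ih'

lemma Step.reverse {w w' : List ℕ} (h : Step w w') : Step w.reverse w'.reverse := by
  cases h with
  | comm u v i j h => simpa using Step.comm v.reverse u.reverse j i h.symm
  | braid u v i => simpa using Step.braid v.reverse u.reverse i

lemma WEq.reverse {w w' : List ℕ} (h : w ≈ᵇ w') : w.reverse ≈ᵇ w'.reverse := by
  induction h with
  | rel _ _ h => exact Relation.EqvGen.rel _ _ h.reverse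
  | refl _ => exact WEq.refl _
  | symm _ _ _ ih => exact ih.symm
  | trans _ _ _ _ _ ih ih' => exact ih.trans ih'

/-- The word is equal, up to commutation and braid moves, to a word with a repeated letter. -/
def Drop (w : List ℕ) : Prop := ∃ u s v, w ≈ᵇ u ++ s :: s :: v

lemma Drop.congr {w w' : List ℕ} (h : w ≈ᵇ w') (hd : Drop w') : Drop w := by
  obtain ⟨u, s, v, hd⟩ := hd
  exact ⟨u, s, v, h.trans hd⟩

lemma Drop.context {w : List ℕ} (h : Drop w) (a b : List ℕ) : Drop (a ++ w ++ b) := by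
  obtain ⟨u, s, v, h⟩ := h
  exact ⟨a ++ u, s, v ++ b, by simpa using h.context a b⟩

lemma Drop.cons {w : List ℕ} (h : Drop w) (r : ℕ) : Drop (r :: w) := by
  simpa using h.context [r] []

lemma Drop.append_left {w : List ℕ} (h : Drop w) (a : List ℕ) : Drop (a ++ w) := by
  simpa using h.context a []

lemma Drop.append_right {w : List ℕ} (h : Drop w) (b : List ℕ) : Drop (w ++ b) := by
  simpa using h.context [] b

/-- Words with letters that are far from `r` commute with `r`. -/
lemma WEq.comm_word (r : ℕ) (R : List ℕ) (h : ∀ i ∈ R, i + 1 < r ∨ r + 1 < i) (W : List ℕ) :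
    r :: (R ++ W) ≈ᵇ R ++ r :: W := by
  induction R with
  | nil => exact WEq.refl _
  | cons i R ih =>
    have h1 := WEq.of_comm r i (R ++ W) (h i (by simp)).symm
    exact h1.trans ((ih fun j hj => h j (by simp [hj])).cons i)

/-! ### Normal forms -/

/-- The word `[i + e - 1, …, i + 1, i]`. -/
def run (i e : ℕ) : List ℕ := (List.range e).reverse.map fun j => j + i

@[simp] lemma run_zero (i : ℕ) : run i 0 = [] := rfl

lemma run_succ (i e : ℕ) : run i (e + 1) = (i + e) :: run i e := by
  simp [run, List.range_succ, add_comm]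

@[simp] lemma length_run (i e : ℕ) : (run i e).length = e := by simp [run]

lemma mem_run {i e j : ℕ} : j ∈ run i e ↔ i ≤ j ∧ j < i + e := by
  simp only [run, List.mem_map, List.mem_reverse, List.mem_range]
  constructor
  · rintro ⟨a, ha, rfl⟩; omega
  · rintro ⟨h1, h2⟩; exact ⟨j - i, by omega, by omega⟩

lemma run_succ' (i e : ℕ) : run i (e + 1) = run (i + 1) e ++ [i] := by
  induction e with
  | zero => simp [run_succ]
  | succ e ih => rw [run_succ, ih, run_succ (i + 1)]; simp; omega

/-- The normal form with given (Lehmer) code, in the letters from `i` on. -/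
def nf : ℕ → List ℕ → List ℕ
  | _, [] => []
  | i, e :: es => run i e ++ nf (i + 1) es

lemma nf_append (i : ℕ) (es fs : List ℕ) : nf i (es ++ fs) = nf i es ++ nf (i + es.length) fs := by
  induction es generalizing i with
  | nil => simp [nf]
  | cons e es ih =>
    simp only [List.cons_append, nf, ih, List.length_cons, List.append_assoc]
    congr 3; omega

@[simp] lemma length_nf (i : ℕ) (es : List ℕ) : (nf i es).length = es.sum := by
  induction es generalizing i with
  | nil => rfl
  | cons e es ih => simp [nf, ih]

lemma le_of_mem_nf {i j : ℕ} {es : List ℕ} (h : j ∈ nf i es) : i ≤ j := by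
  induction es generalizing i with
  | nil => simp [nf] at h
  | cons e es ih =>
    rw [nf, List.mem_append, mem_run] at h
    rcases h with h | h
    · exact h.1
    · have := ih h; omega

lemma nf_replicate_zero (i n : ℕ) : nf i (List.replicate n 0) = [] := by
  induction n generalizing i with
  | zero => rfl
  | succ n ih => simp [List.replicate_succ, nf, ih]

lemma blockWord_eq_nf (a b : ℕ) : blockWord a b = nf 0 (List.replicate a b) := by
  have key : ∀ a, ((List.range a).flatMap fun i => run i b) = nf 0 (List.replicate a b) := by
    intro a
    induction a with
    | zero => rfl
    | succ a ih =>
      rw [List.range_succ, List.flatMap_append, ih, List.replicate_succ', nf_append]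
      simp [nf]
  exact key a

/-- Codes of permutations. -/
def ValidCode : List ℕ → Prop
  | [] => True
  | e :: es => e ≤ es.length ∧ ValidCode es

lemma validCode_replicate (n : ℕ) : ValidCode (List.replicate n 0) := by
  induction n with
  | zero => trivial
  | succ n ih => exact ⟨by simp, ih⟩

lemma lt_of_mem_nf {i j : ℕ} {es : List ℕ} (hv : ValidCode es) (h : j ∈ nf i es) :
    j + 1 < i + es.length := by
  induction es generalizing i with
  | nil => simp [nf] at h
  | cons e es ih =>
    rw [nf, List.mem_append, mem_run] at h
    have := hv.1
    simp only [List.length_cons]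
    rcases h with h | h
    · omega
    · have := ih hv.2 h; omega

/-- A letter moves through a run to the right. -/
lemma WEq.cons_run (r i e : ℕ) (h1 : i ≤ r) (h2 : r + 1 < i + e) (W : List ℕ) :
    r :: (run i e ++ W) ≈ᵇ run i e ++ (r + 1) :: W := by
  induction e with
  | zero => omega
  | succ e ih =>
    rw [run_succ]
    rcases Nat.lt_or_ge (r + 1) (i + e) with h | h
    · exact (WEq.of_comm r (i + e) _ (Or.inl h)).trans ((ih h).cons (i + e))
    -- Here r + 1 is the first letter of the run. A braid move turns r, r+1, r into r+1, r, r+1, and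
    -- the last letter commutes with what is left of the run.
    · obtain ⟨e, rfl⟩ : ∃ e', e = e' + 1 := ⟨e - 1, by omega⟩
      obtain rfl : r = i + e := by omega
      rw [run_succ]
      have h1 := (WEq.of_braid (i + e) (run i e ++ W)).symm
      have h2 := WEq.comm_word (i + e + 1) (run i e) (fun j hj => by
        rw [mem_run] at hj; omega) W
      exact h1.trans ((h2.cons (i + e)).cons (i + e + 1))

/-- The letter r meets the leading run i+e-1, …, i. It passes through it and becomes r+1, or repeats
its first letter, or prolongs it, or commutes with all of it. In the first and the last case the
rest of the code absorbs it by induction. -/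
lemma insert_nf (es : List ℕ) : ∀ (i r : ℕ), ValidCode es → i ≤ r → r + 1 < i + es.length →
    (∃ es', ValidCode es' ∧ es'.length = es.length ∧ r :: nf i es ≈ᵇ nf i es') ∨
      Drop (r :: nf i es) := by
  induction es with
  | nil => intro i r _ h1 h2; simp at h2; omega
  | cons e es ih =>
    intro i r hv h1 h2
    simp only [List.length_cons] at h2
    have key : ∀ r', i + 1 ≤ r' → r' + 1 < i + 1 + es.length →
        r :: nf i (e :: es) ≈ᵇ run i e ++ r' :: nf (i + 1) es →
        (∃ es', ValidCode es' ∧ es'.length = (e :: es).length ∧ r :: nf i (e :: es) ≈ᵇ nf i es') ∨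
          Drop (r :: nf i (e :: es)) := by
      intro r' h3 h4 h5
      rcases ih (i + 1) r' hv.2 h3 h4 with ⟨es', hv', hl, he⟩ | hd
      · exact Or.inl ⟨e :: es', ⟨by rw [hl]; exact hv.1, hv'⟩, by simp [hl],
          h5.trans (he.append_left _)⟩
      · exact Or.inr (Drop.congr h5 (hd.append_left _))
    rcases lt_trichotomy r (i + e) with h | h | h
    · rcases Nat.lt_or_ge (r + 1) (i + e) with h' | h'
      · have := hv.1
        exact key (r + 1) (by omega) (by omega) (WEq.cons_run r i e h1 h' _)
      · obtain ⟨e, rfl⟩ : ∃ e', e = e' + 1 := ⟨e - 1, by omega⟩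
        obtain rfl : r = i + e := by omega
        exact Or.inr ⟨[], i + e, run i e ++ nf (i + 1) es, by
          simp only [nf, run_succ]; exact WEq.refl _⟩
    · subst h
      exact Or.inl ⟨(e + 1) :: es, ⟨by omega, hv.2⟩, rfl, by
        simp only [nf, run_succ]; exact WEq.refl _⟩
    · refine key r (by omega) (by omega) (WEq.comm_word r _ (fun j hj => ?_) _)
      rw [mem_run] at hj; omega

lemma nf_or_drop (n : ℕ) (w : List ℕ) (hw : ∀ i ∈ w, i + 1 < n) :
    (∃ es, ValidCode es ∧ es.length = n ∧ w ≈ᵇ nf 0 es) ∨ Drop w := by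
  induction w with
  | nil =>
    exact Or.inl ⟨List.replicate n 0, validCode_replicate n, by simp, by
      rw [nf_replicate_zero]; exact WEq.refl _⟩
  | cons r w ih =>
    rcases ih fun i hi => hw i (by simp [hi]) with ⟨es, hv, hl, he⟩ | hd
    · rcases insert_nf es 0 r hv (by omega) (by have := hw r (by simp); omega) with
        ⟨es', hv', hl', he'⟩ | hd
      · exact Or.inl ⟨es', hv', by omega, (he.cons r).trans he'⟩
      · exact Or.inr (Drop.congr (he.cons r) hd)
    · exact Or.inr (hd.cons r)

/-! ### Permutations of words -/

/-- The transposition of `i` and `i + 1` (or the identity, if it is out of range). -/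
def simpleSwap (n i : ℕ) : Equiv.Perm (Fin n) :=
  if h : i + 1 < n then Equiv.swap ⟨i, by omega⟩ ⟨i + 1, h⟩ else 1

lemma wordPerm_nil (n : ℕ) : wordPerm n [] = 1 := rfl

lemma wordPerm_cons (n i : ℕ) (w : List ℕ) : wordPerm n (i :: w) = simpleSwap n i * wordPerm n w := by
  simp [wordPerm, simpleSwap]

lemma wordPerm_append (n : ℕ) (u w : List ℕ) : wordPerm n (u ++ w) = wordPerm n u * wordPerm n w := by
  simp [wordPerm]

lemma simpleSwap_val (n i : ℕ) (h : i + 1 < n) (a : Fin n) :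
    (simpleSwap n i a).1 = if a.1 = i then i + 1 else if a.1 = i + 1 then i else a.1 := by
  rw [simpleSwap, dif_pos h, Equiv.swap_apply_def]
  simp only [Fin.ext_iff]
  split_ifs <;> rfl

lemma simpleSwap_mul_self (n i : ℕ) : simpleSwap n i * simpleSwap n i = 1 := by
  unfold simpleSwap; split_ifs <;> simp

lemma Step.wordPerm_eq {n : ℕ} {w w' : List ℕ} (h : Step w w') (hw : ∀ i ∈ w, i + 1 < n) :
    wordPerm n w = wordPerm n w' := by
  cases h with
  | comm u v i j h =>
    have hi := hw i (by simp)
    have hj := hw j (by simp)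
    rw [wordPerm_append, wordPerm_append, wordPerm_cons, wordPerm_cons, wordPerm_cons,
      wordPerm_cons, ← mul_assoc (simpleSwap n i), ← mul_assoc (simpleSwap n j)]
    congr 2
    ext a
    simp only [Equiv.Perm.coe_mul, Function.comp_apply, simpleSwap_val n i hi,
      simpleSwap_val n j hj]
    split_ifs <;> omega
  | braid u v i =>
    have hi := hw i (by simp)
    have hj := hw (i + 1) (by simp)
    simp only [wordPerm_append, wordPerm_cons, ← mul_assoc]
    congr 1
    simp only [mul_assoc]
    congr 1
    ext a
    simp only [Equiv.Perm.coe_mul, Function.comp_apply, simpleSwap_val n i hi,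
      simpleSwap_val n (i + 1) hj]
    split_ifs <;> omega

lemma WEq.wordPerm_eq {n : ℕ} {w w' : List ℕ} (h : w ≈ᵇ w') (hw : ∀ i ∈ w, i + 1 < n) :
    wordPerm n w = wordPerm n w' := by
  induction h with
  | rel _ _ h => exact h.wordPerm_eq hw
  | refl _ => rfl
  | symm a b h ih => exact (ih fun i hi => hw i ((WEq.mem_iff h i).1 hi)).symm
  | trans a b c h h' ih ih' => exact (ih hw).trans (ih' fun i hi => hw i ((WEq.mem_iff h i).2 hi))

lemma wordPerm_fix {n i : ℕ} (hi : i < n) {w : List ℕ} (hw : ∀ j ∈ w, i < j ∧ j + 1 < n) :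
    wordPerm n w ⟨i, hi⟩ = ⟨i, hi⟩ := by
  induction w with
  | nil => rfl
  | cons j w ih =>
    have hj := hw j (by simp)
    rw [wordPerm_cons, Equiv.Perm.mul_apply, ih fun k hk => hw k (by simp [hk])]
    ext
    rw [simpleSwap_val n j hj.2]
    simp only
    split_ifs <;> omega

lemma wordPerm_run_val {n i e : ℕ} (h : i + e < n) (a : Fin n) :
    (wordPerm n (run i e) a).1 =
      if a.1 = i then i + e else if i < a.1 ∧ a.1 ≤ i + e then a.1 - 1 else a.1 := by
  induction e with
  | zero => simp [wordPerm_nil]; split_ifs <;> omega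
  | succ e ih =>
    rw [run_succ, wordPerm_cons, Equiv.Perm.mul_apply, simpleSwap_val n (i + e) (by omega),
      ih (by omega)]
    split_ifs <;> omega

lemma wordPerm_nf_apply {n i e : ℕ} {es : List ℕ} (hv : ValidCode (e :: es))
    (hl : i + (e :: es).length = n) (hi : i < n) :
    (wordPerm n (nf i (e :: es)) ⟨i, hi⟩).1 = i + e := by
  have := hv.1
  simp only [List.length_cons] at hl
  rw [nf, wordPerm_append, Equiv.Perm.mul_apply, wordPerm_fix hi, wordPerm_run_val (by omega),
    if_pos rfl]
  intro j hj
  have := le_of_mem_nf hj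
  have := lt_of_mem_nf hv.2 hj
  omega

/-- The first entry of the code is read off from the image i + e of i. After that the first run
cancels on the left. -/
lemma nf_injective {n : ℕ} (es : List ℕ) : ∀ (i : ℕ) (es' : List ℕ), ValidCode es → ValidCode es' →
    i + es.length = n → i + es'.length = n → wordPerm n (nf i es) = wordPerm n (nf i es') →
    es = es' := by
  induction es with
  | nil =>
    intro i es' _ _ h1 h2 _
    exact (List.length_eq_zero_iff.1 (by simp at h1; omega)).symm
  | cons e es ih =>
    intro i es' hv hv' h1 h2 h
    cases es' with
    | nil => simp at h1 h2; omega
    | cons e' es' =>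
      have hi : i < n := by simp at h1; omega
      have h3 := wordPerm_nf_apply hv h1 hi
      rw [h, wordPerm_nf_apply hv' h2 hi] at h3
      obtain rfl : e = e' := by omega
      rw [nf, nf, wordPerm_append, wordPerm_append, mul_left_cancel_iff] at h
      rw [ih (i + 1) es' hv.2 hv'.2 (by simp at h1; omega) (by simp at h2; omega) h]

/-- Every word is braid equivalent to the normal form of its permutation, or it is not reduced. -/
lemma exists_nf (n : ℕ) (w : List ℕ) (hw : ∀ i ∈ w, i + 1 < n) :
    ∃ es, ValidCode es ∧ es.length = n ∧ wordPerm n w = wordPerm n (nf 0 es) ∧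
      (w ≈ᵇ nf 0 es ∨ (nf 0 es).length < w.length ∧ Drop w) := by
  induction hN : w.length using Nat.strong_induction_on generalizing w with
  | _ N ih =>
    rcases nf_or_drop n w hw with ⟨es, hv, hl, he⟩ | hd
    · exact ⟨es, hv, hl, he.wordPerm_eq hw, Or.inl he⟩
    -- Deleting the repeated pair keeps the permutation and shortens the word, so the code comes
    -- from the induction hypothesis.
    · have hd' := hd
      obtain ⟨u, s, v, h⟩ := hd
      have hlen := h.length_eq
      simp only [List.length_append, List.length_cons] at hlen
      have hw' : ∀ i ∈ u ++ v, i + 1 < n := fun i hi =>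
        hw i ((h.mem_iff i).2 (by simp only [List.mem_append, List.mem_cons] at hi ⊢; tauto))
      obtain ⟨es, hv, hl, hp, h'⟩ := ih (u ++ v).length (by simp; omega) (u ++ v) hw' rfl
      refine ⟨es, hv, hl, ?_, Or.inr ⟨?_, hd'⟩⟩
      · rw [h.wordPerm_eq hw, ← hp, wordPerm_append, wordPerm_cons, wordPerm_cons,
          ← mul_assoc (simpleSwap n s), simpleSwap_mul_self, one_mul, wordPerm_append]
      · have h2 : (nf 0 es).length ≤ (u ++ v).length := by
          rcases h' with h' | h'
          · exact h'.length_eq.ge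
          · exact h'.1.le
        simp only [List.length_append] at h2
        omega

/-- Two words of the same permutation are braid equivalent, or neither of them is reduced. -/
lemma weq_or_drop {n : ℕ} {w w' : List ℕ} (hw : ∀ i ∈ w, i + 1 < n) (hw' : ∀ i ∈ w', i + 1 < n)
    (hp : wordPerm n w = wordPerm n w') (hl : w.length = w'.length) :
    w ≈ᵇ w' ∨ Drop w ∧ Drop w' := by
  obtain ⟨es, hv, hl1, hp1, h1⟩ := exists_nf n w hw
  obtain ⟨es', hv', hl1', hp1', h1'⟩ := exists_nf n w' hw'
  obtain rfl := nf_injective (n := n) es 0 es' hv hv' (by omega) (by omega) (by rw [← hp1, ← hp1', hp])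
  rcases h1 with h1 | h1 <;> rcases h1' with h1' | h1'
  · exact Or.inl (h1.trans h1'.symm)
  · have := h1.length_eq; omega
  · have := h1'.length_eq; omega
  · exact Or.inr ⟨h1.2, h1'.2⟩

/-- A word that is longer than another word of the same permutation is not reduced. -/
lemma drop_of_lt {n : ℕ} {w w' : List ℕ} (hw : ∀ i ∈ w, i + 1 < n) (hw' : ∀ i ∈ w', i + 1 < n)
    (hp : wordPerm n w = wordPerm n w') (hl : w'.length < w.length) : Drop w := by
  obtain ⟨es, hv, hl1, hp1, h1⟩ := exists_nf n w hw
  obtain ⟨es', hv', hl1', hp1', h1'⟩ := exists_nf n w' hw'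
  obtain rfl := nf_injective (n := n) es 0 es' hv hv' (by omega) (by omega) (by rw [← hp1, ← hp1', hp])
  rcases h1 with h1 | h1
  · have h2 : (nf 0 es).length ≤ w'.length := by
      rcases h1' with h1' | h1'
      · exact h1'.length_eq.ge
      · exact h1'.1.le
    have := h1.length_eq
    omega
  · exact h1.2

/-- The exchange property. -/
lemma exchange {n : ℕ} (u : List ℕ) (hu : ∀ i ∈ u, i + 1 < n) (a b : Fin n) (hab : a < b)
    (h : wordPerm n u b < wordPerm n u a) :
    ∃ u' : List ℕ, (∀ i ∈ u', i + 1 < n) ∧ u'.length + 1 = u.length ∧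
      wordPerm n u' = wordPerm n u * Equiv.swap a b := by
  induction u with
  | nil => exact absurd h (not_lt.2 hab.le)
  | cons i u ih =>
    have hu' : ∀ j ∈ u, j + 1 < n := fun j hj => hu j (by simp [hj])
    have hi := hu i (by simp)
    -- If the tail already inverts a and b, a letter is deleted there. Otherwise the head letter i
    -- creates the inversion: the tail takes a, b to i, i + 1, and deleting the head amounts to
    -- multiplying by the transposition on the right.
    rcases lt_or_ge (wordPerm n u b) (wordPerm n u a) with h' | h'
    · obtain ⟨u', h1, h2, h3⟩ := ih hu' h'
      refine ⟨i :: u', ?_, by simp [h2], by rw [wordPerm_cons, h3, wordPerm_cons, mul_assoc]⟩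
      intro j hj
      rcases List.mem_cons.1 hj with rfl | hj
      · exact hi
      · exact h1 j hj
    · refine ⟨u, hu', rfl, ?_⟩
      have hne : wordPerm n u a ≠ wordPerm n u b := fun h => hab.ne ((wordPerm n u).injective h)
      have hne' : (wordPerm n u a).1 ≠ (wordPerm n u b).1 := fun h => hne (Fin.ext h)
      rw [wordPerm_cons, Equiv.Perm.mul_apply, Equiv.Perm.mul_apply, Fin.lt_def,
        simpleSwap_val n i hi, simpleSwap_val n i hi] at h
      rw [Fin.le_def] at h'
      have h1 : (wordPerm n u a).1 = i ∧ (wordPerm n u b).1 = i + 1 := by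
        split_ifs at h <;> omega
      have h2 : simpleSwap n i = Equiv.swap (wordPerm n u a) (wordPerm n u b) := by
        rw [simpleSwap, dif_pos hi]
        congr 1
        · exact Fin.ext h1.1.symm
        · exact Fin.ext h1.2.symm
      rw [wordPerm_cons, h2, Equiv.swap_apply_apply]
      simp [mul_assoc]

/-! ### Grassmannian codes -/

/-- A descent of the code is a right descent of the permutation. The letters of the second run pass
to the left through the first one, whose last letter then commutes past everything behind it. -/
lemma nf_descent (i e e' : ℕ) (h : e' < e) (pre post : List ℕ) :
    ∃ u, nf i (pre ++ e :: e' :: post) ≈ᵇ u ++ [i + pre.length] := by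
  have key : ∀ (j e e' : ℕ), e' < e → ∀ W, run j e ++ (run (j + 1) e' ++ W) ≈ᵇ
      run j e' ++ (run j e ++ W) := by
    intro j e e' h W
    induction e' with
    | zero => exact WEq.refl _
    | succ e' ih =>
      rw [run_succ, run_succ]
      have h1 := (WEq.cons_run (j + e') j e (by omega) (by omega) (run (j + 1) e' ++ W)).symm
      have h2 := (ih (by omega)).cons (j + e')
      rw [show j + 1 + e' = j + e' + 1 by omega]
      exact h1.trans h2
  obtain ⟨e, rfl⟩ : ∃ a, e = a + 1 := ⟨e - 1, by omega⟩
  set j := i + pre.length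
  have h1 : nf i (pre ++ (e + 1) :: e' :: post) =
      nf i pre ++ (run j (e + 1) ++ (run (j + 1) e' ++ nf (j + 1 + 1) post)) := by
    rw [nf_append]; rfl
  have h2 := WEq.comm_word j (nf (j + 1 + 1) post) (fun a ha => by
    have := le_of_mem_nf ha; omega) []
  have h3 := key j (e + 1) e' h (nf (j + 1 + 1) post)
  have h4 : run j e' ++ (run j (e + 1) ++ nf (j + 1 + 1) post) ≈ᵇ
      run j e' ++ (run (j + 1) e ++ (nf (j + 1 + 1) post ++ [j])) := by
    rw [run_succ' j e, List.append_assoc, List.singleton_append]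
    simpa using (h2.append_left (run (j + 1) e)).append_left (run j e')
  refine ⟨nf i pre ++ (run j e' ++ (run (j + 1) e ++ nf (j + 1 + 1) post)), ?_⟩
  rw [h1]
  simpa using (h3.trans h4).append_left (nf i pre)

lemma exists_descent_of_not_pairwise (es : List ℕ) (h : ¬ es.Pairwise (· ≤ ·)) :
    ∃ pre e e' post, es = pre ++ e :: e' :: post ∧ e' < e := by
  induction es with
  | nil => exact absurd List.Pairwise.nil h
  | cons a es ih =>
    by_cases hp : es.Pairwise (· ≤ ·)
    · cases es with
      | nil => exact absurd (List.pairwise_singleton _ _) h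
      | cons b es =>
        rcases Nat.lt_or_ge b a with hb | hb
        · exact ⟨[], a, b, es, rfl, hb⟩
        · refine absurd ?_ h
          refine List.pairwise_cons.2 ⟨fun c hc => ?_, hp⟩
          rcases List.mem_cons.1 hc with rfl | hc
          · exact hb
          · exact hb.trans ((List.pairwise_cons.1 hp).1 c hc)
    · obtain ⟨pre, e, e', post, rfl, he⟩ := ih hp
      exact ⟨a :: pre, e, e', post, rfl, he⟩

lemma ValidCode.of_append {A B : List ℕ} (h : ValidCode (A ++ B)) : ValidCode B := by
  induction A with
  | nil => exact h
  | cons a A ih => exact ih h.2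

/-- The last entry of a code is 0, and in an increasing code it bounds the others. -/
lemma ValidCode.eq_zero_of_pairwise {es : List ℕ} (h : ValidCode es) (hp : es.Pairwise (· ≤ ·)) :
    es = List.replicate es.length 0 := by
  induction es with
  | nil => rfl
  | cons e es ih =>
    have h1 := ih h.2 (List.pairwise_cons.1 hp).2
    cases es with
    | nil => have := h.1; simp at this; simp [this]
    | cons b es =>
      have h2 : b = 0 := by
        rw [List.length_cons, List.replicate_succ, List.cons.injEq] at h1; exact h1.1
      have h3 := (List.pairwise_cons.1 hp).1 b (by simp)
      rw [List.length_cons, List.replicate_succ, ← h1]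
      congr 1; omega

/-- The codes of the minimal length representatives of the left cosets of `𝔖_{l₂} × 𝔖_{l₁}`. -/
structure GrassmannCode (l₂ l₁ : ℕ) (es : List ℕ) : Prop where
  length_eq : es.length = l₂
  sorted : es.Pairwise (· ≤ ·)
  le : ∀ e ∈ es, e ≤ l₁

/-- The code is cut after l₂ entries. A descent inside one of the halves gives a final letter i with
i + 1 ≠ l₂. If both halves increase, the second one vanishes and the first one is bounded by l₁. -/
lemma grassmann_or_descent (l₂ l₁ : ℕ) {es : List ℕ} (hv : ValidCode es)
    (hl : es.length = l₂ + l₁) :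
    (∃ es', GrassmannCode l₂ l₁ es' ∧ nf 0 es = nf 0 es') ∨
      ∃ u i, i + 1 ≠ l₂ ∧ i + 1 < l₂ + l₁ ∧ nf 0 es ≈ᵇ u ++ [i] := by
  obtain ⟨A, B, rfl, hA, hB⟩ : ∃ A B, es = A ++ B ∧ A.length = l₂ ∧ B.length = l₁ :=
    ⟨es.take l₂, es.drop l₂, (List.take_append_drop _ _).symm, by simp; omega, by simp; omega⟩
  by_cases hpA : A.Pairwise (· ≤ ·)
  · by_cases hpB : B.Pairwise (· ≤ ·)
    · left
      have hB0 := hv.of_append.eq_zero_of_pairwise hpB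
      refine ⟨A, ⟨hA, hpA, ?_⟩, ?_⟩
      · intro e he
        obtain ⟨A', a, rfl⟩ : ∃ A' a, A = A' ++ [a] := by
          rcases List.eq_nil_or_concat A with rfl | ⟨A', a, h⟩
          · simp at he
          · exact ⟨A', a, by simpa using h⟩
        have h1 : a ≤ l₁ := by
          rw [List.append_assoc] at hv
          have := hv.of_append.1
          simpa [hB] using this
        rcases List.mem_append.1 he with he | he
        · exact ((List.pairwise_append.1 hpA).2.2 e he a (by simp)).trans h1
        · simp at he; omega
      · rw [nf_append, hB0, nf_replicate_zero, List.append_nil]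
    · right
      obtain ⟨pre, e, e', post, rfl, he⟩ := exists_descent_of_not_pairwise B hpB
      obtain ⟨u, hu⟩ := nf_descent 0 e e' he (A ++ pre) post
      simp only [List.length_append, List.length_cons] at hB
      exact ⟨u, A.length + pre.length, by omega, by omega, by simpa using hu⟩
  · right
    obtain ⟨pre, e, e', post, rfl, he⟩ := exists_descent_of_not_pairwise A hpA
    obtain ⟨u, hu⟩ := nf_descent 0 e e' he pre (post ++ B)
    simp only [List.length_append, List.length_cons] at hA
    exact ⟨u, pre.length, by omega, by omega, by simpa using hu⟩

lemma sum_eq_of_code {l₁ : ℕ} {es : List ℕ} (h : ∀ e ∈ es, e ≤ l₁) (hs : es.length * l₁ ≤ es.sum) :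
    es = List.replicate es.length l₁ := by
  induction es with
  | nil => rfl
  | cons e es ih =>
    have h1 := h e (by simp)
    have h2 : es.sum ≤ es.length * l₁ := by
      have := List.sum_le_card_nsmul es l₁ fun x hx => h x (by simp [hx])
      simpa using this
    simp only [List.length_cons, List.sum_cons, Nat.succ_mul] at hs
    rw [List.length_cons, List.replicate_succ, ← ih (fun x hx => h x (by simp [hx])) (by omega)]
    congr 1; omega

lemma GrassmannCode.eq_replicate {l₂ l₁ : ℕ} {es : List ℕ} (h : GrassmannCode l₂ l₁ es)
    (hs : l₂ * l₁ ≤ es.sum) : es = List.replicate l₂ l₁ := by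
  have := sum_eq_of_code h.le (by rwa [h.length_eq])
  rwa [h.length_eq] at this

lemma grassmannCode_replicate (l₂ l₁ : ℕ) : GrassmannCode l₂ l₁ (List.replicate l₂ l₁) :=
  ⟨by simp, List.pairwise_replicate.2 (Or.inr le_rfl), fun e he => (List.eq_of_mem_replicate he).le⟩

@[simp] lemma length_blockWord (a b : ℕ) : (blockWord a b).length = a * b := by
  rw [blockWord_eq_nf, length_nf]; simp

lemma GrassmannCode.validCode {l₂ l₁ : ℕ} {es : List ℕ} (h : GrassmannCode l₂ l₁ es) :
    ValidCode (es ++ List.replicate l₁ 0) := by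
  obtain ⟨_, _, hle⟩ := h
  induction es generalizing l₂ with
  | nil => exact validCode_replicate _
  | cons e es ih =>
    refine ⟨?_, ih rfl (List.pairwise_cons.1 ‹_›).2 fun x hx => hle x (by simp [hx])⟩
    have := hle e (by simp)
    simp; omega

lemma nf_append_zeros (i n : ℕ) (es : List ℕ) : nf i (es ++ List.replicate n 0) = nf i es := by
  rw [nf_append, nf_replicate_zero, List.append_nil]

lemma GrassmannCode.lt_of_mem {l₂ l₁ : ℕ} {es : List ℕ} (h : GrassmannCode l₂ l₁ es) {i : ℕ}
    (hi : i ∈ nf 0 es) : i + 1 < l₂ + l₁ := by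
  rw [← nf_append_zeros 0 l₁ es] at hi
  have := lt_of_mem_nf h.validCode hi
  simp [h.length_eq] at this
  omega

lemma lt_of_mem_blockWord {a b i : ℕ} (h : i ∈ blockWord a b) : i + 1 < a + b := by
  rw [blockWord_eq_nf] at h
  exact (grassmannCode_replicate a b).lt_of_mem h

lemma GrassmannCode.eq_of_wordPerm_eq {l₂ l₁ : ℕ} {es es' : List ℕ} (h : GrassmannCode l₂ l₁ es)
    (h' : GrassmannCode l₂ l₁ es')
    (hp : wordPerm (l₂ + l₁) (nf 0 es) = wordPerm (l₂ + l₁) (nf 0 es')) : es = es' := by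
  rw [← nf_append_zeros 0 l₁ es, ← nf_append_zeros 0 l₁ es'] at hp
  exact List.append_cancel_right (nf_injective _ 0 _ h.validCode h'.validCode
    (by simp [h.length_eq]) (by simp [h'.length_eq]) hp)

lemma run_sublist_run (i : ℕ) {e e' : ℕ} (h : e ≤ e') : (run i e).Sublist (run i e') := by
  induction e', h using Nat.le_induction with
  | base => exact List.Sublist.refl _
  | succ e' _ ih => rw [run_succ]; exact ih.cons _

/-- This is what makes the terms of Grassmannian codes smaller in the Bruhat order than the leading
term, as the normalisation of ι demands. -/
lemma GrassmannCode.sublist {l₂ l₁ : ℕ} {es : List ℕ} (h : GrassmannCode l₂ l₁ es) :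
    (nf 0 es).Sublist (blockWord l₂ l₁) := by
  obtain ⟨hl, _, hle⟩ := h
  have key : ∀ (es : List ℕ) (i : ℕ), (∀ e ∈ es, e ≤ l₁) →
      (nf i es).Sublist (nf i (List.replicate es.length l₁)) := by
    intro es
    induction es with
    | nil => intro i _; exact List.Sublist.refl _
    | cons e es ih =>
      intro i he
      exact (run_sublist_run i (he e (by simp))).append
        (ih (i + 1) fun x hx => he x (by simp [hx]))
  rw [blockWord_eq_nf, ← hl]
  exact key es 0 hle

/-- A Grassmannian word can be completed to the left to the longest one. -/
lemma exists_completion (i l₁ : ℕ) (es : List ℕ) (hs : es.Pairwise (· ≤ ·)) (hle : ∀ e ∈ es, e ≤ l₁) :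
    ∃ y, y ++ nf i es ≈ᵇ nf i (List.replicate es.length l₁) := by
  induction es using List.reverseRecOn with
  | nil => exact ⟨[], WEq.refl _⟩
  | append_singleton es e ih =>
    have hp := List.pairwise_append.1 hs
    obtain ⟨y, hy⟩ := ih hp.1 fun x hx => hle x (by simp [hx])
    -- Only the last entry is raised here, one letter at a time. The entries before it are at most
    -- e, so all letters of the earlier runs are smaller than the new letter by at least 2 and
    -- commute with it.
    have h1 : ∀ e', e ≤ e' → ∃ y', y' ++ nf i (es ++ [e]) ≈ᵇ nf i (es ++ [e']) := by
      intro e' h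
      induction e', h using Nat.le_induction with
      | base => exact ⟨[], WEq.refl _⟩
      | succ e' he' ih' =>
        obtain ⟨y', hy'⟩ := ih'
        refine ⟨(i + es.length + e') :: y', (hy'.cons _).trans ?_⟩
        rw [nf_append, nf_append]
        have h2 := WEq.comm_word (i + es.length + e') (nf i es) (fun a ha => by
          left
          have h4 : ∀ (fs : List ℕ) (j : ℕ), (∀ x ∈ fs, x ≤ e) → a ∈ nf j fs →
              a + 1 < j + fs.length + e := by
            intro fs
            induction fs with
            | nil => intro j _ h; simp [nf] at h
            | cons f fs ihf =>
              intro j hf h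
              rw [nf, List.mem_append, mem_run] at h
              have := hf f (by simp)
              simp only [List.length_cons]
              rcases h with h | h
              · omega
              · have := ihf (j + 1) (fun x hx => hf x (by simp [hx])) h; omega
          have := h4 es i (fun x hx => hp.2.2 x hx e (by simp)) ha
          omega) (nf (i + es.length) [e'])
        simpa [nf, run_succ] using h2
    obtain ⟨y', hy'⟩ := h1 l₁ (hle e (by simp))
    refine ⟨y ++ y', ?_⟩
    rw [List.append_assoc]
    refine (hy'.append_left y).trans ?_
    rw [nf_append, List.length_append, List.length_singleton, List.replicate_succ', nf_append,
      List.length_replicate, ← List.append_assoc]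
    exact hy.append_right _

lemma GrassmannCode.exists_completion {l₂ l₁ : ℕ} {es : List ℕ} (h : GrassmannCode l₂ l₁ es) :
    ∃ y, y ++ nf 0 es ≈ᵇ blockWord l₂ l₁ := by
  have := TypeC.exists_completion 0 l₁ es h.sorted h.le
  rwa [h.length_eq, ← blockWord_eq_nf] at this

lemma blockWord_succ (a b : ℕ) : blockWord (a + 1) b = blockWord a b ++ run a b := by
  rw [blockWord_eq_nf, blockWord_eq_nf, List.replicate_succ', nf_append]
  simp [nf]

lemma blockWord_zero_right (a : ℕ) : blockWord a 0 = [] := by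
  rw [blockWord_eq_nf, nf_replicate_zero]

/-- The inverse of a block permutation. -/
lemma reverse_blockWord (l₁ l₂ : ℕ) : (blockWord l₁ l₂).reverse ≈ᵇ blockWord l₂ l₁ := by
  have h2 : ∀ b a, (blockWord a (b + 1)).reverse ≈ᵇ (blockWord a b).reverse ++ run b a := by
    intro b a
    induction a with
    | zero => exact WEq.refl _
    | succ a ih =>
      rw [blockWord_succ, blockWord_succ, List.reverse_append, List.reverse_append, run_succ a b,
        List.reverse_cons, run_succ b a, List.append_assoc, List.append_assoc]
      refine (WEq.append_left ?_ _)
      have h3 := WEq.comm_word (a + b) (blockWord a b).reverse (fun i hi => by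
        left
        have := lt_of_mem_blockWord (List.mem_reverse.1 hi); omega) (run b a)
      rw [add_comm b a]
      exact (ih.cons (a + b)).trans h3
  induction l₂ with
  | zero => rw [blockWord_zero_right]; exact WEq.refl _
  | succ b ih =>
    rw [blockWord_succ]
    exact (h2 b l₁).trans (ih.append_right _)

/-! ### Iterated exchange -/

/-- An entry that is larger than the following `b` entries can be moved past them. -/
lemma exchange_run {n : ℕ} (p b : ℕ) (hpb : p + b < n) (u : List ℕ) (hu : ∀ i ∈ u, i + 1 < n)
    (h : ∀ a c : Fin n, a.1 = p → p < c.1 → c.1 ≤ p + b → wordPerm n u c < wordPerm n u a) :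
    ∃ u' : List ℕ, (∀ i ∈ u', i + 1 < n) ∧ u'.length + b = u.length ∧
      wordPerm n u = wordPerm n (u' ++ run p b) := by
  induction b with
  | zero => exact ⟨u, hu, rfl, by simp⟩
  | succ b ih =>
    obtain ⟨u₁, h1, h2, h3⟩ := ih (by omega) fun a c h4 h5 h6 => h a c h4 h5 (by omega)
    -- In `u₁` the large entry sits in position p + b already, while position p + b + 1 is
    -- untouched.
    have h7 := exchange u₁ h1 ⟨p + b, by omega⟩ ⟨p + b + 1, by omega⟩ (by simp [Fin.lt_def]) ?_
    · obtain ⟨u', h8, h9, h10⟩ := h7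
      refine ⟨u', h8, by omega, ?_⟩
      rw [h3, wordPerm_append, wordPerm_append, h10, run_succ, wordPerm_cons, simpleSwap,
        dif_pos (by omega), mul_assoc, ← mul_assoc (Equiv.swap _ _)]
      simp
    · have e1 : (⟨p + b, by omega⟩ : Fin n) = wordPerm n (run p b) ⟨p, by omega⟩ := by
        ext; rw [wordPerm_run_val (by omega)]; simp
      have e2 : (⟨p + b + 1, by omega⟩ : Fin n) = wordPerm n (run p b) ⟨p + b + 1, by omega⟩ := by
        ext; rw [wordPerm_run_val (by omega)]; simp only; split_ifs <;> omega
      rw [e1, e2, ← Equiv.Perm.mul_apply, ← Equiv.Perm.mul_apply, ← wordPerm_append, ← h3]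
      exact h _ _ rfl (by simp only; omega) (by simp only; omega)

/-- A block of entries that are larger than those of the following block can be moved past
them. -/
lemma exchange_blockWord {n : ℕ} (p b : ℕ) (a : ℕ) (hn : p + a + b ≤ n) (u : List ℕ)
    (hu : ∀ i ∈ u, i + 1 < n)
    (h : ∀ x y : Fin n, p ≤ x.1 → x.1 < p + a → p + a ≤ y.1 → y.1 < p + a + b →
      wordPerm n u y < wordPerm n u x) :
    ∃ u' : List ℕ, (∀ i ∈ u', i + 1 < n) ∧ u'.length + a * b = u.length ∧
      wordPerm n u = wordPerm n (u' ++ (blockWord a b).map (p + ·)) := by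
  induction a generalizing u with
  | zero => exact ⟨u, hu, by simp, by simp [blockWord]⟩
  | succ a ih =>
    obtain ⟨u₁, h1, h2, h3⟩ := exchange_run (p + a) b (by omega) u hu fun x c h4 h5 h6 =>
      h x c (by omega) (by omega) (by omega) (by omega)
    have hr : (run a b).map (p + ·) = run (p + a) b := by
      simp only [run, List.map_map, List.map_inj_left]
      intro x _
      simp only [Function.comp_apply]; omega
    -- The last strand of the block is moved first. The other a strands are still inverted with the
    -- b small entries, which are now one position further to the left.
    have h0 : ∀ x y : Fin n, p ≤ x.1 → x.1 < p + a → p + a ≤ y.1 → y.1 < p + a + b →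
        wordPerm n u₁ y < wordPerm n u₁ x := by
      intro x y hx hx' hy hy'
      have e1 : x = wordPerm n (run (p + a) b) x := by
        ext; rw [wordPerm_run_val (by omega)]; split_ifs <;> omega
      have e2 : y = wordPerm n (run (p + a) b) ⟨y.1 + 1, by omega⟩ := by
        ext; rw [wordPerm_run_val (by omega)]; simp only; split_ifs <;> omega
      rw [e1, e2, ← Equiv.Perm.mul_apply, ← Equiv.Perm.mul_apply, ← wordPerm_append, ← h3]
      exact h _ _ hx (by omega) (by simp only; omega) (by simp only; omega)
    obtain ⟨u', h4, h5, h6⟩ := ih (by omega) u₁ h1 h0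
    refine ⟨u', h4, by rw [Nat.succ_mul]; omega, ?_⟩
    rw [h3, blockWord_succ, List.map_append, hr, wordPerm_append, h6, ← List.append_assoc,
      wordPerm_append _ (u' ++ _)]

/-- The entry `0` can be moved to the front. -/
lemma exchange_front {n : ℕ} (p : ℕ) (hp : p < n) (u : List ℕ) (hu : ∀ i ∈ u, i + 1 < n)
    (h : (wordPerm n u ⟨p, hp⟩).1 = 0) :
    ∃ u' : List ℕ, (∀ i ∈ u', i + 1 < n) ∧ u'.length + p = u.length ∧
      wordPerm n u = wordPerm n (u' ++ List.range p) ∧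
      (wordPerm n u' ⟨0, by omega⟩).1 = 0 := by
  induction p generalizing u with
  | zero => exact ⟨u, hu, rfl, by simp, h⟩
  | succ p ih =>
    obtain ⟨u₁, h1, h2, h3⟩ := exchange u hu ⟨p, by omega⟩ ⟨p + 1, hp⟩ (by simp [Fin.lt_def]) (by
      rw [Fin.lt_def, h]
      refine Nat.pos_of_ne_zero fun h0 => ?_
      have := (wordPerm n u).injective (Fin.ext (h0.trans h.symm))
      simp at this)
    obtain ⟨u', h4, h5, h6, h7⟩ := ih (by omega) u₁ h1 (by
      rw [h3, Equiv.Perm.mul_apply, Equiv.swap_apply_left, h])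
    refine ⟨u', h4, by omega, ?_, h7⟩
    rw [List.range_succ, ← List.append_assoc, wordPerm_append, ← h6, h3, wordPerm_cons,
      wordPerm_nil, simpleSwap, dif_pos hp, mul_assoc, mul_one, Equiv.swap_mul_self, mul_one]

/-! ### Cutting words at a position; polynomials with values in a subring -/

lemma exists_split {α : Type*} (ν : List α) (i : ℕ) (h : i + 1 < ν.length) :
    ∃ μ a b ρ, ν = μ ++ a :: b :: ρ ∧ μ.length = i := by
  refine ⟨ν.take i, ν[i], ν[i + 1], ν.drop (i + 2), ?_, by simp; omega⟩
  rw [List.getElem_cons_drop, List.getElem_cons_drop, List.take_append_drop]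

lemma exists_split₃ {α : Type*} (ν : List α) (i : ℕ) (h : i + 2 < ν.length) :
    ∃ μ a b c ρ, ν = μ ++ a :: b :: c :: ρ ∧ μ.length = i := by
  refine ⟨ν.take i, ν[i], ν[i + 1], ν[i + 2], ν.drop (i + 3), ?_, by simp; omega⟩
  rw [List.getElem_cons_drop, List.getElem_cons_drop, List.getElem_cons_drop,
    List.take_append_drop]

lemma exists_split₁ {α : Type*} (ν : List α) (i : ℕ) (h : i < ν.length) :
    ∃ μ a ρ, ν = μ ++ a :: ρ ∧ μ.length = i := by
  refine ⟨ν.take i, ν[i], ν.drop (i + 1), ?_, by simp; omega⟩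
  rw [List.getElem_cons_drop, List.take_append_drop]

lemma qEval_mem {ℓ : ℕ∞} {F : Type*} [Ring F] (S : Subring F) (i j : Idx ℓ) {u v : F} (hu : u ∈ S)
    (hv : v ∈ S) : qEval i j u v ∈ S := by
  refine S.list_sum_mem fun a ha => ?_
  obtain ⟨m, _, rfl⟩ := List.mem_map.1 ha
  exact S.mul_mem (S.pow_mem hu _) (S.pow_mem hv _)

lemma qDivDiff_mem {ℓ : ℕ∞} {F : Type*} [Ring F] (S : Subring F) (i j : Idx ℓ) {u v w : F}
    (hu : u ∈ S) (hv : v ∈ S) (hw : w ∈ S) : qDivDiff i j u v w ∈ S := by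
  refine S.list_sum_mem fun a ha => ?_
  obtain ⟨m, _, rfl⟩ := List.mem_map.1 ha
  exact S.mul_mem (S.sum_mem fun s _ => S.mul_mem (S.pow_mem hu _) (S.pow_mem hw _))
    (S.pow_mem hv _)

/-! ### Consequences of the defining relations of the quiver Hecke algebra -/

namespace QH

variable {k : Type u} [CommRing k] {ℓ : ℕ∞} {β : RootCone ℓ}

lemma e_eq_zero {ν : List (Idx ℓ)} (h : (ν : RootCone ℓ) ≠ β) : e k β ν = 0 :=
  rel_gen k β (.e_zero ν h)

lemma x_eq_zero {r : ℕ} (h : β.card ≤ r) : x k β r = 0 := rel_gen k β (.x_zero r h)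

lemma psi_eq_zero {r : ℕ} (h : β.card ≤ r + 1) : psi k β r = 0 := rel_gen k β (.psi_zero r h)

lemma e_mul_self (ν : List (Idx ℓ)) : e k β ν * e k β ν = e k β ν := rel_gen k β (.e_mul_self ν)

lemma e_mul_of_ne {ν ν' : List (Idx ℓ)} (h : ν ≠ ν') : e k β ν * e k β ν' = 0 :=
  rel_gen k β (.e_mul ν ν' h)

variable (k β) in
lemma sum_e : ∑ ν ∈ words β, e k β ν = 1 := rel_gen k β .e_sum

lemma x_mul_e (r : ℕ) (ν : List (Idx ℓ)) : x k β r * e k β ν = e k β ν * x k β r :=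
  rel_gen k β (.x_e r ν)

lemma psi_mul_e (μ ρ : List (Idx ℓ)) (i j : Idx ℓ) :
    psi k β μ.length * e k β (μ ++ i :: j :: ρ) = e k β (μ ++ j :: i :: ρ) * psi k β μ.length :=
  rel_gen k β (.psi_e μ ρ i j)

lemma x_mul_x (r s : ℕ) : x k β r * x k β s = x k β s * x k β r := rel_gen k β (.x_x r s)

lemma psi_mul_x {r s : ℕ} (h : s ≠ r) (h' : s ≠ r + 1) :
    psi k β r * x k β s = x k β s * psi k β r := rel_gen k β (.psi_x r s h h')

lemma psi_mul_psi {r s : ℕ} (h : r + 1 < s ∨ s + 1 < r) :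
    psi k β r * psi k β s = psi k β s * psi k β r := rel_gen k β (.psi_psi r s h)

lemma x_mul_psi (μ ρ : List (Idx ℓ)) (i j : Idx ℓ) :
    x k β μ.length * psi k β μ.length * e k β (μ ++ i :: j :: ρ) =
      (psi k β μ.length * x k β (μ.length + 1) - if i = j then 1 else 0)
        * e k β (μ ++ i :: j :: ρ) := rel_gen k β (.x_psi μ ρ i j)

lemma x_mul_psi' (μ ρ : List (Idx ℓ)) (i j : Idx ℓ) :
    x k β (μ.length + 1) * psi k β μ.length * e k β (μ ++ i :: j :: ρ) =
      (psi k β μ.length * x k β μ.length + if i = j then 1 else 0)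
        * e k β (μ ++ i :: j :: ρ) := rel_gen k β (.x_psi' μ ρ i j)

lemma psi_mul_self (μ ρ : List (Idx ℓ)) (i j : Idx ℓ) :
    psi k β μ.length * psi k β μ.length * e k β (μ ++ i :: j :: ρ) =
      qEval i j (x k β μ.length) (x k β (μ.length + 1)) * e k β (μ ++ i :: j :: ρ) :=
  rel_gen k β (.psi_sq μ ρ i j)

lemma braid (μ ρ : List (Idx ℓ)) (i j l : Idx ℓ) :
    (psi k β (μ.length + 1) * psi k β μ.length * psi k β (μ.length + 1)
        - psi k β μ.length * psi k β (μ.length + 1) * psi k β μ.length)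
          * e k β (μ ++ i :: j :: l :: ρ) =
      (if i = l then
          qDivDiff i j (x k β μ.length) (x k β (μ.length + 1)) (x k β (μ.length + 2))
        else 0) * e k β (μ ++ i :: j :: l :: ρ) := rel_gen k β (.braid μ ρ i j l)

lemma psiWord_nil : psiWord k β [] = 1 := rfl

lemma psiWord_cons (i : ℕ) (w : List ℕ) : psiWord k β (i :: w) = psi k β i * psiWord k β w := by
  simp [psiWord]

lemma psiWord_append (u w : List ℕ) :
    psiWord k β (u ++ w) = psiWord k β u * psiWord k β w := by
  simp [psiWord]

lemma psiWord_singleton (i : ℕ) : psiWord k β [i] = psi k β i := by simp [psiWord]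

lemma psiWord_eq_zero {w : List ℕ} (h : ∃ i ∈ w, β.card ≤ i + 1) : psiWord k β w = 0 := by
  obtain ⟨i, hi, h⟩ := h
  exact List.prod_eq_zero (List.mem_map.2 ⟨i, hi, psi_eq_zero h⟩)

/-- Induction over the generators of the quiver Hecke algebra. -/
lemma induction {P : QH k β → Prop} (hgen : ∀ s, P (gen k β s))
    (hc : ∀ c : k, P (algebraMap k _ c)) (hadd : ∀ a b, P a → P b → P (a + b))
    (hmul : ∀ a b, P a → P b → P (a * b)) (a : QH k β) : P a := by
  obtain ⟨a, rfl⟩ : ∃ a', proj k β a' = a := RingQuot.mkAlgHom_surjective k _ a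
  induction a using FreeAlgebra.induction with
  | grade0 c => rw [AlgHom.commutes]; exact hc c
  | grade1 s => exact hgen s
  | mul a b ha hb => rw [map_mul]; exact hmul _ _ ha hb
  | add a b ha hb => rw [map_add]; exact hadd _ _ ha hb

lemma lift_gen {S A : Type*} [CommRing S] [Ring A] [Algebra S A] {β : RootCone ℓ} (g : Gen ℓ → A)
    (h : ∀ a b, Rel β g a b → a = b) (s : Gen ℓ) :
    lift (S := S) g h (gen S β s) = g s := by
  unfold lift gen proj
  erw [RingQuot.liftAlgHom_mkAlgHom_apply]
  simp

end QH

/-! ### The filtration of a cyclic module by the number of ψ's -/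

section Rep

variable {k : Type u} [CommRing k] {ℓ : ℕ∞} {β : RootCone ℓ} {V : Type v} [AddCommGroup V]
  [Module k V] (ρ : QH k β →ₐ[k] Module.End k V) (m : V)

lemma rep_mul (a b : QH k β) (v : V) : ρ (a * b) v = ρ a (ρ b v) := by
  rw [map_mul, Module.End.mul_apply]

/-- A weight vector. -/
def IsWeight (v : V) : Prop := ∃ ν, ρ (QH.e k β ν) v = v

variable {ρ} in
lemma rep_e_of_ne {ν ν' : List (Idx ℓ)} {v : V} (h : ρ (QH.e k β ν) v = v) (hne : ν' ≠ ν) :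
    ρ (QH.e k β ν') v = 0 := by
  rw [← h, ← rep_mul, QH.e_mul_of_ne hne, map_zero, LinearMap.zero_apply]

variable {ρ} in
lemma rep_psi_weight {μ ρ' : List (Idx ℓ)} {i j : Idx ℓ} {v : V}
    (h : ρ (QH.e k β (μ ++ i :: j :: ρ')) v = v) :
    ρ (QH.e k β (μ ++ j :: i :: ρ')) (ρ (QH.psi k β μ.length) v) = ρ (QH.psi k β μ.length) v := by
  rw [← rep_mul, ← QH.psi_mul_e, rep_mul, h]

variable {ρ} in
lemma rep_x_weight {ν : List (Idx ℓ)} {v : V} (h : ρ (QH.e k β ν) v = v) (r : ℕ) :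
    ρ (QH.e k β ν) (ρ (QH.x k β r) v) = ρ (QH.x k β r) v := by
  rw [← rep_mul, ← QH.x_mul_e, rep_mul, h]

variable {ρ} in
/-- A weight vector is zero unless its weight is a word of `β`. -/
lemma length_eq_or_zero {ν : List (Idx ℓ)} {v : V} (h : ρ (QH.e k β ν) v = v) :
    ν.length = β.card ∨ v = 0 := by
  by_cases hν : (ν : RootCone ℓ) = β
  · left; rw [← hν, Multiset.coe_card]
  · right; rw [← h, QH.e_eq_zero hν, map_zero, LinearMap.zero_apply]

variable {ρ} in
lemma IsWeight.psi {v : V} (h : IsWeight ρ v) (i : ℕ) : IsWeight ρ (ρ (QH.psi k β i) v) := by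
  obtain ⟨ν, h⟩ := h
  rcases length_eq_or_zero h with hl | rfl
  · rcases Nat.lt_or_ge (i + 1) ν.length with hi | hi
    · obtain ⟨μ, a, b, ρ', rfl, rfl⟩ := exists_split ν i hi
      exact ⟨_, rep_psi_weight h⟩
    · exact ⟨ν, by rw [QH.psi_eq_zero (by omega)]; simp⟩
  · exact ⟨ν, by simp⟩

variable {ρ} in
lemma IsWeight.psiWord {v : V} (h : IsWeight ρ v) (w : List ℕ) :
    IsWeight ρ (ρ (QH.psiWord k β w) v) := by
  induction w with
  | nil => simpa [QH.psiWord_nil] using h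
  | cons i w ih => rw [QH.psiWord_cons, rep_mul]; exact ih.psi i

-- On a weight vector the correction term in the commutation of x and ψ is a scalar, so an x passes
-- a ψ at the cost of a shorter product. The index r' stays existential, since only lengths matter
-- later.
variable {ρ} in
lemma x_psi_weight {v : V} (h : IsWeight ρ v) (r i : ℕ) :
    ∃ (r' : ℕ) (c : k), ρ (QH.x k β r) (ρ (QH.psi k β i) v) =
      ρ (QH.psi k β i) (ρ (QH.x k β r') v) + c • v := by
  by_cases hr : r = i ∨ r = i + 1
  · obtain ⟨ν, h⟩ := h
    rcases length_eq_or_zero h with hl | rfl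
    · rcases Nat.lt_or_ge (i + 1) ν.length with hi | hi
      · obtain ⟨μ, a, b, ρ', rfl, rfl⟩ := exists_split ν i hi
        rcases hr with rfl | rfl
        · refine ⟨μ.length + 1, if a = b then -1 else 0, ?_⟩
          have := congrArg (fun z => ρ z v) (QH.x_mul_psi (k := k) (β := β) μ ρ' a b)
          simp only [rep_mul, h] at this
          rw [this]
          split_ifs <;> simp [sub_eq_add_neg]
        · refine ⟨μ.length, if a = b then 1 else 0, ?_⟩
          have := congrArg (fun z => ρ z v) (QH.x_mul_psi' (k := k) (β := β) μ ρ' a b)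
          simp only [rep_mul, h] at this
          rw [this]
          split_ifs <;> simp
      · exact ⟨0, 0, by rw [QH.psi_eq_zero (by omega)]; simp⟩
    · exact ⟨0, 0, by simp⟩
  · push Not at hr
    exact ⟨r, 0, by rw [← rep_mul, ← QH.psi_mul_x hr.1 hr.2, rep_mul]; simp⟩

/-- The span of the `ψ_w m` for words `w` of length at most `n`. -/
def filt (n : ℕ) : Submodule k V :=
  Submodule.span k {v | ∃ w : List ℕ, w.length ≤ n ∧ v = ρ (QH.psiWord k β w) m}

variable {ρ m}

lemma psiWord_mem_filt {w : List ℕ} {n : ℕ} (h : w.length ≤ n) :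
    ρ (QH.psiWord k β w) m ∈ filt ρ m n := Submodule.subset_span ⟨w, h, rfl⟩

lemma self_mem_filt (n : ℕ) : m ∈ filt ρ m n := by
  have := psiWord_mem_filt (ρ := ρ) (m := m) (w := []) (n := n) (Nat.zero_le _)
  simpa [QH.psiWord_nil] using this

lemma filt_mono {n n' : ℕ} (h : n ≤ n') : filt ρ m n ≤ filt ρ m n' :=
  Submodule.span_mono fun _ ⟨w, hw, hv⟩ => ⟨w, hw.trans h, hv⟩

lemma filt_le {n : ℕ} {W : Submodule k V}
    (h : ∀ w : List ℕ, w.length ≤ n → ρ (QH.psiWord k β w) m ∈ W) : filt ρ m n ≤ W :=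
  Submodule.span_le.2 fun _ ⟨w, hw, hv⟩ => hv ▸ h w hw

lemma psi_mem_filt {v : V} {n : ℕ} (h : v ∈ filt ρ m n) (i : ℕ) :
    ρ (QH.psi k β i) v ∈ filt ρ m (n + 1) := by
  have : filt ρ m n ≤ (filt ρ m (n + 1)).comap (ρ (QH.psi k β i)) := filt_le fun w hw => by
    rw [Submodule.mem_comap, ← rep_mul, ← QH.psiWord_cons]
    exact psiWord_mem_filt (by simpa using hw)
  exact this h

lemma psiWord_filt_mem {v : V} {n : ℕ} (h : v ∈ filt ρ m n) (w : List ℕ) {n' : ℕ}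
    (hn : w.length + n ≤ n') : ρ (QH.psiWord k β w) v ∈ filt ρ m n' := by
  refine filt_mono hn ?_
  clear hn
  induction w with
  | nil => simpa [QH.psiWord_nil] using h
  | cons i w ih =>
    rw [QH.psiWord_cons, rep_mul, List.length_cons, Nat.add_right_comm]
    exact psi_mem_filt ih i

variable (ρ m) in
/-- A weight vector that is an eigenvector of the `x`'s. -/
structure IsEigen : Prop where
  weight : IsWeight ρ m
  x : ∀ r, ∃ c : k, ρ (QH.x k β r) m = c • m

/-- Pushing x_r to the right through the ψ's only creates shorter products, and in the end some x
acts on m by a scalar. -/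
lemma IsEigen.x_mem_filt (hm : IsEigen ρ m) {v : V} {n : ℕ} (h : v ∈ filt ρ m n) (r : ℕ) :
    ρ (QH.x k β r) v ∈ filt ρ m n := by
  have key : ∀ (w : List ℕ) (r : ℕ), ρ (QH.x k β r) (ρ (QH.psiWord k β w) m) ∈
      filt ρ m w.length := by
    intro w
    induction w with
    | nil =>
      intro r
      obtain ⟨c, hc⟩ := hm.x r
      simp only [QH.psiWord_nil, map_one, Module.End.one_apply, hc]
      exact Submodule.smul_mem _ _ (self_mem_filt _)
    | cons i w ih =>
      intro r
      obtain ⟨r', c, h⟩ := x_psi_weight (hm.weight.psiWord w) r i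
      rw [QH.psiWord_cons, rep_mul, h]
      exact Submodule.add_mem _ (psi_mem_filt (ih r') i)
        (Submodule.smul_mem _ _ (psiWord_mem_filt (by simp)))
  have : filt ρ m n ≤ (filt ρ m n).comap (ρ (QH.x k β r)) :=
    filt_le fun w hw => filt_mono hw (key w r)
  exact this h

/-- The elements that stabilise a subspace. -/
def stabiliser (ρ : QH k β →ₐ[k] Module.End k V) (W : Submodule k V) : Subring (QH k β) where
  carrier := {a | ∀ v ∈ W, ρ a v ∈ W}
  mul_mem' ha hb v hv := by rw [rep_mul]; exact ha _ (hb _ hv)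
  one_mem' v hv := by simpa using hv
  add_mem' ha hb v hv := by
    rw [map_add, LinearMap.add_apply]; exact W.add_mem (ha _ hv) (hb _ hv)
  zero_mem' v _ := by simp
  neg_mem' ha v hv := by rw [map_neg, LinearMap.neg_apply]; exact W.neg_mem (ha _ hv)

/-- On a weight vector ψ² is a polynomial in the x's, and these stabilise the filtration. So a
repeated letter gains two steps. -/
lemma IsEigen.psi_sq_mem (hm : IsEigen ρ m) {v : V} {n : ℕ} (h : v ∈ filt ρ m n)
    (hw : IsWeight ρ v) (i : ℕ) : ρ (QH.psi k β i) (ρ (QH.psi k β i) v) ∈ filt ρ m n := by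
  obtain ⟨ν, hν⟩ := hw
  rcases length_eq_or_zero hν with hl | rfl
  · rcases Nat.lt_or_ge (i + 1) ν.length with hi | hi
    · obtain ⟨μ, a, b, ρ', rfl, rfl⟩ := exists_split ν i hi
      have := congrArg (fun z => ρ z v) (QH.psi_mul_self (k := k) (β := β) μ ρ' a b)
      simp only [rep_mul, hν] at this
      rw [this]
      exact qEval_mem (stabiliser ρ (filt ρ m n)) a b (fun v hv => hm.x_mem_filt hv _)
        (fun v hv => hm.x_mem_filt hv _) v h
    · rw [QH.psi_eq_zero (by omega)]; simp
  · simp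

/-- The defect of the braid relation is 0 or a polynomial in the x's, so a braid move changes ψ_w m
only by terms with three letters fewer. -/
lemma IsEigen.braid_mem (hm : IsEigen ρ m) {v : V} {n : ℕ} (h : v ∈ filt ρ m n)
    (hw : IsWeight ρ v) (i : ℕ) :
    ρ (QH.psi k β (i + 1)) (ρ (QH.psi k β i) (ρ (QH.psi k β (i + 1)) v)) -
      ρ (QH.psi k β i) (ρ (QH.psi k β (i + 1)) (ρ (QH.psi k β i) v)) ∈ filt ρ m n := by
  obtain ⟨ν, hν⟩ := hw
  rcases length_eq_or_zero hν with hl | rfl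
  · rcases Nat.lt_or_ge (i + 2) ν.length with hi | hi
    · obtain ⟨μ, a, b, c, ρ', rfl, rfl⟩ := exists_split₃ ν i hi
      have := congrArg (fun z => ρ z v) (QH.braid (k := k) (β := β) μ ρ' a b c)
      simp only [rep_mul, hν, map_sub, LinearMap.sub_apply] at this
      rw [this]
      split_ifs
      · exact qDivDiff_mem (stabiliser ρ (filt ρ m n)) a b (fun v hv => hm.x_mem_filt hv _)
          (fun v hv => hm.x_mem_filt hv _) (fun v hv => hm.x_mem_filt hv _) v h
      · simp
    · rw [QH.psi_eq_zero (r := i + 1) (by omega)]; simp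
  · simp

lemma IsEigen.sub_mem_of_step (hm : IsEigen ρ m) {w w' : List ℕ} (h : Step w w') {N : ℕ}
    (hN : w.length ≤ N + 1) :
    ρ (QH.psiWord k β w) m - ρ (QH.psiWord k β w') m ∈ filt ρ m N := by
  cases h with
  | comm u v i j h =>
    have : QH.psiWord k β (u ++ i :: j :: v) = QH.psiWord k β (u ++ j :: i :: v) := by
      simp only [QH.psiWord_append, QH.psiWord_cons, ← mul_assoc]
      rw [mul_assoc _ (QH.psi k β i), QH.psi_mul_psi h, ← mul_assoc]
    rw [this, sub_self]
    exact zero_mem _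
  | braid u v i =>
    simp only [QH.psiWord_append, QH.psiWord_cons, rep_mul]
    rw [← map_sub]
    refine psiWord_filt_mem (hm.braid_mem (psiWord_mem_filt le_rfl) (hm.weight.psiWord v) i) u ?_
    simp at hN; omega

lemma IsEigen.sub_mem_of_weq (hm : IsEigen ρ m) {w w' : List ℕ} (h : w ≈ᵇ w') {N : ℕ}
    (hN : w.length ≤ N + 1) :
    ρ (QH.psiWord k β w) m - ρ (QH.psiWord k β w') m ∈ filt ρ m N := by
  induction h with
  | rel _ _ h => exact hm.sub_mem_of_step h hN
  | refl _ => rw [sub_self]; exact zero_mem _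
  | symm a b h ih =>
    rw [← neg_sub]
    exact neg_mem (ih (by rw [WEq.length_eq h]; exact hN))
  | trans a b c h h' ih ih' =>
    rw [← sub_add_sub_cancel]
    exact add_mem (ih hN) (ih' (by rw [← WEq.length_eq h]; exact hN))

lemma IsEigen.mem_of_drop (hm : IsEigen ρ m) {w : List ℕ} (h : Drop w) {N : ℕ}
    (hN : w.length ≤ N + 1) : ρ (QH.psiWord k β w) m ∈ filt ρ m N := by
  obtain ⟨u, s, v, h⟩ := h
  have h1 := hm.sub_mem_of_weq h hN
  have hl := h.length_eq
  rw [← sub_add_cancel (ρ (QH.psiWord k β w) m) (ρ (QH.psiWord k β (u ++ s :: s :: v)) m)]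
  refine add_mem h1 ?_
  simp only [QH.psiWord_append, QH.psiWord_cons, rep_mul]
  refine psiWord_filt_mem (hm.psi_sq_mem (psiWord_mem_filt le_rfl) (hm.weight.psiWord v) s) u ?_
  simp at hl; omega

/-- Modulo shorter words, `ψ_w m` depends on the permutation of `w` only. -/
lemma IsEigen.sub_mem_of_wordPerm_eq (hm : IsEigen ρ m) {n : ℕ} {w w' : List ℕ}
    (hw : ∀ i ∈ w, i + 1 < n) (hw' : ∀ i ∈ w', i + 1 < n) (hp : wordPerm n w = wordPerm n w')
    {N : ℕ} (hN : w.length ≤ N + 1) (hN' : w'.length ≤ N + 1) :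
    ρ (QH.psiWord k β w) m - ρ (QH.psiWord k β w') m ∈ filt ρ m N := by
  rcases lt_trichotomy w.length w'.length with h | h | h
  · exact sub_mem (psiWord_mem_filt (by omega))
      (hm.mem_of_drop (drop_of_lt hw' hw hp.symm h) hN')
  · rcases weq_or_drop hw hw' hp h with h | h
    · exact hm.sub_mem_of_weq h hN
    · exact sub_mem (hm.mem_of_drop h.1 hN) (hm.mem_of_drop h.2 hN')
  · exact sub_mem (hm.mem_of_drop (drop_of_lt hw hw' hp h) hN) (psiWord_mem_filt (by omega))

lemma psiWord_eq_zero_or (w : List ℕ) :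
    QH.psiWord k β w = 0 ∨ ∀ i ∈ w, i + 1 < β.card := by
  by_cases h : ∃ i ∈ w, β.card ≤ i + 1
  · exact Or.inl (QH.psiWord_eq_zero h)
  · push Not at h; exact Or.inr h

/-- The cyclic submodule generated by an eigenvector is exhausted by its filtration. -/
lemma IsEigen.exists_mem_filt (hm : IsEigen ρ m) (a : QH k β) : ∃ n, ρ a m ∈ filt ρ m n := by
  have key : ∀ v, (∃ n, v ∈ filt ρ m n) → ∃ n, ρ a v ∈ filt ρ m n := by
    induction a using QH.induction with
    | hgen s =>
      rintro v ⟨n, hv⟩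
      cases s with
      | e ν =>
        refine ⟨n, ?_⟩
        have : filt ρ m n ≤ (filt ρ m n).comap (ρ (QH.e k β ν)) := filt_le fun w hw => by
          obtain ⟨ν', h⟩ := hm.weight.psiWord w
          rw [Submodule.mem_comap]
          by_cases hν : ν = ν'
          · rw [hν, h]; exact psiWord_mem_filt hw
          · rw [rep_e_of_ne h hν]; exact zero_mem _
        exact this hv
      | x r => exact ⟨n, hm.x_mem_filt hv r⟩
      | psi r => exact ⟨n + 1, psi_mem_filt hv r⟩
    | hc c =>
      rintro v ⟨n, hv⟩
      exact ⟨n, by rw [AlgHom.commutes, Module.algebraMap_end_apply]; exact Submodule.smul_mem _ _ hv⟩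
    | hadd a b ha hb =>
      intro v hv
      obtain ⟨n, h⟩ := ha v hv
      obtain ⟨n', h'⟩ := hb v hv
      refine ⟨max n n', ?_⟩
      rw [map_add, LinearMap.add_apply]
      exact add_mem (filt_mono (le_max_left _ _) h) (filt_mono (le_max_right _ _) h')
    | hmul a b ha hb =>
      intro v hv
      rw [rep_mul]
      exact ha _ (hb v hv)
  exact key m ⟨0, self_mem_filt 0⟩

/-- In a module generated by an eigenvector that is killed by all but one of the `ψ`'s, the
Grassmannian words suffice. -/
lemma IsEigen.grassmann_dichotomy (hm : IsEigen ρ m) {l₂ l₁ : ℕ} (hβ : β.card = l₂ + l₁)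
    (hψ : ∀ i, i + 1 ≠ l₂ → ρ (QH.psi k β i) m = 0) (w : List ℕ) :
    (∃ es, GrassmannCode l₂ l₁ es ∧ w ≈ᵇ nf 0 es) ∨
      ∃ N, w.length = N + 1 ∧ ρ (QH.psiWord k β w) m ∈ filt ρ m N := by
  rcases psiWord_eq_zero_or (k := k) (β := β) w with h0 | hw
  -- The empty word is split off, since there is nothing shorter below it; it is Grassmannian
  -- itself.
  · rcases w with _ | ⟨i, w⟩
    · exact Or.inl ⟨List.replicate l₂ 0, ⟨by simp, List.pairwise_replicate.2 (Or.inr le_rfl),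
        fun e he => by rw [List.eq_of_mem_replicate he]; omega⟩, by
          rw [nf_replicate_zero]; exact WEq.refl _⟩
    · exact Or.inr ⟨w.length, rfl, by rw [h0]; simp⟩
  · rw [hβ] at hw
    rcases nf_or_drop _ w hw with ⟨es, hv, hl, he⟩ | hd
    · rcases grassmann_or_descent l₂ l₁ hv hl with ⟨es', h1, h2⟩ | ⟨u, i, h1, h2, h3⟩
      · exact Or.inl ⟨es', h1, h2 ▸ he⟩
      · have h4 := he.trans h3
        have h5 := h4.length_eq
        rw [List.length_append, List.length_singleton] at h5
        refine Or.inr ⟨u.length, h5, ?_⟩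
        have h6 := hm.sub_mem_of_weq h4 h5.le
        rwa [QH.psiWord_append, QH.psiWord_singleton, rep_mul, hψ i h1, map_zero, sub_zero] at h6
    · obtain ⟨u, s, v, h⟩ := id hd
      have hl := h.length_eq
      simp only [List.length_append, List.length_cons] at hl
      exact Or.inr ⟨w.length - 1, by omega, hm.mem_of_drop hd (by omega)⟩

/-- Iterates the dichotomy: up to shorter words, every word is Grassmannian or gives a combination
of shorter ones. -/
lemma IsEigen.filt_le_grassmann (hm : IsEigen ρ m) {l₂ l₁ : ℕ} (hβ : β.card = l₂ + l₁)
    (hψ : ∀ i, i + 1 ≠ l₂ → ρ (QH.psi k β i) m = 0) (n : ℕ) :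
    filt ρ m n ≤ Submodule.span k
      {v | ∃ es, GrassmannCode l₂ l₁ es ∧ es.sum ≤ n ∧ v = ρ (QH.psiWord k β (nf 0 es)) m} := by
  induction n using Nat.strong_induction_on with
  | _ n ih =>
    refine filt_le fun w hw => ?_
    have hlow : ∀ N, N < n → filt ρ m N ≤ Submodule.span k
        {v | ∃ es, GrassmannCode l₂ l₁ es ∧ es.sum ≤ n ∧
          v = ρ (QH.psiWord k β (nf 0 es)) m} := fun N hN =>
      (ih N hN).trans (Submodule.span_mono fun v ⟨es, h1, h2, h3⟩ => ⟨es, h1, by omega, h3⟩)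
    rcases hm.grassmann_dichotomy hβ hψ w with ⟨es, h1, h2⟩ | ⟨N, h1, h2⟩
    · have hl := h2.length_eq
      rw [length_nf] at hl
      have h3 : ρ (QH.psiWord k β (nf 0 es)) m ∈ Submodule.span k
          {v | ∃ es, GrassmannCode l₂ l₁ es ∧ es.sum ≤ n ∧
            v = ρ (QH.psiWord k β (nf 0 es)) m} :=
        Submodule.subset_span ⟨es, h1, by omega, rfl⟩
      rcases Nat.eq_zero_or_pos w.length with h0 | h0
      · have e1 : w = [] := List.length_eq_zero_iff.1 h0
        have e2 : nf 0 es = [] := List.length_eq_zero_iff.1 (by rw [length_nf]; omega)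
        rw [e1, ← e2]; exact h3
      · rw [← sub_add_cancel (ρ (QH.psiWord k β w) m) (ρ (QH.psiWord k β (nf 0 es)) m)]
        exact add_mem (hlow (w.length - 1) (by omega) (hm.sub_mem_of_weq h2 (by omega))) h3
    · exact hlow N (by omega) h2

end Rep

/-! ### Modules with a basis of arrangements of strands -/

lemma exists_split_map {α γ : Type*} {f : α → γ} {L : List α} {μ ρ : List γ} {i j : γ}
    (h : L.map f = μ ++ i :: j :: ρ) :
    ∃ μ' c d ρ', L = μ' ++ c :: d :: ρ' ∧ μ'.length = μ.length ∧ f c = i ∧ f d = j ∧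
      μ'.map f = μ ∧ ρ'.map f = ρ := by
  obtain ⟨μ', L', rfl, hμ, h⟩ := List.map_eq_append_iff.1 h
  obtain ⟨c, L'', rfl, hc, h⟩ := List.map_eq_cons_iff.1 h
  obtain ⟨d, ρ', rfl, hd, hρ⟩ := List.map_eq_cons_iff.1 h
  exact ⟨μ', c, d, ρ', rfl, by simp [← hμ], hc, hd, hμ, hρ⟩

lemma qEval_comm {ℓ : ℕ∞} {F : Type*} [CommRing F] (i j : Idx ℓ) (u v : F) :
    qEval i j u v = qEval j i v u := by
  unfold qEval qExponents
  split_ifs <;> first | omega | (simp; try ring)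

lemma qDivDiff_mul {ℓ : ℕ∞} {F : Type*} [CommRing F] (i j : Idx ℓ) (u v w : F) :
    qDivDiff i j u v w * (u - w) = qEval i j u v - qEval i j w v := by
  unfold qDivDiff qEval
  induction qExponents i j with
  | nil => simp
  | cons a l ih =>
    simp only [List.map_cons, List.sum_cons, add_mul, ih]
    have := Commute.geom_sum₂_mul (Commute.all u w) a.1
    linear_combination v ^ a.2 * this

/-- Eigenvectors of two operators are eigenvectors of their polynomials. -/
lemma qEval_end {ℓ : ℕ∞} {F V : Type*} [CommRing F] [AddCommGroup V] [Module F V] (i j : Idx ℓ)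
    {X Y : Module.End F V} {a b : F} {v : V} (hX : X v = a • v) (hY : Y v = b • v) :
    qEval i j X Y v = qEval i j a b • v := by
  have hpow : ∀ (Z : Module.End F V) (c : F), Z v = c • v → ∀ n, (Z ^ n) v = c ^ n • v := by
    intro Z c hZ n
    induction n with
    | zero => simp
    | succ n ih => rw [pow_succ, Module.End.mul_apply, hZ, map_smul, ih, smul_smul, pow_succ,
        mul_comm]
  unfold qEval
  induction qExponents i j with
  | nil => simp
  | cons m l ih =>
    simp only [List.map_cons, List.sum_cons, LinearMap.add_apply, ih, add_smul,
      Module.End.mul_apply, hpow Y b hY, map_smul, hpow X a hX, smul_smul, mul_comm]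

lemma qDivDiff_end {ℓ : ℕ∞} {F V : Type*} [CommRing F] [AddCommGroup V] [Module F V]
    (i j : Idx ℓ) {X Y Z : Module.End F V} {a b c : F} {v : V} (hX : X v = a • v)
    (hY : Y v = b • v) (hZ : Z v = c • v) :
    qDivDiff i j X Y Z v = qDivDiff i j a b c • v := by
  have hpow : ∀ (Z : Module.End F V) (c : F), Z v = c • v → ∀ n, (Z ^ n) v = c ^ n • v := by
    intro Z c hZ n
    induction n with
    | zero => simp
    | succ n ih => rw [pow_succ, Module.End.mul_apply, hZ, map_smul, ih, smul_smul, pow_succ,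
        mul_comm]
  unfold qDivDiff
  induction qExponents i j with
  | nil => simp
  | cons m l ih =>
    simp only [List.map_cons, List.sum_cons, LinearMap.add_apply, ih, add_smul,
      Module.End.mul_apply, LinearMap.sum_apply, hpow Y b hY, map_smul, hpow X a hX,
      hpow Z c hZ, smul_smul, ← Finset.sum_smul]
    congr 2
    rw [mul_comm]
    congr 1
    exact Finset.sum_congr rfl fun s _ => mul_comm _ _

/-- Here p, q, r stand for β_cd, β_de, β_ce, and the six vectors for the six orders of three
neighbouring strands c, d, e, the order cde being v₁. All terms off the diagonal cancel, because
products of two of the β's vanish. -/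
lemma braid_identity {F V : Type*} [CommRing F] [AddCommGroup V] [Module F V]
    {p q r a a' b b' c : F} (z1 : p * q = 0) (z2 : p * r = 0) (z3 : r * q = 0)
    (v₁ v₂ v₃ v₄ v₅ v₆ : V) :
    b • (c • (a • v₆ + p • v₅) + r • (b' • v₁ + -q • v₂)) +
        q • (a • (c • v₄ + r • v₃) + p • (b • v₂ + q • v₁)) -
      (a • (c • (b • v₆ + q • v₄) + r • (a' • v₁ + -p • v₃)) +
        p • (b • (c • v₅ + r • v₂) + q • (a • v₃ + p • v₁))) =
      (r * (b * b' + q ^ 2 - (a * a' + p ^ 2))) • v₁ := by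
  match_scalars
  · ring
  · ring
  · linear_combination (q - p) * z1 - q * z3 + p * z2
  · linear_combination b * (z1 - z2 - z3)
  · ring
  · linear_combination a * (z3 + z2 - z1)

/-- Colours `col`, eigenvalues `ξ` and coefficients `α`, `β` that define a module over `R(γ)` with a
basis indexed by a set `X` of arrangements of strands. -/
structure StrandData {ℓ : ℕ∞} (γ : RootCone ℓ) {F : Type u} [CommRing F] (col : ℕ → Idx ℓ)
    (ξ : ℕ → F) (α β : ℕ → ℕ → F) (X : Set (List ℕ)) : Prop where
  word : ∀ L ∈ X, (L.map col : RootCone ℓ) = γ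
  swap_mem : ∀ μ ρ c d, α c d ≠ 0 → (μ ++ c :: d :: ρ ∈ X ↔ μ ++ d :: c :: ρ ∈ X)
  antisymm : ∀ c d, β d c = -β c d
  -- For ψ²: by antisymmetry of β the two off-diagonal contributions cancel, and this is the
  -- diagonal one.
  sq : ∀ μ ρ c d, μ ++ c :: d :: ρ ∈ X →
    α c d * α d c + β c d ^ 2 = qEval (col c) (col d) (ξ c) (ξ d)
  mul_sub : ∀ μ ρ c d, μ ++ c :: d :: ρ ∈ X →
    β c d * (ξ d - ξ c) = if col c = col d then 1 else 0
  -- Kills the mixed terms of the braid relation.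
  mul_eq_zero : ∀ μ ρ c d e, μ ++ c :: d :: e :: ρ ∈ X →
    β c d * β d e = 0 ∧ β c d * β c e = 0 ∧ β c e * β d e = 0
  eq_zero_of_ne : ∀ c d, col c ≠ col d → β c d = 0
  -- If the outer strands have equal colours, either β_ce inverts the difference of their
  -- eigenvalues and the braid relation holds by division, or both of its sides vanish.
  divDiff : ∀ μ ρ c d e, μ ++ c :: d :: e :: ρ ∈ X → col c = col e →
    β c e * (ξ e - ξ c) = 1 ∨
      β c e = 0 ∧ qDivDiff (col c) (col d) (ξ c) (ξ d) (ξ e) = 0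

namespace StrandData

variable {ℓ : ℕ∞} {γ : RootCone ℓ} {F : Type u} [CommRing F] (col : ℕ → Idx ℓ)
    (ξ : ℕ → F) (α β : ℕ → ℕ → F) (X : Set (List ℕ))

open scoped Classical in
/-- The basis vector of an arrangement (or `0`, if it is not in `X`). -/
noncomputable def vec (F : Type u) [CommRing F] (X : Set (List ℕ)) (L : List ℕ) : X →₀ F :=
  if h : L ∈ X then Finsupp.single ⟨L, h⟩ 1 else 0

lemma vec_of_mem {L : List ℕ} (h : L ∈ X) : vec F X L = Finsupp.single ⟨L, h⟩ 1 := dif_pos h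

lemma vec_of_notMem {L : List ℕ} (h : L ∉ X) : vec F X L = 0 := dif_neg h

/-- The operators by which the generators act. -/
noncomputable def op : Gen ℓ → Module.End F (X →₀ F)
  | .e ν => Finsupp.linearCombination F fun L : X => if L.1.map col = ν then vec F X L.1 else 0
  | .x r => Finsupp.linearCombination F fun L : X => (L.1[r]?.elim 0 ξ : F) • vec F X L.1
  | .psi r => Finsupp.linearCombination F fun L : X =>
      if h : r + 1 < L.1.length then
        α L.1[r] L.1[r + 1] • vec F X (L.1.take r ++ L.1[r + 1] :: L.1[r] :: L.1.drop (r + 2)) +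
          β L.1[r] L.1[r + 1] • vec F X L.1
      else 0

variable {col ξ α β X}

lemma ext_vec {V : Type*} [AddCommGroup V] [Module F V] {f g : (X →₀ F) →ₗ[F] V}
    (h : ∀ L ∈ X, f (vec F X L) = g (vec F X L)) : f = g := by
  refine Finsupp.lhom_ext' fun L => LinearMap.ext_ring ?_
  have := h L.1 L.2
  rwa [vec_of_mem X L.2] at this

lemma op_e (ν : List (Idx ℓ)) (L : List ℕ) :
    op col ξ α β X (.e ν) (vec F X L) = if L.map col = ν then vec F X L else 0 := by
  by_cases h : L ∈ X
  · rw [op, vec_of_mem X h, Finsupp.linearCombination_single, one_smul, vec_of_mem X h]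
  · simp [vec_of_notMem X h]

lemma op_x (r : ℕ) (L : List ℕ) :
    op col ξ α β X (.x r) (vec F X L) = (L[r]?.elim 0 ξ : F) • vec F X L := by
  by_cases h : L ∈ X
  · rw [op, vec_of_mem X h, Finsupp.linearCombination_single, one_smul, vec_of_mem X h]
  · simp [vec_of_notMem X h]

lemma op_psi_out (r : ℕ) (L : List ℕ) (h : L.length ≤ r + 1) :
    op col ξ α β X (.psi r) (vec F X L) = 0 := by
  by_cases hX : L ∈ X
  · rw [op, vec_of_mem X hX, Finsupp.linearCombination_single, one_smul, dif_neg (by simpa using h)]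
  · simp [vec_of_notMem X hX]

variable (D : StrandData γ col ξ α β X)

include D

lemma op_psi (μ ρ : List ℕ) (c d : ℕ) {r : ℕ} (hr : r = μ.length) :
    op col ξ α β X (.psi r) (vec F X (μ ++ c :: d :: ρ)) =
      α c d • vec F X (μ ++ d :: c :: ρ) + β c d • vec F X (μ ++ c :: d :: ρ) := by
  subst hr
  by_cases h : μ ++ c :: d :: ρ ∈ X
  · rw [op, vec_of_mem X h, Finsupp.linearCombination_single, one_smul, dif_pos (by simp)]
    simp [vec_of_mem X h]
  · rw [vec_of_notMem X h, map_zero, smul_zero, add_zero]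
    by_cases hα : α c d = 0
    · rw [hα, zero_smul]
    · rw [vec_of_notMem X fun h' => h ((D.swap_mem μ ρ c d hα).2 h'), smul_zero]

omit D in
lemma op_x_eq {L : List ℕ} {r c : ℕ} (h : L[r]? = some c) :
    op col ξ α β X (.x r) (vec F X L) = ξ c • vec F X L := by
  rw [op_x, h]; rfl

omit D in
lemma mul_e_ext {f g : Module.End F (X →₀ F)} {ν : List (Idx ℓ)}
    (h : ∀ L ∈ X, L.map col = ν → f (vec F X L) = g (vec F X L)) :
    f * op col ξ α β X (.e ν) = g * op col ξ α β X (.e ν) := by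
  refine ext_vec fun L hL => ?_
  rw [Module.End.mul_apply, Module.End.mul_apply, op_e]
  split_ifs with h'
  · exact h L hL h'
  · simp

/-- The left side multiplies an arrangement by β_ce (Q_de − Q_cd). If the outer colours agree, β_ce
either inverts ξ_e − ξ_c, which turns this into the divided difference, or vanishes together with
it. If they differ, β_ce = 0. -/
lemma op_braid (μ ρ : List (Idx ℓ)) (i j l : Idx ℓ) :
    (op col ξ α β X (.psi (μ.length + 1)) * op col ξ α β X (.psi μ.length) *
        op col ξ α β X (.psi (μ.length + 1)) - op col ξ α β X (.psi μ.length) *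
        op col ξ α β X (.psi (μ.length + 1)) * op col ξ α β X (.psi μ.length)) *
        op col ξ α β X (.e (μ ++ i :: j :: l :: ρ)) =
      (if i = l then qDivDiff i j (op col ξ α β X (.x μ.length))
        (op col ξ α β X (.x (μ.length + 1))) (op col ξ α β X (.x (μ.length + 2))) else 0) *
        op col ξ α β X (.e (μ ++ i :: j :: l :: ρ)) := by
  refine mul_e_ext fun L hL hν => ?_
  obtain ⟨μ', c, d, ρ'', rfl, hμ, rfl, rfl, -, hρ⟩ := exists_split_map hν
  obtain ⟨e, ρ', rfl, rfl, -⟩ := List.map_eq_cons_iff.1 hρ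
  rw [← hμ]
  have e1 : ∀ c d e : ℕ, op col ξ α β X (.psi μ'.length) (vec F X (μ' ++ c :: d :: e :: ρ')) =
      α c d • vec F X (μ' ++ d :: c :: e :: ρ') +
        β c d • vec F X (μ' ++ c :: d :: e :: ρ') := fun c d e => D.op_psi μ' _ c d rfl
  have e2 : ∀ c d e : ℕ, op col ξ α β X (.psi (μ'.length + 1))
      (vec F X (μ' ++ c :: d :: e :: ρ')) =
      α d e • vec F X (μ' ++ c :: e :: d :: ρ') +
        β d e • vec F X (μ' ++ c :: d :: e :: ρ') := fun c d e => by
    simpa using D.op_psi (μ' ++ [c]) ρ' d e (by simp)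
  obtain ⟨z1, z2, z3⟩ := D.mul_eq_zero _ _ _ _ _ hL
  have q1 := D.sq _ _ _ _ hL
  have q2 := D.sq (μ' ++ [c]) ρ' d e (by simpa using hL)
  have g0 : (μ' ++ c :: d :: e :: ρ')[μ'.length]? = some c := by simp
  have g1 : (μ' ++ c :: d :: e :: ρ')[μ'.length + 1]? = some d := by simp
  have g2 : (μ' ++ c :: d :: e :: ρ')[μ'.length + 2]? = some e := by simp
  have lhs : (op col ξ α β X (.psi (μ'.length + 1)) * op col ξ α β X (.psi μ'.length) *
      op col ξ α β X (.psi (μ'.length + 1)) - op col ξ α β X (.psi μ'.length) *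
      op col ξ α β X (.psi (μ'.length + 1)) * op col ξ α β X (.psi μ'.length))
      (vec F X (μ' ++ c :: d :: e :: ρ')) =
      (β c e * (qEval (col d) (col e) (ξ d) (ξ e) - qEval (col c) (col d) (ξ c) (ξ d))) •
        vec F X (μ' ++ c :: d :: e :: ρ') := by
    simp only [LinearMap.sub_apply, Module.End.mul_apply, e1, e2, map_add, map_smul,
      D.antisymm c d, D.antisymm d e, ← q1, ← q2]
    exact braid_identity z1 z2 z3 _ _ _ _ _ _
  rw [lhs]
  by_cases hce : col c = col e
  · rw [if_pos hce, qDivDiff_end _ _ (op_x_eq g0) (op_x_eq g1) (op_x_eq g2)]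
    congr 1
    have h3 := qDivDiff_mul (col c) (col d) (ξ c) (ξ d) (ξ e)
    rw [qEval_comm (col d), ← hce]
    rcases D.divDiff _ _ _ _ _ hL hce with h4 | ⟨h4, h5⟩
    · linear_combination (β c e) * h3 + qDivDiff (col c) (col d) (ξ c) (ξ d) (ξ e) * h4
    · rw [h4, h5, zero_mul]
  · rw [if_neg hce, D.eq_zero_of_ne c e hce, zero_mul, zero_smul, LinearMap.zero_apply]

lemma op_rel (a b : Module.End F (X →₀ F)) (h : Rel γ (op col ξ α β X) a b) : a = b := by
  cases h
  case e_zero ν h =>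
    refine ext_vec fun L hL => ?_
    rw [op_e, if_neg fun h' => h (by rw [← h']; exact D.word L hL), LinearMap.zero_apply]
  case x_zero r h =>
    refine ext_vec fun L hL => ?_
    have := congrArg Multiset.card (D.word L hL)
    simp only [Multiset.coe_card, List.length_map] at this
    rw [op_x, List.getElem?_eq_none (by omega)]
    simp
  case psi_zero r h =>
    refine ext_vec fun L hL => ?_
    have := congrArg Multiset.card (D.word L hL)
    simp only [Multiset.coe_card, List.length_map] at this
    rw [op_psi_out r L (by omega), LinearMap.zero_apply]
  case e_mul_self ν =>
    refine ext_vec fun L hL => ?_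
    rw [Module.End.mul_apply, op_e]
    split_ifs with h
    · rw [op_e, if_pos h]
    · simp
  case e_mul ν ν' h =>
    refine ext_vec fun L hL => ?_
    rw [Module.End.mul_apply, op_e]
    split_ifs with h'
    · rw [op_e, if_neg fun h'' => h (h''.symm.trans h'), LinearMap.zero_apply]
    · simp
  case e_sum =>
    refine ext_vec fun L hL => ?_
    have : L.map col ∈ words γ := (mem_words _ _).2 (D.word L hL)
    simp [LinearMap.sum_apply, op_e, this]
  case x_e r ν =>
    refine ext_vec fun L hL => ?_
    simp only [Module.End.mul_apply, op_e, op_x, map_smul]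
    split_ifs <;> simp [op_x]
  case psi_e μ ρ i j =>
    refine ext_vec fun L hL => ?_
    rw [Module.End.mul_apply, Module.End.mul_apply, op_e]
    rcases Nat.lt_or_ge (μ.length + 1) L.length with hl | hl
    · obtain ⟨μ', c, d, ρ', rfl, hμ⟩ := exists_split L _ hl
      rw [D.op_psi μ' ρ' c d hμ.symm, map_add, map_smul, map_smul, op_e, op_e]
      have h1 : (μ' ++ c :: d :: ρ').map col = μ ++ i :: j :: ρ ↔
          (μ' ++ d :: c :: ρ').map col = μ ++ j :: i :: ρ := by
        simp only [List.map_append, List.map_cons]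
        constructor <;> intro h
        · obtain ⟨h1, h2⟩ := List.append_inj h (by simp [hμ])
          simp only [List.cons.injEq] at h2
          rw [h1, h2.1, h2.2.1, h2.2.2]
        · obtain ⟨h1, h2⟩ := List.append_inj h (by simp [hμ])
          simp only [List.cons.injEq] at h2
          rw [h1, h2.1, h2.2.1, h2.2.2]
      -- The diagonal term could spoil the weight, but β vanishes unless the two colours agree, and
      -- then the swap does not change the weight.
      have h2 : β c d • (if (μ' ++ c :: d :: ρ').map col = μ ++ j :: i :: ρ then
          vec F X (μ' ++ c :: d :: ρ') else 0) =
          β c d • if (μ' ++ c :: d :: ρ').map col = μ ++ i :: j :: ρ then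
          vec F X (μ' ++ c :: d :: ρ') else 0 := by
        by_cases hcd : col c = col d
        · congr 2
          rw [h1]
          simp only [List.map_append, List.map_cons, hcd]
        · rw [D.eq_zero_of_ne c d hcd, zero_smul, zero_smul]
      rw [h2]
      by_cases h : (μ' ++ c :: d :: ρ').map col = μ ++ i :: j :: ρ
      · rw [if_pos h, if_pos (h1.1 h), D.op_psi μ' ρ' c d hμ.symm]
      · rw [if_neg h, if_neg (h1.not.1 h)]; simp
    · rw [op_psi_out _ _ hl]
      split_ifs
      · rw [op_psi_out _ _ hl, map_zero]
      · simp
  case x_x r s =>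
    refine ext_vec fun L hL => ?_
    simp only [Module.End.mul_apply, op_x, map_smul, smul_smul, mul_comm]
  case psi_x r s h h' =>
    refine ext_vec fun L hL => ?_
    rw [Module.End.mul_apply, Module.End.mul_apply, op_x, map_smul]
    rcases Nat.lt_or_ge (r + 1) L.length with hl | hl
    · obtain ⟨μ', c, d, ρ', rfl, hμ⟩ := exists_split L _ hl
      rw [D.op_psi μ' ρ' c d hμ.symm, map_add, map_smul, map_smul, op_x, op_x]
      have : (μ' ++ d :: c :: ρ')[s]? = (μ' ++ c :: d :: ρ')[s]? := by
        rcases Nat.lt_or_ge s μ'.length with h1 | h1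
        · rw [List.getElem?_append_left h1, List.getElem?_append_left h1]
        · rw [List.getElem?_append_right h1, List.getElem?_append_right h1]
          obtain ⟨t, ht⟩ : ∃ t, s - μ'.length = t + 2 := ⟨s - μ'.length - 2, by omega⟩
          rw [ht]; simp
      rw [this]
      module
    · rw [op_psi_out _ _ hl]; simp
  case psi_psi r s h =>
    refine ext_vec fun L hL => ?_
    have key : ∀ r s : ℕ, r + 1 < s →
        op col ξ α β X (.psi r) (op col ξ α β X (.psi s) (vec F X L)) =
        op col ξ α β X (.psi s) (op col ξ α β X (.psi r) (vec F X L)) := by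
      intro r s h
      rcases Nat.lt_or_ge (s + 1) L.length with hl | hl
      · obtain ⟨L', c', d', ρ', rfl, hμ'⟩ := exists_split L _ hl
        obtain ⟨μ, c, d, ρ, rfl, hμ⟩ := exists_split L' r (by omega)
        have e1 : ∀ a b a' b', op col ξ α β X (.psi s)
            (vec F X ((μ ++ a :: b :: ρ) ++ a' :: b' :: ρ')) =
            α a' b' • vec F X ((μ ++ a :: b :: ρ) ++ b' :: a' :: ρ') +
              β a' b' • vec F X ((μ ++ a :: b :: ρ) ++ a' :: b' :: ρ') := by
          intro a b a' b'
          exact D.op_psi _ ρ' a' b' (by rw [← hμ']; simp)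
        have e2 : ∀ a b a' b', op col ξ α β X (.psi r)
            (vec F X ((μ ++ a :: b :: ρ) ++ a' :: b' :: ρ')) =
            α a b • vec F X ((μ ++ b :: a :: ρ) ++ a' :: b' :: ρ') +
              β a b • vec F X ((μ ++ a :: b :: ρ) ++ a' :: b' :: ρ') := by
          intro a b a' b'
          simpa using D.op_psi μ (ρ ++ a' :: b' :: ρ') a b hμ.symm
        simp only [e1, e2, map_add, map_smul]
        module
      · rw [op_psi_out _ _ hl, map_zero]
        rcases Nat.lt_or_ge (r + 1) L.length with hl' | hl'
        · obtain ⟨μ, c, d, ρ, rfl, hμ⟩ := exists_split L r hl'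
          rw [D.op_psi μ ρ c d hμ.symm, map_add, map_smul, map_smul,
            op_psi_out _ _ (by simp at hl ⊢; omega), op_psi_out _ _ hl]
          simp
        · rw [op_psi_out _ _ hl', map_zero]
    rw [Module.End.mul_apply, Module.End.mul_apply]
    rcases h with h | h
    · exact key r s h
    · exact (key s r h).symm
  case x_psi μ ρ i j =>
    refine mul_e_ext fun L hL hν => ?_
    obtain ⟨μ', c, d, ρ', rfl, hμ, rfl, rfl, -⟩ := exists_split_map hν
    have h1 := D.mul_sub _ _ _ _ hL
    rw [← hμ]
    have g1 : ∀ c d : ℕ, (μ' ++ c :: d :: ρ')[μ'.length]? = some c := by simp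
    have g2 : ∀ c d : ℕ, (μ' ++ c :: d :: ρ')[μ'.length + 1]? = some d := by simp
    simp only [Module.End.mul_apply, LinearMap.sub_apply, D.op_psi μ' ρ' c d rfl, map_add,
      map_smul, op_x_eq (g1 _ _), op_x_eq (g2 _ _)]
    have h2 : ((if col c = col d then 1 else 0 : Module.End F (X →₀ F)))
        (vec F X (μ' ++ c :: d :: ρ')) = (β c d * (ξ d - ξ c)) • vec F X (μ' ++ c :: d :: ρ') := by
      rw [h1]; split_ifs <;> simp
    rw [h2]
    module
  case x_psi' μ ρ i j =>
    refine mul_e_ext fun L hL hν => ?_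
    obtain ⟨μ', c, d, ρ', rfl, hμ, rfl, rfl, -⟩ := exists_split_map hν
    have h1 := D.mul_sub _ _ _ _ hL
    rw [← hμ]
    have g1 : ∀ c d : ℕ, (μ' ++ c :: d :: ρ')[μ'.length]? = some c := by simp
    have g2 : ∀ c d : ℕ, (μ' ++ c :: d :: ρ')[μ'.length + 1]? = some d := by simp
    simp only [Module.End.mul_apply, LinearMap.add_apply, D.op_psi μ' ρ' c d rfl, map_add,
      map_smul, op_x_eq (g1 _ _), op_x_eq (g2 _ _)]
    have h2 : ((if col c = col d then 1 else 0 : Module.End F (X →₀ F)))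
        (vec F X (μ' ++ c :: d :: ρ')) = (β c d * (ξ d - ξ c)) • vec F X (μ' ++ c :: d :: ρ') := by
      rw [h1]; split_ifs <;> simp
    rw [h2]
    module
  case psi_sq μ ρ i j =>
    refine mul_e_ext fun L hL hν => ?_
    obtain ⟨μ', c, d, ρ', rfl, hμ, rfl, rfl, -⟩ := exists_split_map hν
    have h1 := D.sq _ _ _ _ hL
    rw [← hμ]
    have g1 : ∀ c d : ℕ, (μ' ++ c :: d :: ρ')[μ'.length]? = some c := by simp
    have g2 : ∀ c d : ℕ, (μ' ++ c :: d :: ρ')[μ'.length + 1]? = some d := by simp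
    rw [qEval_end _ _ (op_x_eq (g1 _ _)) (op_x_eq (g2 _ _)), ← h1]
    simp only [Module.End.mul_apply, D.op_psi μ' ρ' _ _ rfl, map_add, map_smul, D.antisymm c d]
    module
  case braid μ ρ i j l =>
    exact D.op_braid μ ρ i j l

end StrandData

section

open LaurentPolynomial

/-! ### Eigenvalues of the x's on the affinisation of a segment -/

section Zeta

variable (ℓ : ℕ∞)

/-- The residue is that of an end of the Dynkin diagram. -/
def IsEnd (b : ℤ) : Prop := (residue ℓ b).1 = 0 ∨ ((residue ℓ b).1 : ℕ∞) = ℓ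

/-- A sign that changes with every step along a segment, ends of the diagram excepted. -/
def segSign (b : ℤ) : ℤ :=
  if (residue ℓ b).1 + 1 = (residue ℓ (b + 1)).1 then (-1) ^ (residue ℓ b).1
  else -(-1) ^ (residue ℓ b).1

open scoped Classical in
/-- The eigenvalues of the `x`'s on the affinisation of a segment module. -/
noncomputable def zeta (b : ℤ) : ℤ[T;T⁻¹] :=
  if IsEnd ℓ b then -T 2 else (segSign ℓ b : ℤ[T;T⁻¹]) * T 1

open scoped Classical in
/-- The inverses of the eigenvalues `zeta`. -/
noncomputable def zetaInv (b : ℤ) : ℤ[T;T⁻¹] :=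
  if IsEnd ℓ b then -T (-2) else (segSign ℓ b : ℤ[T;T⁻¹]) * T (-1)

lemma segSign_sq (b : ℤ) : (segSign ℓ b : ℤ[T;T⁻¹]) * segSign ℓ b = 1 := by
  rw [← Int.cast_mul, ← sq]
  unfold segSign
  split_ifs <;> simp [← pow_mul]

lemma zeta_mul_zetaInv (b : ℤ) : zeta ℓ b * zetaInv ℓ b = 1 := by
  unfold zeta zetaInv
  split_ifs
  · rw [neg_mul_neg, ← T_add]; simp
  · rw [mul_mul_mul_comm, segSign_sq, ← T_add]; simp

/-- The eigenvalues vanish at `T = 0`. -/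
lemma zeta_eq (b : ℤ) : ∃ p : Polynomial ℤ, zeta ℓ b = Polynomial.toLaurent (p * Polynomial.X) := by
  unfold zeta
  split_ifs
  · refine ⟨-Polynomial.X, ?_⟩
    rw [map_mul, map_neg, Polynomial.toLaurent_X, neg_mul, ← T_add]; norm_num
  · exact ⟨(segSign ℓ b : Polynomial ℤ), by simp⟩

variable [Fact (2 ≤ ℓ)]

lemma ends_facts : ((1 : ℕ) : ℕ∞) ≠ ℓ ∧ ∀ i j : Idx ℓ, (i.1 : ℕ∞) = ℓ → i.1 + 1 ≠ j.1 := by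
  constructor
  · rintro rfl
    exact absurd (Fact.out : (2 : ℕ∞) ≤ ((1 : ℕ) : ℕ∞)) (by norm_num)
  · intro i j hi hj
    have h6 : (j.1 : ℕ∞) ≤ (i.1 : ℕ∞) := j.2.trans_eq hi.symm
    have h7 : j.1 ≤ i.1 := by exact_mod_cast h6
    omega

lemma residue_ne_succ (b : ℤ) : residue ℓ b ≠ residue ℓ (b + 1) := by
  intro h
  have := residue_adjacent ℓ b
  rw [← h] at this
  omega

lemma residue_no_turn (b : ℤ) (h : ¬IsEnd ℓ (b + 1)) :
    (residue ℓ b).1 ≠ (residue ℓ (b + 2)).1 := fun h' =>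
  h (residue_turn ℓ b (Subtype.ext h'))

lemma segSign_succ (b : ℤ) (h' : ¬IsEnd ℓ (b + 1)) :
    segSign ℓ (b + 1) = -segSign ℓ b := by
  have h1 := residue_adjacent ℓ b
  have h2 := residue_adjacent ℓ (b + 1)
  have h3 := residue_no_turn ℓ b h'
  rw [show b + 1 + 1 = b + 2 by ring] at h2
  unfold segSign
  rw [show b + 1 + 1 = b + 2 by ring]
  rcases h1 with h1 | h1
  · rw [if_pos h1, if_pos (by omega), ← h1, pow_succ]; ring
  · rw [if_neg (by omega), if_neg (by omega), ← h1, pow_succ]; ring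

lemma segSign_turn (b : ℤ) (h : residue ℓ b = residue ℓ (b + 2)) (hb : ¬IsEnd ℓ b) :
    segSign ℓ (b + 2) = -segSign ℓ b := by
  have h0 : (residue ℓ b).1 = (residue ℓ (b + 2)).1 := by rw [← h]
  have h1 := residue_adjacent ℓ b
  have h2 := residue_adjacent ℓ (b + 2)
  have h3 := residue_no_turn ℓ (b + 1) (by
    rw [show b + 1 + 1 = b + 2 by ring]; unfold IsEnd at hb ⊢; rwa [← h])
  rw [show b + 1 + 2 = b + 2 + 1 by ring] at h3
  unfold segSign
  rw [← h0] at h2 ⊢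
  rcases h1 with h1 | h1
  · have h4 : ¬ (residue ℓ b).1 + 1 = (residue ℓ (b + 2 + 1)).1 := fun h4 => h3 (h1.symm.trans h4)
    rw [if_pos h1, if_neg h4]
  · have h4 : ¬ (residue ℓ b).1 + 1 = (residue ℓ (b + 1)).1 := by omega
    have h5 : (residue ℓ b).1 + 1 = (residue ℓ (b + 2 + 1)).1 :=
      h2.resolve_right fun h5 => h3 (by omega)
    rw [if_neg h4, if_pos h5, neg_neg]

lemma not_isEnd_one {b : ℤ} (h : (residue ℓ b).1 = 1) : ¬IsEnd ℓ b := by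
  have := (ends_facts ℓ).1
  rintro (h' | h')
  · omega
  · rw [h] at h'; exact this h'

/-- The eigenvalues are made for this. If one of the two residues is an end of the diagram, it
contributes −T² and the other one (±T)²; otherwise the two eigenvalues are T and −T. -/
lemma qEval_zeta (b : ℤ) :
    qEval (residue ℓ b) (residue ℓ (b + 1)) (zeta ℓ b) (zeta ℓ (b + 1)) = 0 := by
  have h1 := residue_adjacent ℓ b
  have hsq : ∀ c, ¬IsEnd ℓ c → zeta ℓ c ^ 2 = T 2 := by
    intro c hc
    rw [zeta, if_neg hc, mul_pow, sq, segSign_sq, T_pow]; simp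
  have hE : ∀ c, IsEnd ℓ c → zeta ℓ c = -T 2 := fun c hc => if_pos hc
  have hne := (ends_facts ℓ).2
  unfold qEval qExponents
  rcases h1 with h1 | h1
  · rw [if_neg (by omega), if_pos h1]
    split_ifs with a1 a2
    · have e1 := hE b (Or.inl a1)
      have e2 := hsq (b + 1) (not_isEnd_one ℓ (by omega))
      simp [e1, e2]
    · have e1 := hE (b + 1) (Or.inr a2)
      have e2 := hsq b (by rintro (h | h); exacts [a1 h, hne _ _ h h1])
      simp [e1, e2]
    · have n1 : ¬IsEnd ℓ b := by rintro (h | h); exacts [a1 h, hne _ _ h h1]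
      have n2 : ¬IsEnd ℓ (b + 1) := by rintro (h | h); exacts [by omega, a2 h]
      simp [zeta, n1, n2, segSign_succ ℓ b n2]
  · rw [if_neg (by omega), if_neg (by omega), if_pos h1]
    split_ifs with a1 a2
    · have e1 := hE (b + 1) (Or.inl a1)
      have e2 := hsq b (not_isEnd_one ℓ (by omega))
      simp [e1, e2]
    · have e1 := hE b (Or.inr a2)
      have e2 := hsq (b + 1) (by rintro (h | h); exacts [a1 h, hne _ _ h h1])
      simp [e1, e2]
    · have n1 : ¬IsEnd ℓ b := by rintro (h | h); exacts [by omega, a2 h]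
      have n2 : ¬IsEnd ℓ (b + 1) := by rintro (h | h); exacts [a1 h, hne _ _ h h1]
      simp [zeta, n1, n2, segSign_succ ℓ b n2]

/-- Equal colours at distance two occur only where the segment turns at an end of the diagram. There
the divided difference is the sum of the two outer eigenvalues. Their signs are opposite, since the
segment runs towards the end before the turn and away from it afterwards. -/
lemma qDivDiff_zeta (b : ℤ) (h : residue ℓ b = residue ℓ (b + 2)) :
    qDivDiff (residue ℓ b) (residue ℓ (b + 1)) (zeta ℓ b) (zeta ℓ (b + 1)) (zeta ℓ (b + 2)) = 0 := by
  have h1 := residue_adjacent ℓ b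
  have ht := residue_turn ℓ b h
  have hne := (ends_facts ℓ).2
  have n1 : ¬IsEnd ℓ b := by
    rcases ht with h0 | h0
    · exact not_isEnd_one ℓ (by omega)
    · rcases h1 with h1 | h1
      · rintro (h2 | h2)
        · refine (ends_facts ℓ).1 ?_
          rw [← h1, h2] at h0
          simpa using h0
        · exact hne _ _ h2 h1
      · exact absurd h1 (hne _ _ h0)
  have n2 : ¬IsEnd ℓ (b + 2) := by unfold IsEnd at n1 ⊢; rwa [← h]
  have hsum : zeta ℓ (b + 2) + zeta ℓ b = 0 := by
    simp [zeta, n1, n2, segSign_turn ℓ b h n1]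
  have hsum' : zeta ℓ b + zeta ℓ (b + 2) = 0 := by rw [add_comm, hsum]
  unfold qDivDiff qExponents
  rcases h1 with h1 | h1
  · rw [if_neg (by omega), if_pos h1, if_neg fun h2 => n1 (Or.inl h2), if_pos (by
      rcases ht with h0 | h0
      · omega
      · exact h0)]
    simp [Finset.sum_range_succ, hsum]
  · rw [if_neg (by omega), if_neg (by omega), if_pos h1, if_pos (by
      rcases ht with h0 | h0
      · exact h0
      · exact absurd h1 (hne _ _ h0))]
    simp [Finset.sum_range_succ, hsum]

end Zeta

/-! ### The module of shuffles of two segments -/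

section TwoBlocks

variable (ℓ : ℕ∞) (a : ℤ) (l₁ l₂ : ℕ)

/-- Shuffles of the sequences `0, …, l₁-1` and `l₁, …, l₁+l₂-1`. -/
def shuffles : Set (List ℕ) :=
  {L | L.filter (· < l₁) = List.range l₁ ∧ L.filter (fun c => ¬ c < l₁) = List.range' l₁ l₂}

open scoped Classical in
/-- The eigenvalue of a strand: `0` in the first block, and `zeta` in the second one. -/
noncomputable def blockXi (c : ℕ) : ℤ[T;T⁻¹] := if c < l₁ then 0 else zeta ℓ (a + c)

/-- The colour of a strand. -/
def blockCol (c : ℕ) : Idx ℓ := residue ℓ (a + c)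

open scoped Classical in
/-- The diagonal coefficients of the `ψ`'s. -/
noncomputable def blockBeta (c d : ℕ) : ℤ[T;T⁻¹] :=
  if blockCol ℓ a c = blockCol ℓ a d then
    if c < l₁ ∧ ¬ d < l₁ then zetaInv ℓ (a + d)
    else if ¬ c < l₁ ∧ d < l₁ then -zetaInv ℓ (a + c) else 0
  else 0

open scoped Classical in
/-- The off-diagonal coefficients of the `ψ`'s. -/
noncomputable def blockAlpha (c d : ℕ) : ℤ[T;T⁻¹] :=
  -- The move that undoes an inversion has coefficient 1, and the opposite move gets the whole of Q
  -- − β². So the longest word has leading coefficient 1.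
  if ¬ c < l₁ ∧ d < l₁ then 1
  else if c < l₁ ∧ ¬ d < l₁ then
    qEval (blockCol ℓ a c) (blockCol ℓ a d) 0 (zeta ℓ (a + d)) - blockBeta ℓ a l₁ c d ^ 2
  else 0

variable {l₁ l₂}

lemma range_consecutive {s n : ℕ} {μ ρ : List ℕ} {c d : ℕ} (h : μ ++ c :: d :: ρ = List.range' s n) :
    d = c + 1 := by
  have h1 : (List.range' s n)[μ.length]? = some c := by rw [← h]; simp
  have h2 : (List.range' s n)[μ.length + 1]? = some d := by rw [← h]; simp
  obtain ⟨_, h1⟩ := List.getElem?_eq_some_iff.1 h1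
  obtain ⟨_, h2⟩ := List.getElem?_eq_some_iff.1 h2
  simp only [List.getElem_range'] at h1 h2
  omega

/-- Successive strands of the same block in a shuffle are successive strands of the block. -/
lemma shuffles_succ {μ σ ρ : List ℕ} {c d : ℕ} (h : μ ++ c :: (σ ++ d :: ρ) ∈ shuffles l₁ l₂)
    (hcd : c < l₁ ↔ d < l₁) (hσ : ∀ e ∈ σ, ¬ (e < l₁ ↔ c < l₁)) : d = c + 1 := by
  obtain ⟨h1, h2⟩ := h
  by_cases hc : c < l₁
  · have hd := hcd.1 hc
    have hσ' : σ.filter (fun x => decide (x < l₁)) = [] := by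
      simp only [List.filter_eq_nil_iff, decide_eq_true_eq]
      exact fun e he h => hσ e he (iff_of_true h hc)
    simp only [List.filter_append, List.filter_cons, hc, hd, decide_true, if_true, hσ',
      List.nil_append, List.range_eq_range'] at h1
    exact range_consecutive h1
  · have hd := hcd.not.1 hc
    have hσ' : σ.filter (fun x => decide (¬ x < l₁)) = [] := by
      simp only [List.filter_eq_nil_iff, decide_eq_true_eq]
      exact fun e he h => hσ e he (iff_of_false h hc)
    simp only [List.filter_append, List.filter_cons, hc, hd, not_false_eq_true, decide_true,
      if_true, hσ', List.nil_append] at h2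
    exact range_consecutive h2

lemma shuffles_perm {L : List ℕ} (h : L ∈ shuffles l₁ l₂) : L.Perm (List.range (l₁ + l₂)) := by
  have h1 := List.filter_append_perm (fun c => decide (c < l₁)) L
  have h2 : L.filter (fun x => !decide (x < l₁)) = List.range' l₁ l₂ := by
    rw [← h.2]
    congr 1
    ext x
    by_cases hx : x < l₁ <;> simp [hx]
  rw [h.1, h2, List.range_eq_range'] at h1
  rw [List.range_eq_range']
  have h3 : List.range' 0 l₁ ++ List.range' l₁ l₂ = List.range' 0 (l₁ + l₂) := by
    have := List.range'_append_1 (s := 0) (m := l₁) (n := l₂)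
    simpa using this
  rw [← h3]
  exact h1.symm

lemma blockBeta_antisymm (c d : ℕ) : blockBeta ℓ a l₁ d c = -blockBeta ℓ a l₁ c d := by
  unfold blockBeta
  by_cases h : blockCol ℓ a c = blockCol ℓ a d
  · rw [if_pos h, if_pos h.symm]
    by_cases hc : c < l₁ <;> by_cases hd : d < l₁ <;> simp [hc, hd]
  · rw [if_neg h, if_neg (Ne.symm h), neg_zero]

lemma blockBeta_same {c d : ℕ} (h : c < l₁ ↔ d < l₁) : blockBeta ℓ a l₁ c d = 0 := by
  unfold blockBeta
  by_cases hc : c < l₁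
  · simp [hc, h.1 hc]
  · simp [hc, h.not.1 hc]

lemma blockBeta_mul (c d : ℕ) (h : ¬ (c < l₁ ↔ d < l₁)) (hcol : blockCol ℓ a c = blockCol ℓ a d) :
    blockBeta ℓ a l₁ c d * (blockXi ℓ a l₁ d - blockXi ℓ a l₁ c) = 1 := by
  unfold blockBeta blockXi
  rw [if_pos hcol]
  by_cases hc : c < l₁ <;> by_cases hd : d < l₁
  · exact absurd (iff_of_true hc hd) h
  · simp only [hc, hd, if_true, if_false, not_false_eq_true, and_self, sub_zero]
    rw [mul_comm, zeta_mul_zetaInv]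
  · simp only [hc, hd, if_true, if_false, not_false_eq_true, and_self, zero_sub, not_true]
    rw [neg_mul_neg, mul_comm, zeta_mul_zetaInv]
  · exact absurd (iff_of_false hc hd) h

lemma blockAlpha_mul (c d : ℕ) (h : ¬ (c < l₁ ↔ d < l₁)) :
    blockAlpha ℓ a l₁ c d * blockAlpha ℓ a l₁ d c + blockBeta ℓ a l₁ c d ^ 2 =
      qEval (blockCol ℓ a c) (blockCol ℓ a d) (blockXi ℓ a l₁ c) (blockXi ℓ a l₁ d) := by
  have hb := blockBeta_antisymm ℓ a (l₁ := l₁) c d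
  unfold blockAlpha blockXi
  by_cases hc : c < l₁ <;> by_cases hd : d < l₁
  · exact absurd (iff_of_true hc hd) h
  · simp [hc, hd]
  · simp only [hc, hd, not_false_eq_true, and_self, not_true, if_true, if_false, hb]
    rw [qEval_comm (blockCol ℓ a c)]
    ring
  · exact absurd (iff_of_false hc hd) h

variable [Fact (2 ≤ ℓ)]

lemma blockCol_ne_succ (c : ℕ) : blockCol ℓ a c ≠ blockCol ℓ a (c + 1) := by
  have := residue_ne_succ ℓ (a + c)
  unfold blockCol
  push_cast
  rwa [← add_assoc]

lemma blockXi_succ (c : ℕ) (h : c < l₁ ↔ c + 1 < l₁) :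
    qEval (blockCol ℓ a c) (blockCol ℓ a (c + 1)) (blockXi ℓ a l₁ c) (blockXi ℓ a l₁ (c + 1)) =
      0 := by
  unfold blockCol blockXi
  push_cast
  rw [← add_assoc]
  by_cases hc : c < l₁
  · rw [if_pos hc, if_pos (h.1 hc)]
    exact qEval_zero ℓ _
  · rw [if_neg hc, if_neg (h.not.1 hc)]
    exact qEval_zeta ℓ _

/-- Neighbours from the same block are successive strands of a segment, so their colours differ and
Q vanishes at their eigenvalues. Strands from different blocks have the eigenvalues 0 and ζ, whose
difference is a unit, so that β can be the inverse of the difference when the colours agree. -/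
lemma strandData : StrandData (segRoot ℓ a (l₁ + l₂)) (blockCol ℓ a) (blockXi ℓ a l₁)
    (blockAlpha ℓ a l₁) (blockBeta ℓ a l₁) (shuffles l₁ l₂) where
  word L hL := by
    rw [segRoot, segWord]
    exact Multiset.coe_eq_coe.2 ((shuffles_perm hL).map _)
  swap_mem μ ρ c d h := by
    have h' : ¬ (c < l₁ ↔ d < l₁) := fun h' => h (by
      unfold blockAlpha
      by_cases hc : c < l₁
      · simp [hc, h'.1 hc]
      · simp [hc, h'.not.1 hc])
    unfold shuffles
    by_cases hc : c < l₁ <;> by_cases hd : d < l₁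
    · exact absurd (iff_of_true hc hd) h'
    · simp [List.filter_cons, hc, hd]
    · simp [List.filter_cons, hc, hd]
    · exact absurd (iff_of_false hc hd) h'
  antisymm := blockBeta_antisymm ℓ a
  sq μ ρ c d h := by
    by_cases hcd : c < l₁ ↔ d < l₁
    · obtain rfl := shuffles_succ (σ := []) h hcd (by simp)
      rw [blockXi_succ ℓ a c hcd, blockBeta_same ℓ a hcd]
      unfold blockAlpha
      by_cases hc : c < l₁
      · simp [hc, hcd.1 hc]
      · simp [hc, hcd.not.1 hc]
    · exact blockAlpha_mul ℓ a c d hcd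
  mul_sub μ ρ c d h := by
    by_cases hcd : c < l₁ ↔ d < l₁
    · obtain rfl := shuffles_succ (σ := []) h hcd (by simp)
      rw [if_neg (blockCol_ne_succ ℓ a c), blockBeta_same ℓ a hcd, zero_mul]
    · by_cases hcol : blockCol ℓ a c = blockCol ℓ a d
      · rw [if_pos hcol, blockBeta_mul ℓ a c d hcd hcol]
      · rw [if_neg hcol]
        unfold blockBeta
        rw [if_neg hcol, zero_mul]
  -- Two nonzero factors would produce two strands of one block that have the same colour and are
  -- successive in the block, contrary to `blockCol_ne_succ`.
  mul_eq_zero μ ρ c d e h := by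
    have hβ : ∀ c d, blockBeta ℓ a l₁ c d ≠ 0 →
        ¬ (c < l₁ ↔ d < l₁) ∧ blockCol ℓ a c = blockCol ℓ a d := by
      intro c d h
      refine ⟨fun h' => h (blockBeta_same ℓ a h'), ?_⟩
      by_contra hcol
      exact h (by unfold blockBeta; rw [if_neg hcol])
    refine ⟨?_, ?_, ?_⟩
    · by_contra h0
      obtain ⟨h1, h2⟩ := hβ c d (left_ne_zero_of_mul h0)
      obtain ⟨h3, h4⟩ := hβ d e (right_ne_zero_of_mul h0)
      obtain rfl := shuffles_succ (σ := [d]) h (by tauto) (by simp; tauto)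
      exact blockCol_ne_succ ℓ a c (h2.trans h4)
    · by_contra h0
      obtain ⟨h1, h2⟩ := hβ c d (left_ne_zero_of_mul h0)
      obtain ⟨h3, h4⟩ := hβ c e (right_ne_zero_of_mul h0)
      obtain rfl := shuffles_succ (μ := μ ++ [c]) (σ := []) (c := d) (d := e) (ρ := ρ)
        (by simpa using h) (by tauto) (by simp)
      exact blockCol_ne_succ ℓ a d (h2.symm.trans h4)
    · by_contra h0
      obtain ⟨h1, h2⟩ := hβ c e (left_ne_zero_of_mul h0)
      obtain ⟨h3, h4⟩ := hβ d e (right_ne_zero_of_mul h0)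
      obtain rfl := shuffles_succ (σ := []) h (by tauto) (by simp)
      exact blockCol_ne_succ ℓ a c (h2.trans h4.symm)
  eq_zero_of_ne c d h := by unfold blockBeta; rw [if_neg h]
  divDiff μ ρ c d e h hce := by
    by_cases hb : c < l₁ ↔ e < l₁
    · right
      refine ⟨blockBeta_same ℓ a hb, ?_⟩
      by_cases hd : d < l₁ ↔ c < l₁
      · obtain rfl := shuffles_succ (σ := []) h hd.symm (by simp)
        obtain rfl := shuffles_succ (μ := μ ++ [c]) (σ := []) (c := c + 1) (d := e) (ρ := ρ)
          (by simpa using h) (by tauto) (by simp)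
        unfold blockCol blockXi at *
        push_cast at *
        rw [show a + ((c : ℤ) + 1 + 1) = a + c + 2 by ring] at hce ⊢
        rw [show a + ((c : ℤ) + 1) = a + c + 1 by ring]
        by_cases hc : c < l₁
        · rw [if_pos hc, if_pos (hd.2 hc), if_pos (hb.1 hc)]
          exact qDivDiff_zero ℓ _ hce
        · rw [if_neg hc, if_neg (hd.not.2 hc), if_neg (hb.not.1 hc)]
          exact qDivDiff_zeta ℓ _ hce
      -- If d belongs to the other block, then e is the successor of c, and the colours of c and e
      -- cannot agree.
      · obtain rfl := shuffles_succ (σ := [d]) h hb (by simpa using hd)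
        exact absurd hce (blockCol_ne_succ ℓ a c)
    · exact Or.inl (blockBeta_mul ℓ a c e hb hce)

end TwoBlocks

/-! ### The height of a shuffle -/

section Height

variable (l₁ : ℕ)

/-- The number of pairs in a list that consist of an entry `≥ l₁` and a later entry `< l₁`. -/
def height : List ℕ → ℕ
  | [] => 0
  | c :: L => (if c < l₁ then 0 else L.countP (· < l₁)) + height L

/-- Only the swapped pair changes its contribution; the corrections stand on both sides to avoid
subtraction in ℕ. -/
lemma height_swap (μ ρ : List ℕ) (c d : ℕ) :
    height l₁ (μ ++ c :: d :: ρ) + (if ¬ d < l₁ ∧ c < l₁ then 1 else 0) =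
      height l₁ (μ ++ d :: c :: ρ) + (if ¬ c < l₁ ∧ d < l₁ then 1 else 0) := by
  induction μ with
  | nil =>
    by_cases hc : c < l₁ <;> by_cases hd : d < l₁ <;>
      simp [height, hc, hd] <;> omega
  | cons a μ ih =>
    have : (μ ++ c :: d :: ρ).countP (fun x => decide (x < l₁)) =
        (μ ++ d :: c :: ρ).countP (fun x => decide (x < l₁)) := by
      simp only [List.countP_append, List.countP_cons]; omega
    simp only [List.cons_append, height, this]
    omega

lemma height_le_swap (μ ρ : List ℕ) (c d : ℕ) :
    height l₁ (μ ++ c :: d :: ρ) ≤ height l₁ (μ ++ d :: c :: ρ) + 1 := by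
  have := height_swap l₁ μ ρ c d
  split_ifs at this <;> omega

lemma height_move (μ ρ : List ℕ) {b : ℕ} (hb : ¬ b < l₁) (as : List ℕ) (has : ∀ c ∈ as, c < l₁) :
    height l₁ (μ ++ b :: (as ++ ρ)) = height l₁ (μ ++ as ++ b :: ρ) + as.length := by
  induction as generalizing μ with
  | nil => simp
  | cons c as ih =>
    have h1 := height_swap l₁ μ (as ++ ρ) b c
    have h2 := ih (μ ++ [c]) fun x hx => has x (by simp [hx])
    have hc : c < l₁ := has c (by simp)
    simp only [hb, hc, not_false_eq_true, and_self, if_true, not_true,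
      if_false, add_zero] at h1
    simp only [List.append_assoc, List.cons_append, List.nil_append,
      List.length_cons] at h1 h2 ⊢
    omega

lemma height_blocks (bs as : List ℕ) (hbs : ∀ c ∈ bs, ¬ c < l₁) (has : ∀ c ∈ as, c < l₁) :
    height l₁ (bs ++ as) = bs.length * as.length := by
  induction bs with
  | nil =>
    simp only [List.nil_append, List.length_nil, zero_mul]
    induction as with
    | nil => rfl
    | cons a as ih =>
      rw [height, if_pos (has a (by simp)), ih fun x hx => has x (by simp [hx]), zero_add]
  | cons b bs ih =>
    have h1 : bs.countP (fun x => decide (x < l₁)) = 0 := by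
      rw [List.countP_eq_zero]; intro x hx; simpa using hbs x (by simp [hx])
    have h2 : as.countP (fun x => decide (x < l₁)) = as.length := by
      rw [List.countP_eq_length]; intro x hx; simpa using has x hx
    rw [List.cons_append, height, if_neg (hbs b (by simp)), ih fun x hx => hbs x (by simp [hx]),
      List.countP_append, h1, h2, List.length_cons]
    ring

lemma height_sorted (as bs : List ℕ) (hbs : ∀ c ∈ bs, ¬ c < l₁) (has : ∀ c ∈ as, c < l₁) :
    height l₁ (as ++ bs) = 0 := by
  induction as with
  | nil => simpa using height_blocks l₁ bs [] hbs (by simp)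
  | cons a as ih =>
    rw [List.cons_append, height, if_pos (has a (by simp)), ih fun x hx => has x (by simp [hx])]

end Height

/-! ### Triangularity of the ψ-words with respect to the height -/

section Functional

variable (ℓ : ℕ∞) (a : ℤ) (l₁ l₂ : ℕ)

/-- The module of shuffles. -/
abbrev ShuffleMod : Type := shuffles l₁ l₂ →₀ ℤ[T;T⁻¹]

/-- The basis vector of a shuffle. -/
noncomputable abbrev shuffleVec (L : List ℕ) : ShuffleMod l₁ l₂ :=
  StrandData.vec ℤ[T;T⁻¹] (shuffles l₁ l₂) L

/-- The operators on the module of shuffles. -/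
noncomputable abbrev shuffleOp (s : Gen ℓ) : Module.End ℤ[T;T⁻¹] (ShuffleMod l₁ l₂) :=
  StrandData.op (blockCol ℓ a) (blockXi ℓ a l₁) (blockAlpha ℓ a l₁) (blockBeta ℓ a l₁)
    (shuffles l₁ l₂) s

/-- The span of the shuffles of height at least `n`. -/
noncomputable def heightGE (n : ℕ) : Submodule ℤ[T;T⁻¹] (ShuffleMod l₁ l₂) :=
  Submodule.span _ {v | ∃ L, n ≤ height l₁ L ∧ v = shuffleVec l₁ l₂ L}

variable {l₁ l₂}

lemma vec_mem_heightGE {n : ℕ} {L : List ℕ} (h : n ≤ height l₁ L) :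
    shuffleVec l₁ l₂ L ∈ heightGE l₁ l₂ n := Submodule.subset_span ⟨L, h, rfl⟩

lemma heightGE_anti {n n' : ℕ} (h : n ≤ n') : heightGE l₁ l₂ n' ≤ heightGE l₁ l₂ n :=
  Submodule.span_mono fun _ ⟨L, h', hv⟩ => ⟨L, h.trans h', hv⟩

variable (l₁ l₂) in
/-- The product of the operators of a word. -/
noncomputable def shuffleWord (w : List ℕ) : Module.End ℤ[T;T⁻¹] (ShuffleMod l₁ l₂) :=
  (w.map fun i => shuffleOp ℓ a l₁ l₂ (.psi i)).prod

lemma shuffleWord_append (u w : List ℕ) :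
    shuffleWord ℓ a l₁ l₂ (u ++ w) = shuffleWord ℓ a l₁ l₂ u * shuffleWord ℓ a l₁ l₂ w := by
  simp [shuffleWord]

lemma shuffleWord_cons (i : ℕ) (w : List ℕ) : shuffleWord ℓ a l₁ l₂ (i :: w) =
    shuffleOp ℓ a l₁ l₂ (.psi i) * shuffleWord ℓ a l₁ l₂ w := by
  simp [shuffleWord]

variable [Fact (2 ≤ ℓ)]

lemma shuffleOp_psi (μ ρ : List ℕ) (c d : ℕ) {r : ℕ} (hr : r = μ.length) :
    shuffleOp ℓ a l₁ l₂ (.psi r) (shuffleVec l₁ l₂ (μ ++ c :: d :: ρ)) =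
      blockAlpha ℓ a l₁ c d • shuffleVec l₁ l₂ (μ ++ d :: c :: ρ) +
        blockBeta ℓ a l₁ c d • shuffleVec l₁ l₂ (μ ++ c :: d :: ρ) :=
  (strandData ℓ a).op_psi μ ρ c d hr

/-- One ψ undoes at most one inversion. Consequently a word of length n lowers the height by at most
n, which is the source of all vanishing statements for short words. -/
lemma shuffleOp_psi_mem {n : ℕ} {v : ShuffleMod l₁ l₂} (h : v ∈ heightGE l₁ l₂ (n + 1)) (r : ℕ) :
    shuffleOp ℓ a l₁ l₂ (.psi r) v ∈ heightGE l₁ l₂ n := by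
  have : heightGE l₁ l₂ (n + 1) ≤ (heightGE l₁ l₂ n).comap (shuffleOp ℓ a l₁ l₂ (.psi r)) := by
    refine Submodule.span_le.2 ?_
    rintro _ ⟨L, hL, rfl⟩
    rw [SetLike.mem_coe, Submodule.mem_comap]
    rcases Nat.lt_or_ge (r + 1) L.length with h | h
    · obtain ⟨μ, c, d, ρ, rfl, rfl⟩ := exists_split L r h
      rw [shuffleOp_psi ℓ a μ ρ c d rfl]
      have := height_le_swap l₁ μ ρ c d
      exact add_mem (Submodule.smul_mem _ _ (vec_mem_heightGE (by omega)))
        (Submodule.smul_mem _ _ (vec_mem_heightGE (by omega)))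
    · rw [StrandData.op_psi_out _ _ h]
      exact zero_mem _
  exact this h

lemma shuffleWord_mem {n : ℕ} {v : ShuffleMod l₁ l₂} (w : List ℕ)
    (h : v ∈ heightGE l₁ l₂ (n + w.length)) : shuffleWord ℓ a l₁ l₂ w v ∈ heightGE l₁ l₂ n := by
  induction w generalizing n with
  | nil => simpa [shuffleWord] using h
  | cons i w ih =>
    rw [shuffleWord_cons, Module.End.mul_apply]
    exact shuffleOp_psi_mem ℓ a (ih (by rwa [Nat.add_assoc, Nat.add_comm 1])) i

/-- The strand b passes the strands of `as` one after another. A diagonal term of some ψ leaves the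
height unchanged, and the remaining letters are then too few to bring it down to that of the target.
-/
lemma shuffleWord_run (μ ρ : List ℕ) {b : ℕ} (hb : ¬ b < l₁) (as : List ℕ)
    (has : ∀ c ∈ as, c < l₁) :
    shuffleWord ℓ a l₁ l₂ (run μ.length as.length) (shuffleVec l₁ l₂ (μ ++ b :: (as ++ ρ))) -
      shuffleVec l₁ l₂ (μ ++ as ++ b :: ρ) ∈
        heightGE l₁ l₂ (height l₁ (μ ++ as ++ b :: ρ) + 1) := by
  induction as generalizing μ with
  | nil => simp [run, shuffleWord]
  | cons c as ih =>
    have hc : c < l₁ := has c (by simp)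
    have has' : ∀ x ∈ as, x < l₁ := fun x hx => has x (by simp [hx])
    have h1 := ih (μ ++ [c]) has'
    have h2 := height_move l₁ μ ρ hb (c :: as) has
    have h3 : shuffleOp ℓ a l₁ l₂ (.psi μ.length) (shuffleVec l₁ l₂ (μ ++ b :: c :: (as ++ ρ))) =
        shuffleVec l₁ l₂ (μ ++ c :: b :: (as ++ ρ)) +
          blockBeta ℓ a l₁ b c • shuffleVec l₁ l₂ (μ ++ b :: c :: (as ++ ρ)) := by
      rw [shuffleOp_psi ℓ a μ _ b c rfl]
      simp [blockAlpha, hb, hc]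
    have h4 : shuffleWord ℓ a l₁ l₂ (run (μ.length + 1) as.length)
        (blockBeta ℓ a l₁ b c • shuffleVec l₁ l₂ (μ ++ b :: c :: (as ++ ρ))) ∈
        heightGE l₁ l₂ (height l₁ (μ ++ (c :: as) ++ b :: ρ) + 1) := by
      refine shuffleWord_mem ℓ a _ (Submodule.smul_mem _ _ (vec_mem_heightGE ?_))
      rw [length_run]
      simp only [List.append_assoc, List.cons_append, List.length_cons] at h2 ⊢
      omega
    rw [List.length_cons, run_succ', shuffleWord_append, Module.End.mul_apply]
    have h5 : shuffleWord ℓ a l₁ l₂ [μ.length] = shuffleOp ℓ a l₁ l₂ (.psi μ.length) := by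
      simp [shuffleWord]
    rw [h5, List.cons_append, h3, map_add, add_sub_right_comm]
    refine add_mem ?_ h4
    simpa using h1

lemma shuffleWord_block (bs as : List ℕ) (hbs : ∀ c ∈ bs, ¬ c < l₁) (has : ∀ c ∈ as, c < l₁)
    (ρ : List ℕ) :
    shuffleWord ℓ a l₁ l₂ (blockWord bs.length as.length) (shuffleVec l₁ l₂ (bs ++ (as ++ ρ))) -
      shuffleVec l₁ l₂ (as ++ (bs ++ ρ)) ∈
        heightGE l₁ l₂ (height l₁ (as ++ (bs ++ ρ)) + 1) := by
  induction bs using List.reverseRecOn generalizing ρ with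
  | nil => simp [blockWord, shuffleWord]
  | append_singleton bs b ih =>
    have hbs' : ∀ c ∈ bs, ¬ c < l₁ := fun c hc => hbs c (by simp [hc])
    have h1 := shuffleWord_run ℓ a (l₂ := l₂) bs ρ (hbs b (by simp)) as has
    have h2 := ih hbs' (b :: ρ)
    have hh : ∀ bs : List ℕ, (∀ c ∈ bs, ¬ c < l₁) → ∀ ρ, height l₁ (bs ++ (as ++ ρ)) =
        height l₁ (as ++ (bs ++ ρ)) + bs.length * as.length := by
      intro bs
      induction bs using List.reverseRecOn with
      | nil => simp
      | append_singleton bs b ih =>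
        intro h ρ
        have h1 := ih (fun c hc => h c (by simp [hc])) (b :: ρ)
        have h2 := height_move l₁ bs ρ (h b (by simp)) as has
        simp only [List.append_assoc, List.cons_append, List.nil_append, List.length_append,
          List.length_singleton] at h1 h2 ⊢
        rw [h2, h1]; ring
    have h3 := hh bs hbs' (b :: ρ)
    rw [List.length_append, List.length_singleton, blockWord_succ, shuffleWord_append,
      Module.End.mul_apply]
    simp only [List.append_assoc, List.cons_append, List.nil_append] at h1 h2 h3 ⊢
    have h4 : shuffleWord ℓ a l₁ l₂ (blockWord bs.length as.length)
        (shuffleWord ℓ a l₁ l₂ (run bs.length as.length)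
          (shuffleVec l₁ l₂ (bs ++ b :: (as ++ ρ))) -
            shuffleVec l₁ l₂ (bs ++ (as ++ b :: ρ))) ∈
        heightGE l₁ l₂ (height l₁ (as ++ (bs ++ b :: ρ)) + 1) := by
      refine shuffleWord_mem ℓ a _ ?_
      rw [length_blockWord]
      convert h1 using 2
      rw [h3]; ring
    rw [map_sub] at h4
    simpa using add_mem h4 h2

end Functional

/-! ### The coefficient of the sorted shuffle and its value at T = 0 -/

section Functional

variable (ℓ : ℕ∞) (a : ℤ) (l₁ l₂ : ℕ)

lemma range_append_range' : List.range l₁ ++ List.range' l₁ l₂ = List.range (l₁ + l₂) := by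
  rw [List.range_eq_range', List.range_eq_range']
  simpa using List.range'_append_1 (s := 0) (m := l₁) (n := l₂)

lemma sorted_mem_shuffles : List.range (l₁ + l₂) ∈ shuffles l₁ l₂ := by
  rw [← range_append_range']
  have h1 : (List.range l₁).filter (fun c => decide (c < l₁)) = List.range l₁ :=
    List.filter_eq_self.2 fun c hc => by simpa using List.mem_range.1 hc
  have h2 : (List.range l₁).filter (fun c => decide (¬ c < l₁)) = [] :=
    List.filter_eq_nil_iff.2 fun c hc => by simpa using List.mem_range.1 hc
  have h3 : (List.range' l₁ l₂).filter (fun c => decide (c < l₁)) = [] :=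
    List.filter_eq_nil_iff.2 fun c hc => by
      have := List.mem_range'_1.1 hc; simp; omega
  have h4 : (List.range' l₁ l₂).filter (fun c => decide (¬ c < l₁)) = List.range' l₁ l₂ :=
    List.filter_eq_self.2 fun c hc => by
      have := List.mem_range'_1.1 hc; simp; omega
  constructor
  · rw [List.filter_append, h1, h3, List.append_nil]
  · rw [List.filter_append, h2, h4, List.nil_append]

/-- The coefficient of the sorted sequence. -/
noncomputable def coefTop : ShuffleMod l₁ l₂ →ₗ[ℤ[T;T⁻¹]] ℤ[T;T⁻¹] :=
  Finsupp.lapply ⟨_, sorted_mem_shuffles l₁ l₂⟩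

open scoped Classical in
lemma coefTop_vec (L : List ℕ) :
    coefTop l₁ l₂ (shuffleVec l₁ l₂ L) = if L = List.range (l₁ + l₂) then 1 else 0 := by
  by_cases hL : L ∈ shuffles l₁ l₂
  · rw [shuffleVec, StrandData.vec_of_mem _ hL, coefTop, Finsupp.lapply_apply, Finsupp.single_apply]
    simp [Subtype.ext_iff]
  · rw [shuffleVec, StrandData.vec_of_notMem _ hL, map_zero, if_neg]
    rintro rfl
    exact hL (sorted_mem_shuffles l₁ l₂)

lemma height_range : height l₁ (List.range (l₁ + l₂)) = 0 := by
  rw [← range_append_range']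
  exact height_sorted l₁ _ _ (fun c hc => by have := List.mem_range'_1.1 hc; omega)
    fun c hc => List.mem_range.1 hc

lemma coefTop_of_mem {v : ShuffleMod l₁ l₂} (h : v ∈ heightGE l₁ l₂ 1) : coefTop l₁ l₂ v = 0 := by
  have : heightGE l₁ l₂ 1 ≤ LinearMap.ker (coefTop l₁ l₂) := by
    refine Submodule.span_le.2 ?_
    rintro _ ⟨L, hL, rfl⟩
    rw [SetLike.mem_coe, LinearMap.mem_ker, coefTop_vec, if_neg]
    rintro rfl
    rw [height_range] at hL
    omega
  exact this h

/-- The generating shuffle. -/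
def startList : List ℕ := List.range' l₁ l₂ ++ List.range l₁

/-- The basis vector of the generating shuffle. -/
noncomputable abbrev startVec : ShuffleMod l₁ l₂ := shuffleVec l₁ l₂ (startList l₁ l₂)

lemma startVec_mem : startVec l₁ l₂ ∈ heightGE l₁ l₂ (l₂ * l₁) := by
  refine vec_mem_heightGE ?_
  rw [startList, height_blocks l₁ _ _ (fun c hc => by have := List.mem_range'_1.1 hc; omega)
    fun c hc => List.mem_range.1 hc]
  simp

lemma coefTop_comp_e (ν : List (Idx ℓ)) (v : ShuffleMod l₁ l₂) :
    coefTop l₁ l₂ (shuffleOp ℓ a l₁ l₂ (.e ν) v) =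
      if ν = segWord ℓ a (l₁ + l₂) then coefTop l₁ l₂ v else 0 := by
  have : coefTop l₁ l₂ ∘ₗ shuffleOp ℓ a l₁ l₂ (.e ν) =
      (if ν = segWord ℓ a (l₁ + l₂) then coefTop l₁ l₂ else 0) := by
    refine StrandData.ext_vec fun L _ => ?_
    rw [LinearMap.comp_apply, StrandData.op_e]
    have e1 : (List.range (l₁ + l₂)).map (blockCol ℓ a) = segWord ℓ a (l₁ + l₂) := rfl
    by_cases hL : L = List.range (l₁ + l₂)
    · rw [hL, e1]
      by_cases hν : ν = segWord ℓ a (l₁ + l₂)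
      · rw [if_pos hν.symm, if_pos hν]
      · rw [if_neg (Ne.symm hν), if_neg hν, map_zero, LinearMap.zero_apply]
    · have h0 : coefTop l₁ l₂ (shuffleVec l₁ l₂ L) = 0 := by rw [coefTop_vec, if_neg hL]
      split_ifs <;> simp [h0]
  have := LinearMap.congr_fun this v
  rw [LinearMap.comp_apply] at this
  rw [this]
  split_ifs <;> rfl

/-- The factor is a multiple of T in ℤ[T], so it removes the constant term as soon as the
coefficient itself is known to be a polynomial. -/
lemma coefTop_comp_x (r : ℕ) : ∃ p : Polynomial ℤ, ∀ v : ShuffleMod l₁ l₂,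
    coefTop l₁ l₂ (shuffleOp ℓ a l₁ l₂ (.x r) v) =
      Polynomial.toLaurent (p * Polynomial.X) * coefTop l₁ l₂ v := by
  obtain ⟨p, hp⟩ : ∃ p : Polynomial ℤ, ((List.range (l₁ + l₂))[r]?.elim 0 (blockXi ℓ a l₁)) =
      Polynomial.toLaurent (p * Polynomial.X) := by
    cases (List.range (l₁ + l₂))[r]? with
    | none => exact ⟨0, by simp⟩
    | some c =>
      by_cases hc : c < l₁
      · exact ⟨0, by simp [blockXi, hc]⟩
      · simpa [blockXi, hc] using zeta_eq ℓ (a + c)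
  refine ⟨p, fun v => ?_⟩
  have : coefTop l₁ l₂ ∘ₗ shuffleOp ℓ a l₁ l₂ (.x r) =
      Polynomial.toLaurent (p * Polynomial.X) • coefTop l₁ l₂ := by
    refine StrandData.ext_vec fun L _ => ?_
    rw [LinearMap.comp_apply, StrandData.op_x, map_smul, LinearMap.smul_apply, coefTop_vec]
    split_ifs with h
    · rw [h, hp]
    · rw [smul_zero, smul_zero]
  exact LinearMap.congr_fun this v

lemma startList_e (ν : List (Idx ℓ)) : shuffleOp ℓ a l₁ l₂ (.e ν) (startVec l₁ l₂) =
    if ν = segWord ℓ (a + l₁) l₂ ++ segWord ℓ a l₁ then startVec l₁ l₂ else 0 := by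
  rw [startVec, shuffleVec, StrandData.op_e]
  have : (startList l₁ l₂).map (blockCol ℓ a) = segWord ℓ (a + l₁) l₂ ++ segWord ℓ a l₁ := by
    rw [startList, List.map_append]
    congr 1
    rw [List.range'_eq_map_range, List.map_map, segWord]
    refine List.map_congr_left fun c _ => ?_
    simp [blockCol, add_assoc]
  rw [this]
  simp only [eq_comm]

lemma startList_x (r : ℕ) : ∃ p : Polynomial ℤ, shuffleOp ℓ a l₁ l₂ (.x r) (startVec l₁ l₂) =
    Polynomial.toLaurent (p * Polynomial.X) • startVec l₁ l₂ := by
  obtain ⟨p, hp⟩ : ∃ p : Polynomial ℤ, ((startList l₁ l₂)[r]?.elim 0 (blockXi ℓ a l₁)) =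
      Polynomial.toLaurent (p * Polynomial.X) := by
    cases (startList l₁ l₂)[r]? with
    | none => exact ⟨0, by simp⟩
    | some c =>
      by_cases hc : c < l₁
      · exact ⟨0, by simp [blockXi, hc]⟩
      · simpa [blockXi, hc] using zeta_eq ℓ (a + c)
  exact ⟨p, by rw [startVec, shuffleVec, StrandData.op_x, hp]⟩

variable [Fact (2 ≤ ℓ)]

omit [Fact (2 ≤ ℓ)] in
lemma blockAlpha_same {c d : ℕ} (h : c < l₁ ↔ d < l₁) : blockAlpha ℓ a l₁ c d = 0 := by
  unfold blockAlpha
  by_cases hc : c < l₁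
  · simp [hc, h.1 hc]
  · simp [hc, h.not.1 hc]

/-- In the sorted arrangement the strands in positions r and r + 1 belong to one block unless r + 1
= l₁, and then α and β vanish for them in both orders. So no arrangement contributes to the sorted
one. -/
lemma coefTop_comp_psi {r : ℕ} (hr : r + 1 ≠ l₁) (v : ShuffleMod l₁ l₂) :
    coefTop l₁ l₂ (shuffleOp ℓ a l₁ l₂ (.psi r) v) = 0 := by
  have : coefTop l₁ l₂ ∘ₗ shuffleOp ℓ a l₁ l₂ (.psi r) = 0 := by
    refine StrandData.ext_vec fun L _ => ?_
    rw [LinearMap.comp_apply, LinearMap.zero_apply]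
    rcases Nat.lt_or_ge (r + 1) L.length with h | h
    · obtain ⟨μ, c, d, ρ, rfl, rfl⟩ := exists_split L r h
      have key : ∀ c d : ℕ, μ ++ c :: d :: ρ = List.range (l₁ + l₂) → (c < l₁ ↔ d < l₁) := by
        intro c d h
        have h1 : (List.range (l₁ + l₂))[μ.length]? = some c := by rw [← h]; simp
        have h2 : (List.range (l₁ + l₂))[μ.length + 1]? = some d := by rw [← h]; simp
        obtain ⟨_, h1⟩ := List.getElem?_eq_some_iff.1 h1
        obtain ⟨_, h2⟩ := List.getElem?_eq_some_iff.1 h2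
        simp only [List.getElem_range] at h1 h2
        omega
      have e1 := shuffleOp_psi ℓ a (l₁ := l₁) (l₂ := l₂) μ ρ c d rfl
      rw [shuffleOp, shuffleVec] at e1
      rw [e1, map_add, map_smul, map_smul, coefTop_vec, coefTop_vec]
      have h1 : (blockAlpha ℓ a l₁ c d •
          (if μ ++ d :: c :: ρ = List.range (l₁ + l₂) then 1 else 0 : ℤ[T;T⁻¹])) = 0 := by
        split_ifs with h
        · rw [blockAlpha_same ℓ a l₁ (key _ _ h).symm, zero_smul]
        · rw [smul_zero]
      have h2 : (blockBeta ℓ a l₁ c d •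
          (if μ ++ c :: d :: ρ = List.range (l₁ + l₂) then 1 else 0 : ℤ[T;T⁻¹])) = 0 := by
        split_ifs with h
        · rw [blockBeta_same ℓ a (key _ _ h), zero_smul]
        · rw [smul_zero]
      rw [h1, h2, add_zero]
    · rw [StrandData.op_psi_out _ _ h, map_zero]
  exact LinearMap.congr_fun this v

lemma startList_psi {r : ℕ} (hr : r + 1 ≠ l₂) :
    shuffleOp ℓ a l₁ l₂ (.psi r) (startVec l₁ l₂) = 0 := by
  rcases Nat.lt_or_ge (r + 1) (startList l₁ l₂).length with h | h
  · obtain ⟨μ, c, d, ρ, h', rfl⟩ := exists_split _ r h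
    have key : c < l₁ ↔ d < l₁ := by
      have h1 : (startList l₁ l₂)[μ.length]? = some c := by rw [h']; simp
      have h2 : (startList l₁ l₂)[μ.length + 1]? = some d := by rw [h']; simp
      simp only [startList, List.getElem?_append, List.length_range'] at h1 h2
      have hl : (startList l₁ l₂).length = l₂ + l₁ := by simp [startList]
      rcases Nat.lt_or_ge (μ.length + 1) l₂ with h3 | h3
      · rw [if_pos (by omega), List.getElem?_range' (by omega)] at h1
        rw [if_pos (by omega), List.getElem?_range' (by omega)] at h2
        simp at h1 h2
        omega
      · rw [if_neg (by omega), List.getElem?_range (by omega)] at h1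
        rw [if_neg (by omega), List.getElem?_range (by omega)] at h2
        simp at h1 h2
        omega
    have e1 := shuffleOp_psi ℓ a (l₁ := l₁) (l₂ := l₂) μ ρ c d rfl
    rw [startVec, h', e1, blockAlpha_same ℓ a l₁ key, blockBeta_same ℓ a key, zero_smul, zero_smul,
      add_zero]
  · exact StrandData.op_psi_out _ _ h

/-- The representation on the module of shuffles. -/
noncomputable def shuffleRep : QH (Polynomial ℤ) (segRoot ℓ a (l₁ + l₂)) →ₐ[Polynomial ℤ]
    Module.End ℤ[T;T⁻¹] (ShuffleMod l₁ l₂) :=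
  QH.lift (shuffleOp ℓ a l₁ l₂) fun _ _ h => (strandData ℓ a).op_rel _ _ h

/-- The same representation, as a representation over the polynomial ring. -/
noncomputable def shuffleRep' : QH (Polynomial ℤ) (segRoot ℓ a (l₁ + l₂)) →ₐ[Polynomial ℤ]
    Module.End (Polynomial ℤ) (ShuffleMod l₁ l₂) :=
  (AlgHom.ofLinearMap
    { toFun := fun f => f.restrictScalars (Polynomial ℤ)
      map_add' := fun _ _ => rfl
      map_smul' := fun _ _ => rfl } rfl fun _ _ => rfl).comp (shuffleRep ℓ a l₁ l₂)

variable {l₁ l₂}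

lemma shuffleRep_gen (s : Gen ℓ) :
    shuffleRep ℓ a l₁ l₂ (QH.gen _ _ s) = shuffleOp ℓ a l₁ l₂ s := QH.lift_gen _ _ s

lemma shuffleRep'_apply (c : QH (Polynomial ℤ) (segRoot ℓ a (l₁ + l₂))) (v : ShuffleMod l₁ l₂) :
    shuffleRep' ℓ a l₁ l₂ c v = shuffleRep ℓ a l₁ l₂ c v := rfl

lemma shuffleRep_psiWord (w : List ℕ) :
    shuffleRep ℓ a l₁ l₂ (QH.psiWord _ _ w) = shuffleWord ℓ a l₁ l₂ w := by
  rw [QH.psiWord, map_list_prod, List.map_map, shuffleWord]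
  congr 1
  exact List.map_congr_left fun i _ => shuffleRep_gen ℓ a _

/-- The generating shuffle has height l₂ l₁ and the sorted one has height 0. -/
lemma coefTop_short {w : List ℕ} (h : w.length < l₂ * l₁) :
    coefTop l₁ l₂ (shuffleWord ℓ a l₁ l₂ w (startVec l₁ l₂)) = 0 :=
  coefTop_of_mem l₁ l₂ (shuffleWord_mem ℓ a w (heightGE_anti (by omega) (startVec_mem l₁ l₂)))

lemma coefTop_blockWord :
    coefTop l₁ l₂ (shuffleWord ℓ a l₁ l₂ (blockWord l₂ l₁) (startVec l₁ l₂)) = 1 := by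
  have h := shuffleWord_block ℓ a (l₁ := l₁) (l₂ := l₂) (List.range' l₁ l₂) (List.range l₁)
    (fun c hc => by have := List.mem_range'_1.1 hc; omega) (fun c hc => List.mem_range.1 hc) []
  simp only [List.append_nil, List.length_range, List.length_range', range_append_range',
    height_range] at h
  have h1 := coefTop_of_mem l₁ l₂ h
  rw [map_sub, coefTop_vec, if_pos rfl, sub_eq_zero] at h1
  exact h1

lemma isEigen_startVec : IsEigen (shuffleRep' ℓ a l₁ l₂) (startVec l₁ l₂) where
  weight := ⟨segWord ℓ (a + l₁) l₂ ++ segWord ℓ a l₁, by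
    rw [shuffleRep'_apply, QH.e, shuffleRep_gen, startList_e, if_pos rfl]⟩
  x r := by
    obtain ⟨p, hp⟩ := startList_x ℓ a l₁ l₂ r
    refine ⟨p * Polynomial.X, ?_⟩
    rw [shuffleRep'_apply, QH.x, shuffleRep_gen, hp, ← algebraMap_smul ℤ[T;T⁻¹] (p * Polynomial.X)]
    rfl

omit [Fact (2 ≤ ℓ)] in
lemma card_segRoot (a : ℤ) (m : ℕ) : (segRoot ℓ a m).card = m := by
  simp [segRoot, segWord]

/-- The coefficients β have poles at T = 0, so matrix entries are no help. But over ℤ[T] the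
generating shuffle is an eigenvector killed by all ψ_r but one. So its cyclic module over ℤ[T] is
spanned by the Grassmannian words, and on these the coefficient is 0 or 1. -/
lemma coefTop_integral (c : QH (Polynomial ℤ) (segRoot ℓ a (l₁ + l₂))) :
    ∃ p : Polynomial ℤ,
      coefTop l₁ l₂ (shuffleRep ℓ a l₁ l₂ c (startVec l₁ l₂)) = Polynomial.toLaurent p := by
  have hm := isEigen_startVec ℓ a (l₁ := l₁) (l₂ := l₂)
  obtain ⟨n, hn⟩ := hm.exists_mem_filt c
  have h1 := hm.filt_le_grassmann (l₂ := l₂) (l₁ := l₁) (by rw [card_segRoot, add_comm])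
    (fun i hi => by rw [shuffleRep'_apply, QH.psi, shuffleRep_gen, startList_psi ℓ a l₁ l₂ hi]) n hn
  rw [shuffleRep'_apply] at h1
  refine Submodule.span_induction (p := fun v _ => ∃ p : Polynomial ℤ,
    coefTop l₁ l₂ v = Polynomial.toLaurent p) ?_ ⟨0, by simp⟩ ?_ ?_ h1
  · rintro _ ⟨es, he, -, rfl⟩
    rw [shuffleRep'_apply, shuffleRep_psiWord]
    rcases Nat.lt_or_ge es.sum (l₂ * l₁) with h2 | h2
    · exact ⟨0, by rw [coefTop_short ℓ a (by rwa [length_nf]), map_zero]⟩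
    · rw [he.eq_replicate h2, ← blockWord_eq_nf]
      exact ⟨1, by rw [coefTop_blockWord, map_one]⟩
  · rintro x y _ _ ⟨p, hp⟩ ⟨q, hq⟩
    exact ⟨p + q, by rw [map_add, hp, hq, map_add]⟩
  · rintro c x _ ⟨p, hp⟩
    refine ⟨c * p, ?_⟩
    rw [← algebraMap_smul ℤ[T;T⁻¹] c x, map_smul, hp, map_mul]
    rfl

/-- Evaluation at `T = 0`. -/
noncomputable def evalZero : ℤ[T;T⁻¹] →+ ℤ :=
  (Polynomial.lcoeff ℤ 0).toAddMonoidHom.comp trunc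

lemma evalZero_toLaurent (p : Polynomial ℤ) : evalZero (Polynomial.toLaurent p) = p.coeff 0 := by
  simp [evalZero, leftInverse_trunc_toLaurent p]

lemma evalZero_eq_zero (p q : Polynomial ℤ) :
    evalZero (Polynomial.toLaurent (p * Polynomial.X) * Polynomial.toLaurent q) = 0 := by
  rw [← map_mul, evalZero_toLaurent]
  simp [Polynomial.mul_coeff_zero]

variable (l₁ l₂) in
/-- A functional on the quiver Hecke algebra that detects the longest Grassmannian word and
transforms on both sides like matrix coefficients between two products of segments. -/
theorem exists_functional : ∃ f : QH ℤ (segRoot ℓ a (l₁ + l₂)) →+ ℤ,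
    (∀ r c, f (QH.x ℤ _ r * c) = 0) ∧ (∀ r c, r + 1 ≠ l₁ → f (QH.psi ℤ _ r * c) = 0) ∧
    (∀ ν c, f (QH.e ℤ _ ν * c) = if ν = segWord ℓ a (l₁ + l₂) then f c else 0) ∧
    (∀ r c, f (c * QH.x ℤ _ r) = 0) ∧ (∀ r c, r + 1 ≠ l₂ → f (c * QH.psi ℤ _ r) = 0) ∧
    (∀ ν c, f (c * QH.e ℤ _ ν) =
      if ν = segWord ℓ (a + l₁) l₂ ++ segWord ℓ a l₁ then f c else 0) ∧
    (∀ w : List ℕ, w.length < l₂ * l₁ → f (QH.psiWord ℤ _ w) = 0) ∧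
    f (QH.psiWord ℤ _ (blockWord l₂ l₁)) = 1 := by
  set B := QH.baseChange ℤ (Polynomial ℤ) (segRoot ℓ a (l₁ + l₂))
  have hB : ∀ s, B (QH.gen _ _ s) = QH.gen _ _ s := fun s => QH.lift_gen _ _ s
  have hBw : ∀ w, B (QH.psiWord _ _ w) = QH.psiWord _ _ w := by
    intro w
    rw [QH.psiWord, map_list_prod, List.map_map, QH.psiWord]
    congr 1
    exact List.map_congr_left fun i _ => hB _
  let F : QH ℤ (segRoot ℓ a (l₁ + l₂)) →+ ℤ[T;T⁻¹] :=
    { toFun := fun c => coefTop l₁ l₂ (shuffleRep ℓ a l₁ l₂ (B c) (startVec l₁ l₂))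
      map_zero' := by simp
      map_add' := fun c d => by simp }
  have hF : ∀ c, F c = coefTop l₁ l₂ (shuffleRep ℓ a l₁ l₂ (B c) (startVec l₁ l₂)) := fun _ => rfl
  have hf : ∀ c, (evalZero.comp F) c = evalZero (F c) := fun _ => rfl
  refine ⟨evalZero.comp F, ?_, ?_, ?_, ?_, ?_, ?_, ?_, ?_⟩
  -- Both x-properties need `coefTop_integral`: the value at T = 0 of a multiple of T is 0 only if
  -- the cofactor has no pole.
  · intro r c
    obtain ⟨p, hp⟩ := coefTop_comp_x ℓ a l₁ l₂ r
    obtain ⟨q, hq⟩ := coefTop_integral ℓ a (B c)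
    rw [hf, hF, map_mul, QH.x, hB, map_mul, Module.End.mul_apply, shuffleRep_gen, hp, hq,
      evalZero_eq_zero]
  · intro r c hr
    rw [hf, hF, map_mul, QH.psi, hB, map_mul, Module.End.mul_apply, shuffleRep_gen,
      coefTop_comp_psi ℓ a l₁ l₂ hr, map_zero]
  · intro ν c
    rw [hf, hF, map_mul, QH.e, hB, map_mul, Module.End.mul_apply, shuffleRep_gen, coefTop_comp_e,
      hf, hF]
    split_ifs
    · rfl
    · rw [map_zero]
  · intro r c
    obtain ⟨p, hp⟩ := startList_x ℓ a l₁ l₂ r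
    obtain ⟨q, hq⟩ := coefTop_integral ℓ a (B c)
    rw [hf, hF, map_mul, QH.x, hB, map_mul, Module.End.mul_apply, shuffleRep_gen, hp, map_smul,
      map_smul, hq, smul_eq_mul, evalZero_eq_zero]
  · intro r c hr
    rw [hf, hF, map_mul, QH.psi, hB, map_mul, Module.End.mul_apply, shuffleRep_gen,
      startList_psi ℓ a l₁ l₂ hr, map_zero, map_zero, map_zero]
  · intro ν c
    rw [hf, hF, map_mul, QH.e, hB, map_mul, Module.End.mul_apply, shuffleRep_gen, startList_e,
      hf, hF]
    split_ifs
    · rfl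
    · rw [map_zero, map_zero, map_zero]
  · intro w hw
    rw [hf, hF, hBw, shuffleRep_psiWord, coefTop_short ℓ a hw, map_zero]
  · rw [hf, hF, hBw, shuffleRep_psiWord, coefTop_blockWord, ← map_one Polynomial.toLaurent,
      evalZero_toLaurent, Polynomial.coeff_one_zero]

end Functional

end

/-! ### The anti-involution -/

section Anti

variable {k : Type u} [CommRing k] {ℓ : ℕ∞} {β : RootCone ℓ}

open MulOpposite

lemma qEval_op {F : Type*} [Ring F] (i j : Idx ℓ) {u v : F} (h : Commute u v) :
    qEval i j (op u) (op v) = op (qEval i j u v) := by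
  unfold qEval
  induction qExponents i j with
  | nil => simp
  | cons m L ih =>
    simp only [List.map_cons, List.sum_cons, ih, op_add]
    rw [(h.pow_pow m.1 m.2).eq, op_mul, op_pow, op_pow]

lemma qDivDiff_op {F : Type*} [Ring F] (i j : Idx ℓ) {u v w : F} (h : Commute u v) (h' : Commute u w)
    (h'' : Commute v w) : qDivDiff i j (op u) (op v) (op w) = op (qDivDiff i j u v w) := by
  unfold qDivDiff
  induction qExponents i j with
  | nil => simp
  | cons m L ih =>
    simp only [List.map_cons, List.sum_cons, ih, op_add]
    congr 1
    have h1 : Commute (∑ s ∈ Finset.range m.1, u ^ s * w ^ (m.1 - 1 - s)) (v ^ m.2) :=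
      Commute.sum_left _ _ _ fun s _ => (h.pow_pow _ _).mul_left (h''.symm.pow_pow _ _)
    rw [h1.eq, op_mul, op_pow, Finset.op_sum]
    congr 1
    refine Finset.sum_congr rfl fun s _ => ?_
    rw [(h'.pow_pow _ _).eq, op_mul, op_pow, op_pow]

lemma qEval_commute {F : Type*} [Ring F] (i j : Idx ℓ) {u v e : F} (h : Commute u e)
    (h' : Commute v e) : Commute (qEval i j u v) e := by
  unfold qEval
  induction qExponents i j with
  | nil => simp
  | cons m L ih =>
    simp only [List.map_cons, List.sum_cons]
    exact ((h.pow_left _).mul_left (h'.pow_left _)).add_left ih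

lemma qDivDiff_commute {F : Type*} [Ring F] (i j : Idx ℓ) {u v w e : F} (h : Commute u e)
    (h' : Commute v e) (h'' : Commute w e) : Commute (qDivDiff i j u v w) e := by
  unfold qDivDiff
  induction qExponents i j with
  | nil => simp
  | cons m L ih =>
    simp only [List.map_cons, List.sum_cons]
    exact ((Commute.sum_left _ _ _ fun s _ => (h.pow_left _).mul_left (h''.pow_left _)).mul_left
      (h'.pow_left _)).add_left ih

/-- Reversing the products puts the idempotent of a relation on the left. Carried back through the
ψ's, it becomes the idempotent of the permuted word, for which the relation is known. In this way
the two relations between x and ψ are exchanged. -/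
lemma op_gen_rel (a b : (QH k β)ᵐᵒᵖ) (h : Rel β (fun s => op (QH.gen k β s)) a b) : a = b := by
  have psi_e : ∀ (μ ρ : List (Idx ℓ)) (i j : Idx ℓ),
      QH.gen k β (.psi μ.length) * QH.gen k β (.e (μ ++ i :: j :: ρ)) =
        QH.gen k β (.e (μ ++ j :: i :: ρ)) * QH.gen k β (.psi μ.length) := QH.psi_mul_e
  have x_e : ∀ r ν, QH.gen k β (.x r) * QH.gen k β (.e ν) =
      QH.gen k β (.e ν) * QH.gen k β (.x r) := QH.x_mul_e
  have x_x : ∀ r s, Commute (QH.gen k β (.x r)) (QH.gen k β (.x s)) := QH.x_mul_x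
  have psi_e' : ∀ (μ ρ : List (Idx ℓ)) (i j l : Idx ℓ),
      QH.gen k β (.psi (μ.length + 1)) * QH.gen k β (.e (μ ++ i :: j :: l :: ρ)) =
        QH.gen k β (.e (μ ++ i :: l :: j :: ρ)) * QH.gen k β (.psi (μ.length + 1)) := by
    intro μ ρ i j l
    simpa using psi_e (μ ++ [i]) ρ j l
  cases h
  case e_zero ν h => rw [← op_zero]; exact congrArg op (QH.e_eq_zero h)
  case x_zero r h => rw [← op_zero]; exact congrArg op (QH.x_eq_zero h)
  case psi_zero r h => rw [← op_zero]; exact congrArg op (QH.psi_eq_zero h)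
  case e_mul_self ν => rw [← op_mul]; exact congrArg op (QH.e_mul_self ν)
  case e_mul ν ν' h => rw [← op_mul, ← op_zero]; exact congrArg op (QH.e_mul_of_ne h.symm)
  case e_sum => rw [← Finset.op_sum, ← op_one]; exact congrArg op (QH.sum_e k β)
  case x_e r ν => rw [← op_mul, ← op_mul, x_e]
  case psi_e μ ρ i j => rw [← op_mul, ← op_mul, psi_e]
  case x_x r s => rw [← op_mul, ← op_mul, (x_x r s).eq]
  case psi_x r s h h' => rw [← op_mul, ← op_mul]; exact congrArg op (QH.psi_mul_x h h').symm
  case psi_psi r s h => rw [← op_mul, ← op_mul]; exact congrArg op (QH.psi_mul_psi h).symm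
  case x_psi μ ρ i j =>
    have h1 : QH.gen k β (.x (μ.length + 1)) * QH.gen k β (.psi μ.length) *
        QH.gen k β (.e (μ ++ j :: i :: ρ)) = (QH.gen k β (.psi μ.length) * QH.gen k β (.x μ.length) +
          if j = i then 1 else 0) * QH.gen k β (.e (μ ++ j :: i :: ρ)) := QH.x_mul_psi' μ ρ j i
    rw [mul_assoc, psi_e, ← mul_assoc, x_e, mul_assoc, add_mul, mul_assoc,
      x_e, ← mul_assoc (QH.gen k β (.psi μ.length)), psi_e, mul_assoc] at h1
    rw [← op_mul, ← op_mul, ← op_mul, ← op_one, ← op_zero, ← apply_ite op, ← op_sub, ← op_mul]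
    congr 1
    rw [mul_sub, h1]
    by_cases hij : i = j
    · subst hij; simp
    · simp [hij, Ne.symm hij]
  case x_psi' μ ρ i j =>
    have h1 : QH.gen k β (.x μ.length) * QH.gen k β (.psi μ.length) *
        QH.gen k β (.e (μ ++ j :: i :: ρ)) = (QH.gen k β (.psi μ.length) *
          QH.gen k β (.x (μ.length + 1)) -
          if j = i then 1 else 0) * QH.gen k β (.e (μ ++ j :: i :: ρ)) := QH.x_mul_psi μ ρ j i
    rw [mul_assoc, psi_e, ← mul_assoc, x_e, mul_assoc, sub_mul, mul_assoc,
      x_e, ← mul_assoc (QH.gen k β (.psi μ.length)), psi_e, mul_assoc] at h1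
    rw [← op_mul, ← op_mul, ← op_mul, ← op_one, ← op_zero, ← apply_ite op, ← op_add, ← op_mul]
    congr 1
    rw [mul_add, h1]
    by_cases hij : i = j
    · subst hij; simp
    · simp [hij, Ne.symm hij]
  case psi_sq μ ρ i j =>
    have h1 : QH.gen k β (.psi μ.length) * QH.gen k β (.psi μ.length) *
        QH.gen k β (.e (μ ++ i :: j :: ρ)) = qEval i j (QH.gen k β (.x μ.length))
          (QH.gen k β (.x (μ.length + 1))) * QH.gen k β (.e (μ ++ i :: j :: ρ)) :=
      QH.psi_mul_self μ ρ i j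
    rw [mul_assoc, psi_e, ← mul_assoc, psi_e, mul_assoc,
      (qEval_commute i j (x_e _ _) (x_e _ _)).eq] at h1
    rw [qEval_op i j (x_x _ _), ← op_mul, ← op_mul, ← op_mul, h1]
  case braid μ ρ i j l =>
    have h1 : (QH.gen k β (.psi (μ.length + 1)) * QH.gen k β (.psi μ.length) *
        QH.gen k β (.psi (μ.length + 1)) - QH.gen k β (.psi μ.length) *
        QH.gen k β (.psi (μ.length + 1)) * QH.gen k β (.psi μ.length)) *
        QH.gen k β (.e (μ ++ l :: j :: i :: ρ)) =
        (if l = i then qDivDiff l j (QH.gen k β (.x μ.length)) (QH.gen k β (.x (μ.length + 1)))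
          (QH.gen k β (.x (μ.length + 2))) else 0) * QH.gen k β (.e (μ ++ l :: j :: i :: ρ)) :=
      QH.braid μ ρ l j i
    have h2 : QH.gen k β (.psi (μ.length + 1)) * QH.gen k β (.psi μ.length) *
        QH.gen k β (.psi (μ.length + 1)) * QH.gen k β (.e (μ ++ l :: j :: i :: ρ)) =
        QH.gen k β (.e (μ ++ i :: j :: l :: ρ)) * (QH.gen k β (.psi (μ.length + 1)) *
          (QH.gen k β (.psi μ.length) * QH.gen k β (.psi (μ.length + 1)))) := by
      rw [mul_assoc, psi_e', ← mul_assoc, mul_assoc _ (QH.gen k β (.psi μ.length)), psi_e,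
        ← mul_assoc, psi_e', mul_assoc, mul_assoc]
    have h3 : QH.gen k β (.psi μ.length) * QH.gen k β (.psi (μ.length + 1)) *
        QH.gen k β (.psi μ.length) * QH.gen k β (.e (μ ++ l :: j :: i :: ρ)) =
        QH.gen k β (.e (μ ++ i :: j :: l :: ρ)) * (QH.gen k β (.psi μ.length) *
          (QH.gen k β (.psi (μ.length + 1)) * QH.gen k β (.psi μ.length))) := by
      rw [mul_assoc, psi_e, ← mul_assoc, mul_assoc _ (QH.gen k β (.psi (μ.length + 1))), psi_e',
        ← mul_assoc, psi_e, mul_assoc, mul_assoc]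
    rw [sub_mul, h2, h3, ← mul_sub] at h1
    rw [qDivDiff_op i j (x_x _ _) (x_x _ _) (x_x _ _), ← op_zero, ← apply_ite op]
    simp only [← op_mul, ← op_sub]
    rw [h1]
    by_cases hil : i = l
    · subst hil
      rw [if_pos rfl, (qDivDiff_commute i j (x_e _ _) (x_e _ _) (x_e _ _)).eq]
    · rw [if_neg hil, if_neg (Ne.symm hil), zero_mul, mul_zero]

variable (k β) in
/-- The anti-involution of the quiver Hecke algebra that fixes the generators. -/
def anti : QH k β →ₐ[k] (QH k β)ᵐᵒᵖ := QH.lift (fun s => op (QH.gen k β s)) op_gen_rel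

lemma anti_gen (s : Gen ℓ) : anti k β (QH.gen k β s) = op (QH.gen k β s) := QH.lift_gen _ _ s

lemma anti_psiWord (w : List ℕ) :
    anti k β (QH.psiWord k β w) = op (QH.psiWord k β w.reverse) := by
  induction w with
  | nil => simp [QH.psiWord_nil]
  | cons i w ih =>
    rw [QH.psiWord_cons, map_mul, ih, List.reverse_cons, QH.psiWord_append, QH.psiWord_singleton,
      op_mul, QH.psi, anti_gen]

lemma anti_anti (a : QH k β) : unop (anti k β (unop (anti k β a))) = a := by
  induction a using QH.induction with
  | hgen s => rw [anti_gen, unop_op, anti_gen, unop_op]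
  | hc c => simp
  | hadd a b ha hb => simp [ha, hb]
  | hmul a b ha hb => simp [ha, hb]

variable (k β) in
/-- The dual of the regular representation, made into a left module by the anti-involution. -/
def dualRep : QH k β →ₐ[k] Module.End k (QH k β →ₗ[k] k) where
  toFun a := LinearMap.lcomp k k (LinearMap.mulLeft k (unop (anti k β a)))
  map_one' := by ext; simp
  map_mul' a b := by ext; simp
  map_zero' := by ext; simp
  map_add' a b := by ext; simp [add_mul]
  commutes' c := by ext; simp [← Algebra.smul_def]

lemma dualRep_apply (a : QH k β) (φ : QH k β →ₗ[k] k) (c : QH k β) :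
    dualRep k β a φ c = φ (unop (anti k β a) * c) := rfl

end Anti

/-! ### Unitriangular systems of equations -/

section Unitriangular

variable {k : Type*} [CommRing k] {ι : Type*} [Fintype ι] {ht : ι → ℕ} {P : ι → ι → k}

/-- Back substitution in the direction of decreasing height: for j ≠ i, the entry P i j can be
nonzero only if ht i < ht j. After n steps the equations of height at least N − n hold. -/
lemma exists_solution (h1 : ∀ i, P i i = 1) (h0 : ∀ i j, j ≠ i → ht j ≤ ht i → P i j = 0)
    (b : ι → k) : ∃ c : ι → k, ∀ i, ∑ j, P i j * c j = b i := by
  have hmax : ∃ N, ∀ i, ht i < N :=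
    ⟨Finset.univ.sup ht + 1, fun i => Nat.lt_succ_of_le (Finset.le_sup (Finset.mem_univ i))⟩
  obtain ⟨N, hN⟩ := hmax
  have key : ∀ n ≤ N, ∃ c : ι → k, ∀ i, N - n ≤ ht i → ∑ j, P i j * c j = b i := by
    intro n
    induction n with
    | zero => exact fun _ => ⟨0, fun i hi => by have := hN i; omega⟩
    | succ n ih =>
      intro hn
      obtain ⟨c, hc⟩ := ih (by omega)
      set r : ι → k := fun i => b i - ∑ j, P i j * c j
      -- The correction is supported in height N − (n+1), so it does not disturb the equations of
      -- larger height, and it meets those of its own height only on the diagonal.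
      refine ⟨fun j => c j + if ht j = N - (n + 1) then r j else 0, fun i hi => ?_⟩
      simp only [mul_add, Finset.sum_add_distrib, mul_ite, mul_zero]
      rcases Nat.eq_or_lt_of_le hi with hi' | hi'
      · rw [Finset.sum_eq_single (a := i) (f := fun j => if ht j = N - (n + 1) then P i j * r j else 0)]
        · rw [if_pos hi'.symm, h1]; simp [r]
        · intro j _ hj
          split_ifs with hj'
          · rw [h0 i j hj (by omega), zero_mul]
          · rfl
        · simp
      · rw [Finset.sum_eq_zero (f := fun j => if ht j = N - (n + 1) then P i j * r j else 0),
          add_zero, hc i (by omega)]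
        intro j _
        split_ifs with hj'
        · rw [h0 i j (by rintro rfl; omega) (by omega), zero_mul]
        · rfl
  obtain ⟨c, hc⟩ := key N le_rfl
  exact ⟨c, fun i => hc i (by omega)⟩

/-- The equation of a nonzero c i of maximal height reduces to its diagonal term. -/
lemma eq_zero_of_solution (h1 : ∀ i, P i i = 1) (h0 : ∀ i j, j ≠ i → ht j ≤ ht i → P i j = 0)
    (c : ι → k) (hc : ∀ i, ∑ j, P i j * c j = 0) : c = 0 := by
  classical
  by_contra hne
  obtain ⟨i, hi⟩ : ∃ i, c i ≠ 0 := by by_contra h; push Not at h; exact hne (funext h)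
  obtain ⟨i, hi, hmax⟩ := Finset.exists_max_image (Finset.univ.filter fun i => c i ≠ 0) ht
    ⟨i, by simpa using hi⟩
  have h2 := hc i
  rw [Finset.sum_eq_single i, h1, one_mul] at h2
  · simp [h2] at hi
  · intro j _ hj
    by_cases hcj : c j = 0
    · rw [hcj, mul_zero]
    · rw [h0 i j hj (hmax j (by simpa using hcj)), zero_mul]
  · simp

end Unitriangular

/-! ### Complementary Grassmannian words and the integral copy of the joint segment -/

section Duality

variable (ℓ : ℕ∞) (a : ℤ) (l₁ l₂ : ℕ)

/-- The left ideal whose quotient is the convolution product of two segments. -/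
def swapIdeal (k : Type u) [CommRing k] :
    Submodule (QH k (segRoot ℓ a (l₁ + l₂))) (QH k (segRoot ℓ a (l₁ + l₂))) :=
  Submodule.span _ ({1 - QH.e k _ (segWord ℓ (a + l₁) l₂ ++ segWord ℓ a l₁)} ∪
    Set.range (QH.x k _) ∪ {z | ∃ r, r + 1 ≠ l₂ ∧ z = QH.psi k _ r})

/-- The cyclic module defined by the relations of the convolution product of two segments. -/
abbrev SwapQuot (k : Type u) [CommRing k] : Type u :=
  QH k (segRoot ℓ a (l₁ + l₂)) ⧸ swapIdeal ℓ a l₁ l₂ k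

/-- The action on `SwapQuot`. -/
def swapRep (k : Type u) [CommRing k] : QH k (segRoot ℓ a (l₁ + l₂)) →ₐ[k]
    Module.End k (SwapQuot ℓ a l₁ l₂ k) :=
  Algebra.lsmul k k _

/-- The generator of `SwapQuot`. -/
def swapGen (k : Type u) [CommRing k] : SwapQuot ℓ a l₁ l₂ k := Submodule.Quotient.mk 1

variable {ℓ a l₁ l₂} {k : Type u} [CommRing k]

lemma swapRep_gen (b : QH k (segRoot ℓ a (l₁ + l₂))) :
    swapRep ℓ a l₁ l₂ k b (swapGen ℓ a l₁ l₂ k) = Submodule.Quotient.mk b := by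
  change b • (Submodule.Quotient.mk 1 : SwapQuot ℓ a l₁ l₂ k) = _
  rw [← Submodule.Quotient.mk_smul, smul_eq_mul, mul_one]

lemma swapRep_gen_eq_zero {b : QH k (segRoot ℓ a (l₁ + l₂))} (h : b ∈ swapIdeal ℓ a l₁ l₂ k) :
    swapRep ℓ a l₁ l₂ k b (swapGen ℓ a l₁ l₂ k) = 0 := by
  rw [swapRep_gen, Submodule.Quotient.mk_eq_zero]; exact h

lemma isEigen_swapGen : IsEigen (swapRep ℓ a l₁ l₂ k) (swapGen ℓ a l₁ l₂ k) where
  weight := ⟨segWord ℓ (a + l₁) l₂ ++ segWord ℓ a l₁, by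
    have h := swapRep_gen_eq_zero (k := k)
      (Submodule.subset_span (Or.inl (Or.inl rfl)) : 1 - QH.e k _ (segWord ℓ (a + l₁) l₂ ++
        segWord ℓ a l₁) ∈ swapIdeal ℓ a l₁ l₂ k)
    rw [map_sub, map_one, LinearMap.sub_apply, sub_eq_zero] at h
    exact h.symm⟩
  x r := ⟨0, by
    rw [zero_smul]
    exact swapRep_gen_eq_zero (Submodule.subset_span (Or.inl (Or.inr ⟨r, rfl⟩)))⟩

lemma swapRep_psi_gen (r : ℕ) (hr : r + 1 ≠ l₂) :
    swapRep ℓ a l₁ l₂ k (QH.psi k _ r) (swapGen ℓ a l₁ l₂ k) = 0 :=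
  swapRep_gen_eq_zero (Submodule.subset_span (Or.inr ⟨r, hr, rfl⟩))

/-- The finite type of Grassmannian codes. -/
abbrev Codes (l₂ l₁ : ℕ) : Type := {es : List ℕ // GrassmannCode l₂ l₁ es}

instance (l₂ l₁ : ℕ) : Finite (Codes l₂ l₁) := by
  have h : ({es | GrassmannCode l₂ l₁ es} : Set (List ℕ)).Finite := by
    refine ((List.finite_length_eq (Fin (l₁ + 1)) l₂).image (List.map Fin.val)).subset ?_
    intro es hes
    refine ⟨es.pmap (fun e h => ⟨e, h⟩) fun e he => Nat.lt_succ_of_le (hes.le e he), ?_, ?_⟩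
    · simpa using hes.length_eq
    · simp [List.map_pmap]
  exact h.to_subtype

variable [Fact (2 ≤ ℓ)]

lemma segCharacter_gen (s : Gen ℓ) (m : ℕ) :
    segCharacter ℓ k a m (QH.gen k _ s) = segScalar ℓ k a m s := QH.lift_gen _ _ s

lemma segCharacter_psiWord {w : List ℕ} (hw : w ≠ []) (m : ℕ) :
    segCharacter ℓ k a m (QH.psiWord k _ w) = 0 := by
  cases w with
  | nil => exact absurd rfl hw
  | cons i w =>
    rw [QH.psiWord_cons, map_mul, QH.psi, segCharacter_gen]
    simp [segScalar]

variable (f : QH k (segRoot ℓ a (l₁ + l₂)) →ₗ[k] k)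
  (fx : ∀ r c, f (QH.x k _ r * c) = 0) (fpsi : ∀ r c, r + 1 ≠ l₁ → f (QH.psi k _ r * c) = 0)
  (fe : ∀ ν c, f (QH.e k _ ν * c) = if ν = segWord ℓ a (l₁ + l₂) then f c else 0)
  (fx' : ∀ r c, f (c * QH.x k _ r) = 0) (fpsi' : ∀ r c, r + 1 ≠ l₂ → f (c * QH.psi k _ r) = 0)
  (fe' : ∀ ν c, f (c * QH.e k _ ν) =
    if ν = segWord ℓ (a + l₁) l₂ ++ segWord ℓ a l₁ then f c else 0)
  (fshort : ∀ w : List ℕ, w.length < l₂ * l₁ → f (QH.psiWord k _ w) = 0)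
  (ftop : f (QH.psiWord k _ (blockWord l₂ l₁)) = 1)

-- The vector V is found as the solution of a linear system: the functional b ↦ f(b V) must take the
-- values of the segment character on the words that complete Grassmannian words to the longest one.
-- The left-hand properties of f force the two functionals to agree everywhere. The pairing defined
-- by f is nondegenerate, so V itself transforms by the character modulo `swapIdeal`.
include fx fpsi fe fx' fpsi' fe' fshort ftop in
lemma swap_vector_of_functional [Nontrivial k] : ∃ V : QH k (segRoot ℓ a (l₁ + l₂)),
    V - QH.psiWord k _ (blockWord l₂ l₁) ∈ Submodule.span k {z | ∃ w : List ℕ,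
      w.Sublist (blockWord l₂ l₁) ∧ w ≠ blockWord l₂ l₁ ∧ z = QH.psiWord k _ w} ∧
    ∀ b, b * V - segCharacter ℓ k a (l₁ + l₂) b • V ∈ swapIdeal ℓ a l₁ l₂ k := by
  classical
  set ρ := swapRep ℓ a l₁ l₂ k with hρ
  set m := swapGen ℓ a l₁ l₂ k with hm
  have hcard : (segRoot ℓ a (l₁ + l₂)).card = l₂ + l₁ := by rw [card_segRoot, add_comm]
  have hE : IsEigen ρ m := isEigen_swapGen
  have hpsi : ∀ i, i + 1 ≠ l₂ → ρ (QH.psi k _ i) m = 0 := swapRep_psi_gen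
  -- the functional on the quotient
  have fJ : ∀ z ∈ swapIdeal ℓ a l₁ l₂ k, f z = 0 := by
    intro z hz
    have : ∀ c, f (c * z) = 0 := by
      refine Submodule.span_induction (p := fun z _ => ∀ c, f (c * z) = 0) ?_ (by simp) ?_ ?_ hz
      · rintro _ ((rfl | ⟨r, rfl⟩) | ⟨r, hr, rfl⟩) c
        · rw [mul_sub, map_sub, mul_one, fe', if_pos rfl, sub_self]
        · exact fx' r c
        · exact fpsi' r c hr
      · intro x y _ _ hx hy c; rw [mul_add, map_add, hx, hy, add_zero]
      · intro d x _ hx c; rw [smul_eq_mul, ← mul_assoc, hx]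
    simpa using this 1
  let π : SwapQuot ℓ a l₁ l₂ k →ₗ[k] k :=
    ((swapIdeal ℓ a l₁ l₂ k).restrictScalars k).liftQ f fun z hz => fJ z hz
  have hπ : ∀ b, π (ρ b m) = f b := by
    intro b
    rw [hρ, hm, swapRep_gen]
    rfl
  have πfilt : ∀ N, N < l₂ * l₁ → ∀ v ∈ filt ρ m N, π v = 0 := by
    intro N hN v hv
    have : filt ρ m N ≤ LinearMap.ker π := filt_le fun w hw => by
      rw [LinearMap.mem_ker, hπ]; exact fshort w (by omega)
    exact this hv
  have πtop : ∀ w, w ≈ᵇ blockWord l₂ l₁ → π (ρ (QH.psiWord k _ w) m) = 1 := by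
    intro w hw
    have hl := hw.length_eq
    rw [length_blockWord] at hl
    rcases Nat.eq_zero_or_pos (l₂ * l₁) with h0 | h0
    · have e1 : w = [] := List.length_eq_zero_iff.1 (by omega)
      have e2 : blockWord l₂ l₁ = [] := List.length_eq_zero_iff.1 (by simp; simpa using h0)
      rw [e1, ← e2, hπ, ftop]
    · have h1 := hE.sub_mem_of_weq hw (N := l₂ * l₁ - 1) (by omega)
      have h2 := πfilt _ (by omega) _ h1
      rw [map_sub, sub_eq_zero, hπ _, hπ _] at h2
      rw [hπ, h2, ftop]
  -- the pairing
  have : Fintype (Codes l₂ l₁) := Fintype.ofFinite _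
  choose y hy using fun es : Codes l₂ l₁ => es.2.exists_completion
  have hlen : ∀ es : Codes l₂ l₁, (y es).length + es.1.sum = l₂ * l₁ := by
    intro es
    have := (hy es).length_eq
    simpa using this
  have hlt : ∀ {w : List ℕ}, w ≈ᵇ blockWord l₂ l₁ → ∀ i ∈ w, i + 1 < l₂ + l₁ :=
    fun h i hi => lt_of_mem_blockWord ((h.mem_iff _).1 hi)
  let P : Codes l₂ l₁ → Codes l₂ l₁ → k := fun i j =>
    f (QH.psiWord k _ (y i) * QH.psiWord k _ (nf 0 j.1))
  have P1 : ∀ i, P i i = 1 := by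
    intro i
    change f _ = 1
    rw [← QH.psiWord_append, ← hπ]
    exact πtop _ (hy i)
  have P0 : ∀ i j : Codes l₂ l₁, j ≠ i → j.1.sum ≤ i.1.sum → P i j = 0 := by
    intro i j hij hle
    change f _ = 0
    rw [← QH.psiWord_append]
    have hi := hlen i
    have hl : (y i ++ nf 0 j.1).length = (y i).length + j.1.sum := by simp
    rcases Nat.eq_or_lt_of_le hle with h | h
    -- The word has the length of the longest Grassmannian word. If it is equivalent to that one,
    -- cancelling y i identifies the permutations of j and i; otherwise it gives shorter terms,
    -- which π kills.
    · rcases hE.grassmann_dichotomy hcard hpsi (y i ++ nf 0 j.1) with ⟨es, h1, h2⟩ | ⟨N, h1, h2⟩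
      · have h3 := h2.length_eq
        rw [hl, length_nf] at h3
        rw [h1.eq_replicate (by omega), ← blockWord_eq_nf] at h2
        have h4 := (h2.trans (hy i).symm).wordPerm_eq (hlt h2)
        rw [wordPerm_append, wordPerm_append, mul_right_inj] at h4
        exact absurd (Subtype.ext (j.2.eq_of_wordPerm_eq i.2 h4)) hij
      · rw [← hπ]
        exact πfilt N (by omega) _ h2
    · exact fshort _ (by omega)
  let top : Codes l₂ l₁ := ⟨_, grassmannCode_replicate l₂ l₁⟩
  have htop : nf 0 top.1 = blockWord l₂ l₁ := (blockWord_eq_nf _ _).symm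
  have htops : top.1.sum = l₂ * l₁ := by simp [top]
  -- The right-hand side is the segment character evaluated at ψ_{y i}: the completion y i is empty
  -- precisely for the longest code.
  obtain ⟨c, hc⟩ := exists_solution P1 P0 fun i => if i = top then 1 else 0
  have hmaxtop : ∀ j : Codes l₂ l₁, j ≠ top → j.1.sum < l₂ * l₁ := by
    intro j hj
    by_contra h
    exact hj (Subtype.ext (j.2.eq_replicate (by omega)))
  have hctop : c top = 1 := by
    have h1 := hc top
    rw [Finset.sum_eq_single top, P1, one_mul, if_pos rfl] at h1
    · exact h1
    · intro j _ hj
      rw [P0 top j hj (by rw [htops]; exact (hmaxtop j hj).le), zero_mul]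
    · simp
  set V := ∑ j, c j • QH.psiWord k (segRoot ℓ a (l₁ + l₂)) (nf 0 j.1) with hV
  refine ⟨V, ?_, ?_⟩
  · rw [hV, ← Finset.add_sum_erase _ _ (Finset.mem_univ top), hctop, one_smul, htop,
      add_sub_cancel_left]
    refine Submodule.sum_mem _ fun j hj => Submodule.smul_mem _ _ (Submodule.subset_span
      ⟨_, j.2.sublist, fun h => ?_, rfl⟩)
    have h1 := hmaxtop j (Finset.ne_of_mem_erase hj)
    rw [← length_nf 0, h, length_blockWord] at h1
    omega
  -- the character of the vector
  set θ : QH k (segRoot ℓ a (l₁ + l₂)) →ₗ[k] k := f ∘ₗ LinearMap.mulRight k V with hθ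
  have hθ' : ∀ b, θ b = f (b * V) := fun _ => rfl
  have θy : ∀ i : Codes l₂ l₁, θ (QH.psiWord k _ (y i)) = if i = top then 1 else 0 := by
    intro i
    rw [hθ', hV, Finset.mul_sum, map_sum, ← hc i]
    refine Finset.sum_congr rfl fun j _ => ?_
    rw [mul_smul_comm, map_smul, smul_eq_mul, mul_comm]
  set χ := segCharacter ℓ k a (l₁ + l₂) with hχ
  have hχg : ∀ s, χ (QH.gen k _ s) = segScalar ℓ k a (l₁ + l₂) s := fun s => segCharacter_gen s _
  -- The aim is g = 0. In the dual of the regular module, g is an eigenvector killed by all ψ_r with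
  -- r + 1 ≠ l₁, so Grassmannian words suffice again, with l₁ and l₂ exchanged.
  set g : QH k (segRoot ℓ a (l₁ + l₂)) →ₗ[k] k := θ - χ.toLinearMap with hg
  have hg' : ∀ b, g b = f (b * V) - χ b := fun _ => rfl
  set D := dualRep k (segRoot ℓ a (l₁ + l₂)) with hD
  have gE : IsEigen D g := by
    constructor
    · refine ⟨segWord ℓ a (l₁ + l₂), LinearMap.ext fun b => ?_⟩
      rw [hD, dualRep_apply, QH.e, anti_gen, MulOpposite.unop_op, hg', hg', mul_assoc, map_mul χ,
        hχg]
      have := fe (segWord ℓ a (l₁ + l₂)) (b * V)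
      rw [QH.e] at this
      rw [this]
      simp [segScalar]
    · refine fun r => ⟨0, LinearMap.ext fun b => ?_⟩
      rw [hD, dualRep_apply, QH.x, anti_gen, MulOpposite.unop_op, hg', mul_assoc, map_mul χ, hχg]
      have := fx r (b * V)
      rw [QH.x] at this
      rw [this]
      simp [segScalar]
  have gpsi : ∀ i, i + 1 ≠ l₁ → D (QH.psi k _ i) g = 0 := by
    intro r hr
    refine LinearMap.ext fun b => ?_
    rw [hD, dualRep_apply, QH.psi, anti_gen, MulOpposite.unop_op, hg', mul_assoc, map_mul χ, hχg]
    have := fpsi r (b * V) hr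
    rw [QH.psi] at this
    rw [this]
    simp [segScalar]
  have hDg : ∀ w : List ℕ, D (QH.psiWord k _ w) g 1 = g (QH.psiWord k _ w.reverse) := by
    intro w
    rw [hD, dualRep_apply, anti_psiWord, MulOpposite.unop_op, mul_one]
  have key : ∀ n (w : List ℕ), w.length = n → D (QH.psiWord k _ w) g 1 = 0 := by
    intro n
    induction n using Nat.strong_induction_on with
    | _ n ih =>
      intro w hw
      have low : ∀ N, N < n → ∀ φ ∈ filt D g N, φ 1 = 0 := by
        intro N hN φ hφ
        have : filt D g N ≤ LinearMap.ker (LinearMap.applyₗ (1 : QH k (segRoot ℓ a (l₁ + l₂)))) :=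
          filt_le fun w hw => by
            rw [LinearMap.mem_ker, LinearMap.applyₗ_apply_apply]
            exact ih _ (by omega) w rfl
        exact this hφ
      have same : ∀ {w w' : List ℕ}, w ≈ᵇ w' → w.length = n →
          D (QH.psiWord k _ w) g 1 = D (QH.psiWord k _ w') g 1 := by
        intro w w' h hw
        have hl := h.length_eq
        rcases Nat.eq_zero_or_pos n with h0 | h0
        · rw [List.length_eq_zero_iff.1 (show w.length = 0 by omega),
            List.length_eq_zero_iff.1 (show w'.length = 0 by omega)]
        · have h1 := low (n - 1) (by omega) _ (gE.sub_mem_of_weq h (N := n - 1) (by omega))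
          rwa [LinearMap.sub_apply, sub_eq_zero] at h1
      rcases gE.grassmann_dichotomy (by rw [hcard, add_comm]) gpsi w with
        ⟨es, h1, h2⟩ | ⟨N, h1, h2⟩
      · rw [same h2 hw]
        obtain ⟨z, hz⟩ := h1.exists_completion
        -- Reversal exhibits (nf 0 es).reverse as a left factor of the longest word. The
        -- complementary factor has to be Grassmannian, say of code es', and then the left factor
        -- agrees with y es' up to braid moves. On these words the values of g are known.
        have h3 : (nf 0 es).reverse ++ z.reverse ≈ᵇ blockWord l₂ l₁ := by
          rw [← List.reverse_append]
          exact hz.reverse.trans (reverse_blockWord l₁ l₂)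
        have hl3 := h3.length_eq
        rw [List.length_append, length_blockWord] at hl3
        rcases hE.grassmann_dichotomy hcard hpsi z.reverse with ⟨es', h4, h5⟩ | ⟨N, h4, h5⟩
        · have h6 := hy ⟨es', h4⟩
          have h7 : (nf 0 es).reverse ++ nf 0 es' ≈ᵇ blockWord l₂ l₁ :=
            (h5.symm.append_left _).trans h3
          have hl7 := h7.length_eq
          have hl6 := h6.length_eq
          have h8 : wordPerm (l₂ + l₁) (nf 0 es).reverse = wordPerm (l₂ + l₁) (y ⟨es', h4⟩) := by
            have := (h7.trans h6.symm).wordPerm_eq (hlt h7)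
            rwa [wordPerm_append, wordPerm_append, mul_left_inj] at this
          rcases weq_or_drop (fun i hi => hlt h7 i (by simp [hi]))
              (fun i hi => hlt h6 i (by simp [hi])) h8 (by
            simp only [List.length_append, length_nf] at hl6 hl7 ⊢; omega) with h9 | ⟨h9, -⟩
          · have h10 : nf 0 es ≈ᵇ (y ⟨es', h4⟩).reverse := by simpa using h9.reverse
            have hl10 := h10.length_eq
            have hl2 := h2.length_eq
            rw [same h10 (by omega), hDg, List.reverse_reverse, hg', ← hθ', θy]
            split_ifs with h11
            · have : y ⟨es', h4⟩ = [] := by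
                refine List.length_eq_zero_iff.1 ?_
                have := hlen ⟨es', h4⟩
                rw [h11] at this ⊢
                omega
              rw [this, QH.psiWord_nil, map_one, sub_self]
            · have h12 : y ⟨es', h4⟩ ≠ [] := by
                intro h12
                have h13 : (y ⟨es', h4⟩).length + es'.sum = l₂ * l₁ := hlen ⟨es', h4⟩
                have h14 : es'.sum < l₂ * l₁ := hmaxtop _ h11
                rw [h12, List.length_nil] at h13
                omega
              rw [hχ, segCharacter_psiWord h12, sub_zero]
          -- The longest word would be a combination of shorter ones, on which π vanishes; but π
          -- takes the value 1 on it.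
          · exfalso
            have h10 : Drop ((nf 0 es).reverse ++ nf 0 es') := h9.append_right _
            have h11 : 0 < l₂ * l₁ := by
              obtain ⟨_, _, _, h⟩ := h10
              have h12 := h.length_eq
              rw [length_blockWord] at hl7
              rw [hl7] at h12
              simp at h12
              omega
            have h12 := hE.mem_of_drop h10 (N := l₂ * l₁ - 1) (by
              rw [hl7, length_blockWord]; omega)
            have h13 := πfilt _ (by omega) _ h12
            rw [πtop _ h7] at h13
            exact one_ne_zero h13
        · exfalso
          have h6 := psiWord_filt_mem h5 (nf 0 es).reverse le_rfl
          rw [← rep_mul, ← QH.psiWord_append] at h6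
          have h7 := πfilt _ (by omega) _ h6
          rw [πtop _ h3] at h7
          exact one_ne_zero h7
      · exact low N (by omega) _ h2
  have g0 : ∀ b, g b = 0 := by
    intro b
    obtain ⟨n, hn⟩ := gE.exists_mem_filt (MulOpposite.unop (anti k _ b))
    have h1 : filt D g n ≤ LinearMap.ker (LinearMap.applyₗ (1 : QH k (segRoot ℓ a (l₁ + l₂)))) :=
      filt_le fun w hw => by
        rw [LinearMap.mem_ker, LinearMap.applyₗ_apply_apply]
        exact key _ w rfl
    have h2 := h1 hn
    rw [LinearMap.mem_ker, LinearMap.applyₗ_apply_apply, hD, dualRep_apply, anti_anti, mul_one] at h2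
    exact h2
  -- injectivity
  intro b
  have hz : Submodule.Quotient.mk (b * V - χ b • V) = ρ (b * V - χ b • V) m := by
    rw [hρ, hm, swapRep_gen]
  rw [← Submodule.Quotient.mk_eq_zero, hz]
  obtain ⟨n, hn⟩ := hE.exists_mem_filt (b * V - χ b • V)
  have h1 := hE.filt_le_grassmann hcard hpsi n hn
  have h2 : ∃ d : Codes l₂ l₁ → k, ρ (b * V - χ b • V) m =
      ∑ j, d j • ρ (QH.psiWord k _ (nf 0 j.1)) m := by
    refine Submodule.span_induction (p := fun z _ => ∃ d : Codes l₂ l₁ → k, z =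
      ∑ j, d j • ρ (QH.psiWord k _ (nf 0 j.1)) m) ?_ ⟨0, by simp⟩ ?_ ?_ h1
    · rintro _ ⟨es, he, -, rfl⟩
      exact ⟨Pi.single ⟨es, he⟩ 1, by simp [Pi.single_apply, Finset.sum_ite_eq']⟩
    · rintro _ _ _ _ ⟨d, rfl⟩ ⟨d', rfl⟩
      exact ⟨d + d', by simp [add_smul, Finset.sum_add_distrib]⟩
    · rintro r _ _ ⟨d, rfl⟩
      exact ⟨r • d, by simp [Finset.smul_sum, mul_smul]⟩
  obtain ⟨d, hd⟩ := h2
  -- Pairing with ψ_{y i} gives θ(ψ_{y i} b) − χ(b) θ(ψ_{y i}), which is 0 because θ = χ is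
  -- multiplicative.
  have h3 : d = 0 := by
    refine eq_zero_of_solution P1 P0 d fun i => ?_
    have h4 : π (ρ (QH.psiWord k _ (y i)) (ρ (b * V - χ b • V) m)) = 0 := by
      have e1 := g0 (QH.psiWord k _ (y i) * b)
      have e2 := g0 (QH.psiWord k _ (y i))
      rw [hg', sub_eq_zero] at e1 e2
      rw [← rep_mul, hπ, mul_sub, map_sub, ← mul_assoc, e1, mul_smul_comm, map_smul, e2,
        map_mul χ, smul_eq_mul, mul_comm, sub_self]
    rw [hd] at h4
    simp only [map_sum, map_smul, ← rep_mul, hπ] at h4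
    rw [← h4]
    refine Finset.sum_congr rfl fun j _ => ?_
    rw [smul_eq_mul, mul_comm]
  rw [hd, h3]
  simp

variable (ℓ a l₁ l₂) in
/-- The convolution product of two segments contains a vector that spans a copy of the joint
segment, and whose leading term is the longest Grassmannian word. -/
theorem exists_swap_vector : ∃ V : QH ℤ (segRoot ℓ a (l₁ + l₂)),
    V - QH.psiWord ℤ _ (blockWord l₂ l₁) ∈ Submodule.span ℤ {z | ∃ w : List ℕ,
      w.Sublist (blockWord l₂ l₁) ∧ w ≠ blockWord l₂ l₁ ∧ z = QH.psiWord ℤ _ w} ∧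
    ∀ b, b * V - segCharacter ℓ ℤ a (l₁ + l₂) b • V ∈ swapIdeal ℓ a l₁ l₂ ℤ := by
  obtain ⟨f, fx, fpsi, fe, fx', fpsi', fe', fshort, ftop⟩ := exists_functional ℓ a l₁ l₂
  have hsmul : ∀ (c : ℤ) (z : QH ℤ (segRoot ℓ a (l₁ + l₂))), f (c • z) = c • f z := by
    intro c z
    rw [Algebra.smul_def, eq_intCast, ← zsmul_eq_mul, map_zsmul]
  exact swap_vector_of_functional ⟨f.toAddHom, hsmul⟩ fx fpsi fe fx' fpsi' fe' fshort ftop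

end Duality

/-! ### Degrees -/

section Degrees

variable {ℓ : ℕ∞}

lemma form_self_of_end {i : Idx ℓ} (h : i.1 = 0 ∨ (i.1 : ℕ∞) = ℓ) : form i i = 4 := by
  simp [form, symmetriser, cartan, h]

lemma form_self_of_not_end {i : Idx ℓ} (h : ¬ (i.1 = 0 ∨ (i.1 : ℕ∞) = ℓ)) : form i i = 2 := by
  simp [form, symmetriser, cartan, h]

variable [Fact (2 ≤ ℓ)]

lemma form_succ {i j : Idx ℓ} (h : i.1 + 1 = j.1) :
    form i j = (if i.1 = 0 ∨ (j.1 : ℕ∞) = ℓ then -2 else -1) ∧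
      form j i = (if i.1 = 0 ∨ (j.1 : ℕ∞) = ℓ then -2 else -1) := by
  have h1 := (ends_facts ℓ).1
  have h2 : ¬ (i.1 : ℕ∞) = ℓ := fun h' => (ends_facts ℓ).2 i j h' h
  have h3 : ¬ j.1 + 1 = i.1 := by omega
  have h4 : ¬ i.1 = j.1 := by omega
  have h5 : ¬ j.1 = 0 := by omega
  unfold form symmetriser cartan
  by_cases hi : i.1 = 0
  · have hj : j.1 = 1 := by omega
    have h6 : ¬ (j.1 : ℕ∞) = ℓ := by rw [hj]; exact h1
    constructor
    · rw [if_pos (Or.inl hi), if_neg h4, if_neg (by omega), if_neg (by tauto), if_pos (Or.inl h),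
        if_pos (Or.inl hi)]
      norm_num
    · rw [if_neg (by tauto), if_neg (Ne.symm h4), if_pos ⟨hj, hi⟩, if_pos (Or.inl hi)]
      norm_num
  · by_cases hj : (j.1 : ℕ∞) = ℓ
    · constructor
      · rw [if_neg (by tauto), if_neg h4, if_neg (by omega), if_pos ⟨h, hj⟩, if_pos (Or.inr hj)]
        norm_num
      · rw [if_pos (Or.inr hj), if_neg (Ne.symm h4), if_neg (by omega), if_neg (by tauto),
          if_pos (Or.inr h), if_pos (Or.inr hj)]
        norm_num
    · constructor
      · rw [if_neg (by tauto), if_neg h4, if_neg (by omega), if_neg (by tauto), if_pos (Or.inl h),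
          if_neg (by tauto)]
        norm_num
      · rw [if_neg (by tauto), if_neg (Ne.symm h4), if_neg (by omega), if_neg (by tauto),
          if_pos (Or.inr h), if_neg (by tauto)]
        norm_num

omit [Fact (2 ≤ ℓ)] in
lemma form_far {i j : Idx ℓ} (h1 : ¬ i.1 = j.1) (h2 : ¬ i.1 + 1 = j.1) (h3 : ¬ j.1 + 1 = i.1) :
    form i j = 0 := by
  unfold form cartan
  rw [if_neg h1, if_neg (by omega), if_neg (by tauto), if_neg (by omega), mul_zero]

lemma form_comm (i j : Idx ℓ) : form i j = form j i := by
  by_cases h1 : i.1 + 1 = j.1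
  · rw [(form_succ h1).1, (form_succ h1).2]
  by_cases h2 : j.1 + 1 = i.1
  · rw [(form_succ h2).1, (form_succ h2).2]
  by_cases h3 : i.1 = j.1
  · rw [show i = j from Subtype.ext h3]
  rw [form_far h3 h1 h2, form_far (Ne.symm h3) h2 h1]

/-- The polynomials `Q_{ij}` are homogeneous. -/
lemma degree_of_mem_qExponents {i j : Idx ℓ} {m : ℕ × ℕ} (h : m ∈ qExponents i j) :
    m.1 * form i i + m.2 * form j j = -form i j - form j i := by
  have h1 := (ends_facts ℓ).1
  have h2 := (ends_facts ℓ).2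
  have h7 : ∀ {i j : Idx ℓ}, i.1 + 1 = j.1 → ¬ (i.1 : ℕ∞) = ℓ := fun h h' => h2 _ _ h' h
  have h8 : ∀ {i : Idx ℓ}, i.1 = 1 → ¬ (i.1 : ℕ∞) = ℓ := fun h h' => h1 (by rwa [h] at h')
  unfold qExponents at h
  split_ifs at h with a1 a2 a3 a4 a5 a6 a7
  · simp at h
  · rw [(form_succ a2).1, (form_succ a2).2, if_pos (Or.inl a3), form_self_of_end (Or.inl a3),
      form_self_of_not_end (i := j) (by have := h8 (i := j) (by omega); have : j.1 ≠ 0 := by omega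
                                        tauto)]
    simp at h; rcases h with rfl | rfl <;> norm_num
  · rw [(form_succ a2).1, (form_succ a2).2, if_pos (Or.inr a4), form_self_of_end (i := j) (Or.inr a4),
      form_self_of_not_end (i := i) (by have := h7 a2; tauto)]
    simp at h; rcases h with rfl | rfl <;> norm_num
  · rw [(form_succ a2).1, (form_succ a2).2, if_neg (by tauto),
      form_self_of_not_end (i := j) (by have : j.1 ≠ 0 := by omega
                                        tauto),
      form_self_of_not_end (i := i) (by have := h7 a2; tauto)]
    simp at h; rcases h with rfl | rfl <;> norm_num
  · rw [(form_succ a5).1, (form_succ a5).2, if_pos (Or.inl a6), form_self_of_end (i := j) (Or.inl a6),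
      form_self_of_not_end (i := i) (by have := h8 (i := i) (by omega); have : i.1 ≠ 0 := by omega
                                        tauto)]
    simp at h; rcases h with rfl | rfl <;> norm_num
  · rw [(form_succ a5).1, (form_succ a5).2, if_pos (Or.inr a7), form_self_of_end (i := i) (Or.inr a7),
      form_self_of_not_end (i := j) (by have := h7 a5; tauto)]
    simp at h; rcases h with rfl | rfl <;> norm_num
  · rw [(form_succ a5).1, (form_succ a5).2, if_neg (by tauto),
      form_self_of_not_end (i := i) (by have : i.1 ≠ 0 := by omega
                                        tauto),
      form_self_of_not_end (i := j) (by have := h7 a5; tauto)]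
    simp at h; rcases h with rfl | rfl <;> norm_num
  · simp at h
    subst h
    simp [form_far a1 a2 a5, form_far (Ne.symm a1) a5 a2]

end Degrees

/-! ### Twisting by degrees -/

section Twist

variable {ℓ : ℕ∞} {A : Type v} [Ring A] {β : RootCone ℓ} (g : Gen ℓ → A) (t : ℤ → A)

open Gen

variable (β) in
/-- The generators, multiplied by the powers of a central unit given by their degrees. -/
def twistGen : Gen ℓ → A
  | .e ν => g (e ν)
  | .x r => ∑ ν ∈ words β, t (ν[r]?.elim 0 fun i => form i i) * g (x r) * g (e ν)
  | .psi r => ∑ ν ∈ words β,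
      t (ν[r]?.elim 0 fun i => ν[r + 1]?.elim 0 fun j => -form i j) * g (psi r) * g (e ν)

/-- `a'` is `a` multiplied by `t d` on `e(ν)`, and `a` changes the weight `ν` to `ν'`. -/
structure IsTwist (ν ν' : List (Idx ℓ)) (d : ℤ) (a a' : A) : Prop where
  move : a * g (e ν) = g (e ν') * a
  twist : a' * g (e ν) = t d * a * g (e ν)

variable {g t} (H : ∀ a b, Rel β g a b → a = b) (hc : ∀ d s, Commute (t d) (g s)) (h0 : t 0 = 1)
  (hadd : ∀ c d, t (c + d) = t c * t d)

lemma IsTwist.add {ν ν' : List (Idx ℓ)} {d : ℤ} {a a' b b' : A} (h : IsTwist g t ν ν' d a a')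
    (h' : IsTwist g t ν ν' d b b') : IsTwist g t ν ν' d (a + b) (a' + b') :=
  ⟨by rw [add_mul, mul_add, h.move, h'.move], by rw [add_mul, h.twist, h'.twist, mul_add, add_mul]⟩

lemma IsTwist.sub {ν ν' : List (Idx ℓ)} {d : ℤ} {a a' b b' : A} (h : IsTwist g t ν ν' d a a')
    (h' : IsTwist g t ν ν' d b b') : IsTwist g t ν ν' d (a - b) (a' - b') :=
  ⟨by rw [sub_mul, mul_sub, h.move, h'.move], by rw [sub_mul, h.twist, h'.twist, mul_sub, sub_mul]⟩

lemma isTwist_zero (ν ν' : List (Idx ℓ)) (d : ℤ) : IsTwist g t ν ν' d 0 0 := ⟨by simp, by simp⟩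

include h0 in
lemma isTwist_one (ν : List (Idx ℓ)) : IsTwist g t ν ν 0 1 1 := ⟨by simp, by simp [h0]⟩

/-- The device that transfers each relation to the twisted generators: both sides are twists of
equal elements, and homogeneity of the relation is the fact that the degree d is the same on both
sides. -/
lemma IsTwist.eq_mul {ν ν' : List (Idx ℓ)} {d : ℤ} {a a' b b' : A} (h : IsTwist g t ν ν' d a a')
    {ν'' : List (Idx ℓ)} (h' : IsTwist g t ν ν'' d b b') (hab : a * g (e ν) = b * g (e ν)) :
    a' * g (e ν) = b' * g (e ν) := by
  rw [h.twist, h'.twist, mul_assoc, hab, mul_assoc]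

lemma IsTwist.sum {ι : Type*} {s : Finset ι} {ν ν' : List (Idx ℓ)} {d : ℤ} {a a' : ι → A}
    (h : ∀ i ∈ s, IsTwist g t ν ν' d (a i) (a' i)) :
    IsTwist g t ν ν' d (∑ i ∈ s, a i) (∑ i ∈ s, a' i) :=
  ⟨by rw [Finset.sum_mul, Finset.mul_sum]; exact Finset.sum_congr rfl fun i hi => (h i hi).move, by
    rw [Finset.sum_mul, Finset.mul_sum, Finset.sum_mul]
    exact Finset.sum_congr rfl fun i hi => (h i hi).twist⟩

lemma IsTwist.list_sum {ι : Type*} {s : List ι} {ν ν' : List (Idx ℓ)} {d : ℤ} {a a' : ι → A}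
    (h : ∀ i ∈ s, IsTwist g t ν ν' d (a i) (a' i)) :
    IsTwist g t ν ν' d (s.map a).sum (s.map a').sum := by
  induction s with
  | nil => exact isTwist_zero _ _ _
  | cons i s ih => exact (h i (by simp)).add (ih fun j hj => h j (by simp [hj]))

include hc in
lemma commute_twistGen (d : ℤ) (h : ∀ c, Commute (t d) (t c)) (s : Gen ℓ) :
    Commute (t d) (twistGen β g t s) := by
  cases s with
  | e ν => exact hc d _
  | x r => exact Commute.sum_right _ _ _ fun ν _ => ((h _).mul_right (hc d _)).mul_right (hc d _)
  | psi r => exact Commute.sum_right _ _ _ fun ν _ => ((h _).mul_right (hc d _)).mul_right (hc d _)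

include hadd in
lemma commute_t (c d : ℤ) : Commute (t c) (t d) := by
  rw [Commute, SemiconjBy, ← hadd, ← hadd, add_comm]

include hadd in
lemma IsTwist.mul {ν ν' ν'' : List (Idx ℓ)} {d d' : ℤ} {a a' b b' : A}
    (h : IsTwist g t ν ν' d a a') (h' : IsTwist g t ν' ν'' d' b b') (hb' : Commute (t d) b') :
    IsTwist g t ν ν'' (d + d') (b * a) (b' * a') :=
  ⟨by rw [mul_assoc, h.move, ← mul_assoc, h'.move, mul_assoc], by
    rw [mul_assoc, h.twist, mul_assoc, h.move, ← mul_assoc, ← hb'.eq, mul_assoc, ← mul_assoc b',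
      h'.twist, hadd]
    simp only [mul_assoc]
    rw [h.move]⟩

include h0 hadd in
lemma IsTwist.pow {ν : List (Idx ℓ)} {d : ℤ} {a a' : A}
    (h : IsTwist g t ν ν d a a') (ha : ∀ c, Commute (t c) a') (n : ℕ) :
    IsTwist g t ν ν (n * d) (a ^ n) (a' ^ n) := by
  induction n with
  | zero => simpa using isTwist_one h0 ν
  | succ n ih =>
    rw [pow_succ', pow_succ']
    have := ih.mul hadd h (ha _)
    rwa [show (n : ℤ) * d + d = ((n + 1 : ℕ) : ℤ) * d by push_cast; ring] at this

include H

lemma mul_e_of_words (a : A) (ν : List (Idx ℓ)) (d : List (Idx ℓ) → ℤ) :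
    (∑ ν' ∈ words β, t (d ν') * a * g (e ν')) * g (e ν) = t (d ν) * a * g (e ν) := by
  rw [Finset.sum_mul]
  by_cases hν : ν ∈ words β
  · rw [Finset.sum_eq_single ν, mul_assoc, H _ _ (.e_mul_self ν)]
    · intro ν' _ h
      rw [mul_assoc, H _ _ (.e_mul ν' ν h), mul_zero]
    · exact fun h => absurd hν h
  · rw [H _ _ (.e_zero ν fun h => hν ((mem_words _ _).2 h))]
    simp

lemma isTwist_x' (ν : List (Idx ℓ)) (r : ℕ) :
    IsTwist g t ν ν (ν[r]?.elim 0 fun i => form i i) (g (x r)) (twistGen β g t (x r)) where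
  move := H _ _ (.x_e _ _)
  twist := mul_e_of_words H _ _ (fun ν => ν[r]?.elim 0 fun i => form i i)

lemma isTwist_x (μ ρ : List (Idx ℓ)) (i : Idx ℓ) {r : ℕ} (hr : r = μ.length) :
    IsTwist g t (μ ++ i :: ρ) (μ ++ i :: ρ) (form i i) (g (x r)) (twistGen β g t (x r)) := by
  have := isTwist_x' (t := t) H (μ ++ i :: ρ) r
  simpa [hr] using this

lemma isTwist_psi (μ ρ : List (Idx ℓ)) (i j : Idx ℓ) {r : ℕ} (hr : r = μ.length) :
    IsTwist g t (μ ++ i :: j :: ρ) (μ ++ j :: i :: ρ) (-form i j) (g (psi r))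
      (twistGen β g t (psi r)) where
  move := by rw [hr]; exact H _ _ (.psi_e _ _ _ _)
  twist := by
    rw [twistGen, mul_e_of_words H _ _
      (fun ν => ν[r]?.elim 0 fun i => ν[r + 1]?.elim 0 fun j => -form i j)]
    simp [hr]

lemma isTwist_psi' {ν : List (Idx ℓ)} {r : ℕ} (h : r + 1 < ν.length) :
    ∃ ν', IsTwist g t ν ν' (ν[r]?.elim 0 fun i => ν[r + 1]?.elim 0 fun j => -form i j) (g (psi r))
      (twistGen β g t (psi r)) ∧ ν'.length = ν.length ∧
      ∀ s, s ≠ r → s ≠ r + 1 → ν'[s]? = ν[s]? := by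
  obtain ⟨μ, i, j, ρ, rfl, rfl⟩ := exists_split ν r h
  refine ⟨μ ++ j :: i :: ρ, by simpa using isTwist_psi (t := t) H μ ρ i j rfl, by simp, ?_⟩
  intro s h1 h2
  rw [List.getElem?_append, List.getElem?_append]
  split_ifs with h8
  · rfl
  · obtain ⟨n, hn⟩ : ∃ n, s - μ.length = n + 2 := ⟨s - μ.length - 2, by omega⟩
    rw [hn]; rfl

lemma ext_e {a b : A} (h : ∀ ν ∈ words β, a * g (e ν) = b * g (e ν)) : a = b := by
  rw [← mul_one a, ← mul_one b, ← H _ _ .e_sum, Finset.mul_sum, Finset.mul_sum]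
  exact Finset.sum_congr rfl h

variable [Fact (2 ≤ ℓ)]

include hc h0 hadd in
/-- The twisted generators satisfy the relations of the quiver Hecke algebra. -/
lemma twistGen_rel (a b : A) (h : Rel β (twistGen β g t) a b) : a = b := by
  have hct : ∀ d s, Commute (t d) (twistGen β g t s) :=
    fun d s => commute_twistGen hc d (commute_t hadd d) s
  have X := fun {μ ρ : List (Idx ℓ)} {i : Idx ℓ} {r : ℕ} (hr : r = μ.length) =>
    isTwist_x (t := t) H μ ρ i hr
  have Y := fun {μ ρ : List (Idx ℓ)} {i j : Idx ℓ} {r : ℕ} (hr : r = μ.length) =>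
    isTwist_psi (t := t) H μ ρ i j hr
  have len : ∀ ν ∈ words β, ν.length = β.card := fun ν hν => by
    rw [← (mem_words _ _).1 hν, Multiset.coe_card]
  have psi0 : ∀ r, β.card ≤ r + 1 → twistGen β g t (psi r) = 0 := fun r hr => by
    simp [twistGen, H _ _ (.psi_zero r hr)]
  have spl : ∀ (μ ρ : List (Idx ℓ)) (i j : Idx ℓ), μ ++ i :: j :: ρ = (μ ++ [i]) ++ j :: ρ := by simp
  cases h
  case e_zero ν h => exact H _ _ (.e_zero ν h)
  case x_zero r h => simp [twistGen, H _ _ (.x_zero r h)]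
  case psi_zero r h => exact psi0 r h
  case e_mul_self ν => exact H _ _ (.e_mul_self ν)
  case e_mul ν ν' h => exact H _ _ (.e_mul ν ν' h)
  case e_sum => exact H _ _ .e_sum
  case x_e r ν =>
    change twistGen β g t (x r) * g (e ν) = g (e ν) * twistGen β g t (x r)
    have hx := H _ _ (.x_e r ν)
    rw [(isTwist_x' H ν r).twist, twistGen, Finset.mul_sum]
    by_cases hν : ν ∈ words β
    · rw [Finset.sum_eq_single ν]
      · rw [← mul_assoc, ← mul_assoc, ← (hc _ _).eq, mul_assoc (t _) (g (e _)), ← hx, mul_assoc,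
          mul_assoc, mul_assoc, H _ _ (.e_mul_self _)]
      · intro ν' _ h
        rw [← mul_assoc, ← mul_assoc, ← (hc _ _).eq, mul_assoc (t _) (g (e _)), ← hx, mul_assoc,
          mul_assoc, H _ _ (.e_mul _ ν' h.symm), mul_zero, mul_zero]
      · exact fun h => absurd hν h
    · rw [Finset.sum_eq_zero, H _ _ (.e_zero _ fun h => hν ((mem_words _ _).2 h)), mul_zero]
      intro ν' hν'
      rw [← mul_assoc, ← mul_assoc, ← (hc _ _).eq, mul_assoc (t _) (g (e _)), ← hx, mul_assoc,
          mul_assoc, H _ _ (.e_mul _ ν' (by rintro rfl; exact hν hν')), mul_zero, mul_zero]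
  case psi_e μ ρ i j =>
    change twistGen β g t (psi _) * g (e _) = g (e _) * twistGen β g t (psi _)
    have hψ := H _ _ (.psi_e μ ρ i j)
    rw [(Y rfl).twist, twistGen, Finset.mul_sum]
    by_cases hν : μ ++ i :: j :: ρ ∈ words β
    · rw [Finset.sum_eq_single (μ ++ i :: j :: ρ)]
      · rw [← mul_assoc, ← mul_assoc, ← (hc _ _).eq, mul_assoc (t _) (g (e _)), ← hψ, mul_assoc,
          mul_assoc, mul_assoc, H _ _ (.e_mul_self _)]
        simp
      · intro ν' _ h
        rw [← mul_assoc, ← mul_assoc, ← (hc _ _).eq, mul_assoc (t _) (g (e _)), ← hψ, mul_assoc,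
          mul_assoc, H _ _ (.e_mul _ ν' h.symm), mul_zero, mul_zero]
      · exact fun h => absurd hν h
    · rw [Finset.sum_eq_zero, H _ _ (.e_zero _ fun h => hν ((mem_words _ _).2 h)), mul_zero]
      intro ν' hν'
      rw [← mul_assoc, ← mul_assoc, ← (hc _ _).eq, mul_assoc (t _) (g (e _)), ← hψ, mul_assoc,
          mul_assoc, H _ _ (.e_mul _ ν' (by rintro rfl; exact hν hν')), mul_zero, mul_zero]
  case x_x r s =>
    refine ext_e H fun ν hν => ?_
    have h1 := isTwist_x' (t := t) H ν r
    have h2 := isTwist_x' (t := t) H ν s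
    have h3 := h2.mul hadd h1 (hct _ _)
    have h4 := h1.mul hadd h2 (hct _ _)
    rw [add_comm] at h3
    exact h3.eq_mul h4 (by rw [H _ _ (.x_x r s)])
  case psi_x r s hs hs' =>
    refine ext_e H fun ν hν => ?_
    rcases Nat.lt_or_ge (r + 1) ν.length with h | h
    · obtain ⟨ν', h1, -, h2⟩ := isTwist_psi' (t := t) H h
      have h3 := (isTwist_x' (t := t) H ν s).mul hadd h1 (hct _ _)
      have h4 := h1.mul hadd (isTwist_x' (t := t) H ν' s) (hct _ _)
      rw [h2 s hs hs', add_comm] at h4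
      exact h3.eq_mul h4 (by rw [H _ _ (.psi_x _ s hs hs')])
    · rw [psi0 r (by rw [← len _ hν]; exact h)]; simp
  case psi_psi r s hrs =>
    refine ext_e H fun ν hν => ?_
    rcases Nat.lt_or_ge (r + 1) ν.length with h | h
    · rcases Nat.lt_or_ge (s + 1) ν.length with h' | h'
      · obtain ⟨ν', h1, hl1, h2⟩ := isTwist_psi' (t := t) H h
        obtain ⟨ν'', h3, hl3, h4⟩ := isTwist_psi' (t := t) H h'
        obtain ⟨ν₁, h5, -, -⟩ := isTwist_psi' (t := t) (r := s) (ν := ν') H (by omega)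
        obtain ⟨ν₂, h6, -, -⟩ := isTwist_psi' (t := t) (r := r) (ν := ν'') H (by omega)
        have h7 := h1.mul hadd h5 (hct _ _)
        have h8 := h3.mul hadd h6 (hct _ _)
        rw [h2 s (by omega) (by omega), h2 (s + 1) (by omega) (by omega), add_comm] at h7
        rw [h4 r (by omega) (by omega), h4 (r + 1) (by omega) (by omega)] at h8
        exact h8.eq_mul h7 (by rw [H _ _ (.psi_psi r s hrs)])
      · rw [psi0 s (by rw [← len _ hν]; exact h')]; simp
    · rw [psi0 r (by rw [← len _ hν]; exact h)]; simp
  case x_psi μ ρ i j =>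
    have h1 := (Y (ρ := ρ) (i := i) (j := j) rfl).mul hadd (X rfl) (hct _ (x μ.length))
    have h2 := (X (μ := μ ++ [i]) (ρ := ρ) (i := j) (r := μ.length + 1) (by simp))
    rw [← spl] at h2
    have h3 := h2.mul hadd (Y rfl) (hct _ (psi μ.length))
    -- The constant term is present only for i = j, where the degree of the relation is 0.
    have h4 : IsTwist g t (μ ++ i :: j :: ρ) (μ ++ j :: i :: ρ) (form j j + -form i j)
        (if i = j then 1 else 0) (if i = j then 1 else 0) := by
      split_ifs with hij
      · subst hij
        rw [add_neg_cancel]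
        exact isTwist_one h0 _
      · exact isTwist_zero _ _ _
    rw [add_comm (-form i j)] at h1
    exact h1.eq_mul (h3.sub h4) (H _ _ (.x_psi μ ρ i j))
  case x_psi' μ ρ i j =>
    have h1 := (X (μ := μ ++ [j]) (ρ := ρ) (i := i) (r := μ.length + 1) (by simp))
    rw [← spl] at h1
    have h2 := (Y (ρ := ρ) (i := i) (j := j) rfl).mul hadd h1 (hct _ (x (μ.length + 1)))
    have h3 := (X (μ := μ) (ρ := j :: ρ) (i := i) rfl).mul hadd (Y rfl) (hct _ (psi μ.length))
    have h4 : IsTwist g t (μ ++ i :: j :: ρ) (μ ++ j :: i :: ρ) (form i i + -form i j)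
        (if i = j then 1 else 0) (if i = j then 1 else 0) := by
      split_ifs with hij
      · subst hij
        rw [add_neg_cancel]
        exact isTwist_one h0 _
      · exact isTwist_zero _ _ _
    rw [add_comm (-form i j)] at h2
    exact h2.eq_mul (h3.add h4) (H _ _ (.x_psi' μ ρ i j))
  case psi_sq μ ρ i j =>
    have h1 := (Y (ρ := ρ) (i := i) (j := j) rfl).mul hadd (Y rfl) (hct _ (psi μ.length))
    have h2 := (X (μ := μ) (ρ := j :: ρ) (i := i) rfl)
    have h3 := (X (μ := μ ++ [i]) (ρ := ρ) (i := j) (r := μ.length + 1) (by simp))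
    rw [← spl] at h3
    suffices h6 : IsTwist g t (μ ++ i :: j :: ρ) (μ ++ i :: j :: ρ) (-form i j + -form j i)
        (qEval i j (g (x μ.length)) (g (x (μ.length + 1))))
        (qEval i j (twistGen β g t (x μ.length)) (twistGen β g t (x (μ.length + 1)))) from
      h1.eq_mul h6 (H _ _ (.psi_sq μ ρ i j))
    refine IsTwist.list_sum fun m hm => ?_
    have h4 := (h3.pow h0 hadd (fun c => hct c _) m.2).mul hadd
      (h2.pow h0 hadd (fun c => hct c _) m.1) ((hct _ _).pow_right _)
    have h5 := degree_of_mem_qExponents hm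
    rwa [show (m.2 : ℤ) * form j j + m.1 * form i i = -form i j + -form j i by linarith] at h4
  case braid μ ρ i j l =>
    have Y' : ∀ i j l, IsTwist g t (μ ++ i :: j :: l :: ρ) (μ ++ i :: l :: j :: ρ) (-form j l)
        (g (psi (μ.length + 1))) (twistGen β g t (psi (μ.length + 1))) := by
      intro i j l
      have := Y (μ := μ ++ [i]) (ρ := ρ) (i := j) (j := l) (r := μ.length + 1) (by simp)
      simpa using this
    have h1 := ((Y' i j l).mul hadd (Y rfl) (hct _ (psi μ.length)))
    have h1' := h1.mul hadd (Y' l i j) (hct _ _)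
    have h2 := (Y (ρ := l :: ρ) (i := i) (j := j) rfl).mul hadd (Y' j i l) (hct _ _)
    have h2' := h2.mul hadd (Y rfl) (hct _ (psi μ.length))
    rw [← mul_assoc, ← mul_assoc] at h1' h2'
    rw [show -form i j + -form i l + -form j l = -form j l + -form i l + -form i j by ring] at h2'
    have h3 := h1'.sub h2'
    have h4 : IsTwist g t (μ ++ i :: j :: l :: ρ) (μ ++ l :: j :: i :: ρ)
        (-form j l + -form i l + -form i j)
        (if i = l then qDivDiff i j (g (x μ.length)) (g (x (μ.length + 1)))
          (g (x (μ.length + 2))) else 0)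
        (if i = l then qDivDiff i j (twistGen β g t (x μ.length)) (twistGen β g t (x (μ.length + 1)))
          (twistGen β g t (x (μ.length + 2))) else 0) := by
      split_ifs with hil
      · subst hil
        refine IsTwist.list_sum fun m hm => ?_
        rw [Finset.sum_mul, Finset.sum_mul]
        refine IsTwist.sum fun s hs => ?_
        have hs' := Finset.mem_range.1 hs
        have x1 := (X (μ := μ) (ρ := j :: i :: ρ) (i := i) rfl)
        have x2 := (X (μ := μ ++ [i]) (ρ := i :: ρ) (i := j) (r := μ.length + 1) (by simp))
        have x3 := (X (μ := μ ++ [i, j]) (ρ := ρ) (i := i) (r := μ.length + 2) (by simp))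
        simp only [List.append_assoc, List.cons_append, List.nil_append] at x2 x3
        have y3 := x3.pow h0 hadd (fun c => hct c _) (m.1 - 1 - s)
        have y2 := x2.pow h0 hadd (fun c => hct c _) m.2
        have y1 := x1.pow h0 hadd (fun c => hct c _) s
        have z := (y2.mul hadd y3 ((hct _ _).pow_right _)).mul hadd y1 ((hct _ _).pow_right _)
        -- The divided difference has the degree of Q_ij lowered by (α_i, α_i). This agrees with the
        -- degree of the triple products of ψ's, since the outer colours are equal.
        have hd := degree_of_mem_qExponents hm
        have e1 : ((m.1 - 1 - s : ℕ) : ℤ) = m.1 - 1 - s := by omega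
        rw [← mul_assoc, ← mul_assoc, e1] at z
        convert z using 1
        linarith
      · exact isTwist_zero _ _ _
    exact h3.eq_mul h4 (H _ _ (.braid μ ρ i j l))

end Twist

/-! ### Graded modules -/

section

variable {K : Type u} [CommRing K] {ℓ : ℕ∞} {β : RootCone ℓ}

/-- A relation between the images of the generators is the image of a relation of R(β). This feeds
an existing action into `twistGen_rel`. -/
lemma rel_of_hom {A : Type*} [Ring A] (φ : QH K β →+* A) {a b : A}
    (h : Rel β (fun s => φ (QH.gen K β s)) a b) : a = b := by
  have key := fun {a b} (h : Rel β (QH.gen K β) a b) => congrArg φ (QH.rel_gen K β h)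
  cases h
  case e_zero ν h => simpa using key (.e_zero ν h)
  case x_zero r h => simpa using key (.x_zero r h)
  case psi_zero r h => simpa using key (.psi_zero r h)
  case e_mul_self ν => simpa using key (.e_mul_self ν)
  case e_mul ν ν' h => simpa using key (.e_mul ν ν' h)
  case e_sum => simpa using key .e_sum
  case x_e r ν => simpa using key (.x_e r ν)
  case psi_e μ ρ i j => simpa using key (.psi_e μ ρ i j)
  case x_x r s => simpa using key (.x_x r s)
  case psi_x r s h h' => simpa using key (.psi_x r s h h')
  case psi_psi r s h => simpa using key (.psi_psi r s h)
  case x_psi μ ρ i j =>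
    have := key (.x_psi μ ρ i j)
    simpa only [map_mul, map_sub, apply_ite φ, map_one, map_zero] using this
  case x_psi' μ ρ i j =>
    have := key (.x_psi' μ ρ i j)
    simpa only [map_mul, map_add, apply_ite φ, map_one, map_zero] using this
  case psi_sq μ ρ i j =>
    have := key (.psi_sq μ ρ i j)
    simpa only [map_mul, map_qEval] using this
  case braid μ ρ i j l =>
    have := key (.braid μ ρ i j l)
    simpa only [map_mul, map_sub, apply_ite φ, map_qDivDiff, map_zero] using this

lemma QH.mul_mem_grade {c d : ℤ} {a b : QH K β} (ha : a ∈ QH.grade K β c)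
    (hb : b ∈ QH.grade K β d) : a * b ∈ QH.grade K β (c + d) := by
  have h1 : QH.grade K β c ≤ (QH.grade K β (c + d)).comap (LinearMap.mulRight K b) := by
    refine Submodule.span_le.2 fun a ha => ?_
    have h2 : QH.grade K β d ≤ (QH.grade K β (c + d)).comap (LinearMap.mulLeft K a) :=
      Submodule.span_le.2 fun b hb => Submodule.subset_span (.mul ha hb)
    exact h2 hb
  exact h1 ha

lemma QH.e_mem_grade (ν : List (Idx ℓ)) : QH.e K β ν ∈ QH.grade K β 0 :=
  Submodule.subset_span (.e ν)

lemma QH.one_mem_grade : (1 : QH K β) ∈ QH.grade K β 0 := by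
  rw [← QH.sum_e K β]
  exact Submodule.sum_mem _ fun ν _ => QH.e_mem_grade ν

/-- The quiver Hecke algebra is the sum of its homogeneous components. -/
lemma QH.iSup_grade : ⨆ d, QH.grade K β d = ⊤ := by
  have hle : ∀ d, QH.grade K β d ≤ ⨆ d, QH.grade K β d := fun d => le_iSup (QH.grade K β) d
  rw [eq_top_iff]
  rintro a -
  have hlen : ∀ ν ∈ words β, ν.length = β.card := fun ν hν => by
    rw [← (mem_words _ _).1 hν, Multiset.coe_card]
  induction a using QH.induction with
  | hgen s =>
    cases s with
    | e ν => exact hle 0 (QH.e_mem_grade ν)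
    | x r =>
      -- A degree is assigned to x_r only on each e(ν), so 1 = ∑ e(ν) is inserted.
      rw [← mul_one (QH.gen K β _), ← QH.sum_e K β, Finset.mul_sum]
      refine Submodule.sum_mem _ fun ν hν => ?_
      rcases Nat.lt_or_ge r ν.length with h | h
      · obtain ⟨μ, i, ρ, rfl, rfl⟩ := exists_split₁ ν r h
        exact hle _ (Submodule.subset_span (.x μ ρ i))
      · have : QH.gen K β (.x r) = 0 := QH.x_eq_zero (by rw [← hlen ν hν]; exact h)
        rw [this, zero_mul]; exact zero_mem _
    | psi r =>
      rw [← mul_one (QH.gen K β _), ← QH.sum_e K β, Finset.mul_sum]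
      refine Submodule.sum_mem _ fun ν hν => ?_
      rcases Nat.lt_or_ge (r + 1) ν.length with h | h
      · obtain ⟨μ, i, j, ρ, rfl, rfl⟩ := exists_split ν r h
        exact hle _ (Submodule.subset_span (.psi μ ρ i j))
      · have : QH.gen K β (.psi r) = 0 := QH.psi_eq_zero (by rw [← hlen ν hν]; exact h)
        rw [this, zero_mul]; exact zero_mem _
  | hc c =>
    have h : algebraMap K (QH K β) c ∈ QH.grade K β 0 := by
      rw [Algebra.algebraMap_eq_smul_one]
      exact Submodule.smul_mem _ _ QH.one_mem_grade
    exact hle 0 h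
  | hadd a b ha hb => exact add_mem ha hb
  | hmul a b ha hb =>
    refine Submodule.iSup_induction _ (motive := fun a => a * b ∈ ⨆ d, QH.grade K β d) ha ?_ ?_ ?_
    · intro c a ha
      refine Submodule.iSup_induction _ (motive := fun b => a * b ∈ ⨆ d, QH.grade K β d) hb ?_ ?_ ?_
      · intro d b hb
        exact hle _ (QH.mul_mem_grade ha hb)
      · rw [mul_zero]; exact zero_mem _
      · intro x y hx hy; rw [mul_add]; exact add_mem hx hy
    · rw [zero_mul]; exact zero_mem _
    · intro x y hx hy; rw [add_mul]; exact add_mem hx hy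

variable (K β) (M : Type v) [AddCommGroup M] [Module K M] [Module (QH K β) M]
  [IsScalarTower K (QH K β) M]

/-- The action of the quiver Hecke algebra on finitely supported functions. -/
noncomputable def finsuppRep : QH K β →ₐ[K] Module.End K (ℤ →₀ M) where
  toFun a := Finsupp.mapRange.linearMap (Algebra.lsmul K K M a)
  map_one' := by ext; simp
  map_mul' a b := by ext; simp
  map_zero' := by ext; simp
  map_add' a b := by ext; simp
  commutes' c := by ext; simp

lemma finsuppRep_single (a : QH K β) (d : ℤ) (m : M) :
    finsuppRep K β M a (Finsupp.single d m) = Finsupp.single d (a • m) := by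
  simp [finsuppRep]

/-- The shift of the degree. -/
noncomputable def shiftDeg (d : ℤ) : Module.End K (ℤ →₀ M) := Finsupp.lmapDomain M K (d + ·)

lemma shiftDeg_single (c d : ℤ) (m : M) :
    shiftDeg K M c (Finsupp.single d m) = Finsupp.single (c + d) m := by
  simp [shiftDeg]

variable [Fact (2 ≤ ℓ)]

omit [Fact (2 ≤ ℓ)] in
lemma twist_hyps : (∀ a b, Rel β (fun s => finsuppRep K β M (QH.gen K β s)) a b → a = b) ∧
    (∀ d s, Commute (shiftDeg K M d) (finsuppRep K β M (QH.gen K β s))) ∧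
    shiftDeg K M 0 = 1 ∧ ∀ c d, shiftDeg K M (c + d) = shiftDeg K M c * shiftDeg K M d := by
  refine ⟨fun a b h => rel_of_hom (finsuppRep K β M).toRingHom h, fun d s => ?_, ?_, fun c d => ?_⟩
  · refine Finsupp.lhom_ext fun n m => ?_
    rw [Module.End.mul_apply, Module.End.mul_apply, finsuppRep_single, shiftDeg_single,
      shiftDeg_single, finsuppRep_single]
  · refine Finsupp.lhom_ext fun n m => ?_
    rw [shiftDeg_single, zero_add, Module.End.one_apply]
  · refine Finsupp.lhom_ext fun n m => ?_
    rw [Module.End.mul_apply, shiftDeg_single, shiftDeg_single, shiftDeg_single, add_assoc]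

/-- The action in which homogeneous elements change the degree. -/
noncomputable def twistRep : QH K β →ₐ[K] Module.End K (ℤ →₀ M) :=
  QH.lift (twistGen β (fun s => finsuppRep K β M (QH.gen K β s)) (shiftDeg K M)) fun a b h =>
    twistGen_rel (twist_hyps K β M).1 (twist_hyps K β M).2.1 (twist_hyps K β M).2.2.1
      (twist_hyps K β M).2.2.2 a b h

variable {K β M}

lemma twistRep_of_homMonomial {c : ℤ} {a : QH K β} (ha : QH.HomMonomial K β c a) :
    twistRep K β M a = shiftDeg K M c * finsuppRep K β M a := by
  obtain ⟨h1, h2, h3, h4⟩ := twist_hyps K β M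
  have hg : ∀ s, twistRep K β M (QH.gen K β s) = twistGen β
      (fun s => finsuppRep K β M (QH.gen K β s)) (shiftDeg K M) s := fun s => QH.lift_gen _ _ s
  have he : ∀ ν, twistRep K β M (QH.e K β ν) = finsuppRep K β M (QH.gen K β (.e ν)) :=
    fun ν => hg _
  induction ha with
  | e ν => rw [h3, one_mul, he]; rfl
  | x μ ρ i =>
    rw [map_mul, map_mul, he, QH.x, hg, (isTwist_x h1 μ ρ i rfl).twist, mul_assoc]; rfl
  | psi μ ρ i j =>
    rw [map_mul, map_mul, he, QH.psi, hg, (isTwist_psi h1 μ ρ i j rfl).twist, mul_assoc]; rfl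
  | @mul c d a b ha hb iha ihb =>
    have hcomm : Commute (shiftDeg K M d) (finsuppRep K β M a) := by
      refine Finsupp.lhom_ext fun n m => ?_
      rw [Module.End.mul_apply, Module.End.mul_apply, finsuppRep_single, shiftDeg_single,
        shiftDeg_single, finsuppRep_single]
    rw [map_mul, iha, ihb, map_mul, h4, mul_assoc, ← mul_assoc (finsuppRep K β M a), ← hcomm.eq]
    simp only [mul_assoc]

lemma twistRep_of_grade {c : ℤ} {a : QH K β} (ha : a ∈ QH.grade K β c) :
    twistRep K β M a = shiftDeg K M c * finsuppRep K β M a := by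
  refine Submodule.span_induction (p := fun a _ => twistRep K β M a =
    shiftDeg K M c * finsuppRep K β M a) (fun a ha => twistRep_of_homMonomial ha) (by simp) ?_ ?_ ha
  · intro x y _ _ hx hy; rw [map_add, map_add, hx, hy, mul_add]
  · intro k x _ hx; rw [map_smul, map_smul, hx, mul_smul_comm]

lemma twistRep_single {c : ℤ} {a : QH K β} (ha : a ∈ QH.grade K β c) (d : ℤ) (m : M) :
    twistRep K β M a (Finsupp.single d m) = Finsupp.single (c + d) (a • m) := by
  rw [twistRep_of_grade ha, Module.End.mul_apply, finsuppRep_single, shiftDeg_single]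

variable (β) in
/-- The submodules `gr d` are the homogeneous components of a grading. -/
structure IsGraded (gr : ℤ → Submodule K M) : Prop where
  -- Independence of the components, stated as the existence of a map that sorts by degree. In this
  -- form it can be obtained from universal properties.
  exists_delta : ∃ δ : M →ₗ[K] (ℤ →₀ M), ∀ d, ∀ m ∈ gr d, δ m = Finsupp.single d m
  iSup_eq_top : ⨆ d, gr d = ⊤
  smul_mem : ∀ c d, ∀ a ∈ QH.grade K β c, ∀ m ∈ gr d, a • m ∈ gr (c + d)

namespace IsGraded

variable {gr : ℤ → Submodule K M} (h : IsGraded β gr)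

include h

/-- The decomposition into homogeneous components is compatible with the twisted action. -/
lemma delta_smul {δ : M →ₗ[K] (ℤ →₀ M)} (hδ : ∀ d, ∀ m ∈ gr d, δ m = Finsupp.single d m)
    (a : QH K β) (m : M) : δ (a • m) = twistRep K β M a (δ m) := by
  have ha : a ∈ ⨆ d, QH.grade K β d := by rw [QH.iSup_grade]; trivial
  have hm : m ∈ ⨆ d, gr d := by rw [h.iSup_eq_top]; trivial
  refine Submodule.iSup_induction _ (motive := fun a => δ (a • m) = twistRep K β M a (δ m)) ha
    ?_ (by simp) ?_
  · intro c a ha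
    refine Submodule.iSup_induction _ (motive := fun m => δ (a • m) = twistRep K β M a (δ m)) hm
      ?_ (by simp) ?_
    · intro d m hm
      rw [hδ _ _ (h.smul_mem c d a ha m hm), hδ d m hm, twistRep_single ha]
    · intro x y hx hy; rw [smul_add, map_add, map_add, map_add, hx, hy]
  · intro x y hx hy
    rw [add_smul, map_add, map_add, LinearMap.add_apply, hx, hy]

omit [IsScalarTower K (QH K β) M] [Fact (2 ≤ ℓ)] in
/-- The homogeneous weight vectors span. -/
lemma span_weight : Submodule.span K
    {m : M | ∃ d ν, m ∈ gr d ∧ QH.e K β ν • m = m} = ⊤ := by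
  rw [eq_top_iff, ← h.iSup_eq_top, iSup_le_iff]
  intro d m hm
  rw [← one_smul (QH K β) m, ← QH.sum_e K β, Finset.sum_smul]
  refine Submodule.sum_mem _ fun ν _ => Submodule.subset_span ⟨d, ν, ?_, ?_⟩
  · have := h.smul_mem 0 d _ (QH.e_mem_grade ν) m hm
    rwa [zero_add] at this
  · rw [← mul_smul, QH.e_mul_self]

/-- A quotient by a homogeneous submodule is graded. -/
lemma quotient {N : Submodule (QH K β) M} (hN : ∃ S : Set M, N = Submodule.span (QH K β) S ∧
    ∀ s ∈ S, ∃ d, s ∈ gr d) :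
    IsGraded β fun d => (gr d).map (N.mkQ.restrictScalars K) := by
  obtain ⟨S, rfl, hS⟩ := hN
  set N := Submodule.span (QH K β) S with hN
  obtain ⟨δ, hδ⟩ := h.exists_delta
  refine ⟨?_, ?_, ?_⟩
  · set q : (ℤ →₀ M) →ₗ[K] (ℤ →₀ M ⧸ N) :=
      Finsupp.mapRange.linearMap (N.mkQ.restrictScalars K) with hq
    have hqs : ∀ d m, q (Finsupp.single d m) = Finsupp.single d (N.mkQ m) := by
      intro d m; simp [hq]
    -- The generators of N are homogeneous and δ intertwines the action with the twisted one, so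
    -- each component of an element of N vanishes in the quotient.
    have hker : N.restrictScalars K ≤ LinearMap.ker (q ∘ₗ δ) := by
      intro n hn
      rw [Submodule.restrictScalars_mem] at hn
      have htw : ∀ (a : QH K β) (f : ℤ →₀ M), q f = 0 → q (twistRep K β M a f) = 0 := by
        have key : ∀ (a : QH K β) (f : ℤ →₀ M), q (twistRep K β M a f) =
            twistRep K β (M ⧸ N) a (q f) := by
          intro a f
          have ha : a ∈ ⨆ d, QH.grade K β d := by rw [QH.iSup_grade]; trivial
          refine Submodule.iSup_induction _ (motive := fun a => q (twistRep K β M a f) =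
            twistRep K β (M ⧸ N) a (q f)) ha ?_ (by simp) ?_
          · intro c a ha
            induction f using Finsupp.induction_linear with
            | zero => simp
            | add f f' hf hf' => rw [map_add, map_add, map_add, map_add, hf, hf']
            | single d m =>
              rw [twistRep_single ha, hqs, hqs, twistRep_single ha, map_smul]
          · intro x y hx hy
            rw [map_add, map_add, LinearMap.add_apply, LinearMap.add_apply, map_add, hx, hy]
        intro a f hf
        rw [key, hf, map_zero]
      refine Submodule.span_induction (p := fun n _ => q (δ n) = 0) ?_ (by simp) ?_ ?_ hn
      · intro s hs
        obtain ⟨d, hd⟩ := hS s hs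
        rw [hδ d s hd, hqs, Submodule.mkQ_apply, (Submodule.Quotient.mk_eq_zero N).2
          (Submodule.subset_span hs), Finsupp.single_zero]
      · intro x y _ _ hx hy; rw [map_add, map_add, hx, hy, add_zero]
      · intro a x _ hx
        rw [h.delta_smul hδ]
        exact htw a _ hx
    refine ⟨(N.restrictScalars K).liftQ (q ∘ₗ δ) hker, ?_⟩
    rintro d _ ⟨m, hm, rfl⟩
    change q (δ m) = _
    rw [hδ d m hm, hqs]
    rfl
  · rw [← Submodule.map_iSup, h.iSup_eq_top, Submodule.map_top, LinearMap.range_eq_top]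
    exact N.mkQ_surjective
  · rintro c d a ha _ ⟨m, hm, rfl⟩
    exact ⟨a • m, h.smul_mem c d a ha m hm, by simp⟩

end IsGraded

end

/-! ### Convolution products -/

lemma exists_flatten_split {α : Type*} {t : ℕ} (ν : Fin t → List α) (i : Fin t) :
    ∃ A B : List α, (List.ofFn ν).flatten = A ++ ν i ++ B ∧
      A.length = ∑ j ∈ Finset.Iio i, (ν j).length := by
  refine ⟨((List.ofFn ν).take i).flatten, ((List.ofFn ν).drop (i + 1)).flatten, ?_, ?_⟩
  · conv_lhs => rw [← List.take_append_drop i (List.ofFn ν),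
      List.drop_eq_getElem_cons (by simp : (i : ℕ) < (List.ofFn ν).length)]
    simp
  · rw [List.length_flatten, List.map_take, List.map_ofFn, List.sum_take_ofFn]
    refine Finset.sum_congr ?_ fun _ _ => rfl
    ext j
    rw [Finset.mem_filter, Finset.mem_Iio, Fin.lt_def]
    simp

/-- For generators x_r and ψ_r only the product with an idempotent has a known degree; in front of a
weight vector the idempotent can be inserted at will. -/
lemma twistRep_single_of_weight {K : Type u} [CommRing K] {ℓ : ℕ∞} {β : RootCone ℓ} {M : Type v}
    [AddCommGroup M] [Module K M] [Module (QH K β) M] [IsScalarTower K (QH K β) M]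
    [Fact (2 ≤ ℓ)] {c : ℤ} {a : QH K β} {ν : List (Idx ℓ)}
    (ha : a * QH.e K β ν ∈ QH.grade K β c)
    (d : ℤ) {m : M} (hm : QH.e K β ν • m = m) :
    twistRep K β M a (Finsupp.single d m) = Finsupp.single (c + d) (a • m) := by
  have h1 := twistRep_single (QH.e_mem_grade (K := K) (β := β) ν) d m
  have h2 := twistRep_single ha d m
  rw [zero_add, hm] at h1
  rwa [map_mul, Module.End.mul_apply, h1, mul_smul, hm] at h2

section

variable {K : Type u} [CommRing K] {ℓ : ℕ∞} {γ : RootCone ℓ} {t : ℕ} {β : Fin t → RootCone ℓ}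
  {M : Fin t → Type v} [∀ i, AddCommGroup (M i)] [∀ i, Module K (M i)]
  [∀ i, Module (QH K (β i)) (M i)]

namespace Conv

lemma smul_mk (a b : QH K γ) (m : ∀ i, M i) :
    a • Conv.mk K γ β M b m = Conv.mk K γ β M (a * b) m := rfl

lemma smul_mk_one (a : QH K γ) (m : ∀ i, M i) :
    a • Conv.mk K γ β M 1 m = Conv.mk K γ β M a m := by rw [smul_mk, mul_one]

variable (K γ β M) in
/-- The map `m ↦ 1 ⊗ m`. -/
noncomputable def tmul : MultilinearMap K M (Conv K γ β M) :=
  (((Submodule.span (QH K γ) {z | ConvRel K γ β M z}).mkQ.restrictScalars K) ∘ₗ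
    (TensorProduct.mk K (QH K γ) (⨂[K] i, M i) 1)).compMultilinearMap (PiTensorProduct.tprod K)

lemma tmul_apply (m : ∀ i, M i) : tmul K γ β M m = Conv.mk K γ β M 1 m := rfl

lemma mk_eq_zero_of_rel {z : QH K γ ⊗[K] (⨂[K] i, M i)} (h : ConvRel K γ β M z) :
    (Submodule.Quotient.mk z : Conv K γ β M) = 0 :=
  (Submodule.Quotient.mk_eq_zero _).2 (Submodule.subset_span h)

lemma e_smul_mk (ν : Fin t → List (Idx ℓ)) (hν : ∀ i, (ν i : RootCone ℓ) = β i) (m : ∀ i, M i) :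
    QH.e K γ (List.ofFn ν).flatten • Conv.mk K γ β M 1 m =
      Conv.mk K γ β M 1 fun i => QH.e K (β i) (ν i) • m i := by
  rw [smul_mk_one]
  exact sub_eq_zero.1 (mk_eq_zero_of_rel (ConvRel.e ν hν m))

lemma x_smul_mk (i : Fin t) (r : ℕ) (hr : r < (β i).card) (m : ∀ i, M i) :
    QH.x K γ (offset β i + r) • Conv.mk K γ β M 1 m =
      Conv.mk K γ β M 1 (Function.update m i (QH.x K (β i) r • m i)) := by
  rw [smul_mk_one]
  exact sub_eq_zero.1 (mk_eq_zero_of_rel (ConvRel.x i r hr m))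

lemma psi_smul_mk (i : Fin t) (r : ℕ) (hr : r + 1 < (β i).card) (m : ∀ i, M i) :
    QH.psi K γ (offset β i + r) • Conv.mk K γ β M 1 m =
      Conv.mk K γ β M 1 (Function.update m i (QH.psi K (β i) r • m i)) := by
  rw [smul_mk_one]
  exact sub_eq_zero.1 (mk_eq_zero_of_rel (ConvRel.psi i r hr m))

lemma span_mk : Submodule.span K
    {z | ∃ a m, z = Conv.mk K γ β M a m} = (⊤ : Submodule K (Conv K γ β M)) := by
  rw [eq_top_iff]
  rintro v -
  obtain ⟨z, rfl⟩ := Submodule.Quotient.mk_surjective _ v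
  induction z using TensorProduct.induction_on with
  | zero => exact zero_mem _
  | add x y hx hy => exact add_mem hx hy
  | tmul a p =>
    induction p using PiTensorProduct.induction_on with
    | smul_tprod c m =>
      rw [TensorProduct.tmul_smul]
      exact Submodule.smul_mem _ c (Submodule.subset_span (s := {z | ∃ a m, z = Conv.mk K γ β M a m}) ⟨a, m, rfl⟩)
    | add x y hx hy =>
      rw [TensorProduct.tmul_add]
      exact add_mem hx hy

/-- The universal property of the convolution product. -/
theorem exists_lift {N : Type w} [AddCommGroup N] [Module K N] (ρ : QH K γ →ₐ[K] Module.End K N)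
    (φ : MultilinearMap K M N)
    (he : ∀ (ν : Fin t → List (Idx ℓ)), (∀ i, (ν i : RootCone ℓ) = β i) → ∀ m,
      ρ (QH.e K γ (List.ofFn ν).flatten) (φ m) = φ fun i => QH.e K (β i) (ν i) • m i)
    (hx : ∀ i r, r < (β i).card → ∀ m, ρ (QH.x K γ (offset β i + r)) (φ m) =
      φ (Function.update m i (QH.x K (β i) r • m i)))
    (hpsi : ∀ i r, r + 1 < (β i).card → ∀ m, ρ (QH.psi K γ (offset β i + r)) (φ m) =
      φ (Function.update m i (QH.psi K (β i) r • m i))) :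
    ∃ f : Conv K γ β M →ₗ[K] N, (∀ a m, f (Conv.mk K γ β M a m) = ρ a (φ m)) ∧
      ∀ (a : QH K γ) v, f (a • v) = ρ a (f v) := by
  set g : QH K γ ⊗[K] (⨂[K] i, M i) →ₗ[K] N :=
    TensorProduct.lift ((LinearMap.lcomp K N (PiTensorProduct.lift φ)) ∘ₗ ρ.toLinearMap) with hg
  have hgt : ∀ a m, g (a ⊗ₜ PiTensorProduct.tprod K m) = ρ a (φ m) := fun a m => by simp [hg]
  have hgs : ∀ (a : QH K γ) z, g (a • z) = ρ a (g z) := by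
    intro a z
    induction z using TensorProduct.induction_on with
    | zero => simp
    | add x y hx hy => rw [smul_add, map_add, hx, hy, map_add, map_add]
    | tmul b p => rw [TensorProduct.smul_tmul']; simp [hg]
  have hker : ∀ z ∈ Submodule.span (QH K γ) {z | ConvRel K γ β M z}, g z = 0 := by
    intro z hz
    refine Submodule.span_induction (p := fun z _ => g z = 0) ?_ (map_zero g) ?_ ?_ hz
    · rintro z (⟨ν, hν, m⟩ | ⟨i, r, hr, m⟩ | ⟨i, r, hr, m⟩)
      · rw [map_sub, hgt, hgt, he ν hν, map_one, Module.End.one_apply, sub_self]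
      · rw [map_sub, hgt, hgt, hx i r hr, map_one, Module.End.one_apply, sub_self]
      · rw [map_sub, hgt, hgt, hpsi i r hr, map_one, Module.End.one_apply, sub_self]
    · intro x y _ _ hx hy; rw [map_add, hx, hy, add_zero]
    · intro a x _ hx; rw [hgs, hx, map_zero]
  refine ⟨((Submodule.span (QH K γ) {z | ConvRel K γ β M z}).restrictScalars K).liftQ g hker,
    fun a m => hgt a m, fun a v => ?_⟩
  obtain ⟨z, rfl⟩ := Submodule.Quotient.mk_surjective _ v
  exact hgs a z

section Graded

variable [Fact (2 ≤ ℓ)] [∀ i, IsScalarTower K (QH K (β i)) (M i)]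
  {gr : ∀ i, ℤ → Submodule K (M i)}

omit [Fact (2 ≤ ℓ)] [∀ i, IsScalarTower K (QH K (β i)) (M i)] in
/-- Multilinear maps that agree on homogeneous weight vectors are equal. -/
lemma multilinear_ext (hgr : ∀ i, IsGraded (β i) (gr i)) {N : Type w} [AddCommGroup N] [Module K N]
    {φ φ' : MultilinearMap K M N} (h : ∀ (δ : Fin t → ℤ) (ν : Fin t → List (Idx ℓ)) (m : ∀ i, M i),
      (∀ i, (ν i : RootCone ℓ) = β i) → (∀ i, m i ∈ gr i (δ i)) →
      (∀ i, QH.e K (β i) (ν i) • m i = m i) → φ m = φ' m) : φ = φ' := by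
  let W : ∀ i, Type v := fun i => {m : M i // ∃ d ν, m ∈ gr i d ∧ QH.e K (β i) ν • m = m}
  let g : ∀ ⦃i⦄, W i → M i := fun i m => m.1
  have hW : ∀ i, Submodule.span K (Set.range (@g i)) = ⊤ := by
    intro i
    rw [← (hgr i).span_weight]
    congr 1
    ext m
    simp [W, g]
  refine MultilinearMap.ext_of_span_eq_top (g := g) hW fun j => ?_
  choose δ ν hδ hν using fun i => (j i).2
  by_cases hc : ∀ i, (ν i : RootCone ℓ) = β i
  · exact h δ ν _ hc hδ hν
  · push Not at hc
    obtain ⟨i, hi⟩ := hc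
    have h0 : g (j i) = 0 := by
      change (j i).1 = 0
      rw [← hν i, QH.e_eq_zero hi, zero_smul]
    rw [φ.map_coord_zero i h0, φ'.map_coord_zero i h0]

omit [Fact (2 ≤ ℓ)] [∀ i, IsScalarTower K (QH K (β i)) (M i)] in
/-- The decomposition of a tensor of graded modules into homogeneous components. -/
lemma exists_tmul_delta (hgr : ∀ i, IsGraded (β i) (gr i)) :
    ∃ Φ : MultilinearMap K M (ℤ →₀ Conv K γ β M), ∀ (δ : Fin t → ℤ) (m : ∀ i, M i),
      (∀ i, m i ∈ gr i (δ i)) → Φ m = Finsupp.single (∑ i, δ i) (Conv.mk K γ β M 1 m) := by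
  classical
  choose D hD using fun i => (hgr i).exists_delta
  -- Every factor is split into its components, and the tensor of components of degrees p i is
  -- placed in degree ∑ p i.
  set Ψ := MultilinearMap.fromDFinsuppEquiv (N := ℤ →₀ Conv K γ β M) (M := fun i (_ : ℤ) => M i)
    (fun _ : Fin t => ℤ) K (fun p => (Finsupp.lsingle (∑ i, p i)).compMultilinearMap
      (tmul K γ β M)) with hΨ
  refine ⟨Ψ.compLinearMap fun i => (finsuppLequivDFinsupp K).toLinearMap ∘ₗ D i, fun δ m hm => ?_⟩
  rw [MultilinearMap.compLinearMap_apply]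
  have : (fun i => ((finsuppLequivDFinsupp K).toLinearMap ∘ₗ D i) (m i)) =
      fun i => DFinsupp.single (δ i) (m i) := by
    funext i
    rw [LinearMap.comp_apply, hD i (δ i) (m i) (hm i)]
    exact Finsupp.toDFinsupp_single _ _
  rw [this, hΨ, MultilinearMap.fromDFinsuppEquiv_single]
  rfl

/-- A convolution product of graded modules is graded. -/
theorem isGraded (hgr : ∀ i, IsGraded (β i) (gr i)) :
    IsGraded γ (Conv.grade K γ β M gr) := by
  classical
  have hmem : ∀ c (δ : Fin t → ℤ) (a : QH K γ) (m : ∀ i, M i), a ∈ QH.grade K γ c →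
      (∀ i, m i ∈ gr i (δ i)) → Conv.mk K γ β M a m ∈ Conv.grade K γ β M gr (c + ∑ i, δ i) :=
    fun c δ a m ha hm => Submodule.subset_span ⟨c, δ, a, m, rfl, ha, hm, rfl⟩
  refine ⟨?_, ?_, ?_⟩
  · obtain ⟨Φ, hΦ⟩ := exists_tmul_delta (γ := γ) hgr
    have hup : ∀ (i : Fin t) (b : QH K (β i)) (m : ∀ i, M i),
        (fun j => (Function.update (fun j => (LinearMap.id : M j →ₗ[K] M j)) i
          (Algebra.lsmul K K (M i) b)) j (m j)) = Function.update m i (b • m i) := by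
      intro i b m
      funext j
      by_cases hj : j = i
      · subst hj; simp
      · simp [hj]
    have hweight : ∀ (ν : Fin t → List (Idx ℓ)) (m : ∀ i, M i), (∀ i, (ν i : RootCone ℓ) = β i) →
        (∀ i, QH.e K (β i) (ν i) • m i = m i) →
        QH.e K γ (List.ofFn ν).flatten • Conv.mk K γ β M 1 m = Conv.mk K γ β M 1 m := by
      intro ν m hc hν
      rw [e_smul_mk ν hc]
      congr 1
      funext i
      exact hν i
    have hlen : ∀ (ν : Fin t → List (Idx ℓ)), (∀ i, (ν i : RootCone ℓ) = β i) →
        ∀ i, (ν i).length = (β i).card := fun ν hc i => by rw [← hc i, Multiset.coe_card]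
    have hsplit : ∀ (ν : Fin t → List (Idx ℓ)), (∀ i, (ν i : RootCone ℓ) = β i) → ∀ i,
        ∃ A B, (List.ofFn ν).flatten = A ++ ν i ++ B ∧ A.length = offset β i := by
      intro ν hc i
      obtain ⟨A, B, h1, h2⟩ := exists_flatten_split ν i
      refine ⟨A, B, h1, h2.trans (Finset.sum_congr rfl fun j _ => hlen ν hc j)⟩
    -- The generators x_r and ψ_r have no degree of their own. So compatibility with them is checked
    -- on homogeneous weight vectors only, where they act with a definite degree c; by
    -- multilinearity this is enough.
    have hupdate : ∀ (a : QH K γ) (i : Fin t) (b : QH K (β i)),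
        (∀ (δ : Fin t → ℤ) (ν : Fin t → List (Idx ℓ)) (m : ∀ i, M i),
          (∀ i, (ν i : RootCone ℓ) = β i) → (∀ i, m i ∈ gr i (δ i)) →
          (∀ i, QH.e K (β i) (ν i) • m i = m i) → ∃ c, b • m i ∈ gr i (c + δ i) ∧
            twistRep K γ (Conv K γ β M) a (Finsupp.single (∑ i, δ i) (Conv.mk K γ β M 1 m)) =
              Finsupp.single (c + ∑ i, δ i)
                (Conv.mk K γ β M 1 (Function.update m i (b • m i)))) →
        (twistRep K γ (Conv K γ β M) a).compMultilinearMap Φ = Φ.compLinearMap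
          (Function.update (fun j => LinearMap.id) i (Algebra.lsmul K K (M i) b)) := by
      intro a i b h
      refine multilinear_ext hgr fun δ ν m hc hδ hν => ?_
      obtain ⟨c, h1, h2⟩ := h δ ν m hc hδ hν
      rw [MultilinearMap.compLinearMap_apply, hup, LinearMap.compMultilinearMap_apply, hΦ δ m hδ,
        h2, hΦ (Function.update δ i (c + δ i))]
      · congr 1
        rw [Finset.sum_update_of_mem (Finset.mem_univ i),
          ← Finset.add_sum_erase _ _ (Finset.mem_univ i), Finset.sdiff_singleton_eq_erase, add_assoc]
      · intro j
        by_cases hj : j = i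
        · subst hj; simpa using h1
        · simpa [hj] using hδ j
    suffices h : ∃ f : Conv K γ β M →ₗ[K] (ℤ →₀ Conv K γ β M), ∀ a m,
        f (Conv.mk K γ β M a m) = twistRep K γ (Conv K γ β M) a (Φ m) by
      obtain ⟨f, hf⟩ := h
      refine ⟨f, fun d v hv => ?_⟩
      refine Submodule.span_induction (p := fun v _ => f v = Finsupp.single d v) ?_ (by simp) ?_ ?_
        hv
      · rintro _ ⟨c, δ, a, m, rfl, ha, hm, rfl⟩
        rw [hf, hΦ δ m hm, twistRep_single ha, smul_mk_one]
      · intro x y _ _ hx hy; rw [map_add, hx, hy, Finsupp.single_add]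
      · intro k x _ hx; rw [map_smul, hx, Finsupp.smul_single]
    refine (exists_lift (twistRep K γ (Conv K γ β M)) Φ ?_ ?_ ?_).imp fun f hf => hf.1
    · intro ν hν m
      refine congrArg (fun φ => φ m) (multilinear_ext hgr (φ := (twistRep K γ (Conv K γ β M)
        (QH.e K γ (List.ofFn ν).flatten)).compMultilinearMap Φ) (φ' := Φ.compLinearMap fun i =>
          Algebra.lsmul K K (M i) (QH.e K (β i) (ν i))) ?_)
      intro δ ν' m hc hδ hν'
      change twistRep _ _ _ _ (Φ m) = Φ fun i => QH.e K (β i) (ν i) • m i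
      rw [hΦ δ m hδ, twistRep_single (QH.e_mem_grade _), zero_add, e_smul_mk ν hν,
        hΦ δ (fun i => QH.e K (β i) (ν i) • m i) fun i => by
          have := (hgr i).smul_mem 0 (δ i) _ (QH.e_mem_grade (ν i)) (m i) (hδ i)
          rwa [zero_add] at this]
    · intro i r hr m
      rw [← hup]
      refine congrArg (fun φ => φ m) (hupdate _ i _ ?_)
      intro δ ν m hc hδ hν
      obtain ⟨A, B, hAB, hA⟩ := hsplit ν hc i
      obtain ⟨C, j, D, hCD, hC⟩ := exists_split₁ (ν i) r (by rw [hlen ν hc i]; exact hr)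
      have hfl : (List.ofFn ν).flatten = (A ++ C) ++ j :: (D ++ B) := by
        rw [hAB, hCD]; simp
      have hAC : offset β i + r = (A ++ C).length := by rw [List.length_append, hA, hC]
      have hw := hweight ν m hc hν
      refine ⟨form j j, ?_, ?_⟩
      · have h1 : QH.x K (β i) r • m i = (QH.x K (β i) C.length * QH.e K (β i) (C ++ j :: D)) •
            m i := by rw [mul_smul, ← hCD, hν i, hC]
        rw [h1]
        exact (hgr i).smul_mem _ _ _ (Submodule.subset_span (.x C D j)) _ (hδ i)
      · rw [hfl] at hw
        rw [← x_smul_mk i r hr, hAC]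
        exact twistRep_single_of_weight (Submodule.subset_span (.x (A ++ C) (D ++ B) j)) _ hw
    · intro i r hr m
      rw [← hup]
      refine congrArg (fun φ => φ m) (hupdate _ i _ ?_)
      intro δ ν m hc hδ hν
      obtain ⟨A, B, hAB, hA⟩ := hsplit ν hc i
      obtain ⟨C, j, j', D, hCD, hC⟩ := exists_split (ν i) r (by rw [hlen ν hc i]; exact hr)
      have hfl : (List.ofFn ν).flatten = (A ++ C) ++ j :: j' :: (D ++ B) := by
        rw [hAB, hCD]; simp
      have hAC : offset β i + r = (A ++ C).length := by rw [List.length_append, hA, hC]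
      have hw := hweight ν m hc hν
      refine ⟨-form j j', ?_, ?_⟩
      · have h1 : QH.psi K (β i) r • m i = (QH.psi K (β i) C.length *
            QH.e K (β i) (C ++ j :: j' :: D)) • m i := by rw [mul_smul, ← hCD, hν i, hC]
        rw [h1]
        exact (hgr i).smul_mem _ _ _ (Submodule.subset_span (.psi C D j j')) _ (hδ i)
      · rw [hfl] at hw
        rw [← psi_smul_mk i r hr, hAC]
        exact twistRep_single_of_weight (Submodule.subset_span (.psi (A ++ C) (D ++ B) j j')) _ hw
  · rw [eq_top_iff, ← span_mk, Submodule.span_le]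
    rintro _ ⟨a, m, rfl⟩
    have ha : a ∈ ⨆ d, QH.grade K γ d := by rw [QH.iSup_grade]; trivial
    -- That a ⊗ m lies in the sum of the components is expressed as the vanishing of a multilinear
    -- map into the quotient, so that homogeneous m suffice.
    have key : ∀ (a : QH K γ) (c : ℤ), a ∈ QH.grade K γ c →
        (((⨆ d, Conv.grade K γ β M gr d).mkQ ∘ₗ Algebra.lsmul K K (Conv K γ β M)
          a).compMultilinearMap (tmul K γ β M)) = 0 := by
      intro a c ha
      refine multilinear_ext hgr fun δ ν m hc hδ hν => ?_
      change (⨆ d, Conv.grade K γ β M gr d).mkQ (a • Conv.mk K γ β M 1 m) = 0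
      rw [smul_mk_one, Submodule.mkQ_apply, Submodule.Quotient.mk_eq_zero]
      exact le_iSup (Conv.grade K γ β M gr) _ (hmem c δ a m ha hδ)
    change Conv.mk K γ β M a m ∈ (⨆ d, Conv.grade K γ β M gr d)
    rw [← smul_mk_one]
    refine Submodule.iSup_induction _ (motive := fun a => a • Conv.mk K γ β M 1 m ∈
      ⨆ d, Conv.grade K γ β M gr d) ha ?_ (by rw [zero_smul]; exact zero_mem _) ?_
    · intro c a ha
      have := congrArg (fun φ => φ m) (key a c ha)
      exact (Submodule.Quotient.mk_eq_zero _).1 this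
    · intro x y hx hy; rw [add_smul]; exact add_mem hx hy
  · intro c d a ha v hv
    refine Submodule.span_induction (p := fun v _ => a • v ∈ Conv.grade K γ β M gr (c + d)) ?_
      (by rw [smul_zero]; exact zero_mem _) ?_ ?_ hv
    · rintro _ ⟨c', δ, b, m, rfl, hb, hm, rfl⟩
      rw [smul_mk, ← add_assoc]
      exact hmem _ _ _ _ (QH.mul_mem_grade ha hb) hm
    · intro x y _ _ hx hy; rw [smul_add]; exact add_mem hx hy
    · intro k x _ hx
      rw [← algebraMap_smul (QH K γ) k x, ← mul_smul, ← Algebra.commutes, mul_smul,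
        algebraMap_smul]
      exact Submodule.smul_mem _ k hx

end Graded

end Conv

end

/-! ### Segment modules -/

lemma exists_take_sum (L : List ℕ) (p : ℕ) (hp : p < L.sum) :
    ∃ (i : ℕ) (hi : i < L.length) (r : ℕ), r < L[i] ∧ p = (L.take i).sum + r := by
  induction L generalizing p with
  | nil => simp at hp
  | cons b L ih =>
    rcases Nat.lt_or_ge p b with h | h
    · exact ⟨0, by simp, p, by simpa using h, by simp⟩
    · obtain ⟨i, hi, r, h1, h2⟩ := ih (p - b) (by rw [List.sum_cons] at hp; omega)
      exact ⟨i + 1, by simpa using hi, r, by simpa using h1, by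
        rw [List.take_succ_cons, List.sum_cons]; omega⟩

lemma offset_eq_take_sum {ℓ : ℕ∞} {t : ℕ} (β : Fin t → RootCone ℓ) (i : Fin t) :
    offset β i = ((List.ofFn fun j => (β j).card).take i).sum := by
  rw [List.sum_take_ofFn, offset]
  refine Finset.sum_congr ?_ fun _ _ => rfl
  ext j
  rw [Finset.mem_filter, Finset.mem_Iio, Fin.lt_def]
  simp

lemma exists_offset_add {ℓ : ℕ∞} {t : ℕ} (β : Fin t → RootCone ℓ) (p : ℕ)
    (hp : p < ∑ i, (β i).card) : ∃ i r, r < (β i).card ∧ p = offset β i + r := by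
  rw [← List.sum_ofFn] at hp
  obtain ⟨i, hi, r, h1, h2⟩ := exists_take_sum _ p hp
  rw [List.getElem_ofFn] at h1
  exact ⟨⟨i, by simpa using hi⟩, r, h1, by rw [offset_eq_take_sum, h2]⟩

section

variable (ℓ : ℕ∞) [Fact (2 ≤ ℓ)] (K : Type u) [CommRing K]

lemma Seg.smul_def {a : ℤ} {m : ℕ} (b : QH K (segRoot ℓ a m)) (x : Seg ℓ K a m) :
    b • x = (segCharacter ℓ K a m b • x : Seg ℓ K a m) := rfl

instance (a : ℤ) (m : ℕ) : IsScalarTower K (QH K (segRoot ℓ a m)) (Seg ℓ K a m) where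
  smul_assoc c b x := by
    rw [Seg.smul_def, Seg.smul_def, map_smul, smul_assoc]

/-- The coordinate of an element of a segment module. -/
def Seg.coord (a : ℤ) (m : ℕ) : Seg ℓ K a m →ₗ[K] K := LinearMap.id

omit [Fact (2 ≤ ℓ)] in
lemma Seg.coord_smul_u {a : ℤ} {m : ℕ} (x : Seg ℓ K a m) :
    Seg.coord ℓ K a m x • Seg.u ℓ K a m = x := mul_one (M := K) x

lemma segCharacter_of_homMonomial (a : ℤ) (m : ℕ) {c : ℤ} {b : QH K (segRoot ℓ a m)}
    (hb : QH.HomMonomial K (segRoot ℓ a m) c b) : c = 0 ∨ segCharacter ℓ K a m b = 0 := by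
  induction hb with
  | e ν => exact Or.inl rfl
  | x μ ρ i =>
    right
    rw [map_mul, QH.x, segCharacter_gen]
    exact zero_mul _
  | psi μ ρ i j =>
    right
    rw [map_mul, QH.psi, segCharacter_gen]
    exact zero_mul _
  | mul _ _ h h' =>
    rcases h with h | h
    · rcases h' with h' | h'
      · left; rw [h, h', add_zero]
      · right; rw [map_mul, h', mul_zero]
    · right; rw [map_mul, h, zero_mul]

theorem Seg.isGraded (a : ℤ) (m : ℕ) : IsGraded (segRoot ℓ a m) (Seg.grade ℓ K a m) := by
  refine ⟨⟨Finsupp.lsingle 0, fun d x hx => ?_⟩, ?_, fun c d b hb x hx => ?_⟩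
  · by_cases hd : d = 0
    · subst hd; rfl
    · rw [Seg.grade, if_neg hd, Submodule.mem_bot] at hx
      rw [hx, map_zero, Finsupp.single_zero]
  · rw [eq_top_iff]
    refine le_trans ?_ (le_iSup _ 0)
    rw [Seg.grade, if_pos rfl]
  · by_cases hd : d = 0
    · by_cases hc : c = 0
      · rw [Seg.grade, if_pos (by rw [hc, hd, add_zero])]; trivial
      · have : segCharacter ℓ K a m b = 0 := by
          refine Submodule.span_induction (p := fun b _ => segCharacter ℓ K a m b = 0) ?_
            (map_zero _) ?_ ?_ hb
          · intro b hb
            exact (segCharacter_of_homMonomial ℓ K a m hb).resolve_left hc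
          · intro x y _ _ hx hy; rw [map_add, hx, hy, add_zero]
          · intro k x _ hx; rw [map_smul, hx, smul_zero]
        rw [Seg.smul_def, this, zero_smul]
        exact zero_mem _
    · rw [Seg.grade, if_neg hd, Submodule.mem_bot] at hx
      rw [hx, smul_zero]
      exact zero_mem _

namespace SegConv

/-- The concatenation of the words of the segments. -/
def word (s : List (ℤ × ℕ)) : List (Idx ℓ) := (s.map fun p => segWord ℓ p.1 p.2).flatten

omit [Fact (2 ≤ ℓ)] in
lemma length_segWord (a : ℤ) (m : ℕ) : (segWord ℓ a m).length = m := by simp [segWord]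

omit [Fact (2 ≤ ℓ)] in
lemma word_eq_ofFn (s : List (ℤ × ℕ)) :
    word ℓ s = (List.ofFn fun i : Fin s.length => segWord ℓ s[i].1 s[i].2).flatten := by
  rw [word]
  congr 1
  conv_lhs => rw [← List.ofFn_getElem (xs := s), List.map_ofFn]
  rfl

omit [Fact (2 ≤ ℓ)] in
lemma length_word (s : List (ℤ × ℕ)) : (word ℓ s).length = (s.map Prod.snd).sum := by
  rw [word, List.length_flatten, List.map_map]
  congr 2
  funext p
  exact length_segWord ℓ _ _

omit [Fact (2 ≤ ℓ)] in
lemma offset_eq (s : List (ℤ × ℕ)) (i : Fin s.length) :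
    offset (fun i : Fin s.length => segRoot ℓ s[i].1 s[i].2) i = ((s.take i).map Prod.snd).sum := by
  rw [offset_eq_take_sum]
  congr 1
  rw [List.map_take]
  congr 1
  conv_rhs => rw [← List.ofFn_getElem (xs := s), List.map_ofFn]
  congr 1
  funext j
  exact card_segRoot ℓ _ _

variable (γ : RootCone ℓ) (s : List (ℤ × ℕ))

theorem isGraded : IsGraded γ (SegConv.grade ℓ K γ s) :=
  Conv.isGraded fun i => Seg.isGraded ℓ K _ _

lemma mk_eq (a : QH K γ) (m : ∀ _i : Fin s.length, Seg ℓ K s[_i].1 s[_i].2) :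
    ∃ c : K, Conv.mk K γ _ _ a m = (c • a) • SegConv.gen ℓ K γ s := by
  refine ⟨∏ i, Seg.coord ℓ K _ _ (m i), ?_⟩
  have h := (Conv.tmul K γ (fun i : Fin s.length => segRoot ℓ s[i].1 s[i].2)
    (fun i : Fin s.length => Seg ℓ K s[i].1 s[i].2)).map_smul_univ
      (fun i => Seg.coord ℓ K _ _ (m i)) fun i => Seg.u ℓ K s[i].1 s[i].2
  simp only [Seg.coord_smul_u] at h
  rw [← Conv.smul_mk_one, ← Conv.tmul_apply, h, smul_assoc, ← smul_comm]
  rfl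

/-- The factors are one-dimensional, so a convolution product of segments is cyclic on u ⊗ ⋯ ⊗ u. -/
lemma exists_smul_gen (v : SegConv ℓ K γ s) : ∃ a : QH K γ, v = a • SegConv.gen ℓ K γ s := by
  have hv : v ∈ Submodule.span K {z | ∃ a m, z = Conv.mk K γ _ _ a m} := by
    rw [Conv.span_mk]; trivial
  refine Submodule.span_induction (p := fun v _ => ∃ a : QH K γ, v = a • SegConv.gen ℓ K γ s)
    ?_ ⟨0, by rw [zero_smul]⟩ ?_ ?_ hv
  · rintro _ ⟨a, m, rfl⟩
    obtain ⟨c, hc⟩ := mk_eq ℓ K γ s a m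
    exact ⟨_, hc⟩
  · rintro x y _ _ ⟨a, rfl⟩ ⟨b, rfl⟩
    exact ⟨a + b, by rw [add_smul]⟩
  · rintro k x _ ⟨a, rfl⟩
    exact ⟨k • a, by rw [smul_assoc]⟩

/-- The factors live in degree 0. A term with a factor of nonzero degree vanishes, so the degree is
carried by the algebra element alone. -/
lemma exists_of_mem_grade {d : ℤ} {v : SegConv ℓ K γ s} (hv : v ∈ SegConv.grade ℓ K γ s d) :
    ∃ a ∈ QH.grade K γ d, v = a • SegConv.gen ℓ K γ s := by
  refine Submodule.span_induction (p := fun v _ => ∃ a ∈ QH.grade K γ d,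
    v = a • SegConv.gen ℓ K γ s) ?_ ⟨0, zero_mem _, by rw [zero_smul]⟩ ?_ ?_ hv
  · rintro _ ⟨c, δ, a, m, hd, ha, hm, rfl⟩
    by_cases hδ : ∀ i, δ i = 0
    · obtain ⟨k, hk⟩ := mk_eq ℓ K γ s a m
      refine ⟨k • a, ?_, hk⟩
      have : c = d := by rw [← hd, Finset.sum_eq_zero fun i _ => hδ i, add_zero]
      exact this ▸ Submodule.smul_mem _ _ ha
    · push Not at hδ
      obtain ⟨i, hi⟩ := hδ
      refine ⟨0, zero_mem _, ?_⟩
      have h0 : m i ∈ Seg.grade ℓ K s[i].1 s[i].2 (δ i) := hm i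
      rw [Seg.grade, if_neg hi, Submodule.mem_bot] at h0
      rw [zero_smul, ← Conv.smul_mk_one, ← Conv.tmul_apply,
        (Conv.tmul K γ _ _).map_coord_zero i h0, smul_zero]
  · rintro x y _ _ ⟨a, ha, rfl⟩ ⟨b, hb, rfl⟩
    exact ⟨a + b, add_mem ha hb, by rw [add_smul]⟩
  · rintro k x _ ⟨a, ha, rfl⟩
    exact ⟨k • a, Submodule.smul_mem _ _ ha, by rw [smul_assoc]⟩

lemma smul_gen_mem_grade {d : ℤ} {a : QH K γ} (ha : a ∈ QH.grade K γ d) :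
    a • SegConv.gen ℓ K γ s ∈ SegConv.grade ℓ K γ s d := by
  refine Submodule.subset_span ⟨d, fun _ => 0, a, fun i => Seg.u ℓ K s[i].1 s[i].2, by simp, ha,
    fun i => ?_, ?_⟩
  · simp [Seg.grade]
  · rw [← Conv.smul_mk_one]; rfl

lemma e_smul_gen : QH.e K γ (word ℓ s) • SegConv.gen ℓ K γ s = SegConv.gen ℓ K γ s := by
  rw [word_eq_ofFn, SegConv.gen, Conv.e_smul_mk
    (β := fun i : Fin s.length => segRoot ℓ s[i].1 s[i].2)
    (fun i : Fin s.length => segWord ℓ s[i].1 s[i].2) (fun i => rfl) fun i : Fin s.length => Seg.u ℓ K s[i].1 s[i].2]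
  congr 1
  funext i
  rw [Seg.smul_def, QH.e, segCharacter_gen, segScalar, if_pos rfl, one_smul]

lemma x_smul_gen (p : ℕ) (hp : p < (s.map Prod.snd).sum) :
    QH.x K γ p • SegConv.gen ℓ K γ s = 0 := by
  obtain ⟨i, hi, r, h1, h2⟩ := exists_take_sum _ p hp
  have hi' : i < s.length := by simpa using hi
  rw [List.getElem_map] at h1
  rw [h2, ← List.map_take, show i = ((⟨i, hi'⟩ : Fin s.length) : ℕ) from rfl, ← offset_eq ℓ s, SegConv.gen,
    Conv.x_smul_mk _ _ (by rw [card_segRoot]; exact h1), Seg.smul_def, QH.x, segCharacter_gen,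
    segScalar, zero_smul, ← Conv.tmul_apply, MultilinearMap.map_update_zero]

lemma psi_smul_gen (i : ℕ) (hi : i < s.length) (r : ℕ) (hr : r + 1 < s[i].2) :
    QH.psi K γ (((s.take i).map Prod.snd).sum + r) • SegConv.gen ℓ K γ s = 0 := by
  rw [show i = ((⟨i, hi⟩ : Fin s.length) : ℕ) from rfl, ← offset_eq ℓ s, SegConv.gen,
    Conv.psi_smul_mk _ _ (by rw [card_segRoot]; exact hr), Seg.smul_def, QH.psi, segCharacter_gen,
    segScalar, zero_smul, ← Conv.tmul_apply, MultilinearMap.map_update_zero]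

/-- The universal property of a convolution product of segment modules. -/
theorem exists_lift {N : Type w} [AddCommGroup N] [Module K N] (ρ : QH K γ →ₐ[K] Module.End K N)
    (n : N) (he : ρ (QH.e K γ (word ℓ s)) n = n)
    (hx : ∀ p, p < (s.map Prod.snd).sum → ρ (QH.x K γ p) n = 0)
    (hpsi : ∀ (i : ℕ) (hi : i < s.length) (r : ℕ), r + 1 < s[i].2 →
      ρ (QH.psi K γ (((s.take i).map Prod.snd).sum + r)) n = 0) :
    ∃ f : SegConv ℓ K γ s →ₗ[K] N, f (SegConv.gen ℓ K γ s) = n ∧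
      ∀ (a : QH K γ) v, f (a • v) = ρ a (f v) := by
  set φ : MultilinearMap K (fun i : Fin s.length => Seg ℓ K s[i].1 s[i].2) N :=
    ((MultilinearMap.mkPiAlgebra K (Fin s.length) K).compLinearMap
      fun i : Fin s.length => Seg.coord ℓ K s[i].1 s[i].2).smulRight n with hφ
  have hφm : ∀ m, φ m = (∏ i, Seg.coord ℓ K _ _ (m i)) • n := fun m => rfl
  have hupd : ∀ (i : Fin s.length) (b : QH K (segRoot ℓ s[i].1 s[i].2)) m,
      segCharacter ℓ K _ _ b = 0 → φ (Function.update m i (b • m i)) = 0 := by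
    intro i b m hb
    rw [Seg.smul_def, hb, zero_smul, MultilinearMap.map_update_zero]
  obtain ⟨f, hf, hfa⟩ := Conv.exists_lift ρ φ (by
    intro ν hν m
    rw [hφm, hφm, map_smul]
    by_cases h : ∀ i, ν i = segWord ℓ s[i].1 s[i].2
    · have : ν = fun i => segWord ℓ s[i].1 s[i].2 := funext h
      subst this
      rw [← word_eq_ofFn, he]
      congr 1
      refine Finset.prod_congr rfl fun i _ => ?_
      rw [Seg.smul_def, QH.e, segCharacter_gen, segScalar, if_pos rfl, one_smul]
    · have hne : (List.ofFn ν).flatten ≠ word ℓ s := by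
        intro heq
        rw [word_eq_ofFn] at heq
        -- Lists of words with prescribed lengths are determined by their concatenation.
        refine h fun i => congrFun (List.ofFn_injective (List.eq_iff_flatten_eq.2 ⟨heq, ?_⟩)) i
        rw [List.map_ofFn, List.map_ofFn]
        congr 1
        funext j
        have := congrArg Multiset.card (hν j)
        exact this
      push Not at h
      obtain ⟨i, hi⟩ := h
      rw [rep_e_of_ne he hne, smul_zero, Finset.prod_eq_zero (Finset.mem_univ i), zero_smul]
      rw [Seg.smul_def, QH.e, segCharacter_gen, segScalar, if_neg hi, zero_smul, map_zero]) (by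
    intro i r hr m
    rw [card_segRoot] at hr
    have hlt : ((s.take i).map Prod.snd).sum + r < (s.map Prod.snd).sum := by
      conv_rhs => rw [← List.take_append_drop i s, List.drop_eq_getElem_cons i.2]
      simp only [List.map_append, List.sum_append, List.map_cons, List.sum_cons]
      have : r < s[(i : ℕ)].2 := hr
      omega
    rw [hφm, map_smul, offset_eq, hx _ hlt, smul_zero, hupd]
    rw [QH.x, segCharacter_gen]; rfl) (by
    intro i r hr m
    rw [card_segRoot] at hr
    rw [hφm, map_smul, offset_eq, hpsi i i.2 r hr, smul_zero, hupd]
    rw [QH.psi, segCharacter_gen]; rfl)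
  refine ⟨f, ?_, hfa⟩
  rw [SegConv.gen, hf, map_one, Module.End.one_apply, hφm]
  have : ∏ i : Fin s.length,
      Seg.coord ℓ K _ _ (Seg.u ℓ K s[i].1 s[i].2) = 1 := Finset.prod_eq_one fun i _ => rfl
  rw [this, one_smul]

end SegConv

end

/-! ### Restriction to a block of consecutive strands -/

section

variable (K : Type u) [CommRing K] {ℓ : ℕ∞} (γ : RootCone ℓ) (P : Type v) [AddCommGroup P]
  [Module K P] [Module (QH K γ) P] [IsScalarTower K (QH K γ) P] (μ τ : List (Idx ℓ))
  (β : RootCone ℓ)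

/-- The space `e P`, where `e = ∑ e(μ * ν * τ)`, the sum over the words `ν` of content `β`. -/
def blockSpace : Submodule K P :=
  LinearMap.ker (Algebra.lsmul K K P (∑ ν ∈ words β, QH.e K γ (μ ++ ν ++ τ)) - LinearMap.id)

variable {K γ P μ τ β}

lemma mem_blockSpace {v : P} :
    v ∈ blockSpace K γ P μ τ β ↔ (∑ ν ∈ words β, QH.e K γ (μ ++ ν ++ τ)) • v = v := by
  rw [blockSpace, LinearMap.mem_ker, LinearMap.sub_apply, sub_eq_zero]
  rfl

lemma mem_blockSpace_of_weight {ν : List (Idx ℓ)} (hν : (ν : RootCone ℓ) = β) {v : P}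
    (h : QH.e K γ (μ ++ ν ++ τ) • v = v) : v ∈ blockSpace K γ P μ τ β := by
  rw [mem_blockSpace, ← h, ← mul_smul, Finset.sum_mul,
    Finset.sum_eq_single ν, QH.e_mul_self]
  · intro ν' _ hne
    exact QH.e_mul_of_ne fun h => hne (List.append_cancel_left (List.append_cancel_right h))
  · intro h; exact absurd ((mem_words _ _).2 hν) h

lemma e_smul_mem_blockSpace (ν : List (Idx ℓ)) (v : P) (hν : (ν : RootCone ℓ) = β) :
    QH.e K γ (μ ++ ν ++ τ) • v ∈ blockSpace K γ P μ τ β :=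
  mem_blockSpace_of_weight hν (by rw [← mul_smul, QH.e_mul_self])

lemma e_smul_blockSpace {ν : List (Idx ℓ)} (hν : (ν : RootCone ℓ) ≠ β) {v : P}
    (hv : v ∈ blockSpace K γ P μ τ β) : QH.e K γ (μ ++ ν ++ τ) • v = 0 := by
  rw [← mem_blockSpace.1 hv, ← mul_smul, Finset.mul_sum, Finset.sum_eq_zero, zero_smul]
  intro ν' hν'
  refine QH.e_mul_of_ne fun h => hν ?_
  rw [List.append_cancel_left (List.append_cancel_right h)]
  exact (mem_words _ _).1 hν'

lemma blockSpace_stable_e (ν : List (Idx ℓ)) (v : P) (hv : v ∈ blockSpace K γ P μ τ β) :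
    QH.e K γ (μ ++ ν ++ τ) • v ∈ blockSpace K γ P μ τ β := by
  by_cases hν : (ν : RootCone ℓ) = β
  · exact e_smul_mem_blockSpace ν v hν
  · rw [e_smul_blockSpace hν hv]; exact zero_mem _

lemma blockSpace_stable_x (p : ℕ) (v : P) (hv : v ∈ blockSpace K γ P μ τ β) :
    QH.x K γ p • v ∈ blockSpace K γ P μ τ β := by
  rw [mem_blockSpace] at hv ⊢
  rw [← mul_smul, Finset.sum_mul, Finset.sum_congr rfl fun ν _ => (QH.x_mul_e p _).symm,
    ← Finset.mul_sum, mul_smul, hv]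

lemma blockSpace_stable_psi (r : ℕ) (hr : r + 1 < β.card) (v : P)
    (hv : v ∈ blockSpace K γ P μ τ β) :
    QH.psi K γ (μ.length + r) • v ∈ blockSpace K γ P μ τ β := by
  rw [← mem_blockSpace.1 hv, ← mul_smul, Finset.mul_sum, Finset.sum_smul]
  refine Submodule.sum_mem _ fun ν hν => ?_
  rw [mem_words] at hν
  obtain ⟨A, i, j, B, rfl, hA⟩ := exists_split ν r (by rw [← Multiset.coe_card, hν]; exact hr)
  have h1 : μ ++ (A ++ i :: j :: B) ++ τ = (μ ++ A) ++ i :: j :: (B ++ τ) := by simp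
  have h2 : μ.length + r = (μ ++ A).length := by rw [List.length_append, hA]
  rw [h1, h2, QH.psi_mul_e, mul_smul]
  have h3 : (μ ++ A) ++ j :: i :: (B ++ τ) = μ ++ (A ++ j :: i :: B) ++ τ := by simp
  rw [h3]
  refine e_smul_mem_blockSpace _ _ ?_
  rw [← hν, Multiset.coe_eq_coe]
  exact (List.Perm.swap i j B).append_left A

variable (K γ P μ τ β) in
/-- The action of the generators on the block. -/
noncomputable def blockGen : Gen ℓ → Module.End K (blockSpace K γ P μ τ β)
  | .e ν => LinearMap.restrict (Algebra.lsmul K K P (QH.e K γ (μ ++ ν ++ τ)))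
      (blockSpace_stable_e ν)
  | .x r => if r < β.card then LinearMap.restrict (Algebra.lsmul K K P (QH.x K γ (μ.length + r)))
      (blockSpace_stable_x (μ.length + r)) else 0
  | .psi r => if h : r + 1 < β.card then
      LinearMap.restrict (Algebra.lsmul K K P (QH.psi K γ (μ.length + r)))
        (blockSpace_stable_psi r h) else 0

variable (v : blockSpace K γ P μ τ β)

lemma blockGen_e (ν : List (Idx ℓ)) :
    (blockGen K γ P μ τ β (.e ν) v : P) = QH.e K γ (μ ++ ν ++ τ) • (v : P) := rfl

lemma blockGen_x {r : ℕ} (hr : r < β.card) :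
    (blockGen K γ P μ τ β (.x r) v : P) = QH.x K γ (μ.length + r) • (v : P) := by
  rw [blockGen, if_pos hr]; rfl

lemma blockGen_psi {r : ℕ} (hr : r + 1 < β.card) :
    (blockGen K γ P μ τ β (.psi r) v : P) = QH.psi K γ (μ.length + r) • (v : P) := by
  rw [blockGen, dif_pos hr]; rfl

lemma blockGen_x_eq_zero {r : ℕ} (hr : ¬ r < β.card) : blockGen K γ P μ τ β (.x r) = 0 := by
  rw [blockGen, if_neg hr]

lemma blockGen_psi_eq_zero {r : ℕ} (hr : ¬ r + 1 < β.card) :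
    blockGen K γ P μ τ β (.psi r) = 0 := by rw [blockGen, dif_neg hr]

variable (K γ P μ τ β) in
/-- Pairs consisting of an operator on the block and an element of `R(γ)` inducing it. -/
def blockPairs : Subring (Module.End K (blockSpace K γ P μ τ β) × QH K γ) where
  carrier := {p | ∀ v, (p.1 v : P) = p.2 • (v : P)}
  mul_mem' {p q} hp hq v := by
    rw [Prod.fst_mul, Prod.snd_mul, Module.End.mul_apply, hp, hq, mul_smul]
  one_mem' v := by simp
  add_mem' {p q} hp hq v := by
    rw [Prod.fst_add, Prod.snd_add, LinearMap.add_apply, Submodule.coe_add, hp, hq, add_smul]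
  zero_mem' v := by simp
  neg_mem' {p} hp v := by
    rw [Prod.fst_neg, Prod.snd_neg, LinearMap.neg_apply, Submodule.coe_neg, hp, neg_smul]

lemma blockPairs_qEval (i j : Idx ℓ) {f g : Module.End K (blockSpace K γ P μ τ β)}
    {x y : QH K γ} (hf : (f, x) ∈ blockPairs K γ P μ τ β) (hg : (g, y) ∈ blockPairs K γ P μ τ β) :
    (qEval i j f g, qEval i j x y) ∈ blockPairs K γ P μ τ β := by
  have h := qEval_mem _ i j hf hg
  have h1 := map_qEval (RingHom.fst _ _) i j (f, x) (g, y)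
  have h2 := map_qEval (RingHom.snd _ _) i j (f, x) (g, y)
  rw [← Prod.mk.eta (p := qEval i j (f, x) (g, y))] at h
  rwa [← RingHom.coe_fst, ← RingHom.coe_snd, h1, h2] at h

lemma blockPairs_qDivDiff (i j : Idx ℓ) {f g h : Module.End K (blockSpace K γ P μ τ β)}
    {x y z : QH K γ} (hf : (f, x) ∈ blockPairs K γ P μ τ β)
    (hg : (g, y) ∈ blockPairs K γ P μ τ β) (hh : (h, z) ∈ blockPairs K γ P μ τ β) :
    (qDivDiff i j f g h, qDivDiff i j x y z) ∈ blockPairs K γ P μ τ β := by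
  have h0 := qDivDiff_mem _ i j hf hg hh
  have h1 := map_qDivDiff (RingHom.fst _ _) i j (f, x) (g, y) (h, z)
  have h2 := map_qDivDiff (RingHom.snd _ _) i j (f, x) (g, y) (h, z)
  rw [← Prod.mk.eta (p := qDivDiff i j (f, x) (g, y) (h, z))] at h0
  rwa [← RingHom.coe_fst, ← RingHom.coe_snd, h1, h2] at h0

/-- Two operators on the block are equal if they agree on weight vectors. -/
lemma eq_of_blockPairs {f g : Module.End K (blockSpace K γ P μ τ β)} {x y : QH K γ}
    (hf : (f, x) ∈ blockPairs K γ P μ τ β) (hg : (g, y) ∈ blockPairs K γ P μ τ β) (ν : List (Idx ℓ))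
    (hxy : x * QH.e K γ (μ ++ ν ++ τ) = y * QH.e K γ (μ ++ ν ++ τ)) :
    f * blockGen K γ P μ τ β (.e ν) = g * blockGen K γ P μ τ β (.e ν) := by
  ext v
  rw [Module.End.mul_apply, Module.End.mul_apply, hf, hg, blockGen_e, ← mul_smul, ← mul_smul, hxy]

lemma blockGen_e_eq_zero {ν : List (Idx ℓ)} (hν : (ν : RootCone ℓ) ≠ β) :
    blockGen K γ P μ τ β (.e ν) = 0 := by
  ext v
  rw [blockGen_e, e_smul_blockSpace hν v.2]
  rfl

/-- Shifted by μ.length strands, a relation of R(β) on e(ν) is a relation of R(γ) on e(μ * ν * τ).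
Both sides lie in `blockPairs`, so they can be compared through the elements of R(γ) that induce
them. Idempotents of words outside of β act as 0 on the block. -/
theorem blockGen_rel (a b : Module.End K (blockSpace K γ P μ τ β))
    (h : Rel β (blockGen K γ P μ τ β) a b) : a = b := by
  have hX : ∀ {r : ℕ}, r < β.card →
      (blockGen K γ P μ τ β (.x r), QH.x K γ (μ.length + r)) ∈ blockPairs K γ P μ τ β :=
    fun hr v => blockGen_x v hr
  have hΨ : ∀ {r : ℕ}, r + 1 < β.card →
      (blockGen K γ P μ τ β (.psi r), QH.psi K γ (μ.length + r)) ∈ blockPairs K γ P μ τ β :=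
    fun hr v => blockGen_psi v hr
  have hE : ∀ ν, (blockGen K γ P μ τ β (.e ν), QH.e K γ (μ ++ ν ++ τ)) ∈ blockPairs K γ P μ τ β :=
    fun ν v => blockGen_e v ν
  have key : ∀ {f g : Module.End K (blockSpace K γ P μ τ β)} {x : QH K γ},
      (f, x) ∈ blockPairs K γ P μ τ β → (g, x) ∈ blockPairs K γ P μ τ β → f = g := by
    intro f g x hf hg
    ext v
    rw [hf, hg]
  have hS := @Subring.mul_mem _ _ (blockPairs K γ P μ τ β)
  have hsub := @Subring.sub_mem _ _ (blockPairs K γ P μ τ β)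
  have hadd := @Subring.add_mem _ _ (blockPairs K γ P μ τ β)
  have hite : ∀ (i j : Idx ℓ), ((if i = j then 1 else 0 : Module.End K _),
      (if i = j then 1 else 0 : QH K γ)) ∈ blockPairs K γ P μ τ β := by
    intro i j
    split_ifs
    · exact one_mem _
    · exact zero_mem _
  have hlen2 : ∀ {A B : List (Idx ℓ)} {i j : Idx ℓ}, ((A ++ i :: j :: B : List (Idx ℓ)) :
      RootCone ℓ) = β → A.length + 1 < β.card := by
    intro A B i j h
    rw [← h, Multiset.coe_card]; simp
  cases h
  case e_zero ν h => exact blockGen_e_eq_zero h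
  case x_zero r h => exact blockGen_x_eq_zero (by omega)
  case psi_zero r h => exact blockGen_psi_eq_zero (by omega)
  case e_mul_self ν => exact key (hS (hE ν) (hE ν)) (by rw [QH.e_mul_self]; exact hE ν)
  case e_mul ν ν' h =>
    refine key (hS (hE ν) (hE ν')) ?_
    rw [QH.e_mul_of_ne fun h' => h (List.append_cancel_left (List.append_cancel_right h'))]
    exact zero_mem _
  case e_sum =>
    ext v
    rw [LinearMap.sum_apply, Submodule.coe_sum, Module.End.one_apply]
    conv_rhs => rw [← mem_blockSpace.1 v.2, Finset.sum_smul]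
    rfl
  case x_e r ν =>
    by_cases hr : r < β.card
    · exact key (hS (hX hr) (hE ν)) (by rw [QH.x_mul_e]; exact hS (hE ν) (hX hr))
    · rw [blockGen_x_eq_zero hr, zero_mul, mul_zero]
  case psi_e A B i j =>
    by_cases hν : ((A ++ i :: j :: B : List (Idx ℓ)) : RootCone ℓ) = β
    · have hr := hlen2 hν
      refine key (hS (hΨ hr) (hE _)) ?_
      have := QH.psi_mul_e (k := K) (β := γ) (μ ++ A) (B ++ τ) i j
      rw [List.length_append] at this
      rw [show μ ++ (A ++ i :: j :: B) ++ τ = μ ++ A ++ i :: j :: (B ++ τ) by simp, this,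
        show μ ++ A ++ j :: i :: (B ++ τ) = μ ++ (A ++ j :: i :: B) ++ τ by simp]
      exact hS (hE _) (hΨ hr)
    · rw [blockGen_e_eq_zero hν, blockGen_e_eq_zero, zero_mul, mul_zero]
      intro h
      refine hν (h ▸ ?_)
      rw [Multiset.coe_eq_coe]
      exact (List.Perm.swap j i B).append_left A
  case x_x r s =>
    by_cases hr : r < β.card
    · by_cases hs : s < β.card
      · exact key (hS (hX hr) (hX hs)) (by rw [QH.x_mul_x]; exact hS (hX hs) (hX hr))
      · rw [blockGen_x_eq_zero hs, zero_mul, mul_zero]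
    · rw [blockGen_x_eq_zero hr, zero_mul, mul_zero]
  case psi_x r s h h' =>
    by_cases hr : r + 1 < β.card
    · by_cases hs : s < β.card
      · refine key (hS (hΨ hr) (hX hs)) ?_
        rw [QH.psi_mul_x (by omega) (by omega)]; exact hS (hX hs) (hΨ hr)
      · rw [blockGen_x_eq_zero hs, zero_mul, mul_zero]
    · rw [blockGen_psi_eq_zero hr, zero_mul, mul_zero]
  case psi_psi r s h =>
    by_cases hr : r + 1 < β.card
    · by_cases hs : s + 1 < β.card
      · refine key (hS (hΨ hr) (hΨ hs)) ?_
        rw [QH.psi_mul_psi (by omega)]; exact hS (hΨ hs) (hΨ hr)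
      · rw [blockGen_psi_eq_zero hs, zero_mul, mul_zero]
    · rw [blockGen_psi_eq_zero hr, zero_mul, mul_zero]
  case x_psi A B i j =>
    by_cases hν : ((A ++ i :: j :: B : List (Idx ℓ)) : RootCone ℓ) = β
    · have hr := hlen2 hν
      refine eq_of_blockPairs (hS (hX (by omega)) (hΨ hr))
        (hsub (hS (hΨ hr) (hX (r := A.length + 1) (by omega))) (hite i j)) _ ?_
      have := QH.x_mul_psi (k := K) (β := γ) (μ ++ A) (B ++ τ) i j
      rw [List.length_append] at this
      rwa [show μ ++ (A ++ i :: j :: B) ++ τ = μ ++ A ++ i :: j :: (B ++ τ) by simp, ← add_assoc]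
    · rw [blockGen_e_eq_zero hν, mul_zero, mul_zero]
  case x_psi' A B i j =>
    by_cases hν : ((A ++ i :: j :: B : List (Idx ℓ)) : RootCone ℓ) = β
    · have hr := hlen2 hν
      refine eq_of_blockPairs (hS (hX (r := A.length + 1) (by omega)) (hΨ hr))
        (hadd (hS (hΨ hr) (hX (r := A.length) (by omega))) (hite i j)) _ ?_
      have := QH.x_mul_psi' (k := K) (β := γ) (μ ++ A) (B ++ τ) i j
      rw [List.length_append] at this
      rwa [show μ ++ (A ++ i :: j :: B) ++ τ = μ ++ A ++ i :: j :: (B ++ τ) by simp, ← add_assoc]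
    · rw [blockGen_e_eq_zero hν, mul_zero, mul_zero]
  case psi_sq A B i j =>
    by_cases hν : ((A ++ i :: j :: B : List (Idx ℓ)) : RootCone ℓ) = β
    · have hr := hlen2 hν
      refine eq_of_blockPairs (hS (hΨ hr) (hΨ hr)) (blockPairs_qEval i j
        (hX (r := A.length) (by omega)) (hX (r := A.length + 1) (by omega))) _ ?_
      have := QH.psi_mul_self (k := K) (β := γ) (μ ++ A) (B ++ τ) i j
      rw [List.length_append] at this
      rwa [show μ ++ (A ++ i :: j :: B) ++ τ = μ ++ A ++ i :: j :: (B ++ τ) by simp, ← add_assoc]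
    · rw [blockGen_e_eq_zero hν, mul_zero, mul_zero]
  case braid A B i j l =>
    by_cases hν : ((A ++ i :: j :: l :: B : List (Idx ℓ)) : RootCone ℓ) = β
    · have hr : A.length + 2 < β.card := by rw [← hν, Multiset.coe_card]; simp
      have h1 := hΨ (r := A.length) (by omega)
      have h2 := hΨ (r := A.length + 1) (by omega)
      have hq := blockPairs_qDivDiff i j (hX (r := A.length) (by omega))
        (hX (r := A.length + 1) (by omega)) (hX (r := A.length + 2) (by omega))
      have := QH.braid (k := K) (β := γ) (μ ++ A) (B ++ τ) i j l
      rw [List.length_append] at this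
      have hw : μ ++ (A ++ i :: j :: l :: B) ++ τ = μ ++ A ++ i :: j :: l :: (B ++ τ) := by simp
      refine eq_of_blockPairs (hsub (hS (hS h2 h1) h2) (hS (hS h1 h2) h1))
        (y := if i = l then qDivDiff i j (QH.x K γ (μ.length + A.length))
          (QH.x K γ (μ.length + (A.length + 1))) (QH.x K γ (μ.length + (A.length + 2))) else 0)
        ?_ _ ?_
      · split_ifs
        · exact hq
        · exact zero_mem _
      · rw [hw]
        simpa only [add_assoc, Prod.snd_sub, Prod.snd_mul] using this
    · rw [blockGen_e_eq_zero hν, mul_zero, mul_zero]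

variable (K γ P μ τ β) in
/-- The action of `R(β)` on the block. -/
noncomputable def blockRep : QH K β →ₐ[K] Module.End K (blockSpace K γ P μ τ β) :=
  QH.lift (blockGen K γ P μ τ β) blockGen_rel

lemma blockRep_e (ν : List (Idx ℓ)) :
    (blockRep K γ P μ τ β (QH.e K β ν) v : P) = QH.e K γ (μ ++ ν ++ τ) • (v : P) := by
  rw [QH.e, blockRep, QH.lift_gen, blockGen_e]

lemma blockRep_x {r : ℕ} (hr : r < β.card) :
    (blockRep K γ P μ τ β (QH.x K β r) v : P) = QH.x K γ (μ.length + r) • (v : P) := by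
  rw [QH.x, blockRep, QH.lift_gen, blockGen_x v hr]

lemma blockRep_psi {r : ℕ} (hr : r + 1 < β.card) :
    (blockRep K γ P μ τ β (QH.psi K β r) v : P) = QH.psi K γ (μ.length + r) • (v : P) := by
  rw [QH.psi, blockRep, QH.lift_gen, blockGen_psi v hr]

/-- The block is stable and the action is homogeneous. -/
lemma blockRep_mem_grade [Fact (2 ≤ ℓ)] {gr : ℤ → Submodule K P} (hgr : IsGraded γ gr) {c d : ℤ}
    {b : QH K β} (hb : b ∈ QH.grade K β c) (hv : (v : P) ∈ gr d) :
    (blockRep K γ P μ τ β b v : P) ∈ gr (c + d) := by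
  have key : ∀ {c : ℤ} {b : QH K β}, QH.HomMonomial K β c b → ∀ {d : ℤ}
      (v : blockSpace K γ P μ τ β), (v : P) ∈ gr d →
        (blockRep K γ P μ τ β b v : P) ∈ gr (c + d) := by
    intro c b hb
    induction hb with
    | e ν =>
      intro d v hv
      rw [blockRep_e]
      exact hgr.smul_mem _ _ _ (QH.e_mem_grade _) _ hv
    | x A B i =>
      intro d v hv
      by_cases hν : ((A ++ i :: B : List (Idx ℓ)) : RootCone ℓ) = β
      · rw [rep_mul, blockRep_x _ (by rw [← hν, Multiset.coe_card]; simp), blockRep_e, ← mul_smul]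
        refine hgr.smul_mem _ _ _ (Submodule.subset_span ?_) _ hv
        rw [← List.length_append, show μ ++ (A ++ i :: B) ++ τ = μ ++ A ++ i :: (B ++ τ) by simp]
        exact .x _ _ _
      · rw [QH.e_eq_zero hν, mul_zero, map_zero]
        exact zero_mem _
    | psi A B i j =>
      intro d v hv
      by_cases hν : ((A ++ i :: j :: B : List (Idx ℓ)) : RootCone ℓ) = β
      · rw [rep_mul, blockRep_psi _ (by rw [← hν, Multiset.coe_card]; simp), blockRep_e, ← mul_smul]
        refine hgr.smul_mem _ _ _ (Submodule.subset_span ?_) _ hv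
        rw [← List.length_append,
          show μ ++ (A ++ i :: j :: B) ++ τ = μ ++ A ++ i :: j :: (B ++ τ) by simp]
        exact .psi _ _ _ _
      · rw [QH.e_eq_zero hν, mul_zero, map_zero]
        exact zero_mem _
    | mul _ _ iha ihb =>
      intro d v hv
      rw [rep_mul, add_assoc]
      exact iha _ (ihb v hv)
  refine Submodule.span_induction (p := fun b _ => (blockRep K γ P μ τ β b v : P) ∈ gr (c + d)) ?_
    (by simp) ?_ ?_ hb
  · intro b hb
    exact key hb v hv
  · intro x y _ _ hx hy
    rw [map_add, LinearMap.add_apply, Submodule.coe_add]; exact add_mem hx hy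
  · intro k x _ hx
    rw [map_smul, LinearMap.smul_apply, Submodule.coe_smul]; exact Submodule.smul_mem _ _ hx

end

/-! ### Homogeneity of products of `ψ`'s -/

section

variable {K : Type u} [CommRing K] {ℓ : ℕ∞} {β : RootCone ℓ}

/-- Moving one strand past a block is homogeneous. -/
lemma homMonomial_run (i : Idx ℓ) (B μ ρ : List (Idx ℓ)) :
    QH.HomMonomial K β (-(B.map fun j => form i j).sum)
      (QH.psiWord K β (run μ.length B.length) * QH.e K β (μ ++ i :: (B ++ ρ))) ∧
    QH.psiWord K β (run μ.length B.length) * QH.e K β (μ ++ i :: (B ++ ρ)) =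
      QH.e K β (μ ++ (B ++ i :: ρ)) * QH.psiWord K β (run μ.length B.length) := by
  induction B using List.reverseRecOn generalizing ρ with
  | nil =>
    simp only [List.length_nil, run, List.range_zero, List.reverse_nil, List.map_nil,
      QH.psiWord_nil, List.sum_nil, neg_zero, List.nil_append, one_mul, mul_one]
    exact ⟨.e _, trivial⟩
  | append_singleton B j ih =>
    obtain ⟨h1, h2⟩ := ih (j :: ρ)
    have e1 : B ++ [j] ++ ρ = B ++ j :: ρ := by simp
    have e2 := QH.psi_mul_e (k := K) (β := β) (μ ++ B) ρ i j
    have h3 := QH.HomMonomial.psi (k := K) (β := β) (μ ++ B) ρ i j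
    rw [List.length_append] at h3 e2
    rw [List.length_append, List.length_singleton, run_succ, QH.psiWord_cons, e1]
    constructor
    · have h4 := h3.mul h1
      have : -form i j + -(B.map fun j => form i j).sum =
          -((B ++ [j]).map fun j => form i j).sum := by simp
      rw [this] at h4
      convert h4 using 1
      rw [mul_assoc, mul_assoc, h2, ← mul_assoc (QH.e K β _)]
      rw [show μ ++ B ++ i :: j :: ρ = μ ++ (B ++ i :: j :: ρ) by simp, QH.e_mul_self]
    · rw [mul_assoc, h2, ← mul_assoc, show μ ++ (B ++ i :: j :: ρ) = μ ++ B ++ i :: j :: ρ by simp,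
        e2, show μ ++ (B ++ [j] ++ i :: ρ) = μ ++ B ++ j :: i :: ρ by simp, mul_assoc]

/-- Moving a block past another block is homogeneous. -/
lemma homMonomial_blockWord (A B ρ : List (Idx ℓ)) :
    QH.HomMonomial K β (-(A.map fun i => (B.map fun j => form i j).sum).sum)
      (QH.psiWord K β (blockWord A.length B.length) * QH.e K β (A ++ B ++ ρ)) := by
  induction A using List.reverseRecOn generalizing ρ with
  | nil =>
    simp only [List.length_nil, blockWord, List.range_zero, List.flatMap_nil, List.map_nil,
      QH.psiWord_nil, List.sum_nil, neg_zero, List.nil_append, one_mul]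
    exact .e _
  | append_singleton A i ih =>
    obtain ⟨h1, h2⟩ := homMonomial_run (K := K) (β := β) i B A ρ
    have h3 := (ih (i :: ρ)).mul h1
    rw [List.length_append, List.length_singleton, blockWord_succ, QH.psiWord_append]
    have : -(A.map fun i => (B.map fun j => form i j).sum).sum + -(B.map fun j => form i j).sum =
        -((A ++ [i]).map fun i => (B.map fun j => form i j).sum).sum := by simp; ring
    rw [this] at h3
    convert h3 using 1
    rw [h2, mul_assoc, mul_assoc, ← mul_assoc (QH.e K β _) (QH.e K β _),
      show A ++ (B ++ i :: ρ) = A ++ B ++ i :: ρ by simp, QH.e_mul_self,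
      show A ++ [i] ++ B ++ ρ = A ++ i :: (B ++ ρ) by simp, h2,
      show A ++ (B ++ i :: ρ) = A ++ B ++ i :: ρ by simp]

variable {M : Type v} [AddCommGroup M] [Module K M] [Module (QH K β) M]
  [IsScalarTower K (QH K β) M] [Fact (2 ≤ ℓ)] {gr : ℤ → Submodule K M}

omit [IsScalarTower K (QH K β) M] [Fact (2 ≤ ℓ)] in
/-- Applying `ψ`'s to a homogeneous weight vector gives homogeneous weight vectors. -/
lemma IsGraded.exists_psiWord_mem (h : IsGraded β gr) {d : ℤ} {m : M} (hm : m ∈ gr d)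
    {ν : List (Idx ℓ)} (hν : QH.e K β ν • m = m) (w : List ℕ) :
    ∃ d' ν', QH.psiWord K β w • m ∈ gr d' ∧
      QH.e K β ν' • QH.psiWord K β w • m = QH.psiWord K β w • m := by
  induction w with
  | nil => exact ⟨d, ν, by rwa [QH.psiWord_nil, one_smul], by rwa [QH.psiWord_nil, one_smul]⟩
  | cons i w ih =>
    obtain ⟨d', ν', h1, h2⟩ := ih
    rw [QH.psiWord_cons, mul_smul]
    set v := QH.psiWord K β w • m
    by_cases hc : (ν' : RootCone ℓ) = β
    · rcases Nat.lt_or_ge (i + 1) ν'.length with hi | hi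
      · obtain ⟨A, a, b, B, rfl, rfl⟩ := exists_split ν' i hi
        refine ⟨-form a b + d', A ++ b :: a :: B, ?_, ?_⟩
        · rw [← h2, ← mul_smul]
          exact h.smul_mem _ _ _ (Submodule.subset_span (.psi A B a b)) _ h1
        · rw [← mul_smul, ← QH.psi_mul_e, mul_smul, h2]
      · refine ⟨0, ν', ?_, ?_⟩ <;>
          rw [QH.psi_eq_zero (by rw [← hc, Multiset.coe_card]; exact hi), zero_smul]
        · exact zero_mem _
        · rw [smul_zero]
    · have hv : v = 0 := by rw [← h2, QH.e_eq_zero hc, zero_smul]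
      exact ⟨0, ν', by rw [hv, smul_zero]; exact zero_mem _, by rw [hv, smul_zero, smul_zero]⟩

/-- Homogeneous elements act compatibly on homogeneous components. -/
lemma IsGraded.smul_component (h : IsGraded β gr) {δ : M →ₗ[K] (ℤ →₀ M)}
    (hδ : ∀ d, ∀ m ∈ gr d, δ m = Finsupp.single d m) {c : ℤ} {a : QH K β}
    (ha : a ∈ QH.grade K β c) (m : M) (d : ℤ) : a • δ m d = δ (a • m) (c + d) := by
  rw [h.delta_smul hδ, twistRep_of_grade ha, Module.End.mul_apply, shiftDeg,
    Finsupp.lmapDomain_apply, Finsupp.mapDomain_apply (add_right_injective c)]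
  simp [finsuppRep]

/-- The components of a vector that spans a copy of a segment module. -/
lemma IsGraded.component_smul {a : ℤ} {n : ℕ} {β : RootCone ℓ} (hβ : β = segRoot ℓ a n)
    {M : Type v} [AddCommGroup M] [Module K M] [Module (QH K β) M] [IsScalarTower K (QH K β) M]
    {gr : ℤ → Submodule K M} (h : IsGraded β gr) {δ : M →ₗ[K] (ℤ →₀ M)}
    (hδ : ∀ d, ∀ m ∈ gr d, δ m = Finsupp.single d m) {m : M}
    (hm : ∀ s, QH.gen K β s • m = segScalar ℓ K a n s • m) (d : ℤ) (s : Gen ℓ) :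
    QH.gen K β s • δ m d = segScalar ℓ K a n s • δ m d := by
  have he : ∀ ν, QH.e K β ν • δ m d = segScalar ℓ K a n (.e ν) • δ m d := by
    intro ν
    rw [h.smul_component hδ (QH.e_mem_grade ν), zero_add, QH.e, hm, map_smul]
    rfl
  have hw : QH.e K β (segWord ℓ a n) • m = m := by
    rw [QH.e, hm, segScalar, if_pos rfl, one_smul]
  have hw' : QH.e K β (segWord ℓ a n) • δ m d = δ m d := by
    rw [he, segScalar, if_pos rfl, one_smul]
  have hlen : (segWord ℓ a n).length = β.card := by rw [hβ, card_segRoot]; simp [segWord]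
  cases s with
  | e ν => exact he ν
  | x r =>
    rw [segScalar, zero_smul]
    rcases Nat.lt_or_ge r (segWord ℓ a n).length with hr | hr
    -- Since x_r has a degree only on weight vectors, the idempotent of the segment is inserted; it
    -- fixes both m and its component.
    · obtain ⟨A, i, B, hAB, rfl⟩ := exists_split₁ _ r hr
      rw [← hw', ← mul_smul, hAB]
      change (QH.x K β A.length * _) • _ = _
      rw [h.smul_component hδ (Submodule.subset_span (.x A B i)), mul_smul, ← hAB, hw, QH.x, hm,
        segScalar, zero_smul, map_zero, Finsupp.zero_apply]
    · change QH.x K β r • _ = _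
      rw [QH.x_eq_zero (by omega), zero_smul]
  | psi r =>
    rw [segScalar, zero_smul]
    rcases Nat.lt_or_ge (r + 1) (segWord ℓ a n).length with hr | hr
    · obtain ⟨A, i, j, B, hAB, rfl⟩ := exists_split _ r hr
      rw [← hw', ← mul_smul, hAB]
      change (QH.psi K β A.length * _) • _ = _
      rw [h.smul_component hδ (Submodule.subset_span (.psi A B i j)), mul_smul, ← hAB, hw, QH.psi,
        hm, segScalar, zero_smul, map_zero, Finsupp.zero_apply]
    · change QH.psi K β r • _ = _
      rw [QH.psi_eq_zero (by omega), zero_smul]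

end

/-! ### Noncommutative polynomials in the `ψ`'s -/

section

variable (K : Type u) [CommRing K] {ℓ : ℕ∞}

/-- The monomial of a word in the letters `0, …, N - 1`. -/
noncomputable def wordMonomial (N : ℕ) (w : List ℕ) : FreeAlgebra K (Fin N) :=
  (w.map fun j => if h : j < N then FreeAlgebra.ι K (⟨j, h⟩ : Fin N) else 0).prod

lemma psiPoly_wordMonomial (γ : RootCone ℓ) (a : ℕ) {N : ℕ} {w : List ℕ} (hw : ∀ j ∈ w, j < N) :
    psiPoly ℓ K γ a (wordMonomial K N w) = QH.psiWord K γ (w.map (a + ·)) := by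
  rw [psiPoly, wordMonomial, map_list_prod, QH.psiWord, List.map_map, List.map_map]
  congr 1
  refine List.map_congr_left fun j hj => ?_
  simp [hw j hj]

variable {K} in
/-- Induction for the elements `h(ψ_{a+1}, …)`. -/
lemma psiPoly_induction {γ : RootCone ℓ} {N : ℕ} (a : ℕ) {p : QH K γ → Prop}
    (hc : ∀ c : K, p (algebraMap K _ c)) (hpsi : ∀ j < N, p (QH.psi K γ (a + j)))
    (hadd : ∀ x y, p x → p y → p (x + y)) (hmul : ∀ x y, p x → p y → p (x * y))
    (h : FreeAlgebra K (Fin N)) : p (psiPoly ℓ K γ a h) := by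
  unfold psiPoly
  induction h using FreeAlgebra.induction with
  | grade0 c => rw [AlgHom.commutes]; exact hc c
  | grade1 j => rw [FreeAlgebra.lift_ι_apply]; exact hpsi j j.2
  | mul x y hx hy => rw [map_mul]; exact hmul _ _ hx hy
  | add x y hx hy => rw [map_add]; exact hadd _ _ hx hy

/-- The elements ψ with indices a, …, a + N − 1 involve only the strands a, …, a + N. -/
lemma psiPoly_comm_x {γ : RootCone ℓ} {N a p : ℕ} (hp : p < a ∨ a + N < p)
    (h : FreeAlgebra K (Fin N)) :
    QH.x K γ p * psiPoly ℓ K γ a h = psiPoly ℓ K γ a h * QH.x K γ p := by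
  refine psiPoly_induction a (p := fun b => QH.x K γ p * b = b * QH.x K γ p)
    (fun c => (Algebra.commutes c _).symm) (fun j hj => (QH.psi_mul_x (by omega) (by omega)).symm)
    (fun x y hx hy => by rw [mul_add, add_mul, hx, hy])
    (fun x y hx hy => by rw [← mul_assoc, hx, mul_assoc, hy, mul_assoc]) h

lemma psiPoly_comm_psi {γ : RootCone ℓ} {N a p : ℕ} (hp : p + 1 < a ∨ a + N < p)
    (h : FreeAlgebra K (Fin N)) :
    QH.psi K γ p * psiPoly ℓ K γ a h = psiPoly ℓ K γ a h * QH.psi K γ p := by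
  refine psiPoly_induction a (p := fun b => QH.psi K γ p * b = b * QH.psi K γ p)
    (fun c => (Algebra.commutes c _).symm) (fun j hj => QH.psi_mul_psi (by omega))
    (fun x y hx hy => by rw [mul_add, add_mul, hx, hy])
    (fun x y hx hy => by rw [← mul_assoc, hx, mul_assoc, hy, mul_assoc]) h

/-- Lets the formula for ι(u) be copied into a block of a larger convolution product. -/
lemma blockRep_psiPoly {γ : RootCone ℓ} {P : Type v} [AddCommGroup P]
    [Module K P] [Module (QH K γ) P] [IsScalarTower K (QH K γ) P] {μ τ : List (Idx ℓ)}
    {β : RootCone ℓ} {N : ℕ} (hN : N + 1 ≤ β.card) (h : FreeAlgebra K (Fin N))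
    (v : blockSpace K γ P μ τ β) :
    (blockRep K γ P μ τ β (psiPoly ℓ K β 0 h) v : P) =
      psiPoly ℓ K γ μ.length h • (v : P) := by
  unfold psiPoly
  induction h using FreeAlgebra.induction generalizing v with
  | grade0 c => simp
  | grade1 j =>
    rw [FreeAlgebra.lift_ι_apply, FreeAlgebra.lift_ι_apply, zero_add, blockRep_psi _ (by omega)]
  | mul x y hx hy => rw [map_mul, map_mul, Module.End.mul_apply, hx, hy, map_mul, mul_smul]
  | add x y hx hy =>
    rw [map_add, map_add, LinearMap.add_apply, Submodule.coe_add, hx, hy, map_add, add_smul]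

end

/-! ### The embedding of a segment -/

section

variable (ℓ : ℕ∞) [Fact (2 ≤ ℓ)] (K : Type u) [CommRing K]

lemma SegConv.x_smul_gen' (γ : RootCone ℓ) (s : List (ℤ × ℕ)) (p : ℕ) :
    QH.x K γ p • SegConv.gen ℓ K γ s = 0 := by
  rcases Nat.lt_or_ge p (s.map Prod.snd).sum with h | h
  · exact x_smul_gen ℓ K γ s p h
  · rw [← e_smul_gen, ← mul_smul]
    by_cases hc : (word ℓ s : RootCone ℓ) = γ
    · rw [QH.x_eq_zero, zero_mul, zero_smul]
      rw [← hc, Multiset.coe_card, length_word]; exact h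
    · rw [QH.e_eq_zero hc, mul_zero, zero_smul]

/-- `p` and `p + 1` belong to the same block, for blocks of the given lengths. -/
def Interior : List ℕ → ℕ → Prop
  | [], _ => False
  | n :: L, p => p + 1 < n ∨ (n ≤ p ∧ Interior L (p - n))

lemma interior_append (L L' : List ℕ) (p : ℕ) :
    Interior (L ++ L') p ↔ Interior L p ∨ (L.sum ≤ p ∧ Interior L' (p - L.sum)) := by
  induction L generalizing p with
  | nil => simp [Interior]
  | cons n L ih =>
    rw [List.cons_append, Interior, Interior, ih, List.sum_cons, Nat.sub_sub, or_assoc]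
    refine or_congr_right ?_
    constructor
    · rintro ⟨h, h' | ⟨h1, h2⟩⟩
      · exact Or.inl ⟨h, h'⟩
      · exact Or.inr ⟨by omega, h2⟩
    · rintro (⟨h, h'⟩ | ⟨h1, h2⟩)
      · exact ⟨h, Or.inl h'⟩
      · exact ⟨by omega, Or.inr ⟨by omega, h2⟩⟩

lemma Interior.lt_sum {L : List ℕ} {p : ℕ} (h : Interior L p) : p + 1 < L.sum := by
  induction L generalizing p with
  | nil => exact h.elim
  | cons n L ih =>
    rw [List.sum_cons]
    rcases h with h | ⟨h, h'⟩
    · omega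
    · have := ih h'; omega

lemma interior_take_sum (L : List ℕ) (i : ℕ) (hi : i < L.length) (r : ℕ) (hr : r + 1 < L[i]) :
    Interior L ((L.take i).sum + r) := by
  induction L generalizing i with
  | nil => simp at hi
  | cons n L ih =>
    cases i with
    | zero => left; simpa using hr
    | succ i =>
      right
      rw [List.take_succ_cons, List.sum_cons]
      refine ⟨by omega, ?_⟩
      rw [add_assoc, Nat.add_sub_cancel_left]
      exact ih i (by simpa using hi) (by simpa using hr)

lemma Interior.exists_take_sum {L : List ℕ} {p : ℕ} (h : Interior L p) :
    ∃ (i : ℕ) (hi : i < L.length) (r : ℕ), r + 1 < L[i] ∧ p = (L.take i).sum + r := by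
  induction L generalizing p with
  | nil => exact h.elim
  | cons n L ih =>
    rcases h with h | ⟨h, h'⟩
    · exact ⟨0, by simp, p, h, by simp⟩
    · obtain ⟨i, hi, r, h1, h2⟩ := ih h'
      exact ⟨i + 1, by simpa using hi, r, by simpa using h1, by
        rw [List.take_succ_cons, List.sum_cons]; omega⟩

lemma SegConv.psi_smul_gen_of_interior (γ : RootCone ℓ) (s : List (ℤ × ℕ)) {p : ℕ}
    (h : Interior (s.map Prod.snd) p) : QH.psi K γ p • SegConv.gen ℓ K γ s = 0 := by
  obtain ⟨i, hi, r, h1, rfl⟩ := h.exists_take_sum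
  rw [List.getElem_map] at h1
  rw [← List.map_take]
  exact psi_smul_gen ℓ K γ s i (by simpa using hi) r h1

theorem SegConv.exists_lift_of_interior (γ : RootCone ℓ) (s : List (ℤ × ℕ)) {N : Type w}
    [AddCommGroup N] [Module K N] (ρ : QH K γ →ₐ[K] Module.End K N)
    (n : N) (he : ρ (QH.e K γ (word ℓ s)) n = n)
    (hx : ∀ p, p < (s.map Prod.snd).sum → ρ (QH.x K γ p) n = 0)
    (hpsi : ∀ p, Interior (s.map Prod.snd) p → ρ (QH.psi K γ p) n = 0) :
    ∃ f : SegConv ℓ K γ s →ₗ[K] N, f (SegConv.gen ℓ K γ s) = n ∧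
      ∀ (a : QH K γ) v, f (a • v) = ρ a (f v) := by
  refine exists_lift ℓ K γ s ρ n he hx fun i hi r hr => hpsi _ ?_
  rw [List.map_take]
  exact interior_take_sum _ i (by simpa using hi) r (by simpa using hr)

/-- The elements of `swapIdeal` annihilate the generator. -/
lemma smul_swapGen_eq_zero (k : ℤ) (l₁ l₂ : ℕ) {b : QH ℤ (segRoot ℓ k (l₁ + l₂))}
    (hb : b ∈ swapIdeal ℓ k l₁ l₂ ℤ) :
    QH.baseChange ℤ K _ b • SwapConv.gen ℓ K k l₁ l₂ = 0 := by
  have hg : ∀ s, QH.baseChange ℤ K (segRoot ℓ k (l₁ + l₂)) (QH.gen ℤ _ s) = QH.gen K _ s :=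
    fun s => QH.lift_gen _ _ s
  refine Submodule.span_induction (p := fun b _ =>
    QH.baseChange ℤ K _ b • SwapConv.gen ℓ K k l₁ l₂ = 0) ?_ (by rw [map_zero, zero_smul]) ?_ ?_ hb
  · rintro b ((rfl | ⟨r, rfl⟩) | ⟨r, hr, rfl⟩)
    · rw [map_sub, map_one, QH.e, hg, sub_smul, one_smul, sub_eq_zero]
      have := SegConv.e_smul_gen ℓ K (segRoot ℓ k (l₁ + l₂)) [(k + l₁, l₂), (k, l₁)]
      simp only [SegConv.word, List.map_cons, List.map_nil, List.flatten_cons, List.flatten_nil,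
        List.append_nil] at this
      exact this.symm
    · rw [QH.x, hg]
      exact SegConv.x_smul_gen' ℓ K _ _ r
    · rw [QH.psi, hg]
      rcases Nat.lt_or_ge (r + 1) (l₁ + l₂) with h | h
      · refine SegConv.psi_smul_gen_of_interior ℓ K _ _ ?_
        simp only [List.map_cons, List.map_nil, Interior]
        omega
      · change QH.psi K _ r • _ = _
        rw [QH.psi_eq_zero (by rw [card_segRoot]; exact h), zero_smul]
  · intro x y _ _ hx hy; rw [map_add, add_smul, hx, hy, add_zero]
  · intro a x _ hx; rw [smul_eq_mul, map_mul, mul_smul, hx, smul_zero]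

lemma baseChange_psiWord (R : Type u) (K : Type v) [CommRing R] [CommRing K] [Algebra R K]
    {ℓ : ℕ∞} (β : RootCone ℓ) (w : List ℕ) :
    QH.baseChange R K β (QH.psiWord R β w) = QH.psiWord K β w := by
  rw [QH.psiWord, map_list_prod, List.map_map, QH.psiWord]
  congr 1
  refine List.map_congr_left fun j _ => QH.lift_gen _ _ _

omit [Fact (2 ≤ ℓ)] in
lemma rootForm_coe (A B : List (Idx ℓ)) :
    rootForm (A : RootCone ℓ) (B : RootCone ℓ) = (A.map fun i => (B.map fun j => form i j).sum).sum := by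
  simp [rootForm]

lemma rootForm_comm (β γ : RootCone ℓ) : rootForm β γ = rootForm γ β := by
  rw [rootForm, Multiset.sum_map_sum_map]
  simp only [form_comm, rootForm]

/-- The homomorphism `ι` exists, and may be chosen integral. -/
theorem exists_segEmbedding (k : ℤ) (l₁ l₂ N : ℕ) (hN : l₁ + l₂ ≤ N + 1) :
    ∃ (ι : Seg ℓ K k (l₁ + l₂) →ₗ[QH K (segRoot ℓ k (l₁ + l₂))] SwapConv ℓ K k l₁ l₂)
      (h : FreeAlgebra K (Fin N)), IsSegEmbedding ℓ K k l₁ l₂ ι ∧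
      ι (Seg.u ℓ K k (l₁ + l₂)) =
        psiPoly ℓ K (segRoot ℓ k (l₁ + l₂)) 0 h • SwapConv.gen ℓ K k l₁ l₂ ∧
      h - wordMonomial K N (blockWord l₂ l₁) ∈ Submodule.span ℤ {z | ∃ w : List ℕ,
        w.Sublist (blockWord l₂ l₁) ∧ w ≠ blockWord l₂ l₁ ∧ z = wordMonomial K N w} := by
  set β := segRoot ℓ k (l₁ + l₂) with hβ
  set g := SwapConv.gen ℓ K k l₁ l₂ with hgdef
  obtain ⟨V, hV1, hV2⟩ := exists_swap_vector ℓ k l₁ l₂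
  have hbc : ∀ s, QH.baseChange ℤ K β (QH.gen ℤ _ s) = QH.gen K _ s := fun s => QH.lift_gen _ _ s
  set z := QH.baseChange ℤ K β V • g with hz
  have hzs : ∀ s, QH.gen K β s • z = segScalar ℓ K k (l₁ + l₂) s • z := by
    intro s
    have h := smul_swapGen_eq_zero ℓ K k l₁ l₂ (hV2 (QH.gen ℤ _ s))
    rw [segCharacter_gen, map_sub, map_mul, hbc, sub_smul, mul_smul, sub_eq_zero] at h
    rw [hz, h]
    cases s with
    | e ν =>
      by_cases hν : ν = segWord ℓ k (l₁ + l₂)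
      · simp only [segScalar, if_pos hν, one_smul]; rfl
      · simp only [segScalar, if_neg hν, zero_smul, map_zero]
    | x r => simp only [segScalar, zero_smul, map_zero]
    | psi r => simp only [segScalar, zero_smul, map_zero]
  have hgr := SegConv.isGraded ℓ K β [(k + l₁, l₂), (k, l₁)]
  obtain ⟨δ, hδ⟩ := hgr.exists_delta
  set d := -rootForm (segRoot ℓ k l₁) (segRoot ℓ (k + l₁) l₂) with hd
  -- The vector z need not be homogeneous. Its component of degree d transforms by the segment
  -- character too, and taking it preserves integer coefficients, because each ψ_w g is homogeneous
  -- and so is either kept or dropped.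
  set D : SwapConv ℓ K k l₁ l₂ →ₗ[ℤ] SwapConv ℓ K k l₁ l₂ :=
    ((Finsupp.lapply d) ∘ₗ δ).restrictScalars ℤ with hD
  have hDapp : ∀ v, D v = δ v d := fun v => rfl
  have hDz : ∀ s, QH.gen K β s • D z = segScalar ℓ K k (l₁ + l₂) s • D z := fun s =>
    IsGraded.component_smul hβ hgr hδ hzs d s
  have hDb : ∀ b : QH K β, b • D z = segCharacter ℓ K k (l₁ + l₂) b • D z := by
    intro b
    induction b using QH.induction with
    | hgen s => rw [hDz, segCharacter_gen]
    | hc c => rw [AlgHom.commutes, algebraMap_smul]; rfl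
    | hadd x y hx hy => rw [add_smul, hx, hy, map_add, add_smul]
    | hmul x y hx hy =>
      rw [mul_smul, hy, smul_comm, hx, map_mul, smul_smul, mul_comm]
  have hword : SegConv.word ℓ [(k + (l₁ : ℤ), l₂), (k, l₁)] =
      segWord ℓ (k + l₁) l₂ ++ segWord ℓ k l₁ := by simp [SegConv.word]
  have hgw : QH.e K β (segWord ℓ (k + l₁) l₂ ++ segWord ℓ k l₁) • g = g := by
    rw [← hword]; exact SegConv.e_smul_gen ℓ K β _
  have hg0 : g ∈ SegConv.grade ℓ K β [(k + (l₁ : ℤ), l₂), (k, l₁)] 0 := by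
    have := SegConv.smul_gen_mem_grade ℓ K β [(k + (l₁ : ℤ), l₂), (k, l₁)] (QH.one_mem_grade)
    rwa [one_smul] at this
  -- The degree d is that of the longest word, so the leading term survives.
  have htop : QH.psiWord K β (blockWord l₂ l₁) • g ∈
      SegConv.grade ℓ K β [(k + (l₁ : ℤ), l₂), (k, l₁)] d := by
    have h1 := homMonomial_blockWord (K := K) (β := β) (segWord ℓ (k + l₁) l₂) (segWord ℓ k l₁) []
    rw [SegConv.length_segWord, SegConv.length_segWord, List.append_nil, ← rootForm_coe] at h1
    rw [← hgw, ← mul_smul, hd, rootForm_comm]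
    exact SegConv.smul_gen_mem_grade ℓ K β _ (Submodule.subset_span h1)
  set T : Set (SwapConv ℓ K k l₁ l₂) := {y | ∃ w : List ℕ, w.Sublist (blockWord l₂ l₁) ∧
    w ≠ blockWord l₂ l₁ ∧ y = QH.psiWord K β w • g} with hT
  have hz1 : z - QH.psiWord K β (blockWord l₂ l₁) • g ∈ Submodule.span ℤ T := by
    rw [hz, ← baseChange_psiWord ℤ K, ← sub_smul, ← map_sub]
    refine Submodule.span_induction (p := fun x _ =>
      QH.baseChange ℤ K β x • g ∈ Submodule.span ℤ T) ?_ (by simp) ?_ ?_ hV1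
    · rintro _ ⟨w, hw, hw', rfl⟩
      exact Submodule.subset_span ⟨w, hw, hw', by rw [baseChange_psiWord]⟩
    · intro x y _ _ hx hy; rw [map_add, add_smul]; exact add_mem hx hy
    · intro c x _ hx
      rw [map_zsmul, smul_assoc]; exact Submodule.smul_mem _ c hx
  have hz2 : D z - QH.psiWord K β (blockWord l₂ l₁) • g ∈ Submodule.span ℤ T := by
    have h1 : D (QH.psiWord K β (blockWord l₂ l₁) • g) = QH.psiWord K β (blockWord l₂ l₁) • g := by
      rw [hDapp, hδ d _ htop, Finsupp.single_eq_same]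
    have h2 : Submodule.span ℤ T ≤ (Submodule.span ℤ T).comap D := by
      refine Submodule.span_le.2 ?_
      rintro _ ⟨w, hw, hw', rfl⟩
      obtain ⟨d', _, h3, _⟩ := hgr.exists_psiWord_mem hg0 hgw w
      change D _ ∈ Submodule.span ℤ T
      rw [hDapp, hδ d' _ h3]
      by_cases hdd : d' = d
      · rw [hdd, Finsupp.single_eq_same]
        exact Submodule.subset_span ⟨w, hw, hw', rfl⟩
      · rw [Finsupp.single_eq_of_ne (Ne.symm hdd)]
        exact zero_mem _
    have h3 := h2 hz1
    rwa [Submodule.mem_comap, map_sub, h1] at h3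
  -- lift to noncommutative polynomials
  let F : FreeAlgebra K (Fin N) →ₗ[ℤ] SwapConv ℓ K k l₁ l₂ :=
    { toFun := fun h => psiPoly ℓ K β 0 h • g
      map_add' := fun x y => by rw [psiPoly, map_add, add_smul]; rfl
      map_smul' := fun c x => by rw [psiPoly, map_zsmul, smul_assoc]; rfl }
  have hFw : ∀ w : List ℕ, w.Sublist (blockWord l₂ l₁) → F (wordMonomial K N w) =
      QH.psiWord K β w • g := by
    intro w hw
    change psiPoly ℓ K β 0 (wordMonomial K N w) • g = _
    rw [psiPoly_wordMonomial]
    · simp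
    · intro j hj
      have := lt_of_mem_blockWord (hw.subset hj)
      omega
  have hTF : T ⊆ F '' {z | ∃ w : List ℕ, w.Sublist (blockWord l₂ l₁) ∧ w ≠ blockWord l₂ l₁ ∧
      z = wordMonomial K N w} := by
    rintro _ ⟨w, hw, hw', rfl⟩
    exact ⟨_, ⟨w, hw, hw', rfl⟩, hFw w hw⟩
  have hz3 := Submodule.span_mono hTF hz2
  rw [← Submodule.map_span] at hz3
  obtain ⟨h', hh', hh''⟩ := hz3
  have hFz : F (h' + wordMonomial K N (blockWord l₂ l₁)) = D z := by
    rw [map_add, hh'', hFw _ (List.Sublist.refl _), sub_add_cancel]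
  let ι : Seg ℓ K k (l₁ + l₂) →ₗ[QH K β] SwapConv ℓ K k l₁ l₂ :=
    { toFun := fun x => Seg.coord ℓ K k (l₁ + l₂) x • D z
      map_add' := fun x y => by rw [map_add, add_smul]
      map_smul' := fun b x => by
        rw [Seg.smul_def, map_smul, RingHom.id_apply, smul_comm b, hDb, smul_smul, smul_eq_mul,
          mul_comm] }
  have hιu : ι (Seg.u ℓ K k (l₁ + l₂)) = D z := one_smul K _
  refine ⟨ι, h' + wordMonomial K N (blockWord l₂ l₁), ⟨?_, ?_⟩, ?_, ?_⟩
  · rw [hιu]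
    have h1 : ∀ y ∈ T, D y ∈ SegConv.grade ℓ K β [(k + (l₁ : ℤ), l₂), (k, l₁)] d := by
      rintro _ ⟨w, hw, hw', rfl⟩
      obtain ⟨d', _, h3, _⟩ := hgr.exists_psiWord_mem hg0 hgw w
      rw [hDapp, hδ d' _ h3]
      by_cases hdd : d' = d
      · rw [hdd, Finsupp.single_eq_same]; rwa [hdd] at h3
      · rw [Finsupp.single_eq_of_ne (Ne.symm hdd)]
        exact zero_mem _
    have h2 : Submodule.span ℤ T ≤ ((SegConv.grade ℓ K β [(k + (l₁ : ℤ), l₂), (k, l₁)]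
        d).restrictScalars ℤ).comap D := Submodule.span_le.2 h1
    have h3 : D (z - QH.psiWord K β (blockWord l₂ l₁) • g) ∈
      SegConv.grade ℓ K β [(k + (l₁ : ℤ), l₂), (k, l₁)] d := h2 hz1
    have h4 : D (QH.psiWord K β (blockWord l₂ l₁) • g) = QH.psiWord K β (blockWord l₂ l₁) • g := by
      rw [hDapp, hδ d _ htop, Finsupp.single_eq_same]
    rw [map_sub, h4] at h3
    have := add_mem h3 htop
    rwa [sub_add_cancel] at this
  · rw [hιu]
    exact Submodule.span_le_restrictScalars ℤ K T hz2
  · rw [hιu, ← hFz]; rfl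
  · rwa [add_sub_cancel_right]

end

/-! ### Garnir homomorphisms -/

section

variable (ℓ : ℕ∞)

lemma segWord_add (a : ℤ) (m n : ℕ) :
    segWord ℓ a (m + n) = segWord ℓ a m ++ segWord ℓ (a + m) n := by
  rw [segWord, List.range_add, List.map_append, List.map_map, segWord, segWord]
  congr 1
  refine List.map_congr_left fun t _ => ?_
  simp [add_assoc]

variable [Fact (2 ≤ ℓ)] (K : Type u) [CommRing K]

/-- The homomorphism into a block of a convolution product of segments. -/
lemma exists_blockHom (γ : RootCone ℓ) (s : List (ℤ × ℕ)) (μ τ : List (Idx ℓ)) (k : ℤ) (l₁ l₂ : ℕ)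
    (hs : SegConv.word ℓ s = μ ++ (segWord ℓ (k + l₁) l₂ ++ segWord ℓ k l₁) ++ τ)
    (hint : ∀ r, r + 1 < l₁ + l₂ → r + 1 ≠ l₂ → Interior (s.map Prod.snd) (μ.length + r)) :
    ∃ f : SwapConv ℓ K k l₁ l₂ →ₗ[K]
        blockSpace K γ (SegConv ℓ K γ s) μ τ (segRoot ℓ k (l₁ + l₂)),
      (f (SwapConv.gen ℓ K k l₁ l₂) : SegConv ℓ K γ s) = SegConv.gen ℓ K γ s ∧
      ∀ (a : QH K (segRoot ℓ k (l₁ + l₂))) v, f (a • v) = blockRep K γ _ μ τ _ a (f v) := by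
  have hg : QH.e K γ (μ ++ (segWord ℓ (k + l₁) l₂ ++ segWord ℓ k l₁) ++ τ) • SegConv.gen ℓ K γ s =
      SegConv.gen ℓ K γ s := by
    rw [← hs]; exact SegConv.e_smul_gen ℓ K γ s
  have hc : ((segWord ℓ (k + l₁) l₂ ++ segWord ℓ k l₁ : List (Idx ℓ)) : RootCone ℓ) =
      segRoot ℓ k (l₁ + l₂) := by
    rw [segRoot, segWord_add, Multiset.coe_eq_coe]
    exact List.perm_append_comm
  let n : blockSpace K γ (SegConv ℓ K γ s) μ τ (segRoot ℓ k (l₁ + l₂)) :=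
    ⟨SegConv.gen ℓ K γ s, mem_blockSpace_of_weight hc hg⟩
  obtain ⟨f, hf, hfa⟩ := SegConv.exists_lift_of_interior ℓ K (segRoot ℓ k (l₁ + l₂))
    [(k + (l₁ : ℤ), l₂), (k, l₁)] (blockRep K γ (SegConv ℓ K γ s) μ τ _) n (by
      apply Subtype.ext
      rw [blockRep_e]
      simpa [SegConv.word] using hg) (by
      intro p hp
      apply Subtype.ext
      rw [blockRep_x _ (by rw [card_segRoot]; simp at hp; omega)]
      exact SegConv.x_smul_gen' ℓ K γ s _) (by
      intro p hp
      have hp' := hp.lt_sum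
      simp only [List.map_cons, List.map_nil, List.sum_cons, List.sum_nil, add_zero] at hp'
      simp only [List.map_cons, List.map_nil, Interior] at hp
      apply Subtype.ext
      rw [blockRep_psi _ (by rw [card_segRoot]; omega)]
      exact SegConv.psi_smul_gen_of_interior ℓ K γ s (hint p (by omega) (by omega)))
  exact ⟨f, by rw [hf], hfa⟩

/-- The image of the generator of a Garnir module. -/
lemma garnir_vector (γ : RootCone ℓ) (s₁ s₂ : List (ℤ × ℕ)) (k : ℤ) (c l₁ l₂ m N : ℕ)
    (hN : l₁ + l₂ = N + 1) {s : List (ℤ × ℕ)}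
    (hs : s = s₁ ++ [(k + l₁ - c, c + l₂), (k, l₁ + m)] ++ s₂)
    {ι : Seg ℓ K k (l₁ + l₂) →ₗ[QH K (segRoot ℓ k (l₁ + l₂))] SwapConv ℓ K k l₁ l₂}
    {h : FreeAlgebra K (Fin N)} (hι : IsSegEmbedding ℓ K k l₁ l₂ ι)
    (hh : ι (Seg.u ℓ K k (l₁ + l₂)) =
      psiPoly ℓ K (segRoot ℓ k (l₁ + l₂)) 0 h • SwapConv.gen ℓ K k l₁ l₂) :
    (∃ d, psiPoly ℓ K γ ((s₁.map Prod.snd).sum + c) h • SegConv.gen ℓ K γ s ∈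
      SegConv.grade ℓ K γ s d) ∧
    ∃ G : SegConv ℓ K γ (s₁ ++ [(k + l₁ - c, c), (k, l₁ + l₂), (k + l₁, m)] ++ s₂) →ₗ[QH K γ]
        SegConv ℓ K γ s, G (SegConv.gen ℓ K γ _) =
      psiPoly ℓ K γ ((s₁.map Prod.snd).sum + c) h • SegConv.gen ℓ K γ s := by
  -- The block in question begins after the rows above and the first c letters of the upper row. It
  -- consists of the last l₂ letters of that row and the first l₁ letters of the next one, so the
  -- generator looks there like u ⊗ u of L(k+l₁;l₂) ∘ L(k;l₁).
  set μ := SegConv.word ℓ s₁ ++ segWord ℓ (k + l₁ - c) c with hμ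
  set τ := segWord ℓ (k + l₁) m ++ SegConv.word ℓ s₂ with hτ
  have hμl : μ.length = (s₁.map Prod.snd).sum + c := by
    rw [hμ, List.length_append, SegConv.length_word, SegConv.length_segWord]
  have hsl : s.map Prod.snd = s₁.map Prod.snd ++ (c + l₂) :: (l₁ + m) :: s₂.map Prod.snd := by
    rw [hs]; simp
  have hint : ∀ p, Interior (s.map Prod.snd) p ↔ Interior (s₁.map Prod.snd) p ∨
      ((s₁.map Prod.snd).sum ≤ p ∧ (p - (s₁.map Prod.snd).sum + 1 < c + l₂ ∨
        (c + l₂ ≤ p - (s₁.map Prod.snd).sum ∧ (p - (s₁.map Prod.snd).sum - (c + l₂) + 1 < l₁ + m ∨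
          (l₁ + m ≤ p - (s₁.map Prod.snd).sum - (c + l₂) ∧ Interior (s₂.map Prod.snd)
            (p - (s₁.map Prod.snd).sum - (c + l₂) - (l₁ + m))))))) := by
    intro p
    rw [hsl, interior_append]; rfl
  obtain ⟨f, hf, hfa⟩ := exists_blockHom ℓ K γ s μ τ k l₁ l₂ (by
    rw [hs, hμ, hτ]
    simp only [SegConv.word, List.map_append, List.map_cons, List.map_nil, List.flatten_append,
      List.flatten_cons, List.flatten_nil, segWord_add, List.append_assoc, List.append_nil]
    rw [sub_add_cancel]) (by
    intro r h1 h2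
    rw [hint, hμl]
    omega)
  set β := segRoot ℓ k (l₁ + l₂) with hβ
  have hcard : β.card = N + 1 := by rw [hβ, card_segRoot, hN]
  set y := f (ι (Seg.u ℓ K k (l₁ + l₂))) with hy
  set z := psiPoly ℓ K γ ((s₁.map Prod.snd).sum + c) h • SegConv.gen ℓ K γ s with hz
  have hyz : (y : SegConv ℓ K γ s) = z := by
    rw [hy, hh, hfa, blockRep_psiPoly K (by rw [hcard]) h, hf, hμl]
  -- The vector y is the image of u under homomorphisms of R(β)-modules.
  have hyb : ∀ b : QH K β, blockRep K γ _ μ τ _ b y = segCharacter ℓ K k (l₁ + l₂) b • y := by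
    intro b
    rw [hy, ← hfa, ← map_smul, ← map_smul, Seg.smul_def, ← algebraMap_smul (QH K β) _ (Seg.u ..),
      map_smul, algebraMap_smul]
  constructor
  · obtain ⟨b, hb, hbg⟩ := SegConv.exists_of_mem_grade ℓ K _ _ hι.homogeneous
    refine ⟨-rootForm (segRoot ℓ k l₁) (segRoot ℓ (k + l₁) l₂) + 0, ?_⟩
    rw [← hyz, hy, hbg, hfa]
    refine blockRep_mem_grade _ (SegConv.isGraded ℓ K γ s) hb ?_
    rw [hf]
    have := SegConv.smul_gen_mem_grade ℓ K γ s QH.one_mem_grade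
    rwa [one_smul] at this
  · obtain ⟨G, hG, hGa⟩ := SegConv.exists_lift_of_interior ℓ K γ
      (s₁ ++ [(k + l₁ - c, c), (k, l₁ + l₂), (k + l₁, m)] ++ s₂)
      (Algebra.lsmul K K (SegConv ℓ K γ s)) z (by
        have h1 : SegConv.word ℓ (s₁ ++ [(k + l₁ - c, c), (k, l₁ + l₂), (k + l₁, m)] ++ s₂) =
            μ ++ segWord ℓ k (l₁ + l₂) ++ τ := by
          simp [SegConv.word, hμ, hτ]
        rw [h1]
        change QH.e K γ _ • z = z
        rw [← hyz, ← blockRep_e, hyb, QH.e, segCharacter_gen, segScalar, if_pos rfl, one_smul]) (by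
        intro p hp
        change QH.x K γ p • z = 0
        -- Away from the block, x commutes with h and kills the generator. Inside the block it acts
        -- on y through the segment character.
        by_cases hpb : p < (s₁.map Prod.snd).sum + c ∨ (s₁.map Prod.snd).sum + c + N < p
        · rw [hz, ← mul_smul, psiPoly_comm_x K hpb, mul_smul, SegConv.x_smul_gen', smul_zero]
        · obtain ⟨r, rfl⟩ : ∃ r, p = μ.length + r := ⟨p - μ.length, by omega⟩
          have hr : r < β.card := by omega
          rw [← hyz, ← blockRep_x _ hr, hyb, QH.x, segCharacter_gen, segScalar, zero_smul]
          rfl) (by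
        intro p hp
        change QH.psi K γ p • z = 0
        -- Two strands of one segment of the Garnir module either both lie in the block, or both lie
        -- outside of it and in one row of s; the cuts between the three middle segments are not
        -- interior.
        have hcase : (Interior (s.map Prod.snd) p ∧
            (p + 1 < (s₁.map Prod.snd).sum + c ∨ (s₁.map Prod.snd).sum + c + N < p)) ∨
            ∃ r, r + 1 < β.card ∧ p = μ.length + r := by
          rw [hint]
          rw [List.map_append, List.map_append, List.append_assoc, interior_append] at hp
          simp only [List.map_cons, List.map_nil, List.cons_append, List.nil_append,
            Interior] at hp
          rcases hp with hp | ⟨h1, hp⟩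
          · exact Or.inl ⟨Or.inl hp, Or.inl (by have := hp.lt_sum; omega)⟩
          rcases hp with hp | ⟨h2, hp⟩
          · exact Or.inl ⟨Or.inr ⟨h1, Or.inl (by omega)⟩, Or.inl (by omega)⟩
          rcases hp with hp | ⟨h3, hp⟩
          · exact Or.inr ⟨p - μ.length, by omega, by omega⟩
          refine Or.inl ⟨Or.inr ⟨h1, Or.inr ⟨by omega, ?_⟩⟩, Or.inr (by omega)⟩
          rcases hp with hp | ⟨h4, hp⟩
          · exact Or.inl (by omega)
          · refine Or.inr ⟨by omega, ?_⟩
            have : p - (s₁.map Prod.snd).sum - (c + l₂) - (l₁ + m) =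
              p - (s₁.map Prod.snd).sum - c - (l₁ + l₂) - m := by omega
            rwa [this]
        rcases hcase with ⟨hi, hpb⟩ | ⟨r, hr, rfl⟩
        · rw [hz, ← mul_smul, psiPoly_comm_psi K hpb, mul_smul,
            SegConv.psi_smul_gen_of_interior ℓ K γ s hi, smul_zero]
        · rw [← hyz, ← blockRep_psi _ hr, hyb, QH.psi, segCharacter_gen, segScalar, zero_smul]
          rfl)
    exact ⟨{ G with map_smul' := hGa }, hG⟩

end

/-! ### Cokernels of the Garnir homomorphisms and their integral relations -/

section

variable (ℓ : ℕ∞) [Fact (2 ≤ ℓ)] (K : Type u) [CommRing K] (κ : ℤ) (μ : YoungDiagram)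

lemma lt_colLen_zero {μ : YoungDiagram} {r c : ℕ} (h : (r, c) ∈ μ) : r < μ.colLen 0 :=
  YoungDiagram.mem_iff_lt_colLen.1 (μ.up_left_mem le_rfl (Nat.zero_le c) h)

lemma take_rowSegs_sum {r : ℕ} (hr : r ≤ μ.colLen 0) :
    (((rowSegs κ μ).take r).map Prod.snd).sum = ∑ q ∈ Finset.range r, μ.rowLen q := by
  rw [rowSegs, ← List.map_take, List.take_range, Nat.min_eq_left hr, List.map_map]
  rfl

/-- The two rows are written with k = κ − r − 1, l₁ = c + 1 and l₂ = μ_r − c, the shape that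
`garnir_vector` expects. -/
lemma rowSegs_eq {r c : ℕ} (h : (r + 1, c) ∈ μ) :
    rowSegs κ μ = (rowSegs κ μ).take r ++
      [(κ - r - 1 + ((c + 1 : ℕ) : ℤ) - c, c + (μ.rowLen r - c)),
        (κ - r - 1, c + 1 + (μ.rowLen (r + 1) - (c + 1)))] ++ (rowSegs κ μ).drop (r + 2) := by
  have h1 := lt_colLen_zero h
  have h2 := YoungDiagram.mem_iff_lt_rowLen.1 h
  have h3 := μ.rowLen_anti r (r + 1) (Nat.le_succ r)
  conv_lhs => rw [← List.take_append_drop r (rowSegs κ μ)]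
  rw [List.append_assoc]
  congr 1
  have hl : (rowSegs κ μ).length = μ.colLen 0 := by simp [rowSegs]
  rw [List.drop_eq_getElem_cons (by omega), List.drop_eq_getElem_cons (by omega)]
  simp only [rowSegs, List.getElem_map, List.getElem_range, List.cons_append, List.nil_append]
  have e1 : κ - r - 1 + ((c + 1 : ℕ) : ℤ) - c = κ - r := by push_cast; ring
  have e2 : κ - ((r + 1 : ℕ) : ℤ) = κ - r - 1 := by push_cast; ring
  have e3 : c + (μ.rowLen r - c) = μ.rowLen r := by omega
  have e4 : c + 1 + (μ.rowLen (r + 1) - (c + 1)) = μ.rowLen (r + 1) := by omega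
  rw [e1, e2, e3, e4]

lemma garnirSegs_eq {r c : ℕ} (h : (r + 1, c) ∈ μ) :
    garnirSegs κ μ r c = (rowSegs κ μ).take r ++
      [(κ - r - 1 + ((c + 1 : ℕ) : ℤ) - c, c), (κ - r - 1, c + 1 + (μ.rowLen r - c)),
        (κ - r - 1 + ((c + 1 : ℕ) : ℤ), μ.rowLen (r + 1) - (c + 1))] ++
      (rowSegs κ μ).drop (r + 2) := by
  have h2 := YoungDiagram.mem_iff_lt_rowLen.1 h
  have h3 := μ.rowLen_anti r (r + 1) (Nat.le_succ r)
  have e1 : κ - r - 1 + ((c + 1 : ℕ) : ℤ) - c = κ - r := by push_cast; ring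
  have e2 : κ - r - 1 + ((c + 1 : ℕ) : ℤ) = κ - r + c := by push_cast; ring
  have e3 : c + 1 + (μ.rowLen r - c) = μ.rowLen r + 1 := by omega
  rw [e1, e2, e3, garnirSegs]

/-- The Garnir modules are cyclic, so the images of their generators suffice. These are homogeneous,
which gives the grading of the cokernel. -/
lemma garnirImage_eq_span : garnirImage ℓ K κ μ = Submodule.span _
    {z | ∃ (r c : ℕ) (_ : (r + 1, c) ∈ μ)
      (G : GarnirPerm ℓ K κ μ r c →ₗ[QH K (contPartition ℓ κ μ)] PermMod ℓ K κ μ),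
      IsGarnirHom ℓ K κ μ r c G ∧ z = G (SegConv.gen ℓ K _ _)} := by
  refine le_antisymm ?_ ?_
  · refine iSup_le fun r => iSup_le fun c => iSup_le fun h => iSup_le fun G => iSup_le fun hG => ?_
    rintro _ ⟨v, rfl⟩
    obtain ⟨a, rfl⟩ := SegConv.exists_smul_gen ℓ K _ _ v
    rw [map_smul]
    exact Submodule.smul_mem _ _ (Submodule.subset_span ⟨r, c, h, G, hG, rfl⟩)
  · refine Submodule.span_le.2 ?_
    rintro _ ⟨r, c, h, G, hG, rfl⟩
    refine Submodule.mem_iSup_of_mem r <| Submodule.mem_iSup_of_mem c <|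
      Submodule.mem_iSup_of_mem h <| Submodule.mem_iSup_of_mem G <| Submodule.mem_iSup_of_mem hG ?_
    exact ⟨_, rfl⟩

theorem GarnirCoker.isGraded :
    IsGraded (contPartition ℓ κ μ) (GarnirCoker.grade ℓ K κ μ) := by
  refine (SegConv.isGraded ℓ K (contPartition ℓ κ μ) (rowSegs κ μ)).quotient
    ⟨_, garnirImage_eq_span ℓ K κ μ, ?_⟩
  rintro _ ⟨r, c, h, G, ⟨ι, p, hι, hp, hG⟩, rfl⟩
  rw [hG, ← take_rowSegs_sum κ μ (by have := lt_colLen_zero h; omega)]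
  exact (garnir_vector ℓ K _ _ _ _ c _ _ _ _ (by omega) (rowSegs_eq κ μ h) hι hp).1

/-- The generator of the cokernel of the Garnir homomorphisms. -/
abbrev GarnirCoker.gen : GarnirCoker ℓ K κ μ := (garnirImage ℓ K κ μ).mkQ (SegConv.gen ℓ K _ _)

/-- The integral Garnir relations. -/
theorem GarnirCoker.garnir_relation {r c : ℕ} (h : (r + 1, c) ∈ μ) :
    QH.psiWord K (contPartition ℓ κ μ) ((blockWord (μ.rowLen r - c) (c + 1)).map
      ((∑ q ∈ Finset.range r, μ.rowLen q) + c + ·)) • GarnirCoker.gen ℓ K κ μ ∈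
    Submodule.span ℤ {z | ∃ w : List ℕ, w.Sublist (blockWord (μ.rowLen r - c) (c + 1)) ∧
      w ≠ blockWord (μ.rowLen r - c) (c + 1) ∧
      z = QH.psiWord K (contPartition ℓ κ μ) (w.map ((∑ q ∈ Finset.range r, μ.rowLen q) + c + ·)) •
        GarnirCoker.gen ℓ K κ μ} := by
  set a := (∑ q ∈ Finset.range r, μ.rowLen q) + c with ha
  set γ := contPartition ℓ κ μ
  obtain ⟨ι, p, hι, hp, hspan⟩ := exists_segEmbedding ℓ K (κ - r - 1) (c + 1) (μ.rowLen r - c)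
    (c + (μ.rowLen r - c)) (by omega)
  obtain ⟨G, hG⟩ := (garnir_vector ℓ K γ _ _ _ c _ _ _ _ (by omega) (rowSegs_eq κ μ h) hι hp).2
  rw [take_rowSegs_sum κ μ (by have := lt_colLen_zero h; omega)] at hG
  have hz : psiPoly ℓ K γ a p • SegConv.gen ℓ K γ (rowSegs κ μ) ∈ garnirImage ℓ K κ μ := by
    rw [garnirImage_eq_span]
    -- The list of segments in `garnirSegs` and the one from `garnir_vector` are equal, but not by
    -- definition; the homomorphism is transported along the equality.
    have key : ∀ s t : List (ℤ × ℕ), s = t → (∃ G : SegConv ℓ K γ t →ₗ[QH K γ] PermMod ℓ K κ μ,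
        G (SegConv.gen ℓ K γ t) = psiPoly ℓ K γ a p • SegConv.gen ℓ K γ (rowSegs κ μ)) →
        ∃ G : SegConv ℓ K γ s →ₗ[QH K γ] PermMod ℓ K κ μ,
        G (SegConv.gen ℓ K γ s) = psiPoly ℓ K γ a p • SegConv.gen ℓ K γ (rowSegs κ μ) := by
      rintro s _ rfl hG
      exact hG
    obtain ⟨G', hG'⟩ := key _ _ (garnirSegs_eq κ μ h) ⟨G, hG⟩
    exact Submodule.subset_span ⟨r, c, h, G', ⟨ι, p, hι, hp, hG'⟩, hG'.symm⟩
  have hz' : psiPoly ℓ K γ a p • GarnirCoker.gen ℓ K κ μ = 0 := by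
    rw [GarnirCoker.gen, ← map_smul]
    exact (Submodule.Quotient.mk_eq_zero _).2 hz
  let F : FreeAlgebra K (Fin (c + (μ.rowLen r - c))) →ₗ[ℤ] GarnirCoker ℓ K κ μ :=
    { toFun := fun h => psiPoly ℓ K γ a h • GarnirCoker.gen ℓ K κ μ
      map_add' := fun x y => by rw [psiPoly, map_add, add_smul]; rfl
      map_smul' := fun c x => by rw [psiPoly, map_zsmul, smul_assoc]; rfl }
  have hFw : ∀ w : List ℕ, w.Sublist (blockWord (μ.rowLen r - c) (c + 1)) →
      F (wordMonomial K _ w) = QH.psiWord K γ (w.map (a + ·)) • GarnirCoker.gen ℓ K κ μ := by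
    intro w hw
    change psiPoly ℓ K γ a (wordMonomial K (c + (μ.rowLen r - c)) w) •
      GarnirCoker.gen ℓ K κ μ = _
    rw [psiPoly_wordMonomial]
    intro j hj
    have := lt_of_mem_blockWord (hw.subset hj)
    omega
  -- As p kills the generator, the image of p minus its leading monomial is the negative of the
  -- leading term. It lies in the ℤ-span of the images of proper subwords.
  have h1 := Submodule.mem_map_of_mem (f := F) hspan
  rw [Submodule.map_span, map_sub, hFw _ (List.Sublist.refl _)] at h1
  have h2 : F p = 0 := hz'
  rw [h2, zero_sub, neg_mem_iff] at h1
  refine Submodule.span_mono ?_ h1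
  rintro _ ⟨_, ⟨w, hw, hw', rfl⟩, rfl⟩
  exact ⟨w, hw, hw', hFw w hw⟩

end

/-! ### The generator of a Specht module -/

section

lemma sum_cells {A : Type*} [AddCommMonoid A] (μ : YoungDiagram) (f : ℕ × ℕ → A) :
    ∑ x ∈ μ.cells, f x = ∑ r ∈ Finset.range (μ.colLen 0), ∑ c ∈ Finset.range (μ.rowLen r),
      f (r, c) := by
  refine Finset.sum_finset_product μ.cells _ _ fun p => ?_
  rw [YoungDiagram.mem_cells, Finset.mem_range, Finset.mem_range, ← YoungDiagram.mem_iff_lt_rowLen]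
  exact ⟨fun h => ⟨lt_colLen_zero h, h⟩, fun h => h.2⟩

lemma sum_rowLen (μ : YoungDiagram) :
    ∑ r ∈ Finset.range (μ.colLen 0), μ.rowLen r = μ.card := by
  have := sum_cells μ fun _ => 1
  rw [Finset.sum_const, smul_eq_mul, mul_one] at this
  rw [YoungDiagram.card, this]
  simp

variable (ℓ : ℕ∞)

lemma coe_word_rowSegs (κ : ℤ) (μ : YoungDiagram) :
    (SegConv.word ℓ (rowSegs κ μ) : RootCone ℓ) = contPartition ℓ κ μ := by
  have h1 : ∀ L : List (List (Idx ℓ)), (L.flatten : RootCone ℓ) =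
      (L.map (Multiset.ofList : List (Idx ℓ) → RootCone ℓ)).sum := by
    intro L
    induction L with
    | nil => rfl
    | cons x L ih => rw [List.flatten_cons, List.map_cons, List.sum_cons, ← ih, Multiset.coe_add]
  have h2 := sum_cells μ fun A => ({residue ℓ (κ + A.2 - A.1)} : RootCone ℓ)
  have h3 : contPartition ℓ κ μ = ∑ A ∈ μ.cells, ({residue ℓ (κ + A.2 - A.1)} : RootCone ℓ) := by
    rw [contPartition, ← Multiset.sum_map_singleton (Multiset.map _ _), Multiset.map_map]
    rfl
  rw [h3, h2, SegConv.word, h1, rowSegs, List.map_map, List.map_map, Finset.sum_range,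
    ← List.sum_ofFn, List.ofFn_eq_map, ← List.map_coe_finRange_eq_range, List.map_map]
  congr 1
  refine List.map_congr_left fun r _ => ?_
  simp only [Function.comp_apply]
  have h4 : ∀ (n : ℕ) (g : ℕ → Idx ℓ), (((List.range n).map g : List (Idx ℓ)) : RootCone ℓ) =
      ∑ c ∈ Finset.range n, {g c} := by
    intro n g
    induction n with
    | zero => rfl
    | succ n ih =>
      rw [List.range_succ, List.map_append, ← Multiset.coe_add, ih, Finset.sum_range_succ]
      rfl
  rw [segWord, h4]
  refine Finset.sum_congr rfl fun c _ => ?_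
  congr 2
  ring

lemma card_contPartition (κ : ℤ) (μ : YoungDiagram) : (contPartition ℓ κ μ).card = μ.card := by
  simp [contPartition, YoungDiagram.card]

end

section

variable {K : Type u} [CommRing K] {ℓ : ℕ∞} {γ : RootCone ℓ} {t : ℕ} {β : Fin t → RootCone ℓ}
  {M : Fin t → Type v} [∀ i, AddCommGroup (M i)] [∀ i, Module K (M i)]
  [∀ i, Module (QH K (β i)) (M i)]

lemma Conv.psiWord_smul_mk (i : Fin t) {w : List ℕ} (hw : ∀ r ∈ w, r + 1 < (β i).card)
    (m : ∀ i, M i) :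
    QH.psiWord K γ (w.map (offset β i + ·)) • Conv.mk K γ β M 1 m =
      Conv.mk K γ β M 1 (Function.update m i (QH.psiWord K (β i) w • m i)) := by
  induction w with
  | nil => simp [QH.psiWord_nil]
  | cons r w ih =>
    rw [List.map_cons, QH.psiWord_cons, mul_smul, ih fun j hj => hw j (by simp [hj]),
      Conv.psi_smul_mk i r (hw r (by simp)), Function.update_idem, Function.update_self,
      QH.psiWord_cons, mul_smul]

end

section

variable (ℓ : ℕ∞) [Fact (2 ≤ ℓ)] {l : ℕ} (κ : Fin l → ℤ) (lam : Fin l → YoungDiagram)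
  (K : Type u) [CommRing K]

variable {lam} in
/-- The position of a node in the reading order. -/
def nodePos (lam : Fin l → YoungDiagram) (t : Fin l) (r c : ℕ) : ℕ :=
  (∑ s ∈ Finset.Iio t, (lam s).card) + ∑ q ∈ Finset.range r, (lam t).rowLen q + c

omit [Fact (2 ≤ ℓ)] in
lemma offset_contPartition (t : Fin l) :
    offset (fun t => contPartition ℓ (κ t) (lam t)) t = ∑ s ∈ Finset.Iio t, (lam s).card := by
  simp only [offset, card_contPartition]

omit [Fact (2 ≤ ℓ)] in
lemma card_cont : (cont ℓ κ lam).card = size lam := by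
  rw [cont, Multiset.card_sum, size]
  exact Finset.sum_congr rfl fun t _ => card_contPartition ℓ _ _

/-- The word of the generator of the Specht module. -/
def initialWord : List (Idx ℓ) :=
  (List.ofFn fun t => SegConv.word ℓ (rowSegs (κ t) (lam t))).flatten

namespace Specht

lemma e_smul_gen : QH.e K (cont ℓ κ lam) (initialWord ℓ κ lam) • Specht.gen ℓ κ lam K =
    Specht.gen ℓ κ lam K := by
  rw [initialWord, Specht.gen, Conv.e_smul_mk (β := fun t => contPartition ℓ (κ t) (lam t)) _
    fun t => coe_word_rowSegs ℓ (κ t) (lam t)]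
  congr 1
  funext t
  rw [← map_smul, SegConv.e_smul_gen]

lemma x_smul_gen (p : ℕ) : QH.x K (cont ℓ κ lam) p • Specht.gen ℓ κ lam K = 0 := by
  rcases Nat.lt_or_ge p (cont ℓ κ lam).card with h | h
  · rw [cont, Multiset.card_sum] at h
    obtain ⟨t, r, hr, rfl⟩ := exists_offset_add _ p h
    rw [Specht.gen, Conv.x_smul_mk t r hr, ← map_smul, SegConv.x_smul_gen', map_zero,
      ← Conv.tmul_apply, MultilinearMap.map_update_zero]
  · rw [QH.x_eq_zero h, zero_smul]

/-- The two strands belong to the same row, and ψ acts as 0 on a segment module. -/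
lemma psi_smul_gen (t : Fin l) (r c : ℕ) (h : (r, c + 1) ∈ lam t) :
    QH.psi K (cont ℓ κ lam) (nodePos lam t r c) • Specht.gen ℓ κ lam K = 0 := by
  have h1 := lt_colLen_zero h
  have h2 := YoungDiagram.mem_iff_lt_rowLen.1 h
  have hi := interior_take_sum ((rowSegs (κ t) (lam t)).map Prod.snd) r (by simpa [rowSegs]) c
    (by simpa [rowSegs])
  rw [← List.map_take, take_rowSegs_sum _ _ h1.le] at hi
  have hlt : ∑ q ∈ Finset.range r, (lam t).rowLen q + c + 1 < (contPartition ℓ (κ t) (lam t)).card := by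
    have := hi.lt_sum
    rwa [← SegConv.length_word ℓ, ← Multiset.coe_card, coe_word_rowSegs] at this
  rw [nodePos, add_assoc, ← offset_contPartition ℓ κ, Specht.gen, Conv.psi_smul_mk t _ hlt,
    ← map_smul, SegConv.psi_smul_gen_of_interior ℓ K _ _ hi, map_zero,
      ← Conv.tmul_apply, MultilinearMap.map_update_zero]

/-- The relation of the component t is carried over by the map that varies only the t-th factor of
the tensor product. -/
lemma garnir_relation (t : Fin l) (r c : ℕ) (h : (r + 1, c) ∈ lam t) :
    QH.psiWord K (cont ℓ κ lam) ((blockWord ((lam t).rowLen r - c) (c + 1)).map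
      (nodePos lam t r c + ·)) • Specht.gen ℓ κ lam K ∈
    Submodule.span ℤ {z | ∃ w : List ℕ, w.Sublist (blockWord ((lam t).rowLen r - c) (c + 1)) ∧
      w ≠ blockWord ((lam t).rowLen r - c) (c + 1) ∧
      z = QH.psiWord K (cont ℓ κ lam) (w.map (nodePos lam t r c + ·)) •
        Specht.gen ℓ κ lam K} := by
  have h1 := lt_colLen_zero h
  have h2 := YoungDiagram.mem_iff_lt_rowLen.1 h
  have h3 := (lam t).rowLen_anti r (r + 1) (Nat.le_succ r)
  have hle : ∑ q ∈ Finset.range (r + 2), (lam t).rowLen q ≤ (contPartition ℓ (κ t) (lam t)).card := by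
    rw [card_contPartition, ← sum_rowLen]
    exact Finset.sum_le_sum_of_subset (Finset.range_mono h1)
  rw [Finset.sum_range_succ, Finset.sum_range_succ] at hle
  set b := ∑ q ∈ Finset.range r, (lam t).rowLen q + c with hb
  have hpos : nodePos lam t r c = offset (fun t => contPartition ℓ (κ t) (lam t)) t + b := by
    rw [nodePos, add_assoc, offset_contPartition]
  let m : ∀ t, GarnirCoker ℓ K (κ t) (lam t) := fun t => GarnirCoker.gen ℓ K (κ t) (lam t)
  let F : GarnirCoker ℓ K (κ t) (lam t) →ₗ[ℤ] Specht ℓ κ lam K :=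
    ((Conv.tmul K (cont ℓ κ lam) (fun t => contPartition ℓ (κ t) (lam t))
      (fun t => GarnirCoker ℓ K (κ t) (lam t))).toLinearMap m t).restrictScalars ℤ
  have hF : ∀ w : List ℕ, w.Sublist (blockWord ((lam t).rowLen r - c) (c + 1)) →
      F (QH.psiWord K (contPartition ℓ (κ t) (lam t)) (w.map (b + ·)) • m t) =
        QH.psiWord K (cont ℓ κ lam) (w.map (nodePos lam t r c + ·)) • Specht.gen ℓ κ lam K := by
    intro w hw
    have : w.map (nodePos lam t r c + ·) = (w.map (b + ·)).map
        (offset (fun t => contPartition ℓ (κ t) (lam t)) t + ·) := by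
      rw [List.map_map]
      refine List.map_congr_left fun j _ => ?_
      simp only [Function.comp_apply]; omega
    rw [this, Specht.gen, Conv.psiWord_smul_mk]
    · rfl
    · intro j hj
      obtain ⟨i, hi, rfl⟩ := List.mem_map.1 hj
      have := lt_of_mem_blockWord (hw.subset hi)
      omega
  have h4 := Submodule.mem_map_of_mem (f := F) (GarnirCoker.garnir_relation ℓ K (κ t) (lam t) h)
  rw [Submodule.map_span] at h4
  have h5 := hF _ (List.Sublist.refl _)
  rw [← h5]
  refine Submodule.span_mono ?_ h4
  rintro _ ⟨_, ⟨w, hw, hw', rfl⟩, rfl⟩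
  exact ⟨w, hw, hw', hF w hw⟩

end Specht

theorem Specht.isGraded : IsGraded (cont ℓ κ lam) (Conv.grade K (cont ℓ κ lam)
    (fun t => contPartition ℓ (κ t) (lam t)) (fun t => GarnirCoker ℓ K (κ t) (lam t))
    (fun t => GarnirCoker.grade ℓ K (κ t) (lam t))) :=
  Conv.isGraded fun t => GarnirCoker.isGraded ℓ K (κ t) (lam t)

end

/-! ### Standard tableaux span -/

section

variable {l : ℕ} (lam : Fin l → YoungDiagram)

lemma nodePos_lt_of_row {t : Fin l} {r r' c c' : ℕ} (h : (r, c) ∈ lam t) (hr : r < r') :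
    nodePos lam t r c < nodePos lam t r' c' := by
  have h2 := YoungDiagram.mem_iff_lt_rowLen.1 h
  have h3 : ∑ q ∈ Finset.range (r + 1), (lam t).rowLen q ≤
      ∑ q ∈ Finset.range r', (lam t).rowLen q :=
    Finset.sum_le_sum_of_subset (Finset.range_mono hr)
  rw [Finset.sum_range_succ] at h3
  unfold nodePos
  omega

lemma nodePos_lt_card {t : Fin l} {r c : ℕ} (h : (r, c) ∈ lam t) :
    nodePos lam t r c < ∑ s ∈ Finset.Iic t, (lam s).card := by
  have h2 := YoungDiagram.mem_iff_lt_rowLen.1 h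
  have h3 : ∑ q ∈ Finset.range (r + 1), (lam t).rowLen q ≤ (lam t).card := by
    rw [← sum_rowLen]
    exact Finset.sum_le_sum_of_subset (Finset.range_mono (lt_colLen_zero h))
  rw [Finset.sum_range_succ] at h3
  have h4 : ∑ s ∈ Finset.Iic t, (lam s).card = ∑ s ∈ Finset.Iio t, (lam s).card + (lam t).card := by
    rw [← Finset.Iio_insert, Finset.sum_insert (by simp), add_comm]
  unfold nodePos
  omega

lemma nodePos_lt_size {t : Fin l} {r c : ℕ} (h : (r, c) ∈ lam t) :
    nodePos lam t r c < size lam :=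
  (nodePos_lt_card lam h).trans_le (Finset.sum_le_sum_of_subset (Finset.subset_univ _))

lemma nodePos_lt_of_comp {t t' : Fin l} {r r' c c' : ℕ} (h : (r, c) ∈ lam t) (ht : t < t') :
    nodePos lam t r c < nodePos lam t' r' c' := by
  refine (nodePos_lt_card lam h).trans_le ?_
  unfold nodePos
  rw [add_assoc]
  refine le_trans (Finset.sum_le_sum_of_subset fun s hs => ?_) (Nat.le_add_right _ _)
  rw [Finset.mem_Iic] at hs
  rw [Finset.mem_Iio]
  exact hs.trans_lt ht

/-- The initial tableau numbers the nodes in the reading order. -/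
lemma initial_apply (A : Node lam) :
    (initial lam A : ℕ) = nodePos lam A.1.comp A.1.row A.1.col := by
  set e := Fintype.orderIsoFinOfCardEq (Node lam) (card_node lam) with he
  let p : Node lam → Fin (size lam) := fun A =>
    ⟨nodePos lam A.1.comp A.1.row A.1.col, nodePos_lt_size lam A.2⟩
  have hp : StrictMono p := by
    rintro A B hAB
    rw [Fin.lt_def]
    change nodePos lam _ _ _ < nodePos lam _ _ _
    have h := Prod.Lex.lt_iff.1 (show A.1 < B.1 from hAB)
    rcases h with h | ⟨h1, h2⟩
    · exact nodePos_lt_of_comp lam A.2 h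
    · have h1' : A.1.comp = B.1.comp := h1
      have h2 := Prod.Lex.lt_iff.1 h2
      rcases h2 with h2 | ⟨h2, h3⟩
      · have hA := A.2
        rw [h1'] at hA ⊢
        exact nodePos_lt_of_row lam hA h2
      · have h2' : A.1.row = B.1.row := h2
        have h3' : A.1.col < B.1.col := h3
        rw [h1', h2']
        unfold nodePos
        omega
  have hmono : StrictMono (p ∘ e) := hp.comp e.strictMono
  -- A strictly increasing map of a finite chain to itself is the identity.
  have hid : p ∘ e = id := by
    refine (StrictMono.range_inj hmono strictMono_id).1 ?_
    rw [Set.range_id, Set.range_eq_univ]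
    exact Finite.surjective_of_injective hmono.injective
  have := congrFun hid (initial lam A)
  rw [Function.comp_apply, id] at this
  have h2 : e (initial lam A) = A := e.apply_symm_apply A
  rw [h2] at this
  exact (congrArg Fin.val this).symm

variable {lam} in
/-- The node in row `r` and column `c` of the component `t`. -/
def mkNode {t : Fin l} {r c : ℕ} (h : (r, c) ∈ lam t) : Node lam := ⟨toLex (t, toLex (r, c)), h⟩

lemma initial_mkNode {t : Fin l} {r c : ℕ} (h : (r, c) ∈ lam t) :
    initial lam (mkNode h) = ⟨nodePos lam t r c, nodePos_lt_size lam h⟩ :=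
  Fin.ext (initial_apply lam _)

variable {lam}

lemma exists_eq_mkNode (A : Node lam) :
    ∃ (t : Fin l) (r c : ℕ) (h : (r, c) ∈ lam t), A = mkNode h :=
  ⟨A.1.comp, A.1.row, A.1.col, A.2, rfl⟩

lemma tableau_row_lt {T : Tableau lam} {t : Fin l} {r : ℕ}
    (hrow : ∀ (c : ℕ) (h : (r, c) ∈ lam t) (h' : (r, c + 1) ∈ lam t), T (mkNode h) < T (mkNode h'))
    {c c' : ℕ} (h : (r, c) ∈ lam t) (h' : (r, c') ∈ lam t) (hc : c < c') :
    T (mkNode h) < T (mkNode h') := by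
  induction c', hc using Nat.le_induction with
  | base => exact hrow c h h'
  | succ d hd ih =>
    have h'' : (r, d) ∈ lam t := (lam t).up_left_mem le_rfl (Nat.le_succ d) h'
    exact (ih h'').trans (hrow d h'' h')

lemma tableau_col_lt {T : Tableau lam} {t : Fin l} {c : ℕ}
    (hcol : ∀ (r : ℕ) (h : (r, c) ∈ lam t) (h' : (r + 1, c) ∈ lam t), T (mkNode h) < T (mkNode h'))
    {r r' : ℕ} (h : (r, c) ∈ lam t) (h' : (r', c) ∈ lam t) (hr : r < r') :
    T (mkNode h) < T (mkNode h') := by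
  induction r', hr using Nat.le_induction with
  | base => exact hcol r h h'
  | succ d hd ih =>
    have h'' : (d, c) ∈ lam t := (lam t).up_left_mem (Nat.le_succ d) le_rfl h'
    exact (ih h'').trans (hcol d h'' h')

/-- A tableau is standard if its entries increase along rows and columns in adjacent nodes. -/
lemma isStandard_of_adjacent {T : Tableau lam}
    (hrow : ∀ (t : Fin l) (r c : ℕ) (h : (r, c) ∈ lam t) (h' : (r, c + 1) ∈ lam t),
      T (mkNode h) < T (mkNode h'))
    (hcol : ∀ (t : Fin l) (r c : ℕ) (h : (r, c) ∈ lam t) (h' : (r + 1, c) ∈ lam t),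
      T (mkNode h) < T (mkNode h')) : IsStandard T := by
  constructor
  · intro A B
    obtain ⟨t, r, c, h, rfl⟩ := exists_eq_mkNode A
    obtain ⟨t', r', c', h', rfl⟩ := exists_eq_mkNode B
    intro (h1 : t = t') (h2 : r = r') (h3 : c < c')
    subst h1 h2
    exact tableau_row_lt (hrow t r) h h' h3
  · intro A B
    obtain ⟨t, r, c, h, rfl⟩ := exists_eq_mkNode A
    obtain ⟨t', r', c', h', rfl⟩ := exists_eq_mkNode B
    intro (h1 : t = t') (h2 : c = c') (h3 : r < r')
    subst h1 h2
    exact tableau_col_lt (fun r => hcol t r c) h h' h3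

end

/-! ### Straightening by means of the Garnir relations -/

section

variable (ℓ : ℕ∞) [Fact (2 ≤ ℓ)] {l : ℕ} (κ : Fin l → ℤ) (lam : Fin l → YoungDiagram)
  (K : Type u) [CommRing K] (R : Type v) [CommRing R] [Algebra R K]

/-- The action of `R_R(β)` on the Specht module. -/
noncomputable def spechtRep :
    QH R (cont ℓ κ lam) →ₐ[R] Module.End R (Specht ℓ κ lam K) :=
  (Algebra.lsmul R R (Specht ℓ κ lam K)).comp (QH.baseChange R K (cont ℓ κ lam))

lemma spechtRep_apply (a : QH R (cont ℓ κ lam)) (v : Specht ℓ κ lam K) :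
    spechtRep ℓ κ lam K R a v = QH.baseChange R K (cont ℓ κ lam) a • v := rfl

lemma spechtRep_gen (s : Gen ℓ) (v : Specht ℓ κ lam K) :
    spechtRep ℓ κ lam K R (QH.gen R _ s) v = QH.gen K (cont ℓ κ lam) s • v := by
  rw [spechtRep_apply, QH.baseChange, QH.lift_gen]

lemma spechtRep_psiWord (w : List ℕ) (v : Specht ℓ κ lam K) :
    spechtRep ℓ κ lam K R (QH.psiWord R _ w) v = QH.psiWord K (cont ℓ κ lam) w • v := by
  rw [spechtRep_apply, baseChange_psiWord]

lemma isEigen_gen : IsEigen (spechtRep ℓ κ lam K R) (Specht.gen ℓ κ lam K) where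
  weight := ⟨initialWord ℓ κ lam, by rw [QH.e, spechtRep_gen]; exact Specht.e_smul_gen ℓ κ lam K⟩
  x r := ⟨0, by rw [QH.x, spechtRep_gen, zero_smul]; exact Specht.x_smul_gen ℓ κ lam K r⟩

/-- A product of `ψ`'s that contains the leading term of a Garnir relation can be shortened. -/
lemma garnir_shorten (t : Fin l) (r c : ℕ) (h : (r + 1, c) ∈ lam t) (u : List ℕ) {N : ℕ}
    (hN : u.length + ((lam t).rowLen r - c) * (c + 1) ≤ N + 1) :
    spechtRep ℓ κ lam K R (QH.psiWord R _ (u ++ (blockWord ((lam t).rowLen r - c) (c + 1)).map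
      (nodePos lam t r c + ·))) (Specht.gen ℓ κ lam K) ∈
        filt (spechtRep ℓ κ lam K R) (Specht.gen ℓ κ lam K) N := by
  set ρ := spechtRep ℓ κ lam K R
  set m := Specht.gen ℓ κ lam K
  rw [QH.psiWord_append, rep_mul]
  set F : Specht ℓ κ lam K →ₗ[ℤ] Specht ℓ κ lam K := (ρ (QH.psiWord R _ u)).toAddMonoidHom.toIntLinearMap
  have h1 := Submodule.mem_map_of_mem (f := F) (Specht.garnir_relation ℓ κ lam K t r c h)
  rw [Submodule.map_span, ← spechtRep_psiWord ℓ κ lam K R] at h1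
  -- The relation has integer coefficients, so the R-submodule on the right, seen as a subgroup,
  -- contains all its lower terms. This is where integrality is indispensable.
  refine (Submodule.span_le (p := AddSubgroup.toIntSubmodule (filt ρ m N).toAddSubgroup)).2 ?_ h1
  rintro _ ⟨_, ⟨w, hw, hw', rfl⟩, rfl⟩
  change ρ (QH.psiWord R _ u) _ ∈ filt ρ m N
  rw [← spechtRep_psiWord ℓ κ lam K R, ← rep_mul, ← QH.psiWord_append]
  refine psiWord_mem_filt ?_
  have h2 := hw.length_le
  have h3 : w.length ≠ (blockWord ((lam t).rowLen r - c) (c + 1)).length :=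
    fun h => hw' (hw.eq_of_length h)
  rw [length_blockWord] at h2 h3
  rw [List.length_append, List.length_map]
  omega

/-- Straightening: the filtration of the Specht module is spanned by standard tableaux. -/
theorem filt_le_standard (rex : Equiv.Perm (Fin (size lam)) → List ℕ)
    (hrex : ∀ w, IsReducedExpression w (rex w)) (n : ℕ) :
    filt (spechtRep ℓ κ lam K R) (Specht.gen ℓ κ lam K) n ≤
      Submodule.span R {v | ∃ T : Tableau lam, IsStandard T ∧
        v = QH.psiWord K (cont ℓ κ lam) (rex (permOf T)) • Specht.gen ℓ κ lam K} := by
  set ρ := spechtRep ℓ κ lam K R with hρ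
  set m := Specht.gen ℓ κ lam K with hm
  set W := Submodule.span R {v | ∃ T : Tableau lam, IsStandard T ∧
        v = QH.psiWord K (cont ℓ κ lam) (rex (permOf T)) • m} with hW
  have hE : IsEigen ρ m := isEigen_gen ℓ κ lam K R
  induction n using Nat.strong_induction_on with
  | _ n ih =>
  refine filt_le fun u hun => ?_
  rcases hun.lt_or_eq with hlt | hun
  · exact ih _ hlt (psiWord_mem_filt le_rfl)
  rcases psiWord_eq_zero_or (k := R) (β := cont ℓ κ lam) u with h0 | hu
  · rw [h0, map_zero]; exact zero_mem _
  rw [card_cont] at hu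
  set σ := wordPerm (size lam) u with hσ
  set T : Tableau lam := (initial lam).trans σ with hT
  have hTσ : permOf T = σ := by
    ext x; simp [permOf, hT]
  by_cases hst : IsStandard T
  · obtain ⟨hr1, hr2, hr3⟩ := hrex (permOf T)
    have hlen : (rex (permOf T)).length ≤ u.length := hr3 u hu (by rw [hTσ])
    have hmem : ρ (QH.psiWord R _ (rex (permOf T))) m ∈ W :=
      Submodule.subset_span ⟨T, hst, spechtRep_psiWord ℓ κ lam K R _ _⟩
    rcases Nat.eq_zero_or_pos n with h0 | hpos
    · have h1 : u = [] := List.eq_nil_of_length_eq_zero (by omega)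
      have h2 : rex (permOf T) = [] := List.eq_nil_of_length_eq_zero (by omega)
      rw [h2, ← h1] at hmem
      exact hmem
    -- The word u need not be reduced. Both words have the same permutation and at most n letters,
    -- so they agree modulo products of at most n − 1 letters.
    · have h1 := hE.sub_mem_of_wordPerm_eq hu hr1 (by rw [hr2, hTσ]) (N := n - 1) (by omega)
        (by omega)
      have h2 := ih (n - 1) (by omega) h1
      have := add_mem h2 hmem
      rwa [sub_add_cancel] at this
  · -- the exchange step
    have hshort : ∀ u' w : List ℕ, (∀ i ∈ u', i + 1 < size lam) → (∀ i ∈ w, i + 1 < size lam) →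
        u'.length + w.length = n → 0 < w.length →
        wordPerm (size lam) u = wordPerm (size lam) (u' ++ w) →
        ρ (QH.psiWord R _ (u' ++ w)) m ∈ filt ρ m (n - 1) → ρ (QH.psiWord R _ u) m ∈ W := by
      intro u' w hu' hw hlen hwpos hperm hmem
      have h1 := hE.sub_mem_of_wordPerm_eq (w' := u' ++ w) hu (by
        intro i hi
        rcases List.mem_append.1 hi with hi | hi
        · exact hu' i hi
        · exact hw i hi) hperm (N := n - 1) (by omega) (by rw [List.length_append]; omega)
      have h2 := add_mem h1 hmem
      rw [sub_add_cancel] at h2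
      exact ih (n - 1) (by omega) h2
    have hσT : ∀ {t : Fin l} {r c : ℕ} (h : (r, c) ∈ lam t),
        σ ⟨nodePos lam t r c, nodePos_lt_size lam h⟩ = T (mkNode h) := by
      intro t r c h
      rw [hT, Equiv.trans_apply, initial_mkNode]
    -- The argument for columns needs increasing rows, so a descent in a row is treated separately.
    by_cases hrow : ∀ (t : Fin l) (r c : ℕ) (h : (r, c) ∈ lam t) (h' : (r, c + 1) ∈ lam t),
        T (mkNode h) < T (mkNode h')
    · have hcol : ∃ (t : Fin l) (r c : ℕ) (h : (r, c) ∈ lam t) (h' : (r + 1, c) ∈ lam t),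
          T (mkNode h') ≤ T (mkNode h) := by
        by_contra hcon
        push Not at hcon
        exact hst (isStandard_of_adjacent hrow hcon)
      obtain ⟨t, r, c, h, h', hTT⟩ := hcol
      have hle : ∀ {r c c' : ℕ} (h : (r, c) ∈ lam t) (h' : (r, c') ∈ lam t), c ≤ c' →
          T (mkNode h) ≤ T (mkNode h') := by
        intro r c c' h h' hc
        rcases hc.lt_or_eq with hc | rfl
        · exact (tableau_row_lt (hrow t r) h h' hc).le
        · exact le_rfl
      have hL := YoungDiagram.mem_iff_lt_rowLen.1 h
      have hpos : ∀ j, nodePos lam t (r + 1) j =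
          nodePos lam t r c + ((lam t).rowLen r - c) + j := by
        intro j
        unfold nodePos
        rw [Finset.sum_range_succ]
        omega
      have hsz := nodePos_lt_size lam h'
      rw [hpos] at hsz
      -- The nodes of row r from column c on and those of row r + 1 up to column c are consecutive
      -- in the reading order. Since rows increase, the descent at (r, c) makes each entry of the
      -- former larger than each entry of the latter. So the whole block permutation, the leading
      -- word of the Garnir relation, splits off on the right.
      obtain ⟨u', hu'1, hu'2, hu'3⟩ := exchange_blockWord (nodePos lam t r c) (c + 1)
        ((lam t).rowLen r - c) (by omega) u hu (by
          intro x y hx1 hx2 hy1 hy2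
          obtain ⟨j, hj⟩ : ∃ j, x.1 = nodePos lam t r c + j := ⟨x.1 - nodePos lam t r c, by omega⟩
          obtain ⟨j', hj'⟩ : ∃ j', y.1 = nodePos lam t (r + 1) j' :=
            ⟨y.1 - (nodePos lam t r c + ((lam t).rowLen r - c)), by rw [hpos]; omega⟩
          have hj2 := hpos j'
          have hxn : (r, c + j) ∈ lam t := YoungDiagram.mem_iff_lt_rowLen.2 (by omega)
          have hyn : (r + 1, j') ∈ lam t := (lam t).up_left_mem le_rfl (by omega) h'
          have hx : x = ⟨nodePos lam t r (c + j), nodePos_lt_size lam hxn⟩ := Fin.ext (by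
            rw [hj]; simp only [nodePos]; omega)
          have hy : y = ⟨nodePos lam t (r + 1) j', nodePos_lt_size lam hyn⟩ := Fin.ext hj'
          refine lt_of_le_of_ne ?_ fun heq => ?_
          · rw [← hσ, hx, hy, hσT hyn, hσT hxn]
            exact (hle hyn h' (by omega)).trans (hTT.trans (hle h hxn (by omega)))
          · have := congrArg Fin.val ((wordPerm (size lam) u).injective heq)
            omega)
      refine hshort u' _ hu'1 ?_ ?_ ?_ hu'3 (garnir_shorten ℓ κ lam K R t r c h' u' ?_)
      · intro i hi
        obtain ⟨j, hj, rfl⟩ := List.mem_map.1 hi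
        have := lt_of_mem_blockWord hj
        omega
      · rw [List.length_map, length_blockWord]; omega
      · rw [List.length_map, length_blockWord]
        exact Nat.mul_pos (by omega) (by omega)
      · omega
    · push Not at hrow
      obtain ⟨t, r, c, h, h', hTT⟩ := hrow
      have hsz := nodePos_lt_size lam h'
      have hpos : nodePos lam t r (c + 1) = nodePos lam t r c + 1 := rfl
      -- A descent in a row is the case of two blocks with one entry each.
      have hbw : (blockWord 1 1).map (nodePos lam t r c + ·) = [nodePos lam t r c] := rfl
      obtain ⟨u', hu'1, hu'2, hu'3⟩ := exchange_blockWord (nodePos lam t r c) 1 1 (by omega) u hu (by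
          intro x y hx1 hx2 hy1 hy2
          have hx : x = ⟨nodePos lam t r c, nodePos_lt_size lam h⟩ := Fin.ext (by
            change x.1 = nodePos lam t r c; omega)
          have hy : y = ⟨nodePos lam t r (c + 1), nodePos_lt_size lam h'⟩ := Fin.ext (by
            change y.1 = nodePos lam t r (c + 1); omega)
          refine lt_of_le_of_ne ?_ fun heq => ?_
          · rw [← hσ, hx, hy, hσT h', hσT h]
            exact hTT
          · have := congrArg Fin.val ((wordPerm (size lam) u).injective heq)
            omega)
      rw [hbw] at hu'3
      refine hshort u' _ hu'1 ?_ ?_ ?_ hu'3 ?_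
      · intro i hi
        rw [List.mem_singleton.1 hi]
        omega
      · rw [List.length_singleton]; omega
      · rw [List.length_singleton]; omega
      · rw [QH.psiWord_append, rep_mul, QH.psiWord_singleton, QH.psi, spechtRep_gen]
        have : QH.gen K (cont ℓ κ lam) (.psi (nodePos lam t r c)) • m = 0 :=
          Specht.psi_smul_gen ℓ κ lam K t r c h'
        rw [this, map_zero]
        exact zero_mem _

/-- The lattice is spanned by the vectors of standard tableaux. -/
theorem spechtLattice_eq (rex : Equiv.Perm (Fin (size lam)) → List ℕ)
    (hrex : ∀ w, IsReducedExpression w (rex w)) :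
    SpechtLattice ℓ κ lam K R = Submodule.span R {v | ∃ T : Tableau lam, IsStandard T ∧
        v = QH.psiWord K (cont ℓ κ lam) (rex (permOf T)) • Specht.gen ℓ κ lam K} := by
  refine le_antisymm ?_ (Submodule.span_le.2 ?_)
  · rintro _ ⟨a, rfl⟩
    obtain ⟨n, hn⟩ := (isEigen_gen ℓ κ lam K R).exists_mem_filt a
    exact filt_le_standard ℓ κ lam K R rex hrex n hn
  · rintro _ ⟨T, _, rfl⟩
    exact ⟨QH.psiWord R _ (rex (permOf T)), by rw [baseChange_psiWord]⟩

end

/-! ### The cyclotomic relations -/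

section

variable {ℓ : ℕ∞} {k : Type u} [CommRing k] {β : RootCone ℓ} {V : Type v} [AddCommGroup V]
  [Module k V] {ρ : QH k β →ₐ[k] Module.End k V}

/-- The product `ψ_1 ⋯ ψ_p` moves the letter in position `p + 1` of the weight to the front. -/
lemma rep_psiWord_range_weight (μ : List (Idx ℓ)) {ρ' : List (Idx ℓ)} {a : Idx ℓ} {v : V}
    (h : ρ (QH.e k β (μ ++ a :: ρ')) v = v) :
    ρ (QH.e k β (a :: (μ ++ ρ'))) (ρ (QH.psiWord k β (List.range μ.length)) v) =
      ρ (QH.psiWord k β (List.range μ.length)) v := by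
  induction μ using List.reverseRecOn generalizing ρ' v with
  | nil => simpa [QH.psiWord_nil] using h
  | append_singleton μ b ih =>
    rw [List.append_assoc, List.singleton_append] at h
    have := ih (rep_psi_weight h)
    rw [← rep_mul _ (QH.psiWord k β (List.range μ.length)), ← QH.psiWord_singleton,
      ← QH.psiWord_append, ← List.range_succ] at this
    simpa using this

/-- Products of `ψ_r` with `r ≥ 2` do not change the first letter of the weight. -/
lemma rep_psiWord_head {a : Idx ℓ} {ν : List (Idx ℓ)} {v : V} (h : ρ (QH.e k β (a :: ν)) v = v)
    {w : List ℕ} (hw : ∀ i ∈ w, 1 ≤ i) :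
    ∃ ν', ρ (QH.e k β (a :: ν')) (ρ (QH.psiWord k β w) v) = ρ (QH.psiWord k β w) v := by
  induction w with
  | nil => exact ⟨ν, by simpa [QH.psiWord_nil] using h⟩
  | cons i w ih =>
    obtain ⟨ν', h'⟩ := ih fun j hj => hw j (List.mem_cons_of_mem _ hj)
    rw [QH.psiWord_cons, rep_mul]
    obtain ⟨j, rfl⟩ := Nat.exists_eq_add_of_le' (hw i List.mem_cons_self)
    rcases length_eq_or_zero h' with hl | h0
    · rcases Nat.lt_or_ge (j + 1) ν'.length with hj | hj
      · obtain ⟨μ, b, c, ρ', rfl, rfl⟩ := exists_split ν' j hj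
        exact ⟨_, rep_psi_weight (μ := a :: μ) h'⟩
      · rw [List.length_cons] at hl
        exact ⟨ν', by rw [QH.psi_eq_zero (by omega)]; simp⟩
    · exact ⟨ν', by rw [h0]; simp⟩

lemma x_pow_psiWord (N : ℕ) {w : List ℕ} (hw : ∀ i ∈ w, 1 ≤ i) :
    QH.x k β 0 ^ N * QH.psiWord k β w = QH.psiWord k β w * QH.x k β 0 ^ N := by
  induction w with
  | nil => simp [QH.psiWord_nil]
  | cons i w ih =>
    have hi := hw i List.mem_cons_self
    have h1 : Commute (QH.psi k β i) (QH.x k β 0) := QH.psi_mul_x (by omega) (by omega)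
    rw [QH.psiWord_cons, ← mul_assoc, ← (h1.pow_right N).eq, mul_assoc,
      ih fun j hj => hw j (List.mem_cons_of_mem _ hj), mul_assoc]

/-- Applying an `x` shortens products of `ψ`'s on a vector killed by all `x`. -/
lemma x_psiWord_mem_filt {m : V} (hm : IsWeight ρ m) (hx : ∀ r, ρ (QH.x k β r) m = 0) (r : ℕ)
    (w : List ℕ) : ρ (QH.x k β r) (ρ (QH.psiWord k β w) m) ∈ filt ρ m (w.length - 1) := by
  induction w generalizing r with
  | nil => simp [QH.psiWord_nil, hx]
  | cons i w ih =>
    rw [QH.psiWord_cons, rep_mul]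
    obtain ⟨r', c, h⟩ := x_psi_weight (hm.psiWord w) r i
    rw [h, List.length_cons, Nat.add_sub_cancel]
    refine add_mem ?_ (Submodule.smul_mem _ c (psiWord_mem_filt le_rfl))
    rcases w with _ | ⟨j, w⟩
    · simp [QH.psiWord_nil, hx]
    · exact psi_mem_filt (ih r') i

end

section

variable {l : ℕ} {lam : Fin l → YoungDiagram}

lemma exists_nodePos {p : ℕ} (hp : p < size lam) :
    ∃ (t : Fin l) (r c : ℕ), (r, c) ∈ lam t ∧ nodePos lam t r c = p := by
  obtain ⟨t, r, c, h, hA⟩ := exists_eq_mkNode ((initial lam).symm ⟨p, hp⟩)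
  have h2 := initial_mkNode lam h
  rw [← hA, Equiv.apply_symm_apply] at h2
  exact ⟨t, r, c, h, (congrArg Fin.val h2).symm⟩

/-- For a Garnir node in the first column the leading word is of this form, up to a shift. -/
lemma blockWord_one (a : ℕ) : blockWord a 1 = List.range a := by
  simp [blockWord, List.flatMap_singleton']

variable (ℓ : ℕ∞) [Fact (2 ≤ ℓ)] (κ : Fin l → ℤ)

omit [Fact (2 ≤ ℓ)] in
lemma initialWord_split {t : Fin l} (h : (0, 0) ∈ lam t) :
    ∃ μ ν : List (Idx ℓ), initialWord ℓ κ lam = μ ++ residue ℓ (κ t) :: ν ∧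
      μ.length = nodePos lam t 0 0 := by
  obtain ⟨A, B, h1, h2⟩ := exists_flatten_split
    (fun t => SegConv.word ℓ (rowSegs (κ t) (lam t))) t
  have h3 : 0 < (lam t).colLen 0 := YoungDiagram.mem_iff_lt_colLen.1 h
  have h4 : 0 < (lam t).rowLen 0 := YoungDiagram.mem_iff_lt_rowLen.1 h
  obtain ⟨N, hN⟩ := Nat.exists_eq_succ_of_ne_zero h3.ne'
  obtain ⟨N', hN'⟩ := Nat.exists_eq_succ_of_ne_zero h4.ne'
  have h5 : ∃ C, SegConv.word ℓ (rowSegs (κ t) (lam t)) = residue ℓ (κ t) :: C := by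
    rw [SegConv.word, rowSegs, hN, List.range_succ_eq_map]
    simp only [List.map_cons, List.flatten_cons, segWord, hN', List.range_succ_eq_map]
    simp
  obtain ⟨C, hC⟩ := h5
  refine ⟨A, C ++ B, ?_, ?_⟩
  · rw [initialWord, h1, hC]; simp
  · rw [h2, nodePos]
    simp only [Finset.range_zero, Finset.sum_empty, add_zero]
    refine Finset.sum_congr rfl fun s _ => ?_
    rw [← Multiset.coe_card, coe_word_rowSegs, card_contPartition]

end

section

variable (ℓ : ℕ∞) [Fact (2 ≤ ℓ)] {l : ℕ} (κ : Fin l → ℤ) (lam : Fin l → YoungDiagram)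
  (K : Type u) [CommRing K] (R : Type v) [CommRing R] [Algebra R K]

/-- The vectors `ψ_w ψ_1 ⋯ ψ_p m`, where `p + 1` is the first position of a component and `w` is a
word in the letters from `2` on. -/
def frontVectors (n : ℕ) : Set (Specht ℓ κ lam K) :=
  {v | ∃ (t : Fin l) (w : List ℕ), (0, 0) ∈ lam t ∧ (∀ i ∈ w, 1 ≤ i) ∧
    w.length + nodePos lam t 0 0 ≤ n ∧ v = spechtRep ℓ κ lam K R (QH.psiWord R _ w)
      (spechtRep ℓ κ lam K R (QH.psiWord R _ (List.range (nodePos lam t 0 0)))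
        (Specht.gen ℓ κ lam K))}

lemma frontVectors_mono {n n' : ℕ} (h : n ≤ n') :
    frontVectors ℓ κ lam K R n ⊆ frontVectors ℓ κ lam K R n' :=
  fun _ ⟨t, w, h1, h2, h3, h4⟩ => ⟨t, w, h1, h2, h3.trans h, h4⟩

/-- The Specht module is generated by the vectors `ψ_1 ⋯ ψ_p m` for the first positions `p + 1` of
the components, by means of the `ψ_r` with `r ≥ 2`. -/
theorem filt_le_front (hs : 0 < size lam) (n : ℕ) :
    filt (spechtRep ℓ κ lam K R) (Specht.gen ℓ κ lam K) n ≤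
      Submodule.span R (frontVectors ℓ κ lam K R n) := by
  set ρ := spechtRep ℓ κ lam K R with hρ
  set m := Specht.gen ℓ κ lam K with hm
  have hE : IsEigen ρ m := isEigen_gen ℓ κ lam K R
  induction n using Nat.strong_induction_on with
  | _ n ih =>
  have ih' : ∀ n' < n, filt ρ m n' ≤ Submodule.span R (frontVectors ℓ κ lam K R n) :=
    fun n' hn' => (ih n' hn').trans (Submodule.span_mono
      (frontVectors_mono ℓ κ lam K R hn'.le))
  refine filt_le fun u hun => ?_
  rcases hun.lt_or_eq with hlt | hun
  · exact ih' _ hlt (psiWord_mem_filt le_rfl)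
  rcases psiWord_eq_zero_or (k := R) (β := cont ℓ κ lam) u with h0 | hu
  · rw [h0, map_zero]; exact zero_mem _
  rw [card_cont] at hu
  obtain ⟨p, hp⟩ : ∃ p : Fin (size lam), wordPerm (size lam) u p = ⟨0, hs⟩ :=
    (wordPerm (size lam) u).surjective _
  -- The strand that ends in the first position is brought there by ψ_1 ⋯ ψ_p before anything else
  -- happens.
  obtain ⟨u', hu1, hu2, hu3, hu4⟩ := exchange_front p.1 p.2 u hu (by rw [hp])
  obtain ⟨es, hv, hl, hperm, hes⟩ := exists_nf (size lam) u' hu1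
  have hlen : (nf 0 es).length ≤ u'.length := by
    rcases hes with h | h
    · exact h.length_eq.ge
    · exact h.1.le
  rcases es with _ | ⟨e, es⟩
  · simp at hl; omega
  -- What remains fixes the first position, so its code begins with 0 and its normal form does not
  -- contain ψ_1.
  have he := wordPerm_nf_apply (i := 0) hv (by rw [zero_add]; exact hl) hs
  rw [← hperm, hu4, zero_add] at he
  subst he
  have hnf : nf 0 (0 :: es) = nf 1 es := by simp [nf]
  rw [hnf] at hlen hperm
  have hmem1 : ∀ i ∈ nf 1 es, 1 ≤ i := fun i hi => le_of_mem_nf hi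
  have hmem2 : ∀ i ∈ nf 1 es ++ List.range p.1, i + 1 < size lam := by
    intro i hi
    have hp2 := p.2
    rcases List.mem_append.1 hi with hi | hi
    · have := lt_of_mem_nf hv.2 hi
      rw [List.length_cons] at hl
      omega
    · have := List.mem_range.1 hi
      omega
  have hmain : ρ (QH.psiWord R _ (nf 1 es ++ List.range p.1)) m ∈
      Submodule.span R (frontVectors ℓ κ lam K R n) := by
    -- Only the first node of a component survives. In a column other than the first, the rightmost
    -- ψ joins two strands of a row and kills m. At the beginning of a lower row, the product ends
    -- in the leading word of the Garnir relation of the node above.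
    obtain ⟨t, r, c, h, hpos⟩ := exists_nodePos p.2
    rcases c with _ | c
    · rcases r with _ | r
      · rw [← hpos, QH.psiWord_append, rep_mul]
        exact Submodule.subset_span ⟨t, nf 1 es, h, hmem1, by omega, rfl⟩
      · have hsucc : nodePos lam t (r + 1) 0 = nodePos lam t r 0 + (lam t).rowLen r := by
          simp only [nodePos, Finset.sum_range_succ]; omega
        have hr : 0 < (lam t).rowLen r := YoungDiagram.mem_iff_lt_rowLen.1
          ((lam t).up_left_mem (Nat.le_succ r) le_rfl h)
        rw [← hpos, hsucc, List.range_add, ← List.append_assoc]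
        refine ih' (n - 1) (by omega) ?_
        have := garnir_shorten ℓ κ lam K R t r 0 h (nf 1 es ++ List.range (nodePos lam t r 0))
          (N := n - 1) (by rw [List.length_append, List.length_range]; omega)
        rwa [blockWord_one] at this
    · have hsucc : nodePos lam t r (c + 1) = nodePos lam t r c + 1 := rfl
      rw [← hpos, hsucc, List.range_succ, ← List.append_assoc, QH.psiWord_append, rep_mul,
        QH.psiWord_singleton, QH.psi, spechtRep_gen]
      have : QH.gen K (cont ℓ κ lam) (.psi (nodePos lam t r c)) • m = 0 :=
        Specht.psi_smul_gen ℓ κ lam K t r c h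
      rw [this, map_zero]
      exact zero_mem _
  rcases Nat.eq_zero_or_pos n with h0 | hpos
  · have h1 : u = [] := List.eq_nil_of_length_eq_zero (by omega)
    have h2 : nf 1 es ++ List.range p.1 = [] := List.eq_nil_of_length_eq_zero (by
      rw [List.length_append, List.length_range]; omega)
    rw [h2, ← h1] at hmain
    exact hmain
  · have h1 := hE.sub_mem_of_wordPerm_eq hu hmem2
      (by rw [hu3, wordPerm_append, wordPerm_append, hperm]) (N := n - 1) (by omega)
      (by rw [List.length_append, List.length_range]; omega)
    have h2 := add_mem (ih' (n - 1) (by omega) h1) hmain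
    rwa [sub_add_cancel] at h2

/-- A power of `x_1` kills the part of the Specht module with a given first letter. -/
theorem x_pow_filt (i : Idx ℓ) (ν : List (Idx ℓ)) (n : ℕ) {v : Specht ℓ κ lam K}
    (hv : v ∈ filt (spechtRep ℓ κ lam K R) (Specht.gen ℓ κ lam K) n) :
    spechtRep ℓ κ lam K R (QH.x R _ 0 ^ (Finset.univ.filter fun t : Fin l =>
      nodePos lam t 0 0 ≤ n ∧ residue ℓ (κ t) = i).card) (spechtRep ℓ κ lam K R
        (QH.e R _ (i :: ν)) v) = 0 := by
  set ρ := spechtRep ℓ κ lam K R with hρ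
  set m := Specht.gen ℓ κ lam K
  have hx : ∀ r, ρ (QH.x R _ r) m = 0 := fun r => by
    rw [QH.x, spechtRep_gen]; exact Specht.x_smul_gen ℓ κ lam K r
  have hm : ρ (QH.e R _ (initialWord ℓ κ lam)) m = m := by
    rw [QH.e, spechtRep_gen]; exact Specht.e_smul_gen ℓ κ lam K
  induction n using Nat.strong_induction_on generalizing ν v with
  | _ n ih =>
  rcases Nat.eq_zero_or_pos (size lam) with h0 | hs
  · rw [QH.e_eq_zero, map_zero, LinearMap.zero_apply, map_zero]
    intro h
    have := congrArg Multiset.card h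
    rw [card_cont, h0] at this
    simp at this
  set N := (Finset.univ.filter fun t : Fin l =>
    nodePos lam t 0 0 ≤ n ∧ residue ℓ (κ t) = i).card with hN
  have h1 : filt ρ m n ≤ LinearMap.ker (ρ (QH.x R _ 0 ^ N) * ρ (QH.e R _ (i :: ν))) := by
    refine (filt_le_front ℓ κ lam K R hs n).trans (Submodule.span_le.2 ?_)
    rintro v ⟨t, w, h00, hw, hn, rfl⟩
    rw [SetLike.mem_coe, LinearMap.mem_ker, Module.End.mul_apply, ← hρ]
    obtain ⟨μ, ν₀, hsplit, hμ⟩ := initialWord_split ℓ κ h00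
    rw [hsplit] at hm
    have hz := rep_psiWord_range_weight μ hm
    rw [hμ] at hz
    obtain ⟨ν', hν'⟩ := rep_psiWord_head hz hw
    by_cases hne : i :: ν = residue ℓ (κ t) :: ν'
    swap
    · rw [rep_e_of_ne hν' hne, map_zero]
    rw [hne, hν', ← rep_mul, x_pow_psiWord _ hw, rep_mul]
    obtain ⟨hi, -⟩ := List.cons.inj hne
    suffices h : ρ (QH.x R _ 0 ^ N)
        (ρ (QH.psiWord R _ (List.range (nodePos lam t 0 0))) m) = 0 by rw [h, map_zero]
    have hmem : t ∈ Finset.univ.filter fun t : Fin l =>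
        nodePos lam t 0 0 ≤ n ∧ residue ℓ (κ t) = i := by
      rw [Finset.mem_filter]; exact ⟨Finset.mem_univ _, by omega, hi.symm⟩
    -- If the component begins at the very first position, the vector is m itself and one x_1
    -- suffices; the exponent is positive because t is counted.
    rcases Nat.eq_zero_or_pos (nodePos lam t 0 0) with h0 | hpos
    · have hc := Finset.card_pos.2 ⟨t, hmem⟩
      obtain ⟨N', hN'⟩ := Nat.exists_eq_succ_of_ne_zero hc.ne'
      rw [hN, hN', pow_succ, rep_mul, h0, List.range_zero, QH.psiWord_nil, map_one,
        Module.End.one_apply, hx, map_zero]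
    -- One factor x_1 takes the product of p ψ's to products of at most p − 1. At that level the
    -- component t is no longer counted, so the exponent of the induction hypothesis is strictly
    -- smaller. The weight is unchanged, as x_1 commutes with the idempotents.
    · have h2 := x_psiWord_mem_filt ⟨_, hm⟩ hx 0 (List.range (nodePos lam t 0 0))
      rw [List.length_range] at h2
      have h3 := ih (nodePos lam t 0 0 - 1) (by omega) (μ ++ ν₀) h2
      rw [hi, rep_x_weight hz, ← hi] at h3
      have hlt : (Finset.univ.filter fun s : Fin l => nodePos lam s 0 0 ≤ nodePos lam t 0 0 - 1 ∧
          residue ℓ (κ s) = i).card < (Finset.univ.filter fun t : Fin l =>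
            nodePos lam t 0 0 ≤ n ∧ residue ℓ (κ t) = i).card := by
        refine Finset.card_lt_card (Finset.ssubset_iff_of_subset ?_ |>.2 ⟨t, hmem, ?_⟩)
        · intro s hs
          rw [Finset.mem_filter] at hs ⊢
          exact ⟨hs.1, by omega, hs.2.2⟩
        · rw [Finset.mem_filter]; omega
      obtain ⟨N', hN'⟩ := Nat.exists_eq_add_of_lt hlt
      rw [hN, hN', pow_succ, rep_mul, add_comm, pow_add, rep_mul, h3, map_zero]
  exact h1 hv

/-- The cyclotomic relations hold in the lattice. -/
theorem x_pow_weight (i : Idx ℓ) (ν : List (Idx ℓ)) {v : Specht ℓ κ lam K}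
    (hv : v ∈ SpechtLattice ℓ κ lam K R) :
    QH.baseChange R K (cont ℓ κ lam) (QH.x R _ 0 ^ weight ℓ κ i * QH.e R _ (i :: ν)) • v = 0 := by
  obtain ⟨a, rfl⟩ := hv
  obtain ⟨n, hn⟩ := (isEigen_gen ℓ κ lam K R).exists_mem_filt a
  have h := x_pow_filt ℓ κ lam K R i ν n hn
  -- Dropping the condition on the position gives exactly the multiplicity of the residue i in κ.
  have hle : (Finset.univ.filter fun t : Fin l =>
      nodePos lam t 0 0 ≤ n ∧ residue ℓ (κ t) = i).card ≤ weight ℓ κ i := by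
    rw [weight, Finsupp.finsetSum_apply, Finset.card_filter]
    refine Finset.sum_le_sum fun t _ => ?_
    rw [Finsupp.single_apply]
    split_ifs <;> simp_all
  obtain ⟨N, hN⟩ := Nat.exists_eq_add_of_le' hle
  rw [← spechtRep_apply, hN, pow_add, mul_assoc, rep_mul, rep_mul, ← spechtRep_apply, h, map_zero]

end

/-! ### The lattice as a graded module over the cyclotomic algebra -/

lemma QH.baseChange_mem_grade (R : Type u) (K : Type v) [CommRing R] [CommRing K] [Algebra R K]
    {ℓ : ℕ∞} {β : RootCone ℓ} {c : ℤ} {a : QH R β} (ha : a ∈ QH.grade R β c) :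
    QH.baseChange R K β a ∈ QH.grade K β c := by
  have hgen : ∀ s, QH.baseChange R K β (QH.gen R β s) = QH.gen K β s := QH.lift_gen _ _
  have h : QH.grade R β c ≤
      ((QH.grade K β c).restrictScalars R).comap (QH.baseChange R K β).toLinearMap := by
    refine Submodule.span_le.2 fun b hb => Submodule.subset_span ?_
    change QH.HomMonomial R β c b at hb
    clear ha
    change QH.HomMonomial K β c (QH.baseChange R K β b)
    induction hb with
    | e ν => rw [QH.e, hgen]; exact .e ν
    | x μ ρ i => rw [map_mul, QH.e, QH.x, hgen, hgen]; exact .x μ ρ i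
    | psi μ ρ i j => rw [map_mul, QH.e, QH.psi, hgen, hgen]; exact .psi μ ρ i j
    | mul _ _ h1 h2 => rw [map_mul]; exact .mul h1 h2
  exact h ha

section

variable (ℓ : ℕ∞) [Fact (2 ≤ ℓ)] {l : ℕ} (κ : Fin l → ℤ) (lam : Fin l → YoungDiagram)
  (K : Type u) [CommRing K] (R : Type v) [CommRing R] [Algebra R K]

lemma SegConv.gen_mem_grade (γ : RootCone ℓ) (s : List (ℤ × ℕ)) :
    SegConv.gen ℓ K γ s ∈ SegConv.grade ℓ K γ s 0 :=
  Submodule.subset_span ⟨0, 0, 1, _, by simp, QH.one_mem_grade, fun i => by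
    simp [Seg.grade], rfl⟩

lemma Specht.gen_mem_grade :
    Specht.gen ℓ κ lam K ∈ Specht.grade ℓ κ lam K (degree ℓ κ (initial lam)) := by
  rw [Specht.grade, sub_self]
  exact Submodule.subset_span ⟨0, 0, 1, _, by simp, QH.one_mem_grade, fun t =>
    ⟨_, SegConv.gen_mem_grade ℓ K _ _, rfl⟩, rfl⟩

lemma Specht.smul_mem_grade {c d : ℤ} {a : QH K (cont ℓ κ lam)} (ha : a ∈ QH.grade K _ c)
    {v : Specht ℓ κ lam K} (hv : v ∈ Specht.grade ℓ κ lam K d) :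
    a • v ∈ Specht.grade ℓ κ lam K (c + d) := by
  have := (Specht.isGraded ℓ κ lam K).smul_mem c _ a ha v hv
  rwa [Specht.grade, add_sub_assoc]

lemma smul_mem_spechtLattice (a : QH R (cont ℓ κ lam)) {v : Specht ℓ κ lam K}
    (hv : v ∈ SpechtLattice ℓ κ lam K R) :
    spechtRep ℓ κ lam K R a v ∈ SpechtLattice ℓ κ lam K R := by
  obtain ⟨b, rfl⟩ := hv
  exact ⟨a * b, by rw [map_mul, mul_smul]; rfl⟩

/-- The action of `R_R(β)` on the lattice. -/
noncomputable def latticeRep :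
    QH R (cont ℓ κ lam) →ₐ[R] Module.End R (SpechtLattice ℓ κ lam K R) where
  toFun a := (spechtRep ℓ κ lam K R a).restrict
    fun _ hv => smul_mem_spechtLattice ℓ κ lam K R a hv
  map_one' := LinearMap.ext fun v => Subtype.ext (by
    rw [LinearMap.coe_restrict_apply, map_one]; rfl)
  map_mul' a b := LinearMap.ext fun v => Subtype.ext (by
    rw [LinearMap.coe_restrict_apply, map_mul]; rfl)
  map_zero' := LinearMap.ext fun v => Subtype.ext (by
    rw [LinearMap.coe_restrict_apply, map_zero]; rfl)
  map_add' a b := LinearMap.ext fun v => Subtype.ext (by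
    rw [LinearMap.coe_restrict_apply, map_add]; rfl)
  commutes' c := LinearMap.ext fun v => Subtype.ext (by
    rw [LinearMap.coe_restrict_apply, AlgHom.commutes]; rfl)

/-- The action of `R_R^Λ(β)` on the lattice. -/
noncomputable def cycRep :
    CycQH R (cont ℓ κ lam) (weight ℓ κ) →ₐ[R] Module.End R (SpechtLattice ℓ κ lam K R) :=
  RingQuot.liftAlgHom R ⟨latticeRep ℓ κ lam K R, by
    rintro _ _ ⟨i, ν⟩
    rw [map_zero]
    exact LinearMap.ext fun v => Subtype.ext (x_pow_weight ℓ κ lam K R i ν v.2)⟩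

lemma cycRep_mk (a : QH R (cont ℓ κ lam)) :
    cycRep ℓ κ lam K R (CycQH.mk R _ _ a) = latticeRep ℓ κ lam K R a :=
  RingQuot.liftAlgHom_mkAlgHom_apply ..

/-- The lattice is the direct sum of its homogeneous components. -/
theorem spechtLattice_isInternal :
    DirectSum.IsInternal (SpechtLattice.grade ℓ κ lam K R) := by
  rw [DirectSum.isInternal_submodule_iff_iSupIndep_and_iSup_eq_top]
  constructor
  · obtain ⟨δ, hδ⟩ := (Specht.isGraded ℓ κ lam K).exists_delta
    have hδ' : ∀ d, ∀ v ∈ SpechtLattice.grade ℓ κ lam K R d,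
        δ (v : Specht ℓ κ lam K) = Finsupp.single (d - degree ℓ κ (initial lam)) v.1 :=
      fun d v hv => hδ _ _ hv
    intro d
    rw [Submodule.disjoint_def]
    intro v hv hv'
    have h1 : ∀ w ∈ ⨆ j, ⨆ (_ : j ≠ d), SpechtLattice.grade ℓ κ lam K R j,
        δ (w : Specht ℓ κ lam K) (d - degree ℓ κ (initial lam)) = 0 := by
      intro w hw
      refine Submodule.iSup_induction _ (motive := fun w : SpechtLattice ℓ κ lam K R =>
        δ (w : Specht ℓ κ lam K) (d - degree ℓ κ (initial lam)) = 0) hw ?_ (by simp) ?_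
      · intro j x hx
        by_cases hj : j = d
        · simp only [hj, ne_eq, not_true_eq_false, iSup_false, Submodule.mem_bot] at hx
          simp [hx]
        · simp only [ne_eq, hj, not_false_eq_true, iSup_true] at hx
          rw [hδ' j x hx, Finsupp.single_apply, if_neg (by omega)]
      · intro x y hx hy
        rw [Submodule.coe_add, map_add, Finsupp.add_apply, hx, hy, add_zero]
    have h2 := h1 v hv'
    rw [hδ' d v hv, Finsupp.single_eq_same] at h2
    exact Subtype.ext h2
  · rw [eq_top_iff]
    rintro ⟨_, a, rfl⟩ -
    have ha : a ∈ ⨆ c, QH.grade R (cont ℓ κ lam) c := by rw [QH.iSup_grade]; trivial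
    let g : SpechtLattice ℓ κ lam K R := ⟨Specht.gen ℓ κ lam K, 1, by rw [map_one, one_smul]⟩
    refine Submodule.iSup_induction _ (motive := fun a => latticeRep ℓ κ lam K R a g ∈
        ⨆ d, SpechtLattice.grade ℓ κ lam K R d) ha ?_ ?_ ?_
    · intro c a ha
      refine Submodule.mem_iSup_of_mem (c + degree ℓ κ (initial lam)) ?_
      exact Specht.smul_mem_grade ℓ κ lam K (QH.baseChange_mem_grade R K ha)
        (Specht.gen_mem_grade ℓ κ lam K)
    · rw [map_zero]; exact zero_mem _
    · intro a b ha hb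
      rw [map_add]; exact add_mem ha hb

end

end TypeC

/-- The module structure is the one of `cycRep`. It exists because the cyclotomic relations hold on
the lattice, and it is compatible with the action on the module over K because `latticeRep` is the
restriction of that action. Homogeneous elements of the quotient lift to homogeneous elements of
R_R(β), whose degree is preserved under the passage to K. -/
theorem mainTheorem5 (ℓ : ℕ∞) [Fact (2 ≤ ℓ)]
    (R : Type*) [CommRing R] [IsDomain R] (K : Type*) [Field K] [Algebra R K] [IsFractionRing R K]
    (l : ℕ) (hl : 0 < l) (κ : Fin l → ℤ) (lam : Fin l → YoungDiagram)
    (rex : Equiv.Perm (Fin (TypeC.size lam)) → List ℕ)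
    (hrex : ∀ w, TypeC.IsReducedExpression w (rex w)) :
    TypeC.SpechtLattice ℓ κ lam K R =
      Submodule.span R {v | ∃ T : TypeC.Tableau lam, TypeC.IsStandard T ∧
        v = TypeC.QH.psiWord K (TypeC.cont ℓ κ lam) (rex (TypeC.permOf T)) •
          TypeC.Specht.gen ℓ κ lam K} ∧
    ∃ _ : Module (TypeC.CycQH R (TypeC.cont ℓ κ lam) (TypeC.weight ℓ κ))
        (TypeC.SpechtLattice ℓ κ lam K R),
      (∀ (a : TypeC.QH R (TypeC.cont ℓ κ lam)) (v : TypeC.SpechtLattice ℓ κ lam K R),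
        ((TypeC.CycQH.mk R (TypeC.cont ℓ κ lam) (TypeC.weight ℓ κ) a • v :
            TypeC.SpechtLattice ℓ κ lam K R) : TypeC.Specht ℓ κ lam K) =
          TypeC.QH.baseChange R K (TypeC.cont ℓ κ lam) a • (v : TypeC.Specht ℓ κ lam K)) ∧
      DirectSum.IsInternal (TypeC.SpechtLattice.grade ℓ κ lam K R) ∧
      ∀ (c d : ℤ), ∀ a ∈ TypeC.CycQH.grade R (TypeC.cont ℓ κ lam) (TypeC.weight ℓ κ) c,
        ∀ v ∈ TypeC.SpechtLattice.grade ℓ κ lam K R d,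
          a • v ∈ TypeC.SpechtLattice.grade ℓ κ lam K R (c + d) := by
  refine ⟨TypeC.spechtLattice_eq ℓ κ lam K R rex hrex,
    Module.compHom _ (TypeC.cycRep ℓ κ lam K R).toRingHom, ?_,
    TypeC.spechtLattice_isInternal ℓ κ lam K R, ?_⟩
  · intro a v
    change ((TypeC.cycRep ℓ κ lam K R (TypeC.CycQH.mk R _ _ a) v :
      TypeC.SpechtLattice ℓ κ lam K R) : TypeC.Specht ℓ κ lam K) = _
    rw [TypeC.cycRep_mk]
    rfl
  · rintro c d _ ⟨a, ha, rfl⟩ v hv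
    change TypeC.cycRep ℓ κ lam K R (TypeC.CycQH.mk R _ _ a) v ∈ _
    rw [TypeC.cycRep_mk]
    exact TypeC.Specht.smul_mem_grade ℓ κ lam K (TypeC.QH.baseChange_mem_grade R K ha) hv
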